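/- **Setting.** Let $M$ be a smooth manifold, $H$ a closed real three-form on $M$, and $\mathcal J$ an $H$-twisted generalized complex structure on $M$: an orthogonal (for $\langle X+\alpha,Y+\beta\rangle=\frac12(\beta(X)+\alpha(Y))$) bundle map of $TM\oplus T^*M$ with $\mathcal J^2=-1$ such that the sections of its $\sqrt{-1}$-eigenbundle $L$ are closed under the $H$-twisted Courant bracket $[X+\xi,Y+\eta]=[X,Y]+L_X\eta-L_Y\xi-\frac12d(\eta(X)-\xi(Y))+\iota_Y\iota_XH$. Let $\Omega(M)$ be the space of smooth complex differential forms, on which $TM\oplus T^*M$ acts by $(X+\xi)\cdot\alpha=\iota_X\alpha+\xi\wedge\alpha$. Let $\Gamma(U^k)\subset\Omega(M)$ be the $-k\sqrt{-1}$-eigenspace of the induced Clifford action of $\mathcal J\in\mathfrak{so}(TM\oplus T^*M)$, so that $\Omega(M)=\bigoplus_k\Gamma(U^k)$, and let $\partial:\Gamma(U^k)\to\Gamma(U^{k-1})$ and $\bar\partial:\Gamma(U^k)\to\Gamma(U^{k+1})$ be the components of $d_H=d-H\wedge$. The $\bar\partial\partial$-lemma is the statement $$\ker\partial\cap\operatorname{im}\bar\partial=\operatorname{im}\partial\cap\ker\bar\partial=\operatorname{im}\bar\partial\partial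 .$$ Let $H_\partial(M)=\ker\partial/\operatorname{im}\partial$ be the homology of $(\Omega(M),\partial)$. Let a compact connected Lie group $G$ with Lie algebra $\mathfrak g$ act smoothly on $M$, preserving $\mathcal J$ and $H$, and suppose that the action is Hamiltonian: there are a smooth equivariant map $f:M\to\mathfrak g^*$ (generalized moment map) and a one-form $\eta\in\Omega^1(M,\mathfrak g^*)$ (moment one-form) such that, for all $\xi\in\mathfrak g$ with induced vector field $\xi_M$, the section $\xi_M-\sqrt{-1}(df^\xi+\sqrt{-1}\eta^\xi)$ lies in $L$ and $\iota_{\xi_M}H=d\eta^\xi$. Let $U_G=(S\mathfrak g^*\otimes\Omega(M))^G$, with the bigrading $U_G^{i,j}=(S^i\mathfrak g^*\otimes\Gamma(U^{j-i}))^G$, the vertical differential $\bar\partial=1\otimes\bar\partial$, the horizontal differential $(\mathscr A\alpha)(\xi)=-\iota_{\xi_M}\alpha(\xi)+\sqrt{-1}(df^\xi+\sqrt{-1}\eta^\xi)\wedge\alpha(\xi)$, the total degree $i+j$ and the total differential $\bar\partial_G=\bar\partial+\mathscr A$; and let $U_{G,\partial}=U_G\cap\ker(1\otimes\partial)$ be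 its $\partial$-closed sub-double complex, with total cohomology $H_{G,\partial}(M)=H(U_{G,\partial},\bar\partial_G)$. Let $E$ and $E_\partial$ be the spectral sequences of $U_G$ and $U_{G,\partial}$ for the filtration by the horizontal degree $i$. **Theorem.** Assume that $(M,\mathcal J)$ satisfies the $\bar\partial\partial$-lemma. Then: 1. the spectral sequences $E$ and $E_\partial$ degenerate at $E_1$, i.e. all differentials $d_r$ with $r\ge1$ vanish; 2. the inclusion $U_{G,\partial}\subset U_G$ induces an isomorphism of $(S\mathfrak g^*)^G$-modules $H_{G,\partial}(M)\to H(U_G,\bar\partial_G)$; 3. sending the class of a $\bar\partial_G$-closed $\alpha\in U_{G,\partial}$ to its $\partial$-homology class is a well-defined isomorphism of $(S\mathfrak g^*)^G$-modules $H_{G,\partial}(M)\to H(U_G,\partial)$, and there is an isomorphism of $(S\mathfrak g^*)^G$-modules $H(U_G,\partial)\cong(S\mathfrak g^*)^G\otimes H_\partial(M)$ which is compatible with taking $\partial$-homology classes, i.e. whose composite with the inclusion into $S\mathfrak g^*\otimes H_\partial(M)$ sends the class of $\sum_i p_i\otimes\alpha_i\in U_G$, where $\partial\alpha_i=0$, to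 $\sum_ip_i\otimes[\alpha_i]$. So the natural maps are $(S\mathfrak g^*)^G$-module isomorphisms $H(U_G,\bar\partial_G)\leftarrow H_{G,\partial}(M)\rightarrow(S\mathfrak g^*)^G\otimes H_\partial(M)$. -/

import Mathlib

open scoped Manifold ContDiff Topology
noncomputable section
open ContinuousAlternatingMap (alternatizeUncurryFin alternatizeUncurryFin_apply)
namespace GenEquivariant
set_option linter.unusedSectionVars false

section Forms
variable {E : Type*} [NormedAddCommGroup E] [NormedSpace ℝ E]
  {F : Type*} [NormedAddCommGroup F] [NormedSpace ℝ F]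
  {M : Type*} [TopologicalSpace M] [ChartedSpace E M]

/-- The derivative of a map of manifolds, `T_x M = E`. -/
def tmap (φ : M → M) (x : M) : E →L[ℝ] E := mfderiv 𝓘(ℝ, E) 𝓘(ℝ, E) φ x

/-- The derivative of the chart at `x₀`, as a map `T_x M → E`. -/
def dchart (x₀ x : M) : E →L[ℝ] E :=
  mfderiv 𝓘(ℝ, E) 𝓘(ℝ, E) (extChartAt 𝓘(ℝ, E) x₀) x

/-- The derivative of the inverse of the chart at `x₀`, as a map `E → T_x M`. -/
def dchartSymm (x₀ : M) (y : E) : E →L[ℝ] E :=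
  mfderiv 𝓘(ℝ, E) 𝓘(ℝ, E) (extChartAt 𝓘(ℝ, E) x₀).symm y

/-- The `F`-valued `k`-form `α` on `M`, read in the chart at `x₀`. A `k`-form on `M` is a family of
alternating maps on the tangent spaces `T_x M = E`. -/
def inChart {k : ℕ} (α : M → E [⋀^Fin k]→L[ℝ] F) (x₀ : M) (y : E) : E [⋀^Fin k]→L[ℝ] F :=
  (α ((extChartAt 𝓘(ℝ, E) x₀).symm y)).compContinuousLinearMap (dchartSymm x₀ y)

/-- Smoothness of a differential form: it is smooth in every chart. -/
def IsSmooth {k : ℕ} (α : M → E [⋀^Fin k]→L[ℝ] F) : Prop :=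
  ∀ x₀ : M, ContDiffOn ℝ ∞ (inChart α x₀) (extChartAt 𝓘(ℝ, E) x₀).target

/-- The exterior derivative of a differential form, computed in the chart at `x`. -/
def extd {k : ℕ} (α : M → E [⋀^Fin k]→L[ℝ] F) (x : M) : E [⋀^Fin (k + 1)]→L[ℝ] F :=
  (extDeriv (inChart α x) (extChartAt 𝓘(ℝ, E) x x)).compContinuousLinearMap (dchart x x)

/-- The pullback `φ^* α` of a differential form. -/
def pull {k : ℕ} (φ : M → M) (α : M → E [⋀^Fin k]→L[ℝ] F) (x : M) : E [⋀^Fin k]→L[ℝ] F :=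
  (α (φ x)).compContinuousLinearMap (tmap φ x)

theorem contDiff_curryLeft {n : ℕ∞ω} {k : ℕ} :
    ContDiff ℝ n (fun a : E [⋀^Fin (k + 1)]→L[ℝ] F => a.curryLeft) := by
  apply IsBoundedLinearMap.contDiff
  refine IsLinearMap.with_bound ⟨fun _ _ => rfl, fun _ _ => rfl⟩ 1 (fun x => ?_)
  simp [ContinuousAlternatingMap.norm_curryLeft]

theorem contDiffAt_eval {X : Type*} [NormedAddCommGroup X] [NormedSpace ℝ X] {n : ℕ∞ω} {k : ℕ}
    {α : X → E [⋀^Fin k]→L[ℝ] F} {v : X → Fin k → E} {x : X}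
    (hα : ContDiffAt ℝ n α x) (hv : ContDiffAt ℝ n v x) :
    ContDiffAt ℝ n (fun y => α y (v y)) x := by
  induction k with
  | zero =>
    have : (fun y => α y (v y)) =
        fun y => (ContinuousAlternatingMap.constOfIsEmptyLIE ℝ E F (Fin 0)).symm (α y) := by
      funext y
      simp [ContinuousAlternatingMap.constOfIsEmptyLIE]
      exact congrArg (α y) (Subsingleton.elim _ _)
    rw [this]
    exact (LinearIsometryEquiv.contDiff _).contDiffAt.comp x hα
  | succ k ih =>
    have h1 : ContDiffAt ℝ n
        (fun y => ((α y).curryLeft) (v y 0)) x := by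
      refine ContDiffAt.clm_apply ?_ ?_
      · exact contDiff_curryLeft.contDiffAt.comp x hα
      · exact (contDiffAt_pi.1 hv) 0
    have h2 : ContDiffAt ℝ n (fun y => Fin.tail (v y)) x := by
      rw [contDiffAt_pi]
      intro i
      exact (contDiffAt_pi.1 hv) i.succ
    have := ih h1 h2
    refine this.congr_of_eventuallyEq (Filter.Eventually.of_forall fun y => ?_)
    simp [Matrix.vecCons, Fin.cons_self_tail]

theorem contDiffAt_clm_of_apply [FiniteDimensional ℝ E] {X : Type*} [NormedAddCommGroup X]
    [NormedSpace ℝ X] {n : ℕ∞ω} {f : X → E →L[ℝ] F} {x : X}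
    (h : ∀ v, ContDiffAt ℝ n (fun y => f y v) x) : ContDiffAt ℝ n f x := by
  let d := Module.finrank ℝ E
  have hd : d = Module.finrank ℝ (Fin d → ℝ) := (Module.finrank_fin_fun ℝ).symm
  let e₁ := ContinuousLinearEquiv.ofFinrankEq hd
  let e₂ := (e₁.arrowCongr (1 : F ≃L[ℝ] F)).trans (ContinuousLinearEquiv.piRing (Fin d))
  rw [← Function.id_comp f, ← e₂.symm_comp_self]
  exact e₂.symm.contDiff.contDiffAt.comp x (contDiffAt_pi.mpr fun i => h _)

theorem contDiffAt_of_eval [FiniteDimensional ℝ E] {X : Type*} [NormedAddCommGroup X]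
    [NormedSpace ℝ X] {n : ℕ∞ω} {k : ℕ} {α : X → E [⋀^Fin k]→L[ℝ] F} {x : X}
    (h : ∀ v : Fin k → E, ContDiffAt ℝ n (fun y => α y v) x) : ContDiffAt ℝ n α x := by
  induction k with
  | zero =>
    have : α = fun y => (ContinuousAlternatingMap.constOfIsEmptyLIE ℝ E F (Fin 0)) (α y 0) := by
      funext y
      ext v
      simp [ContinuousAlternatingMap.constOfIsEmptyLIE]
      exact congrArg (α y) (Subsingleton.elim _ _)
    rw [this]
    exact (LinearIsometryEquiv.contDiff _).contDiffAt.comp x (h 0)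
  | succ k ih =>
    have h1 : ContDiffAt ℝ n (fun y => (α y).curryLeft) x := by
      refine contDiffAt_clm_of_apply fun w => ?_
      apply ih
      intro v
      simpa using h (Matrix.vecCons w v)
    have h2 : α = fun y => ((k + 1 : ℝ)⁻¹) •
        ContinuousAlternatingMap.alternatizeUncurryFinCLM ℝ E F ((α y).curryLeft) := by
      funext y
      have : ((k : ℝ) + 1) ≠ 0 := by positivity
      rw [ContinuousAlternatingMap.alternatizeUncurryFinCLM_apply,
        ContinuousAlternatingMap.alternatizeUncurryFin_curryLeft, ← Nat.cast_smul_eq_nsmul ℝ,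
        smul_smul]
      push_cast
      rw [inv_mul_cancel₀ this, one_smul]
    rw [h2]
    exact ((ContinuousLinearMap.contDiff _).contDiffAt.comp x h1).const_smul _

theorem contDiffAt_comp [FiniteDimensional ℝ E] {X : Type*} [NormedAddCommGroup X]
    [NormedSpace ℝ X] {n : ℕ∞ω} {k : ℕ} {α : X → E [⋀^Fin k]→L[ℝ] F} {L : X → E →L[ℝ] E} {x : X}
    (hα : ContDiffAt ℝ n α x) (hL : ContDiffAt ℝ n L x) :
    ContDiffAt ℝ n (fun y => (α y).compContinuousLinearMap (L y)) x := by
  apply contDiffAt_of_eval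
  intro v
  simp only [ContinuousAlternatingMap.compContinuousLinearMap_apply]
  refine contDiffAt_eval hα ?_
  rw [contDiffAt_pi]
  intro i
  exact hL.clm_apply contDiffAt_const

theorem IsSmooth.contDiffAt {k : ℕ} {α : M → E [⋀^Fin k]→L[ℝ] F} (h : IsSmooth α) {x₀ : M} {y : E}
    (hy : y ∈ (extChartAt 𝓘(ℝ, E) x₀).target) : ContDiffAt ℝ ∞ (inChart α x₀) y :=
  (h x₀).contDiffAt ((isOpen_extChartAt_target x₀).mem_nhds hy)

variable [IsManifold 𝓘(ℝ, E) ∞ M]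

/-- The map `φ` read in the charts at `x₀` and at `z`. -/
def trans (φ : M → M) (x₀ z : M) (y : E) : E :=
  extChartAt 𝓘(ℝ, E) z (φ ((extChartAt 𝓘(ℝ, E) x₀).symm y))

theorem trans_facts {φ : M → M} (hφ : ContMDiff 𝓘(ℝ, E) 𝓘(ℝ, E) ∞ φ) {x₀ z : M} {y : E}
    (hy : y ∈ (extChartAt 𝓘(ℝ, E) x₀).target)
    (hz : φ ((extChartAt 𝓘(ℝ, E) x₀).symm y) ∈ (extChartAt 𝓘(ℝ, E) z).source) :
    ContDiffAt ℝ ∞ (trans φ x₀ z) y ∧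
    fderiv ℝ (trans φ x₀ z) y =
      ((dchart z (φ ((extChartAt 𝓘(ℝ, E) x₀).symm y))).comp (tmap φ ((extChartAt 𝓘(ℝ, E) x₀).symm y))).comp
      (dchartSymm x₀ y) ∧
    (dchartSymm z (trans φ x₀ z y)).comp
      (fderiv ℝ (trans φ x₀ z) y) =
      (tmap φ ((extChartAt 𝓘(ℝ, E) x₀).symm y)).comp
      (dchartSymm x₀ y) := by
  have h1 : ContMDiffAt 𝓘(ℝ, E) 𝓘(ℝ, E) ∞ (extChartAt 𝓘(ℝ, E) x₀).symm y :=
    (contMDiffOn_extChartAt_symm x₀).contMDiffAt ((isOpen_extChartAt_target x₀).mem_nhds hy)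
  have h2 : ContMDiffAt 𝓘(ℝ, E) 𝓘(ℝ, E) ∞ φ ((extChartAt 𝓘(ℝ, E) x₀).symm y) := hφ _
  have h3 : ContMDiffAt 𝓘(ℝ, E) 𝓘(ℝ, E) ∞ (extChartAt 𝓘(ℝ, E) z)
      (φ ((extChartAt 𝓘(ℝ, E) x₀).symm y)) :=
    contMDiffAt_extChartAt' (by simpa using hz)
  have d1 := h1.mdifferentiableAt (by simp)
  have d2 := h2.mdifferentiableAt (by simp)
  have d3 := h3.mdifferentiableAt (by simp)
  have hc : fderiv ℝ (trans φ x₀ z) y =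
      ((dchart z (φ ((extChartAt 𝓘(ℝ, E) x₀).symm y))).comp (tmap φ ((extChartAt 𝓘(ℝ, E) x₀).symm y))).comp
      (dchartSymm x₀ y) := by
    have e1 := mfderiv_comp y (g := φ) (f := (extChartAt 𝓘(ℝ, E) x₀).symm) d2 d1
    have e2 := mfderiv_comp y (g := extChartAt 𝓘(ℝ, E) z)
      (f := φ ∘ (extChartAt 𝓘(ℝ, E) x₀).symm) d3 (d2.comp y d1)
    rw [← mfderiv_eq_fderiv]
    refine e2.trans ?_
    rw [e1]
    rfl
  refine ⟨?_, hc, ?_⟩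
  · rw [← contMDiffAt_iff_contDiffAt]
    exact h3.comp y (h2.comp y h1)
  · rw [hc]
    have := mfderivWithin_extChartAt_symm_comp_mfderiv_extChartAt' (I := 𝓘(ℝ, E)) hz
    simp only [modelWithCornersSelf_coe, Set.range_id, mfderivWithin_univ] at this
    rw [← ContinuousLinearMap.comp_assoc, ← ContinuousLinearMap.comp_assoc]
    have h5 : (dchartSymm z (trans φ x₀ z y)).comp (dchart z (φ ((extChartAt 𝓘(ℝ, E) x₀).symm y))) = ContinuousLinearMap.id ℝ E := this
    rw [h5, ContinuousLinearMap.id_comp]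

theorem inChart_pull {φ : M → M} (hφ : ContMDiff 𝓘(ℝ, E) 𝓘(ℝ, E) ∞ φ) {k : ℕ}
    (α : M → E [⋀^Fin k]→L[ℝ] F) {x₀ z : M} {y : E}
    (hy : y ∈ (extChartAt 𝓘(ℝ, E) x₀).target)
    (hz : φ ((extChartAt 𝓘(ℝ, E) x₀).symm y) ∈ (extChartAt 𝓘(ℝ, E) z).source) :
    inChart (pull φ α) x₀ y = (inChart α z (trans φ x₀ z y)).compContinuousLinearMap
      (fderiv ℝ (trans φ x₀ z) y) := by
  obtain ⟨-, -, h3⟩ := trans_facts hφ hy hz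
  have e : (extChartAt 𝓘(ℝ, E) z).symm (trans φ x₀ z y) = φ ((extChartAt 𝓘(ℝ, E) x₀).symm y) :=
    (extChartAt 𝓘(ℝ, E) z).left_inv hz
  ext v
  simp only [inChart, pull, ContinuousAlternatingMap.compContinuousLinearMap_apply, e]
  congr 1
  funext i
  exact (DFunLike.congr_fun h3 (v i)).symm

theorem inChart_pull_eventually {φ : M → M} (hφ : ContMDiff 𝓘(ℝ, E) 𝓘(ℝ, E) ∞ φ) {k : ℕ}
    (α : M → E [⋀^Fin k]→L[ℝ] F) {x₀ z : M} {y : E}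
    (hy : y ∈ (extChartAt 𝓘(ℝ, E) x₀).target)
    (hz : φ ((extChartAt 𝓘(ℝ, E) x₀).symm y) ∈ (extChartAt 𝓘(ℝ, E) z).source) :
    inChart (pull φ α) x₀ =ᶠ[𝓝 y] fun y => (inChart α z (trans φ x₀ z y)).compContinuousLinearMap
      (fderiv ℝ (trans φ x₀ z) y) := by
  have c : ContinuousAt (fun y => φ ((extChartAt 𝓘(ℝ, E) x₀).symm y)) y :=
    (hφ.continuous.continuousAt).comp (continuousAt_extChartAt_symm'' hy)
  filter_upwards [(isOpen_extChartAt_target (I := 𝓘(ℝ, E)) x₀).mem_nhds hy,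
    c ((isOpen_extChartAt_source (I := 𝓘(ℝ, E)) z).mem_nhds hz)] with y' h1 h2
  exact inChart_pull hφ α h1 h2

theorem IsSmooth.pull [FiniteDimensional ℝ E] {φ : M → M} (hφ : ContMDiff 𝓘(ℝ, E) 𝓘(ℝ, E) ∞ φ)
    {k : ℕ} {α : M → E [⋀^Fin k]→L[ℝ] F} (h : IsSmooth α) : IsSmooth (pull φ α) := by
  intro x₀ y hy
  have hz := mem_extChartAt_source (I := 𝓘(ℝ, E)) (φ ((extChartAt 𝓘(ℝ, E) x₀).symm y))
  obtain ⟨h1, -, -⟩ := trans_facts hφ hy hz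
  refine ContDiffAt.contDiffWithinAt (ContDiffAt.congr_of_eventuallyEq ?_
    (inChart_pull_eventually hφ α hy hz))
  refine contDiffAt_comp ?_ (h1.fderiv_right (by simp))
  exact (h.contDiffAt ((extChartAt 𝓘(ℝ, E) _).map_source hz)).comp y h1

theorem pull_id {k : ℕ} (α : M → E [⋀^Fin k]→L[ℝ] F) : pull id α = α := by
  funext x
  ext v
  simp only [pull, tmap, mfderiv_id]
  rfl

theorem inChart_extd {k : ℕ} {α : M → E [⋀^Fin k]→L[ℝ] F} (h : IsSmooth α) {x₀ : M} {y : E}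
    (hy : y ∈ (extChartAt 𝓘(ℝ, E) x₀).target) :
    inChart (extd α) x₀ y = extDeriv (inChart α x₀) y := by
  set x := (extChartAt 𝓘(ℝ, E) x₀).symm y with hx
  have hz : id x ∈ (extChartAt 𝓘(ℝ, E) x).source := mem_extChartAt_source x
  obtain ⟨h1, h2, -⟩ := trans_facts (φ := id) contMDiff_id hy hz
  have h4 := inChart_pull_eventually (φ := id) contMDiff_id α hy hz
  rw [pull_id] at h4
  rw [h4.extDeriv_eq, extDeriv_pullback (r := ∞)]
  · ext v
    simp only [inChart, extd, ContinuousAlternatingMap.compContinuousLinearMap_apply, h2, tmap,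
      mfderiv_id]
    rfl
  · exact (h.contDiffAt ((extChartAt 𝓘(ℝ, E) x).map_source hz)).differentiableAt (by simp)
  · exact h1
  · simp only [minSmoothness_of_isRCLikeNormedField]
    exact WithTop.coe_le_coe.2 le_top

theorem IsSmooth.extd {k : ℕ} {α : M → E [⋀^Fin k]→L[ℝ] F} (h : IsSmooth α) :
    IsSmooth (extd α) := by
  intro x₀
  refine ContDiffOn.congr ?_ (fun y hy => inChart_extd h hy)
  intro y hy
  refine ContDiffAt.contDiffWithinAt ?_
  exact (ContinuousLinearMap.contDiff
    (ContinuousAlternatingMap.alternatizeUncurryFinCLM ℝ E F)).contDiffAt.comp y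
    ((h.contDiffAt hy).fderiv_right (m := ∞) (by simp))

end Forms

section Pointwise
variable {E : Type*} [NormedAddCommGroup E] [NormedSpace ℝ E] [FiniteDimensional ℝ E]
  {F : Type*} [NormedAddCommGroup F] [NormedSpace ℝ F]

/-- The exterior product `a ∧ b` of a real `p`-form and a `k`-form, by recursion on `p`:
`(a ∧ b)(v₀, …) = p⁻¹ Σ_i (-1)^i ((ι_{v_i} a) ∧ b)(v₀, …, omit v_i, …)`. For `p = 1` this is
`Σ_i (-1)^i a(v_i) b(v₀, …, omit v_i, …)`. -/
def wedge {k : ℕ} : (p : ℕ) → (E [⋀^Fin p]→L[ℝ] ℝ) →ₗ[ℝ]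
    (E [⋀^Fin k]→L[ℝ] F) →ₗ[ℝ] (E [⋀^Fin (k + p)]→L[ℝ] F)
  | 0 => LinearMap.mk₂ ℝ (fun a b => a ![] • b)
      (fun _ _ _ => add_smul _ _ _) (fun _ _ _ => smul_assoc _ _ _)
      (fun _ _ _ => smul_add _ _ _) (fun _ _ _ => smul_comm _ _ _)
  | p + 1 => LinearMap.mk₂ ℝ
      (fun a b => (p + 1 : ℝ)⁻¹ • alternatizeUncurryFin (LinearMap.toContinuousLinearMap
        ((wedge p).flip b ∘ₗ (a.curryLeft : E →ₗ[ℝ] E [⋀^Fin p]→L[ℝ] ℝ))))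
      (fun a a' b => by
        ext v; simp [alternatizeUncurryFin_apply, Finset.sum_add_distrib, smul_add])
      (fun c a b => by
        ext v; simp [alternatizeUncurryFin_apply, Finset.smul_sum, smul_comm _ c])
      (fun a b b' => by
        ext v; simp [alternatizeUncurryFin_apply, Finset.sum_add_distrib, smul_add])
      (fun c a b => by
        ext v; simp [alternatizeUncurryFin_apply, Finset.smul_sum, smul_comm _ c])

theorem wedge_zero_apply {k : ℕ} (a : E [⋀^Fin 0]→L[ℝ] ℝ) (b : E [⋀^Fin k]→L[ℝ] F) :
    wedge 0 a b = a ![] • b := by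
  rw [wedge]
  rfl

theorem wedge_succ_apply {k p : ℕ} (a : E [⋀^Fin (p + 1)]→L[ℝ] ℝ)
    (b : E [⋀^Fin k]→L[ℝ] F) (v : Fin (k + p + 1) → E) :
    wedge (p + 1) a b v = (p + 1 : ℝ)⁻¹ • ∑ i : Fin (k + p + 1),
      (-1) ^ (i : ℕ) • wedge p (a.curryLeft (v i)) b (i.removeNth v) := by
  rw [wedge]
  simp [alternatizeUncurryFin_apply]

theorem wedge_complex_smul {k : ℕ} (p : ℕ) (c : ℂ) (a : E [⋀^Fin p]→L[ℝ] ℝ)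
    (b : E [⋀^Fin k]→L[ℝ] ℂ) : wedge p a (c • b) = c • wedge p a b := by
  induction p with
  | zero =>
    rw [wedge_zero_apply, wedge_zero_apply]
    exact smul_comm (M := ℝ) (N := ℂ) _ _ _
  | succ p ih =>
    ext v
    rw [wedge_succ_apply, ContinuousAlternatingMap.smul_apply, wedge_succ_apply, smul_comm c]
    congr 1
    rw [Finset.smul_sum]
    refine Finset.sum_congr rfl fun i _ => ?_
    rw [ih, ContinuousAlternatingMap.smul_apply, smul_comm]

theorem wedge_comp {k : ℕ} (p : ℕ) (a : E [⋀^Fin p]→L[ℝ] ℝ)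
    (b : E [⋀^Fin k]→L[ℝ] F) (L : E →L[ℝ] E) :
    (wedge p a b).compContinuousLinearMap L =
      wedge p (a.compContinuousLinearMap L) (b.compContinuousLinearMap L) := by
  induction p with
  | zero =>
    ext v
    simp only [wedge_zero_apply, ContinuousAlternatingMap.compContinuousLinearMap_apply,
      ContinuousAlternatingMap.smul_apply]
    rw [Subsingleton.elim (L ∘ (![] : Fin 0 → E)) ![]]
  | succ p ih =>
    ext v
    simp only [wedge_succ_apply, ContinuousAlternatingMap.compContinuousLinearMap_apply]
    congr 1
    refine Finset.sum_congr rfl fun i _ => ?_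
    congr 1
    rw [ContinuousAlternatingMap.curryLeft_compContinuousLinearMap, ← ih]
    rfl

theorem contDiffAt_wedge {X : Type*} [NormedAddCommGroup X] [NormedSpace ℝ X] {n : ℕ∞ω} {k : ℕ}
    (p : ℕ) {a : X → E [⋀^Fin p]→L[ℝ] ℝ} {b : X → E [⋀^Fin k]→L[ℝ] F} {x : X}
    (ha : ContDiffAt ℝ n a x) (hb : ContDiffAt ℝ n b x) :
    ContDiffAt ℝ n (fun y => wedge p (a y) (b y)) x := by
  induction p with
  | zero =>
    simp only [wedge_zero_apply]
    exact (contDiffAt_eval ha contDiffAt_const).smul hb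
  | succ p ih =>
    apply contDiffAt_of_eval
    intro v
    simp only [wedge_succ_apply]
    refine ContDiffAt.const_smul _ (ContDiffAt.sum fun i _ => ?_)
    have h1 : ContDiffAt ℝ n (fun y => (a y).curryLeft (v i)) x :=
      (contDiff_curryLeft.contDiffAt.comp x ha).clm_apply contDiffAt_const
    have := contDiffAt_eval (ih h1) (v := fun _ => i.removeNth v) contDiffAt_const
    exact this.const_smul ((-1 : ℤ) ^ (i : ℕ))

variable (E) in
/-- The complex exterior algebra `⋀ E^* ⊗ ℂ`, the element being given by its components in all
degrees (those above `dim E` are zero). -/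
abbrev Lam : Type _ := (k : ℕ) → E [⋀^Fin k]→L[ℝ] ℂ

variable (E) in
/-- The generalized tangent space `V ⊕ V^*`. -/
abbrev GT : Type _ := E × (E →L[ℝ] ℝ)

/-- A covector, as an alternating form of degree one. -/
def covForm (ξ : E →L[ℝ] ℝ) : E [⋀^Fin 1]→L[ℝ] ℝ :=
  ContinuousAlternatingMap.ofSubsingleton ℝ E ℝ 0 ξ

/-- The contraction `ι_X`. -/
def contract (X : E) : Lam E →ₗ[ℂ] Lam E where
  toFun b k := (b (k + 1)).curryLeft X
  map_add' _ _ := rfl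
  map_smul' _ _ := rfl

/-- `b ↦ a ∧ b` for a real one-form `a`. -/
def wedgeOne (a : E [⋀^Fin 1]→L[ℝ] ℝ) : Lam E →ₗ[ℂ] Lam E where
  toFun b
    | 0 => 0
    | k + 1 => wedge 1 a (b k)
  map_add' b b' := by funext k; cases k <;> simp
  map_smul' c b := by
    funext k
    cases k
    · exact (smul_zero (A := E [⋀^Fin 0]→L[ℝ] ℂ) c).symm
    · exact wedge_complex_smul 1 c a _

/-- `b ↦ a ∧ b` for a real three-form `a`. -/
def wedgeThree (a : E [⋀^Fin 3]→L[ℝ] ℝ) : Lam E →ₗ[ℂ] Lam E where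
  toFun b
    | 0 => 0
    | 1 => 0
    | 2 => 0
    | k + 3 => wedge 3 a (b k)
  map_add' b b' := by funext k; rcases k with _ | _ | _ | k <;> simp
  map_smul' c b := by
    funext k
    rcases k with _ | _ | _ | k
    · exact (smul_zero (A := E [⋀^Fin 0]→L[ℝ] ℂ) c).symm
    · exact (smul_zero (A := E [⋀^Fin 1]→L[ℝ] ℂ) c).symm
    · exact (smul_zero (A := E [⋀^Fin 2]→L[ℝ] ℂ) c).symm
    · exact wedge_complex_smul 3 c a _

/-- The Clifford action `(X + ξ) · b = ι_X b + ξ ∧ b`. -/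
def cliff (v : GT E) : Lam E →ₗ[ℂ] Lam E := contract v.1 + wedgeOne (covForm v.2)

/-- The natural pairing `⟨X + ξ, Y + η⟩ = (η(X) + ξ(Y)) / 2`. -/
def pairing (v w : GT E) : ℝ := (1 / 2) * (w.2 v.1 + v.2 w.1)

/-- The Clifford (spin) action on forms of a skew-adjoint endomorphism `J` of `V ⊕ V^*`, via
`so(V ⊕ V^*) ≅ ⋀²(V ⊕ V^*)` in the Clifford algebra of the action `cliff`: for a basis `e_a` with
dual basis `e^a` it is `½ Σ_a (J e_a · e^a · + J e^a · e_a ·)`. It satisfies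
`[spin J, v ·] = (J v) ·`, and no scalar has to be subtracted since `J` has trace zero. -/
def spin (J : GT E →ₗ[ℝ] GT E) : Lam E →ₗ[ℂ] Lam E :=
  let b := Module.finBasis ℝ E
  (1 / 2 : ℂ) • ∑ a,
    (cliff (J (b a, 0)) ∘ₗ cliff (0, LinearMap.toContinuousLinearMap (b.coord a)) +
      cliff (J (0, LinearMap.toContinuousLinearMap (b.coord a))) ∘ₗ cliff (b a, 0))

end Pointwise

section Smooth
variable {E : Type*} [NormedAddCommGroup E] [NormedSpace ℝ E] [FiniteDimensional ℝ E]
  {F : Type*} [NormedAddCommGroup F] [NormedSpace ℝ F]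
  {M : Type*} [TopologicalSpace M] [ChartedSpace E M]
  [IsManifold 𝓘(ℝ, E) ∞ M]

/-- A smooth vector field. -/
def IsSmoothVF (X : M → E) : Prop :=
  ContMDiff 𝓘(ℝ, E) 𝓘(ℝ, E).tangent ∞ (fun x => (⟨x, X x⟩ : TangentBundle 𝓘(ℝ, E) M))

theorem IsSmoothVF.chart {X : M → E} (hX : IsSmoothVF X) {x₀ : M} {y : E}
    (hy : y ∈ (extChartAt 𝓘(ℝ, E) x₀).target) :
    ContDiffAt ℝ ∞ (fun y => dchart x₀ ((extChartAt 𝓘(ℝ, E) x₀).symm y)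
      (X ((extChartAt 𝓘(ℝ, E) x₀).symm y))) y := by
  have h1 : ContMDiffAt 𝓘(ℝ, E) 𝓘(ℝ, E) ∞ (extChartAt 𝓘(ℝ, E) x₀).symm y :=
    (contMDiffOn_extChartAt_symm x₀).contMDiffAt ((isOpen_extChartAt_target x₀).mem_nhds hy)
  have hx : (extChartAt 𝓘(ℝ, E) x₀).symm y ∈ (extChartAt 𝓘(ℝ, E) x₀).source :=
    (extChartAt 𝓘(ℝ, E) x₀).map_target hy
  have hx' : (extChartAt 𝓘(ℝ, E) x₀).symm y ∈ (chartAt E x₀).source := by simpa using hx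
  have h2 : ContMDiffAt 𝓘(ℝ, E) 𝓘(ℝ, E) ∞
      (fun x => (trivializationAt E (TangentSpace 𝓘(ℝ, E)) x₀ ⟨x, X x⟩).2)
      ((extChartAt 𝓘(ℝ, E) x₀).symm y) :=
    ((Bundle.Trivialization.contMDiffAt_section_iff
      (trivializationAt E (TangentSpace 𝓘(ℝ, E)) x₀) (IB := 𝓘(ℝ, E)) (by simpa using hx')).1 (hX _))
  rw [← contMDiffAt_iff_contDiffAt]
  refine (h2.comp y h1).congr_of_eventuallyEq ?_
  filter_upwards [(isOpen_extChartAt_target (I := 𝓘(ℝ, E)) x₀).mem_nhds hy] with y' hy'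
  have hz : (extChartAt 𝓘(ℝ, E) x₀).symm y' ∈ (chartAt E x₀).source := by
    simpa using (extChartAt 𝓘(ℝ, E) x₀).map_target hy'
  have := TangentBundle.continuousLinearMapAt_trivializationAt (I := 𝓘(ℝ, E)) hz
  have h3 := DFunLike.congr_fun this (X ((extChartAt 𝓘(ℝ, E) x₀).symm y'))
  refine h3.symm.trans ?_
  have h4 := (trivializationAt E (TangentSpace 𝓘(ℝ, E)) x₀).coe_linearMapAt_of_mem (R := ℝ)
    (show (extChartAt 𝓘(ℝ, E) x₀).symm y' ∈ _ by simpa using hz)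
  exact congrFun h4 (X ((extChartAt 𝓘(ℝ, E) x₀).symm y'))

theorem IsSmooth.zero {k : ℕ} : IsSmooth (0 : M → E [⋀^Fin k]→L[ℝ] F) := by
  intro x₀
  have : inChart (0 : M → E [⋀^Fin k]→L[ℝ] F) x₀ = fun _ => 0 := by
    funext y; ext v; rfl
  rw [this]
  exact contDiffOn_const

theorem IsSmooth.add {k : ℕ} {a b : M → E [⋀^Fin k]→L[ℝ] F} (ha : IsSmooth a) (hb : IsSmooth b) :
    IsSmooth (a + b) := fun x₀ => (ha x₀).add (hb x₀)

theorem IsSmooth.complex_smul {k : ℕ} {a : M → E [⋀^Fin k]→L[ℝ] ℂ} (c : ℂ) (ha : IsSmooth a) :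
    IsSmooth (c • a) := fun x₀ => (ha x₀).const_smul c

theorem IsSmooth.curryLeft {k : ℕ} {a : M → E [⋀^Fin (k + 1)]→L[ℝ] F} {X : M → E}
    (ha : IsSmooth a) (hX : IsSmoothVF X) : IsSmooth (fun x => (a x).curryLeft (X x)) := by
  intro x₀ y hy
  refine ContDiffAt.contDiffWithinAt ?_
  have h := (contDiff_curryLeft.contDiffAt.comp y (ha.contDiffAt hy)).clm_apply (hX.chart hy)
  refine h.congr_of_eventuallyEq ?_
  filter_upwards [(isOpen_extChartAt_target (I := 𝓘(ℝ, E)) x₀).mem_nhds hy] with y' hy'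
  have h1 := mfderivWithin_extChartAt_symm_comp_mfderiv_extChartAt (I := 𝓘(ℝ, E)) hy'
  simp only [modelWithCornersSelf_coe, Set.range_id, mfderivWithin_univ] at h1
  have h2 : (dchartSymm x₀ y').comp (dchart x₀ ((extChartAt 𝓘(ℝ, E) x₀).symm y')) =
    ContinuousLinearMap.id ℝ E := h1
  have h3 := DFunLike.congr_fun h2 (X ((extChartAt 𝓘(ℝ, E) x₀).symm y'))
  simp only [ContinuousLinearMap.comp_apply, ContinuousLinearMap.id_apply] at h3
  simp only [inChart, Function.comp_def,
    ContinuousAlternatingMap.curryLeft_compContinuousLinearMap, h3]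

theorem IsSmooth.wedge {k p : ℕ} {a : M → E [⋀^Fin p]→L[ℝ] ℝ} {b : M → E [⋀^Fin k]→L[ℝ] F}
    (ha : IsSmooth a) (hb : IsSmooth b) : IsSmooth (fun x => wedge p (a x) (b x)) := by
  intro x₀ y hy
  refine ContDiffAt.contDiffWithinAt ?_
  have h := contDiffAt_wedge p (ha.contDiffAt hy) (hb.contDiffAt hy)
  refine h.congr_of_eventuallyEq (Filter.Eventually.of_forall fun y' => ?_)
  simp only [inChart, wedge_comp]

theorem extd_add {k : ℕ} {a b : M → E [⋀^Fin k]→L[ℝ] F} (ha : IsSmooth a) (hb : IsSmooth b) :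
    extd (a + b) = extd a + extd b := by
  funext x
  have e : inChart (a + b) x = inChart a x + inChart b x := rfl
  simp only [extd, e, Pi.add_apply]
  rw [extDeriv_add ((ha.contDiffAt (mem_extChartAt_target x)).differentiableAt (by simp))
    ((hb.contDiffAt (mem_extChartAt_target x)).differentiableAt (by simp))]
  rfl

theorem extd_complex_smul {k : ℕ} {a : M → E [⋀^Fin k]→L[ℝ] ℂ} (c : ℂ) (ha : IsSmooth a) :
    extd (c • a) = c • extd a := by
  funext x
  have e : inChart (c • a) x = c • inChart a x := rfl
  simp only [extd, e, Pi.smul_apply]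
  have : extDeriv (c • inChart a x) (extChartAt 𝓘(ℝ, E) x x) =
      c • extDeriv (inChart a x) (extChartAt 𝓘(ℝ, E) x x) := by
    rw [extDeriv, extDeriv, fderiv_const_smul
      ((ha.contDiffAt (mem_extChartAt_target x)).differentiableAt (by simp))]
    exact ContinuousAlternatingMap.alternatizeUncurryFin_smul _ _
  rw [this]
  rfl

/-- A smooth section of `TM ⊕ T^*M`. -/
def IsSmoothSection (s : M → GT E) : Prop :=
  IsSmoothVF (fun x => (s x).1) ∧ IsSmooth (fun x => covForm (s x).2)

variable (E M) in
/-- The smooth complex differential forms `Ω(M)`, as a subspace of all families of forms. -/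
def Omega : Submodule ℂ (M → Lam E) where
  carrier := {α | ∀ k, IsSmooth (fun x => α x k)}
  add_mem' ha hb k := (ha k).add (hb k)
  zero_mem' _ := IsSmooth.zero
  smul_mem' c _ ha k := (ha k).complex_smul c

variable (E M) in
/-- The complex vector space `Ω(M)` of smooth complex differential forms (of mixed degree). -/
def Forms : Type _ := Omega E M

instance : AddCommGroup (Forms E M) := inferInstanceAs (AddCommGroup (Omega E M))

instance : Module ℂ (Forms E M) := inferInstanceAs (Module ℂ (Omega E M))

/-- A differential form from its values and its smoothness. -/
def mkForm (α : M → Lam E) (h : ∀ k, IsSmooth (fun x => α x k)) : Forms E M :=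
  (⟨α, h⟩ : Omega E M)

/-- The exterior derivative `d` on `Ω(M)`. -/
def dTotal : Forms E M →ₗ[ℂ] Forms E M where
  toFun α := mkForm (fun x k => match k with
    | 0 => 0
    | k + 1 => extd (fun x => α.1 x k) x) fun k => match k with
    | 0 => IsSmooth.zero
    | k + 1 => (α.2 k).extd
  map_add' α β := by
    refine Subtype.ext (funext fun x => funext fun k => ?_)
    cases k with
    | zero => exact (add_zero _).symm
    | succ k => exact congrFun (extd_add (α.2 k) (β.2 k)) x
  map_smul' c α := by
    refine Subtype.ext (funext fun x => funext fun k => ?_)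
    cases k with
    | zero => exact (smul_zero (A := E [⋀^Fin 0]→L[ℝ] ℂ) c).symm
    | succ k => exact congrFun (extd_complex_smul c (α.2 k)) x

/-- The operator on `Ω(M)` given by a smooth family of linear maps of the fibres. -/
def pointwise (T : M → Lam E →ₗ[ℂ] Lam E)
    (hT : ∀ α ∈ Omega E M, (fun x => T x (α x)) ∈ Omega E M) : Forms E M →ₗ[ℂ] Forms E M where
  toFun α := mkForm (fun x => T x (α.1 x)) (hT α.1 α.2)
  map_add' _ _ := Subtype.ext (funext fun x => map_add (T x) _ _)
  map_smul' _ _ := Subtype.ext (funext fun x => map_smul (T x) _ _)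

theorem wedgeOne_mem {a : M → E [⋀^Fin 1]→L[ℝ] ℝ} (ha : IsSmooth a) :
    ∀ α ∈ Omega E M, (fun x => wedgeOne (a x) (α x)) ∈ Omega E M
  | _, _, 0 => IsSmooth.zero
  | _, hα, k + 1 => ha.wedge (hα k)

theorem wedgeThree_mem {a : M → E [⋀^Fin 3]→L[ℝ] ℝ} (ha : IsSmooth a) :
    ∀ α ∈ Omega E M, (fun x => wedgeThree (a x) (α x)) ∈ Omega E M
  | _, _, 0 => IsSmooth.zero
  | _, _, 1 => IsSmooth.zero
  | _, _, 2 => IsSmooth.zero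
  | _, hα, k + 3 => ha.wedge (hα k)

theorem cliff_mem {s : M → GT E} (hs : IsSmoothSection s) :
    ∀ α ∈ Omega E M, (fun x => cliff (s x) (α x)) ∈ Omega E M := fun α hα =>
  Submodule.add_mem _ (show (fun x => contract (s x).1 (α x)) ∈ Omega E M from
    fun k => (hα (k + 1)).curryLeft hs.1) (wedgeOne_mem hs.2 α hα)

/-- Clifford multiplication by a smooth section of `TM ⊕ T^*M`. -/
def cliffOp (s : M → GT E) (hs : IsSmoothSection s) : Forms E M →ₗ[ℂ] Forms E M :=
  pointwise (fun x => cliff (s x)) (cliff_mem hs)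

/-- The pullback of forms by a smooth map. -/
def pullOp (φ : M → M) (hφ : ContMDiff 𝓘(ℝ, E) 𝓘(ℝ, E) ∞ φ) : Forms E M →ₗ[ℂ] Forms E M where
  toFun α := mkForm (fun x k => pull φ (fun x => α.1 x k) x) fun k => (α.2 k).pull hφ
  map_add' _ _ := rfl
  map_smul' _ _ := rfl

/-! ### Twisted generalized complex structures -/

variable (E M) in
/-- A closed real three-form. -/
structure ClosedThreeForm where
  toFun : M → E [⋀^Fin 3]→L[ℝ] ℝ
  smooth : IsSmooth toFun
  closed : extd toFun = 0

/-- The twisted exterior derivative `d_H = d - H ∧`. -/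
def dH (H : ClosedThreeForm E M) : Forms E M →ₗ[ℂ] Forms E M :=
  dTotal - pointwise (fun x => wedgeThree (H.toFun x)) (wedgeThree_mem H.smooth)

/-- The contraction `ι_X a` of a form with a vector field. -/
def interior {k : ℕ} (X : M → E) (a : M → E [⋀^Fin (k + 1)]→L[ℝ] F) (x : M) : E [⋀^Fin k]→L[ℝ] F :=
  (a x).curryLeft (X x)

/-- Lie derivative by Cartan's formula. -/
def lieD {k : ℕ} (X : M → E) (a : M → E [⋀^Fin (k + 1)]→L[ℝ] F) :
    M → E [⋀^Fin (k + 1)]→L[ℝ] F :=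
  extd (interior X a) + interior X (extd a)

/-- The vector field of a section of `TM ⊕ T^*M`. -/
def vec (s : M → GT E) (x : M) : E := (s x).1

/-- The one-form of a section of `TM ⊕ T^*M`. -/
def cov (s : M → GT E) (x : M) : E [⋀^Fin 1]→L[ℝ] ℝ := covForm (s x).2

/-- The `H`-twisted Courant bracket of real sections `X + ξ`, `Y + η`:
`[X, Y] + L_X η - L_Y ξ - ½ d(η(X) - ξ(Y)) + ι_Y ι_X H`. -/
def courant (H : M → E [⋀^Fin 3]→L[ℝ] ℝ) (u v : M → GT E) (x : M) : GT E :=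
  (VectorField.mlieBracket 𝓘(ℝ, E) (vec u) (vec v) x,
    (ContinuousAlternatingMap.ofSubsingleton ℝ E ℝ (0 : Fin 1)).symm
      ((lieD (vec u) (cov v) - lieD (vec v) (cov u)
        - (1 / 2 : ℝ) • extd (interior (vec u) (cov v) - interior (vec v) (cov u))
        + interior (vec v) (interior (vec u) H)) x))

/-- For real `u`, `v`: the complex vector `u + √-1 v` lies in the `√-1`-eigenspace of `J`. -/
def InL (J : GT E →ₗ[ℝ] GT E) (u v : GT E) : Prop := J u = -v ∧ J v = u

variable (E M) in
/-- An `H`-twisted generalized complex structure: a smooth orthogonal bundle map `J` of `TM ⊕ T^*M`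
with `J² = -1`, such that the sections of its `√-1`-eigenbundle `L` are closed under the (complex
bilinear extension of the) `H`-twisted Courant bracket. Sections of `L` are written `u + √-1 v`. -/
structure GCStructure (H : ClosedThreeForm E M) where
  J : M → GT E →ₗ[ℝ] GT E
  orthogonal : ∀ x v w, pairing (J x v) (J x w) = pairing v w
  sq : ∀ x v, J x (J x v) = -v
  smooth : ∀ s : M → GT E, IsSmoothSection s → IsSmoothSection (fun x => J x (s x))
  integrable : ∀ u v u' v' : M → GT E, IsSmoothSection u → IsSmoothSection v →
    IsSmoothSection u' → IsSmoothSection v' →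
    (∀ x, InL (J x) (u x) (v x)) → (∀ x, InL (J x) (u' x) (v' x)) →
    ∀ x, InL (J x) ((courant H.toFun u u' - courant H.toFun v v') x) ((courant H.toFun u v' + courant H.toFun v u') x)

/-! ### The decomposition of the forms and the operators `∂`, `∂̄` -/

/-- `Γ(U^k)`, the forms in the `-k√-1`-eigenbundle of the Clifford action of `J`. -/
def UDeg (J : M → GT E →ₗ[ℝ] GT E) (k : ℤ) : Submodule ℂ (Forms E M) where
  carrier := {α | ∀ x, spin (J x) (α.1 x) = (-(k : ℂ) * Complex.I) • α.1 x}
  add_mem' {α β} hα hβ x := by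
    show spin (J x) (α.1 x + β.1 x) = _ • (α.1 x + β.1 x)
    rw [map_add, hα x, hβ x, smul_add]
  zero_mem' x := by
    show spin (J x) (0 : Lam E) = _ • (0 : Lam E)
    rw [map_zero]
    exact (smul_zero (A := Lam E) (-(k : ℂ) * Complex.I)).symm
  smul_mem' c α hα x := by
    show spin (J x) (c • α.1 x) = _ • (c • α.1 x)
    rw [map_smul, hα x, smul_comm]

section Graded
variable {V : Type*} [AddCommGroup V] [Module ℂ V]
open Classical in
/-- If `V` is the direct sum of the `U k`, the part of degree `s` of the operator `T`: on `U k` it is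
`T` followed by the projection to `U (k + s)`. -/
def gradedPart (U : ℤ → Submodule ℂ V) (T : V →ₗ[ℂ] V) (s : ℤ) : V →ₗ[ℂ] V :=
  if h : DirectSum.IsInternal U then
    let e := LinearEquiv.ofBijective (DirectSum.coeLinearMap U) h
    DirectSum.toModule ℂ ℤ V (fun k => (U (k + s)).subtype ∘ₗ
      DirectSum.component ℂ ℤ (fun k => U k) (k + s) ∘ₗ e.symm.toLinearMap ∘ₗ T ∘ₗ (U k).subtype)
      ∘ₗ e.symm.toLinearMap
  else 0

end Graded

variable {H : ClosedThreeForm E M}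

/-- `∂`, the component `Γ(U^k) → Γ(U^(k-1))` of `d_H`. (For a generalized complex structure the forms
always are the direct sum of the `Γ(U^k)`.) -/
def del (𝒥 : GCStructure E M H) : Forms E M →ₗ[ℂ] Forms E M := gradedPart (UDeg 𝒥.J) (dH H) (-1)

/-- `∂̄`, the component `Γ(U^k) → Γ(U^(k+1))` of `d_H`. -/
def delbar (𝒥 : GCStructure E M H) : Forms E M →ₗ[ℂ] Forms E M := gradedPart (UDeg 𝒥.J) (dH H) 1

/-- The `∂̄∂`-lemma: `ker ∂ ∩ im ∂̄ = im ∂ ∩ ker ∂̄ = im ∂̄∂`. -/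
def DelbarDelLemma (𝒥 : GCStructure E M H) : Prop :=
  (LinearMap.ker (del 𝒥) ⊓ LinearMap.range (delbar 𝒥) =
    LinearMap.range (del 𝒥) ⊓ LinearMap.ker (delbar 𝒥)) ∧
  LinearMap.range (del 𝒥) ⊓ LinearMap.ker (delbar 𝒥) = LinearMap.range (delbar 𝒥 ∘ₗ del 𝒥)

end Smooth

section Cohomology
variable {R V : Type*} [CommRing R] [AddCommGroup V] [Module R V]

/-- The cohomology `ker D / im D` of a subspace `K` preserved by the differential `D`. -/
abbrev Coh (K : Submodule R V) (D : V →ₗ[R] V) : Type _ :=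
  ↥(K ⊓ LinearMap.ker D) ⧸ (K.map D).submoduleOf (K ⊓ LinearMap.ker D)

/-- The class of a cocycle. -/
def Coh.mk (K : Submodule R V) (D : V →ₗ[R] V) : ↥(K ⊓ LinearMap.ker D) →ₗ[R] Coh K D :=
  Submodule.mkQ _

/-- The map in cohomology induced by an inclusion of subcomplexes. -/
def Coh.incl {K K' : Submodule R V} (h : K ≤ K') (D : V →ₗ[R] V) : Coh K D →ₗ[R] Coh K' D :=
  Submodule.mapQ _ _ (Submodule.inclusion (inf_le_inf_right _ h)) fun _ hx =>
    Submodule.map_mono h hx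

end Cohomology

section SpectralSequence
variable {V : Type*} [AddCommGroup V] [Module ℝ V]
  (F : ℤ → ℤ → Submodule ℝ V) (D : V →ₗ[ℝ] V)

/-- For a complex with terms `K^n`, differential `D` and decreasing filtration `F p n = F^p K^n`:
`Z_r^{p}(K^n) = {x ∈ F^p K^n | D x ∈ F^{p+r} K^{n+1}}`. -/
def pageZ (r p n : ℤ) : Submodule ℝ V := F p n ⊓ (F (p + r) (n + 1)).comap D

/-- `B_r^p(K^n) = Z_{r-1}^{p+1}(K^n) + D Z_{r-1}^{p-r+1}(K^{n-1})`. -/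
def pageB (r p n : ℤ) : Submodule ℝ V :=
  pageZ F D (r - 1) (p + 1) n ⊔ (pageZ F D (r - 1) (p - r + 1) (n - 1)).map D

/-- The term `E_r^{p,n-p} = Z_r^p / B_r^p` of the spectral sequence of a filtered complex. -/
abbrev Page (r p n : ℤ) : Type _ :=
  ↥(pageZ F D r p n) ⧸ (pageB F D r p n).submoduleOf (pageZ F D r p n)

variable {F D}

/-- The differential `d_r : E_r^{p,n-p} → E_r^{p+r,n-p-r+1}`, induced by `D`. -/
def pageDiff (hD : ∀ p n, ∀ x ∈ F p n, D (D x) = 0) (r p n : ℤ) :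
    Page F D r p n →ₗ[ℝ] Page F D r (p + r) (n + 1) :=
  Submodule.mapQ _ _
    (D.restrict (p := pageZ F D r p n) (q := pageZ F D r (p + r) (n + 1)) fun x hx =>
      ⟨hx.2, by
        show D (D x) ∈ F (p + r + r) (n + 1 + 1)
        rw [hD p n x hx.1]
        exact Submodule.zero_mem _⟩)
    (by
      rintro ⟨x, hx⟩ hB
      obtain ⟨y, hy, z, hz, rfl⟩ := Submodule.mem_sup.1 hB
      obtain ⟨w, hw, rfl⟩ := hz
      refine Submodule.mem_sup_right ⟨y, ?_, ?_⟩
      · have h1 : p + r - r + 1 = p + 1 := by ring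
        have h2 : n + 1 - 1 = n := by ring
        rw [h1, h2]
        exact hy
      · have := hD _ _ w hw.1
        show D y = D (y + D w)
        rw [map_add, this, add_zero])

variable (F D)

/-- The spectral sequence of the filtered complex degenerates at `E_1`: all `d_r`, `r ≥ 1`, vanish.
(That `D² = 0` is part of the statement.) -/
def DegeneratesAtE1 : Prop :=
  ∃ hD : ∀ p n, ∀ x ∈ F p n, D (D x) = 0,
    ∀ r : ℤ, 1 ≤ r → ∀ p n : ℤ, pageDiff hD r p n = 0

end SpectralSequence

section Action
variable {E : Type*} [NormedAddCommGroup E] [NormedSpace ℝ E] [FiniteDimensional ℝ E]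
  {M : Type*} [TopologicalSpace M] [ChartedSpace E M] [IsManifold 𝓘(ℝ, E) ∞ M]
  {𝔤 : Type*} [NormedAddCommGroup 𝔤] [NormedSpace ℝ 𝔤] [FiniteDimensional ℝ 𝔤]
  {G : Type*} [TopologicalSpace G] [ChartedSpace 𝔤 G] [Group G] [LieGroup 𝓘(ℝ, 𝔤) ∞ G]
  [MulAction G M] [ContMDiffSMul 𝓘(ℝ, 𝔤) 𝓘(ℝ, E) ∞ G M]

variable (E M G) in
/-- The vector field `ξ_M` on `M` induced by `ξ ∈ 𝔤 = T_1 G`: the derivative at `1` of `g ↦ g • x`,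
applied to `ξ`. -/
def fundVF (ξ : 𝔤) (x : M) : E := mfderiv 𝓘(ℝ, 𝔤) 𝓘(ℝ, E) (fun g : G => g • x) 1 ξ

theorem isSmoothVF_fundVF (ξ : 𝔤) : IsSmoothVF (fundVF E M G ξ) := by
  have hI : IsManifold 𝓘(ℝ, 𝔤) ∞ G := LieGroup.toContMDiffMul.toIsManifold
  have hI1 : IsManifold 𝓘(ℝ, 𝔤) 1 G := IsManifold.of_le (n := ∞) (by simp)
  have hI2 : IsManifold 𝓘(ℝ, E) 1 M := IsManifold.of_le (n := ∞) (by simp)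
  have hs := ContMDiffSMul.contMDiff_smul (I := 𝓘(ℝ, 𝔤)) (I' := 𝓘(ℝ, E)) (n := ∞) (G := G) (M := M)
  have S₁ : ContMDiff 𝓘(ℝ, E) (𝓘(ℝ, 𝔤).tangent.prod 𝓘(ℝ, E).tangent) ∞
      (fun x : M => ((⟨1, ξ⟩ : TangentBundle 𝓘(ℝ, 𝔤) G), (⟨x, 0⟩ : TangentBundle 𝓘(ℝ, E) M))) :=
    contMDiff_const.prodMk (Bundle.contMDiff_zeroSection _ _)
  have S₂ := contMDiff_equivTangentBundleProd_symm (n := ∞)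
    (I := 𝓘(ℝ, 𝔤)) (M := G) (I' := 𝓘(ℝ, E)) (M' := M)
  have S₃ := hs.contMDiff_tangentMap (m := ∞) (by simp)
  have S := (S₃.comp S₂).comp S₁
  have key : ∀ x : M, fundVF E M G ξ x =
      mfderiv (𝓘(ℝ, 𝔤).prod 𝓘(ℝ, E)) 𝓘(ℝ, E) (fun p : G × M => p.1 • p.2) (1, x) (ξ, 0) := by
    intro x
    have d : MDifferentiableAt (𝓘(ℝ, 𝔤).prod 𝓘(ℝ, E)) 𝓘(ℝ, E) (fun p : G × M => p.1 • p.2) (1, x) :=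
      hs.mdifferentiableAt (by simp)
    refine Eq.trans ?_ (mfderiv_prod_eq_add_apply (v := ((ξ, 0) : 𝔤 × E)) d).symm
    let B : E →L[ℝ] E := mfderiv 𝓘(ℝ, E) 𝓘(ℝ, E) (fun y : M => (1 : G) • y) x
    have hB : B 0 = 0 := map_zero B
    exact ((congrArg (fundVF E M G ξ x + ·) hB).trans (add_zero _)).symm
  have aux : ∀ x y : M, y = x → ∀ v : E,
      (⟨y, v⟩ : TangentBundle 𝓘(ℝ, E) M) = ⟨x, v⟩ := by
    rintro x y rfl v; rfl
  have e : (fun x => (⟨x, fundVF E M G ξ x⟩ : TangentBundle 𝓘(ℝ, E) M)) =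
      (tangentMap (𝓘(ℝ, 𝔤).prod 𝓘(ℝ, E)) 𝓘(ℝ, E) (fun p : G × M => p.1 • p.2) ∘
        (equivTangentBundleProd 𝓘(ℝ, 𝔤) G 𝓘(ℝ, E) M).symm) ∘
      (fun x : M => ((⟨1, ξ⟩ : TangentBundle 𝓘(ℝ, 𝔤) G), (⟨x, 0⟩ : TangentBundle 𝓘(ℝ, E) M))) := by
    funext x
    rw [key]
    exact (aux x ((1 : G) • x) (one_smul G x) _).symm
  unfold IsSmoothVF
  rw [e]
  exact S

/-- The adjoint action of `G` on `𝔤 = T_1 G`. -/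
def Ad (g : G) : 𝔤 →L[ℝ] 𝔤 := mfderiv 𝓘(ℝ, 𝔤) 𝓘(ℝ, 𝔤) (fun h : G => g * h * g⁻¹) 1

/-- The action of `g` on `TM ⊕ T^*M`, from the fibre over `x` to the fibre over `g • x`. -/
def push (g : G) (x : M) (v : GT E) : GT E :=
  (tmap (fun y : M => g • y) x v.1, v.2.comp (tmap (fun y : M => g⁻¹ • y) (g • x)))

section Functions
variable {F : Type*} [NormedAddCommGroup F] [NormedSpace ℝ F]

/-- A function, as a form of degree zero. -/
def zeroForm (f : M → F) (x : M) : E [⋀^Fin 0]→L[ℝ] F :=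
  ContinuousAlternatingMap.constOfIsEmpty ℝ E (Fin 0) (f x)

theorem isSmooth_zeroForm {f : M → F} (hf : ContMDiff 𝓘(ℝ, E) 𝓘(ℝ, F) ∞ f) :
    IsSmooth (zeroForm f : M → E [⋀^Fin 0]→L[ℝ] F) := by
  intro x₀
  have h : ContDiffOn ℝ ∞ (fun y => f ((extChartAt 𝓘(ℝ, E) x₀).symm y))
      (extChartAt 𝓘(ℝ, E) x₀).target := by
    rw [← contMDiffOn_iff_contDiffOn]
    exact hf.comp_contMDiffOn (contMDiffOn_extChartAt_symm x₀)
  exact (LinearIsometryEquiv.contDiff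
    (ContinuousAlternatingMap.constOfIsEmptyLIE ℝ E F (Fin 0))).comp_contDiffOn h

end Functions

/-- The component `η^ξ` of a `𝔤^*`-valued one-form. -/
def evalOne (η : M → E [⋀^Fin 1]→L[ℝ] (𝔤 →L[ℝ] ℝ)) (ξ : 𝔤) (x : M) : E [⋀^Fin 1]→L[ℝ] ℝ :=
  (ContinuousLinearMap.apply ℝ ℝ ξ).compContinuousAlternatingMap (η x)

theorem isSmooth_evalOne {η : M → E [⋀^Fin 1]→L[ℝ] (𝔤 →L[ℝ] ℝ)} (hη : IsSmooth η) (ξ : 𝔤) :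
    IsSmooth (evalOne η ξ) := by
  intro x₀ y hy
  refine ContDiffAt.contDiffWithinAt (contDiffAt_of_eval fun v => ?_)
  exact (contDiffAt_eval (hη.contDiffAt hy) (contDiffAt_const (c := v))).clm_apply
    (contDiffAt_const (c := ξ))

/-- A form of degree one, as a covector. -/
def ofOneForm (a : E [⋀^Fin 1]→L[ℝ] ℝ) : E →L[ℝ] ℝ :=
  (ContinuousAlternatingMap.ofSubsingleton ℝ E ℝ (0 : Fin 1)).symm a

theorem covForm_ofOneForm (a : E [⋀^Fin 1]→L[ℝ] ℝ) : covForm (ofOneForm a) = a :=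
  (ContinuousAlternatingMap.ofSubsingleton ℝ E ℝ (0 : Fin 1)).apply_symm_apply a

variable {H : ClosedThreeForm E M}

/-- The one-form `d f^ξ`. -/
def dMoment (f : M → 𝔤 →L[ℝ] ℝ) (ξ : 𝔤) : M → E [⋀^Fin 1]→L[ℝ] ℝ :=
  extd (zeroForm (fun x => f x ξ))

theorem isSmooth_dMoment {f : M → 𝔤 →L[ℝ] ℝ}
    (hf : ContMDiff 𝓘(ℝ, E) 𝓘(ℝ, 𝔤 →L[ℝ] ℝ) ∞ f) (ξ : 𝔤) :
    IsSmooth (dMoment f ξ : M → E [⋀^Fin 1]→L[ℝ] ℝ) :=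
  IsSmooth.extd (isSmooth_zeroForm
    ((ContinuousLinearMap.apply ℝ ℝ ξ).contMDiff.comp hf))

variable (𝔤 G) in
/-- A Hamiltonian action of `G` on the `H`-twisted generalized complex manifold `(M, 𝒥)`: `G` preserves
`𝒥` and `H`, and there are an equivariant smooth `f : M → 𝔤^*` (generalized moment map) and a
`𝔤^*`-valued one-form `η` (moment one-form) such that `ξ_M - √-1 (d f^ξ + √-1 η^ξ)`, that is,
`(ξ_M + η^ξ) + √-1 (- d f^ξ)`, lies in `L`, and `ι_{ξ_M} H = d η^ξ`. -/
structure HamiltonianAction (𝒥 : GCStructure E M H) where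
  invariant : ∀ (g : G) (x : M) (v : GT E), 𝒥.J (g • x) (push g x v) = push g x (𝒥.J x v)
  invariant_three : ∀ g : G, pull (fun x => g • x) H.toFun = H.toFun
  f : M → 𝔤 →L[ℝ] ℝ
  f_smooth : ContMDiff 𝓘(ℝ, E) 𝓘(ℝ, 𝔤 →L[ℝ] ℝ) ∞ f
  f_equivariant : ∀ (g : G) (x : M) (ξ : 𝔤), f (g • x) (Ad g ξ) = f x ξ
  η : M → E [⋀^Fin 1]→L[ℝ] (𝔤 →L[ℝ] ℝ)
  η_smooth : IsSmooth η
  moment : ∀ (ξ : 𝔤) (x : M), InL (𝒥.J x) (fundVF E M G ξ x, ofOneForm (evalOne η ξ x))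
    (0, -ofOneForm (dMoment f ξ x))
  twist : ∀ ξ : 𝔤, interior (fundVF E M G ξ) H.toFun = extd (evalOne η ξ)

variable {𝒥 : GCStructure E M H}

/-- The operator `𝒜(ξ) = - ι_{ξ_M} + √-1 (d f^ξ + √-1 η^ξ) ∧` on forms. -/
def HamiltonianAction.cliffA (A : HamiltonianAction 𝔤 G 𝒥) (ξ : 𝔤) : Forms E M →ₗ[ℂ] Forms E M :=
  -cliffOp (fun x => (fundVF E M G ξ x, ofOneForm (evalOne A.η ξ x)))
      ⟨isSmoothVF_fundVF ξ, by simpa only [covForm_ofOneForm] using isSmooth_evalOne A.η_smooth ξ⟩ +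
    Complex.I • pointwise (fun x => wedgeOne (dMoment A.f ξ x))
      (wedgeOne_mem (isSmooth_dMoment A.f_smooth ξ))

/-! ### The equivariant double complex -/

variable (𝔤 E M) in
/-- The action of `g` on forms, `α ↦ (g⁻¹)^* α`. -/
def translate (g : G) : Forms E M →ₗ[ℂ] Forms E M :=
  pullOp (fun x => g⁻¹ • x)
    ((ContMDiffSMul.contMDiff_smul (I := 𝓘(ℝ, 𝔤)) (I' := 𝓘(ℝ, E)) (n := ∞) (G := G) (M := M)).comp
      (contMDiff_const.prodMk contMDiff_id))

variable (𝔤) in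
/-- The symmetric algebra `S𝔤^*`. -/
abbrev SymDual : Type _ := SymmetricAlgebra ℝ (𝔤 →L[ℝ] ℝ)

/-- The action of `g` on `S𝔤^*` extending the coadjoint action `l ↦ l ∘ Ad_{g⁻¹}`. -/
def coadPoly (g : G) : SymDual 𝔤 →ₐ[ℝ] SymDual 𝔤 :=
  SymmetricAlgebra.lift (SymmetricAlgebra.ι ℝ (𝔤 →L[ℝ] ℝ) ∘ₗ
    { toFun := fun l => l.comp (Ad g⁻¹)
      map_add' := fun _ _ => rfl
      map_smul' := fun _ _ => rfl })

variable (𝔤 G) in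
/-- The invariant polynomials `(S𝔤^*)^G`. -/
def InvPoly : Subalgebra ℝ (SymDual 𝔤) where
  carrier := {p | ∀ g : G, coadPoly g p = p}
  mul_mem' hp hq g := by rw [map_mul, hp g, hq g]
  add_mem' hp hq g := by rw [map_add, hp g, hq g]
  algebraMap_mem' r g := AlgHom.commutes _ r

open scoped TensorProduct

variable (𝔤 E M) in
/-- `S𝔤^* ⊗ Ω(M)`. -/
abbrev PolyForms : Type _ := SymDual 𝔤 ⊗[ℝ] Forms E M

variable (E M) in
/-- The diagonal action of `g` on `S𝔤^* ⊗ Ω(M)`. -/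
def act (g : G) : PolyForms E M 𝔤 →ₗ[ℝ] PolyForms E M 𝔤 :=
  TensorProduct.map (coadPoly g).toLinearMap ((translate E M 𝔤 g).restrictScalars ℝ)

theorem act_smul (g : G) (p : SymDual 𝔤) (t : PolyForms E M 𝔤) :
    act E M g (p • t) = coadPoly g p • act E M g t := by
  induction t using TensorProduct.induction_on with
  | zero => simp
  | add a b ha hb => rw [smul_add, map_add, ha, hb, map_add, smul_add]
  | tmul q α => simp [act, TensorProduct.smul_tmul']

variable (𝔤 G E M) in
/-- `U_G = (S𝔤^* ⊗ Ω(M))^G`, a module over `(S𝔤^*)^G`. -/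
def UG : Submodule (InvPoly 𝔤 G) (PolyForms E M 𝔤) where
  carrier := {t | ∀ g : G, act E M g t = t}
  add_mem' ha hb g := by rw [map_add, ha g, hb g]
  zero_mem' g := map_zero _
  smul_mem' p t ht g := by
    show act E M g ((p : SymDual 𝔤) • t) = (p : SymDual 𝔤) • t
    rw [act_smul, ht g, p.2 g]

/-- The operator `1 ⊗ T` on `S𝔤^* ⊗ Ω(M)`. -/
def extendOp (T : Forms E M →ₗ[ℂ] Forms E M) : PolyForms E M 𝔤 →ₗ[SymDual 𝔤] PolyForms E M 𝔤 :=
  (T.restrictScalars ℝ).baseChange (SymDual 𝔤)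

variable (G) in
/-- `1 ⊗ ∂`. -/
def delInv (𝒥 : GCStructure E M H) : PolyForms E M 𝔤 →ₗ[InvPoly 𝔤 G] PolyForms E M 𝔤 :=
  (extendOp (del 𝒥)).restrictScalars (InvPoly 𝔤 G)

/-- The horizontal differential `𝒜`, `(𝒜 α)(ξ) = 𝒜(ξ) (α(ξ))`, that is `Σ_a x_a ⊗ 𝒜(ξ_a)` for a basis
`ξ_a` of `𝔤` with dual basis `x_a`. -/
def HamiltonianAction.calA (A : HamiltonianAction 𝔤 G 𝒥) :
    PolyForms E M 𝔤 →ₗ[SymDual 𝔤] PolyForms E M 𝔤 :=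
  let b := Module.finBasis ℝ 𝔤
  ∑ a, SymmetricAlgebra.ι ℝ (𝔤 →L[ℝ] ℝ) (LinearMap.toContinuousLinearMap (b.coord a)) •
    extendOp (A.cliffA (b a))

/-- The total differential `∂̄_G = ∂̄ + 𝒜`. -/
def HamiltonianAction.delbarG (A : HamiltonianAction 𝔤 G 𝒥) :
    PolyForms E M 𝔤 →ₗ[InvPoly 𝔤 G] PolyForms E M 𝔤 :=
  (extendOp (delbar 𝒥) + A.calA).restrictScalars (InvPoly 𝔤 G)

variable (𝔤 G) in
/-- The `∂`-closed subcomplex `U_{G,∂} = U_G ∩ ker ∂`. -/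
def UGdel (𝒥 : GCStructure E M H) : Submodule (InvPoly 𝔤 G) (PolyForms E M 𝔤) :=
  UG E M 𝔤 G ⊓ LinearMap.ker (delInv G 𝒥)

variable (𝔤) in
/-- `S^i 𝔤^* ⊗ Γ(U^(j-i))`. -/
def homogeneous (𝒥 : GCStructure E M H) (i : ℕ) (j : ℤ) : Submodule ℝ (PolyForms E M 𝔤) :=
  LinearMap.range (TensorProduct.map
    (LinearMap.range (SymmetricAlgebra.ι ℝ (𝔤 →L[ℝ] ℝ)) ^ i : Submodule ℝ (SymDual 𝔤)).subtype
    ((UDeg 𝒥.J (j - i)).restrictScalars ℝ).subtype)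

/-- For `K = U_G` or `K = U_{G,∂}`: the part of total degree `n` and horizontal degree at least `p`,
`⨁_{i ≥ p} K^{i,n-i}` with `K^{i,j} = K ∩ (S^i 𝔤^* ⊗ Γ(U^(j-i)))`. -/
def rowFiltration (𝒥 : GCStructure E M H) (K : Submodule (InvPoly 𝔤 G) (PolyForms E M 𝔤))
    (p n : ℤ) : Submodule ℝ (PolyForms E M 𝔤) :=
  ⨆ (i : ℕ) (_ : p ≤ i), K.restrictScalars ℝ ⊓ homogeneous 𝔤 𝒥 i (n - i)

/-- `H_∂(M)`, the homology of `Ω(M)` with respect to `∂`. -/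
abbrev HDel (𝒥 : GCStructure E M H) : Type _ :=
  Coh (⊤ : Submodule ℝ (Forms E M)) ((del 𝒥).restrictScalars ℝ)

end Action

end GenEquivariant

end

open GenEquivariant
open scoped Manifold ContDiff TensorProduct

noncomputable section
namespace GenEquivariant
set_option linter.unusedSectionVars false
open ContinuousAlternatingMap (alternatizeUncurryFin alternatizeUncurryFin_apply)

section WedgeOne
variable {E : Type*} [NormedAddCommGroup E] [NormedSpace ℝ E] [FiniteDimensional ℝ E]
  {F : Type*} [NormedAddCommGroup F] [NormedSpace ℝ F]

theorem covForm_apply (ξ : E →L[ℝ] ℝ) (v : Fin 1 → E) : covForm ξ v = ξ (v 0) := by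
  simp [covForm]

theorem wedge_one_apply {k : ℕ} (a : E [⋀^Fin 1]→L[ℝ] ℝ) (b : E [⋀^Fin k]→L[ℝ] F)
    (v : Fin (k + 1) → E) :
    wedge 1 a b v = ∑ i : Fin (k + 1), (-1) ^ (i : ℕ) • a ![v i] • b (i.removeNth v) := by
  have := wedge_succ_apply (p := 0) a b v
  simp only [Nat.cast_zero, zero_add, inv_one, one_smul] at this
  refine this.trans (Finset.sum_congr rfl fun i _ => ?_)
  rw [wedge_zero_apply]
  rfl

theorem ext_curryLeft {k : ℕ} {a b : E [⋀^Fin (k + 1)]→L[ℝ] F}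
    (h : ∀ X, a.curryLeft X = b.curryLeft X) : a = b := by
  ext v
  have := DFunLike.congr_fun (h (v 0)) (Fin.tail v)
  simpa [Matrix.vecCons, Fin.cons_self_tail] using this

theorem curryLeft_wedge_one_zero (a : E [⋀^Fin 1]→L[ℝ] ℝ) (b : E [⋀^Fin 0]→L[ℝ] F) (X : E) :
    (wedge 1 a b).curryLeft X = a ![X] • b := by
  ext v
  have := wedge_one_apply a b (Matrix.vecCons X v)
  simp only [ContinuousAlternatingMap.curryLeft_apply_apply]
  refine this.trans ?_
  simp only [ContinuousAlternatingMap.smul_apply]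
  simp

theorem removeNth_succ_vecCons {k : ℕ} (X : E) (v : Fin (k + 1) → E) (i : Fin (k + 1)) :
    i.succ.removeNth (Matrix.vecCons X v : Fin (k + 2) → E) =
      (Matrix.vecCons X (i.removeNth v) : Fin (k + 1) → E) := by
  funext j
  refine Fin.cases ?_ (fun j => ?_) j
  · simp [Fin.removeNth]
  · simp [Fin.removeNth, Fin.succ_succAbove_succ]

theorem curryLeft_wedge_one {k : ℕ} (a : E [⋀^Fin 1]→L[ℝ] ℝ) (b : E [⋀^Fin (k + 1)]→L[ℝ] F)
    (X : E) : (wedge 1 a b).curryLeft X = a ![X] • b - wedge 1 a (b.curryLeft X) := by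
  ext v
  simp only [ContinuousAlternatingMap.curryLeft_apply_apply, ContinuousAlternatingMap.sub_apply,
    ContinuousAlternatingMap.smul_apply]
  refine (wedge_one_apply a b (Matrix.vecCons X v)).trans ?_
  rw [Fin.sum_univ_succ, wedge_one_apply, sub_eq_add_neg, ← Finset.sum_neg_distrib]
  congr 1
  · simp [Fin.removeNth_zero, Fin.tail_def]
  · refine Finset.sum_congr rfl fun i _ => ?_
    rw [removeNth_succ_vecCons]
    simp only [Fin.val_succ, pow_succ, Matrix.cons_val_succ,
      ContinuousAlternatingMap.curryLeft_apply_apply]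
    simp

theorem wedge_one_anticomm {k : ℕ} (a b : E [⋀^Fin 1]→L[ℝ] ℝ) (c : E [⋀^Fin k]→L[ℝ] F) :
    wedge 1 a (wedge 1 b c) + wedge 1 b (wedge 1 a c) = 0 := by
  induction k with
  | zero =>
    refine ext_curryLeft fun X => ?_
    have h : ∀ u w : E [⋀^Fin (0 + 1 + 1)]→L[ℝ] F,
      (u + w).curryLeft X = u.curryLeft X + w.curryLeft X := fun _ _ => rfl
    rw [h, curryLeft_wedge_one, curryLeft_wedge_one, curryLeft_wedge_one_zero,
      curryLeft_wedge_one_zero, map_smul, map_smul]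
    refine Eq.trans ?_ (rfl : (0 : E [⋀^Fin (0 + 1)]→L[ℝ] F) = _)
    abel
  | succ k ih =>
    refine ext_curryLeft fun X => ?_
    have h : ∀ u w : E [⋀^Fin (k + 1 + 1 + 1)]→L[ℝ] F,
      (u + w).curryLeft X = u.curryLeft X + w.curryLeft X := fun _ _ => rfl
    rw [h, curryLeft_wedge_one, curryLeft_wedge_one, curryLeft_wedge_one,
      curryLeft_wedge_one, map_sub, map_sub, map_smul, map_smul]
    refine Eq.trans ?_ (ih (c.curryLeft X))
    abel

/-- The covectors of a dual basis, as one-forms. -/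
def dualForm {ι : Type*} [Finite ι] (b : Module.Basis ι ℝ E) (i : ι) : E [⋀^Fin 1]→L[ℝ] ℝ :=
  covForm (LinearMap.toContinuousLinearMap (b.coord i))

theorem dualForm_apply {ι : Type*} [Finite ι] (b : Module.Basis ι ℝ E) (i : ι) (v : Fin 1 → E) :
    dualForm b i v = b.repr (v 0) i := by
  simp [dualForm, covForm_apply]

theorem alternatizeUncurryFin_eq_sum {ι : Type*} [Fintype ι] (b : Module.Basis ι ℝ E) {k : ℕ}
    (A : E →L[ℝ] E [⋀^Fin k]→L[ℝ] F) :
    alternatizeUncurryFin A = ∑ i, wedge 1 (dualForm b i) (A (b i)) := by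
  ext v
  simp only [ContinuousAlternatingMap.sum_apply, wedge_one_apply, alternatizeUncurryFin_apply]
  rw [Finset.sum_comm]
  refine Finset.sum_congr rfl fun j _ => ?_
  rw [← Finset.smul_sum]
  congr 1
  conv_lhs => rw [← b.sum_repr (v j), map_sum]
  simp [dualForm_apply]

theorem wedge_succ_eq_sum {ι : Type*} [Fintype ι] (e : Module.Basis ι ℝ E) {k p : ℕ}
    (a : E [⋀^Fin (p + 1)]→L[ℝ] ℝ) (b : E [⋀^Fin k]→L[ℝ] F) :
    wedge (p + 1) a b =
      (p + 1 : ℝ)⁻¹ • ∑ i, wedge 1 (dualForm e i) (wedge p (a.curryLeft (e i)) b) := by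
  have h : wedge (p + 1) a b = (p + 1 : ℝ)⁻¹ • alternatizeUncurryFin
      (LinearMap.toContinuousLinearMap
        ((wedge p).flip b ∘ₗ (a.curryLeft : E →ₗ[ℝ] E [⋀^Fin p]→L[ℝ] ℝ))) := by
    rw [wedge]; rfl
  rw [h, alternatizeUncurryFin_eq_sum e]
  rfl

theorem eq_sum_wedge_curryLeft {ι : Type*} [Fintype ι] (e : Module.Basis ι ℝ E) {k : ℕ}
    (a : E [⋀^Fin (k + 1)]→L[ℝ] F) :
    ∑ i, wedge 1 (dualForm e i) (a.curryLeft (e i)) = (k + 1 : ℝ) • a := by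
  rw [← alternatizeUncurryFin_eq_sum e a.curryLeft,
    ContinuousAlternatingMap.alternatizeUncurryFin_curryLeft, ← Nat.cast_smul_eq_nsmul ℝ]
  push_cast
  rfl

end WedgeOne

section Clifford
variable {E : Type*} [NormedAddCommGroup E] [NormedSpace ℝ E] [FiniteDimensional ℝ E]

theorem contract_apply (X : E) (b : Lam E) (k : ℕ) : contract X b k = (b (k + 1)).curryLeft X := rfl
theorem wedgeOne_zero (a : E [⋀^Fin 1]→L[ℝ] ℝ) (b : Lam E) : wedgeOne a b 0 = 0 := rfl
theorem wedgeOne_succ (a : E [⋀^Fin 1]→L[ℝ] ℝ) (b : Lam E) (k : ℕ) :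
    wedgeOne a b (k + 1) = wedge 1 a (b k) := rfl

/-- `b ↦ a ∧ b` for a real two-form `a`. -/
def wedgeTwo (a : E [⋀^Fin 2]→L[ℝ] ℝ) : Lam E →ₗ[ℂ] Lam E where
  toFun b
    | 0 => 0
    | 1 => 0
    | k + 2 => wedge 2 a (b k)
  map_add' b b' := by funext k; rcases k with _ | _ | k <;> simp
  map_smul' c b := by
    funext k
    rcases k with _ | _ | k
    · exact (smul_zero (A := E [⋀^Fin 0]→L[ℝ] ℂ) c).symm
    · exact (smul_zero (A := E [⋀^Fin 1]→L[ℝ] ℂ) c).symm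
    · exact wedge_complex_smul 2 c a _

theorem lam_smul_apply (c : ℂ) (b : Lam E) (k : ℕ) : (c • b) k = c • b k := rfl

theorem lam_smul_neg (c : ℂ) (b : Lam E) : c • (-b) = -(c • b) := by module

theorem real_smul_complex {k : ℕ} (r : ℝ) (b : E [⋀^Fin k]→L[ℝ] ℂ) : (r : ℂ) • b = r • b := by
  ext v; simp

theorem contract_wedgeOne (X : E) (a : E [⋀^Fin 1]→L[ℝ] ℝ) (b : Lam E) :
    contract X (wedgeOne a b) = (a ![X] : ℂ) • b - wedgeOne a (contract X b) := by
  funext k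
  rw [Pi.sub_apply, lam_smul_apply, real_smul_complex]
  cases k with
  | zero => exact (curryLeft_wedge_one_zero a (b 0) X).trans (sub_zero _).symm
  | succ k => exact curryLeft_wedge_one a (b (k + 1)) X

theorem curryLeft_curryLeft {F : Type*} [NormedAddCommGroup F] [NormedSpace ℝ F] {k : ℕ}
    (a : E [⋀^Fin (k + 2)]→L[ℝ] F) (X Y : E) :
    (a.curryLeft X).curryLeft Y = -(a.curryLeft Y).curryLeft X := by
  ext v
  have h := a.toAlternatingMap.map_swap (Matrix.vecCons X (Matrix.vecCons Y v))
    (show (0 : Fin (k + 2)) ≠ 1 by simp)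
  have e : (Matrix.vecCons X (Matrix.vecCons Y v) : Fin (k + 2) → E) ∘ ⇑(Equiv.swap (0 : Fin (k + 2)) 1) =
      Matrix.vecCons Y (Matrix.vecCons X v) := by
    funext j
    refine Fin.cases ?_ (fun j => ?_) j
    · simp
    · refine Fin.cases ?_ (fun j => ?_) j
      · simp
      · rw [Function.comp_apply, Equiv.swap_apply_of_ne_of_ne]
        · rfl
        · exact Fin.succ_ne_zero _
        · intro h
          exact Fin.succ_ne_zero j (Fin.succ_injective _ h)
  rw [e] at h
  exact (neg_eq_iff_eq_neg.2 h).symm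

theorem contract_contract (X Y : E) (b : Lam E) :
    contract X (contract Y b) = -contract Y (contract X b) :=
  funext fun k => curryLeft_curryLeft (b (k + 2)) Y X

theorem wedgeOne_wedgeOne (a c : E [⋀^Fin 1]→L[ℝ] ℝ) (b : Lam E) :
    wedgeOne a (wedgeOne c b) = -wedgeOne c (wedgeOne a b) := by
  funext k
  rcases k with _ | _ | k
  · exact neg_zero.symm
  · show wedge 1 a 0 = -wedge 1 c 0
    rw [map_zero, map_zero, neg_zero]
  · exact eq_neg_of_add_eq_zero_left (wedge_one_anticomm a c (b k))

theorem cliff_apply (v : GT E) (b : Lam E) :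
    cliff v b = contract v.1 b + wedgeOne (covForm v.2) b := rfl

/-- The Clifford relation. -/
theorem cliff_cliff (u v : GT E) (b : Lam E) :
    cliff u (cliff v b) + cliff v (cliff u b) = ((u.2 v.1 + v.2 u.1 : ℝ) : ℂ) • b := by
  simp only [cliff_apply, map_add, contract_wedgeOne, covForm_apply, Matrix.cons_val_zero]
  rw [contract_contract, wedgeOne_wedgeOne]
  push_cast
  module

theorem wedgeTwo_eq_sum {ι : Type*} [Fintype ι] (e : Module.Basis ι ℝ E)
    (a : E [⋀^Fin 2]→L[ℝ] ℝ) (b : Lam E) :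
    wedgeTwo a b = (2 : ℂ)⁻¹ • ∑ i, wedgeOne (dualForm e i) (wedgeOne (a.curryLeft (e i)) b) := by
  funext k
  rw [lam_smul_apply, Finset.sum_apply]
  rcases k with _ | _ | k
  · rw [Finset.sum_eq_zero fun i _ => by rfl, smul_zero]; rfl
  · rw [Finset.sum_eq_zero fun i _ => ?_, smul_zero]
    · rfl
    show wedge 1 _ 0 = 0
    rw [map_zero]
  · refine (wedge_succ_eq_sum e a (b k)).trans ?_
    have : (2 : ℂ)⁻¹ = (((1 : ℕ) + 1 : ℝ)⁻¹ : ℝ) := by push_cast; norm_num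
    rw [this, real_smul_complex]
    rfl

theorem wedgeThree_eq_sum {ι : Type*} [Fintype ι] (e : Module.Basis ι ℝ E)
    (a : E [⋀^Fin 3]→L[ℝ] ℝ) (b : Lam E) :
    wedgeThree a b = (3 : ℂ)⁻¹ • ∑ i, wedgeOne (dualForm e i) (wedgeTwo (a.curryLeft (e i)) b) := by
  funext k
  rw [lam_smul_apply, Finset.sum_apply]
  rcases k with _ | _ | _ | k
  · rw [Finset.sum_eq_zero fun i _ => by rfl, smul_zero]; rfl
  · rw [Finset.sum_eq_zero fun i _ => ?_, smul_zero]
    · rfl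
    show wedge 1 _ 0 = 0
    rw [map_zero]
  · rw [Finset.sum_eq_zero fun i _ => ?_, smul_zero]
    · rfl
    show wedge 1 _ 0 = 0
    rw [map_zero]
  · refine (wedge_succ_eq_sum e a (b k)).trans ?_
    have : (3 : ℂ)⁻¹ = (((2 : ℕ) + 1 : ℝ)⁻¹ : ℝ) := by push_cast; norm_num
    rw [this, real_smul_complex]
    rfl

theorem wedgeOne_wedgeTwo (c : E [⋀^Fin 1]→L[ℝ] ℝ) (a : E [⋀^Fin 2]→L[ℝ] ℝ) (b : Lam E) :
    wedgeOne c (wedgeTwo a b) = wedgeTwo a (wedgeOne c b) := by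
  simp only [wedgeTwo_eq_sum (Module.finBasis ℝ E), map_smul, map_sum]
  refine congrArg ((2 : ℂ)⁻¹ • ·) (Finset.sum_congr rfl fun i _ => ?_)
  rw [wedgeOne_wedgeOne c, wedgeOne_wedgeOne c, map_neg, neg_neg]

theorem wedgeOne_wedgeThree (c : E [⋀^Fin 1]→L[ℝ] ℝ) (a : E [⋀^Fin 3]→L[ℝ] ℝ) (b : Lam E) :
    wedgeOne c (wedgeThree a b) = -wedgeThree a (wedgeOne c b) := by
  simp only [wedgeThree_eq_sum (Module.finBasis ℝ E), map_smul, map_sum]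
  refine Eq.trans (congrArg ((3 : ℂ)⁻¹ • ·) ?_) (lam_smul_neg _ _)
  rw [← Finset.sum_neg_distrib]
  refine Finset.sum_congr rfl fun i _ => ?_
  rw [wedgeOne_wedgeOne c, wedgeOne_wedgeTwo]

theorem wedgeTwo_wedgeThree (c : E [⋀^Fin 2]→L[ℝ] ℝ) (a : E [⋀^Fin 3]→L[ℝ] ℝ) (b : Lam E) :
    wedgeTwo c (wedgeThree a b) = wedgeThree a (wedgeTwo c b) := by
  simp only [wedgeTwo_eq_sum (Module.finBasis ℝ E) c, map_smul, map_sum]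
  refine congrArg ((2 : ℂ)⁻¹ • ·) (Finset.sum_congr rfl fun i _ => ?_)
  rw [wedgeOne_wedgeThree, map_neg, wedgeOne_wedgeThree, neg_neg]

theorem wedgeThree_wedgeThree (c a : E [⋀^Fin 3]→L[ℝ] ℝ) (b : Lam E) :
    wedgeThree c (wedgeThree a b) = -wedgeThree a (wedgeThree c b) := by
  simp only [wedgeThree_eq_sum (Module.finBasis ℝ E) c, map_smul, map_sum]
  refine Eq.trans (congrArg ((3 : ℂ)⁻¹ • ·) ?_) (lam_smul_neg _ _)
  rw [← Finset.sum_neg_distrib]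
  refine Finset.sum_congr rfl fun i _ => ?_
  rw [wedgeTwo_wedgeThree, wedgeOne_wedgeThree]

theorem wedgeOne_add (a c : E [⋀^Fin 1]→L[ℝ] ℝ) (b : Lam E) :
    wedgeOne (a + c) b = wedgeOne a b + wedgeOne c b := by
  funext k
  cases k with
  | zero => exact (add_zero _).symm
  | succ k => exact LinearMap.congr_fun (map_add (wedge 1) a c) (b k)

theorem wedgeOne_smul (r : ℝ) (a : E [⋀^Fin 1]→L[ℝ] ℝ) (b : Lam E) :
    wedgeOne (r • a) b = (r : ℂ) • wedgeOne a b := by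
  funext k
  rw [lam_smul_apply]
  cases k with
  | zero => exact (smul_zero (A := E [⋀^Fin 0]→L[ℝ] ℂ) (r : ℂ)).symm
  | succ k =>
    rw [real_smul_complex]
    exact LinearMap.congr_fun (map_smul (wedge 1) r a) (b k)

theorem wedgeTwo_add (a c : E [⋀^Fin 2]→L[ℝ] ℝ) (b : Lam E) :
    wedgeTwo (a + c) b = wedgeTwo a b + wedgeTwo c b := by
  funext k
  rcases k with _ | _ | k
  · exact (add_zero _).symm
  · exact (add_zero _).symm
  · exact LinearMap.congr_fun (map_add (wedge 2) a c) (b k)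

theorem wedgeTwo_smul (r : ℝ) (a : E [⋀^Fin 2]→L[ℝ] ℝ) (b : Lam E) :
    wedgeTwo (r • a) b = (r : ℂ) • wedgeTwo a b := by
  funext k
  rw [lam_smul_apply]
  rcases k with _ | _ | k
  · exact (smul_zero (A := E [⋀^Fin 0]→L[ℝ] ℂ) (r : ℂ)).symm
  · exact (smul_zero (A := E [⋀^Fin 1]→L[ℝ] ℂ) (r : ℂ)).symm
  · rw [real_smul_complex]
    exact LinearMap.congr_fun (map_smul (wedge 2) r a) (b k)

/-- `a ↦ a ∧ b` for one-forms `a`. -/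
def wedgeOneₗ (b : Lam E) : (E [⋀^Fin 1]→L[ℝ] ℝ) →ₗ[ℝ] Lam E where
  toFun a := wedgeOne a b
  map_add' a c := wedgeOne_add a c b
  map_smul' r a := (wedgeOne_smul r a b).trans (funext fun _ => real_smul_complex r _)

/-- `a ↦ a ∧ b` for two-forms `a`. -/
def wedgeTwoₗ (b : Lam E) : (E [⋀^Fin 2]→L[ℝ] ℝ) →ₗ[ℝ] Lam E where
  toFun a := wedgeTwo a b
  map_add' a c := wedgeTwo_add a c b
  map_smul' r a := (wedgeTwo_smul r a b).trans (funext fun _ => real_smul_complex r _)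

theorem sum_repr_smul_curryLeft {F : Type*} [NormedAddCommGroup F] [NormedSpace ℝ F] {ι : Type*}
    [Fintype ι] (e : Module.Basis ι ℝ E) {k : ℕ} (a : E [⋀^Fin (k + 1)]→L[ℝ] F) (X : E) :
    ∑ i, e.repr X i • a.curryLeft (e i) = a.curryLeft X := by
  conv_rhs => rw [← e.sum_repr X, map_sum]
  simp

theorem oneForm_apply (a : E [⋀^Fin 1]→L[ℝ] ℝ) (X : E) : a ![X] = ofOneForm a X := by
  conv_lhs => rw [← covForm_ofOneForm a]
  simp [covForm_apply]

theorem sum_smul_dualForm {ι : Type*} [Fintype ι] (e : Module.Basis ι ℝ E)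
    (a : E [⋀^Fin 1]→L[ℝ] ℝ) : ∑ i, a ![e i] • dualForm e i = a := by
  ext v
  simp only [ContinuousAlternatingMap.sum_apply, ContinuousAlternatingMap.smul_apply,
    dualForm_apply, smul_eq_mul]
  have hv : v = ![v 0] := by funext i; fin_cases i; rfl
  conv_rhs => rw [hv, oneForm_apply, ← e.sum_repr (v 0), map_sum]
  refine Finset.sum_congr rfl fun i _ => ?_
  rw [oneForm_apply, map_smul, smul_eq_mul, mul_comm]

theorem contract_wedgeTwo (X : E) (a : E [⋀^Fin 2]→L[ℝ] ℝ) (b : Lam E) :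
    contract X (wedgeTwo a b) = wedgeOne (a.curryLeft X) b + wedgeTwo a (contract X b) := by
  set e := Module.finBasis ℝ E
  have h1 : ∀ i, contract X (wedgeOne (dualForm e i) (wedgeOne (a.curryLeft (e i)) b)) =
      wedgeOneₗ b (e.repr X i • a.curryLeft (e i)) +
        wedgeOneₗ b ((a.curryLeft X) ![e i] • dualForm e i) +
      wedgeOne (dualForm e i) (wedgeOne (a.curryLeft (e i)) (contract X b)) := by
    intro i
    have h3 : (a.curryLeft (e i)) ![X] = -(a.curryLeft X) ![e i] := by
      have := DFunLike.congr_fun (curryLeft_curryLeft a (e i) X) ![]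
      simpa using this
    show _ = wedgeOne (e.repr X i • a.curryLeft (e i)) b +
      wedgeOne ((a.curryLeft X) ![e i] • dualForm e i) b + _
    rw [wedgeOne_smul, wedgeOne_smul, contract_wedgeOne, contract_wedgeOne, h3, dualForm_apply,
      map_sub, map_smul, Complex.ofReal_neg]
    simp only [Matrix.cons_val_zero]
    module
  rw [wedgeTwo_eq_sum e, map_smul, map_sum, Finset.sum_congr rfl fun i _ => h1 i,
    Finset.sum_add_distrib, Finset.sum_add_distrib, ← map_sum, ← map_sum, sum_repr_smul_curryLeft,
    sum_smul_dualForm, smul_add, ← wedgeTwo_eq_sum e, ← two_smul ℂ, smul_smul]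
  norm_num
  rfl

theorem contract_wedgeThree (X : E) (a : E [⋀^Fin 3]→L[ℝ] ℝ) (b : Lam E) :
    contract X (wedgeThree a b) = wedgeTwo (a.curryLeft X) b - wedgeThree a (contract X b) := by
  set e := Module.finBasis ℝ E
  have h1 : ∀ i, contract X (wedgeOne (dualForm e i) (wedgeTwo (a.curryLeft (e i)) b)) =
      wedgeTwoₗ b (e.repr X i • a.curryLeft (e i)) +
        wedgeOne (dualForm e i) (wedgeOne ((a.curryLeft X).curryLeft (e i)) b) -
      wedgeOne (dualForm e i) (wedgeTwo (a.curryLeft (e i)) (contract X b)) := by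
    intro i
    have h4 : wedgeOne ((a.curryLeft (e i)).curryLeft X) b =
        -wedgeOne ((a.curryLeft X).curryLeft (e i)) b := by
      rw [curryLeft_curryLeft]
      exact map_neg (wedgeOneₗ b) _
    show _ = wedgeTwo (e.repr X i • a.curryLeft (e i)) b + _ - _
    rw [wedgeTwo_smul, contract_wedgeOne, contract_wedgeTwo, h4, dualForm_apply, map_add, map_neg]
    simp only [Matrix.cons_val_zero]
    module
  have h5 : ∑ i, wedgeOne (dualForm e i) (wedgeOne ((a.curryLeft X).curryLeft (e i)) b) =
      (2 : ℂ) • wedgeTwo (a.curryLeft X) b := by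
    rw [wedgeTwo_eq_sum e, smul_smul]
    norm_num
  rw [wedgeThree_eq_sum e, map_smul, map_sum, Finset.sum_congr rfl fun i _ => h1 i,
    Finset.sum_sub_distrib, Finset.sum_add_distrib, ← map_sum, sum_repr_smul_curryLeft, h5,
    smul_sub, ← wedgeThree_eq_sum e]
  congr 1
  show (3 : ℂ)⁻¹ • (wedgeTwo (a.curryLeft X) b + (2 : ℂ) • wedgeTwo (a.curryLeft X) b) = _
  module

end Clifford
end GenEquivariant
end

noncomputable section
namespace GenEquivariant
set_option linter.unusedSectionVars false

theorem lam_smul_add {E : Type*} [NormedAddCommGroup E] [NormedSpace ℝ E] (c : ℂ) (b b' : Lam E) :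
    c • (b + b') = c • b + c • b' := by module

section Irreducible
variable {E : Type*} [NormedAddCommGroup E] [NormedSpace ℝ E] [FiniteDimensional ℝ E]

theorem alternating_eq_zero_of_finrank_lt {k : ℕ} (hk : Module.finrank ℝ E < k)
    (b : E [⋀^Fin k]→L[ℝ] ℂ) : b = 0 := by
  ext v
  refine b.toAlternatingMap.map_linearDependent v fun h => ?_
  have := h.fintype_card_le_finrank
  simp at this
  omega

/-- The element `1` of the exterior algebra. -/
def lamOne : Lam E := Pi.single 0 (ContinuousAlternatingMap.constOfIsEmpty ℝ E (Fin 0) (1 : ℂ))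

theorem single_zero_eq (b : E [⋀^Fin 0]→L[ℝ] ℂ) : (Pi.single 0 b : Lam E) = b ![] • lamOne := by
  funext k
  rw [lam_smul_apply]
  cases k with
  | zero =>
    ext v
    simp [lamOne, Subsingleton.elim v ![]]
  | succ k => exact (smul_zero (A := E [⋀^Fin (k + 1)]→L[ℝ] ℂ) (b ![])).symm

theorem wedgeOne_single (a : E [⋀^Fin 1]→L[ℝ] ℝ) {k : ℕ} (b : E [⋀^Fin k]→L[ℝ] ℂ) :
    wedgeOne a (Pi.single k b) = Pi.single (k + 1) (wedge 1 a b) := by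
  funext j
  cases j with
  | zero =>
    rw [Pi.single_eq_of_ne (Nat.succ_ne_zero k).symm]
    rfl
  | succ j =>
    rw [wedgeOne_succ]
    by_cases h : j = k
    · subst h; simp
    · rw [Pi.single_eq_of_ne h, Pi.single_eq_of_ne (by simpa using h), map_zero]

theorem lam_eq_sum_single (b : Lam E) :
    b = ∑ k ∈ Finset.range (Module.finrank ℝ E + 1), Pi.single k (b k) := by
  funext j
  rw [Finset.sum_apply]
  by_cases h : j ∈ Finset.range (Module.finrank ℝ E + 1)
  · rw [Finset.sum_eq_single_of_mem j h fun i _ hi => Pi.single_eq_of_ne' hi _, Pi.single_eq_same]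
  · rw [Finset.sum_eq_zero fun i hi => Pi.single_eq_of_ne' (by rintro rfl; exact h hi) _]
    exact alternating_eq_zero_of_finrank_lt (by simpa [Nat.lt_succ_iff] using h) _

theorem single_mem {P : ℕ → Submodule ℂ (Lam E)} (h0 : lamOne ∈ P 0)
    (h1 : ∀ (i : Fin (Module.finrank ℝ E)) k, ∀ b ∈ P k,
      wedgeOne (dualForm (Module.finBasis ℝ E) i) b ∈ P (k + 1))
    {k : ℕ} (b : E [⋀^Fin k]→L[ℝ] ℂ) : (Pi.single k b : Lam E) ∈ P k := by
  induction k with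
  | zero =>
    rw [single_zero_eq]
    exact (P 0).smul_mem _ h0
  | succ k ih =>
    have h := eq_sum_wedge_curryLeft (Module.finBasis ℝ E) b
    have h2 : (Pi.single (k + 1) b : Lam E) = ((k + 1 : ℝ)⁻¹ : ℂ) •
        ∑ i, wedgeOne (dualForm (Module.finBasis ℝ E) i)
          (Pi.single k (b.curryLeft (Module.finBasis ℝ E i))) := by
      simp only [wedgeOne_single]
      have h3 := map_sum (AddMonoidHom.single (fun k => E [⋀^Fin k]→L[ℝ] ℂ) (k + 1))
        (fun i => wedge 1 (dualForm (Module.finBasis ℝ E) i)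
          (b.curryLeft (Module.finBasis ℝ E i))) Finset.univ
      simp only [AddMonoidHom.single_apply] at h3
      rw [← h3, h, ← Complex.ofReal_inv]
      funext j
      rw [lam_smul_apply]
      by_cases hj : j = k + 1
      · subst hj
        have : (k + 1 : ℝ) ≠ 0 := by positivity
        rw [Pi.single_eq_same, Pi.single_eq_same, real_smul_complex, smul_smul,
          inv_mul_cancel₀ this, one_smul]
      · rw [Pi.single_eq_of_ne hj, Pi.single_eq_of_ne hj]
        exact (smul_zero (A := E [⋀^Fin j]→L[ℝ] ℂ) (((k + 1 : ℝ)⁻¹ : ℝ) : ℂ)).symm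
    rw [h2]
    exact (P (k + 1)).smul_mem _ (Submodule.sum_mem _ fun i _ => h1 i k _ (ih _))

/-- The span of the products of `k` elements of a basis of the one-forms. -/
def wedgeSpan : ℕ → Submodule ℂ (Lam E)
  | 0 => Submodule.span ℂ {lamOne}
  | k + 1 => ⨆ i, (wedgeSpan k).map (wedgeOne (dualForm (Module.finBasis ℝ E) i))

theorem wedgeSpan_finite (k : ℕ) : Module.Finite ℂ (wedgeSpan (E := E) k) := by
  induction k with
  | zero => exact FiniteDimensional.span_singleton ℂ _
  | succ k ih => exact Submodule.finite_iSup _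

instance lam_finite : Module.Finite ℂ (Lam E) := by
  have h : (⨆ k : Fin (Module.finrank ℝ E + 1), wedgeSpan (E := E) k) = ⊤ := by
    refine eq_top_iff.2 fun b _ => ?_
    rw [lam_eq_sum_single b]
    refine Submodule.sum_mem _ fun k hk => ?_
    refine Submodule.mem_iSup_of_mem ⟨k, Finset.mem_range.1 hk⟩
      (single_mem (Submodule.mem_span_singleton_self _) (fun i k b hb => ?_) _)
    exact Submodule.mem_iSup_of_mem i (Submodule.mem_map_of_mem hb)
  have := fun k => wedgeSpan_finite (E := E) k
  have h2 : Module.Finite ℂ ↥(⨆ k : Fin (Module.finrank ℝ E + 1), wedgeSpan (E := E) k) :=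
    Submodule.finite_iSup _
  rw [h] at h2
  exact Module.Finite.of_surjective (⊤ : Submodule ℂ (Lam E)).subtype
    (fun x => ⟨⟨x, trivial⟩, rfl⟩)

theorem cliff_vec (X : E) (b : Lam E) : cliff (X, 0) b = contract X b := by
  have : covForm (0 : E →L[ℝ] ℝ) = 0 := by ext; simp [covForm_apply]
  rw [cliff_apply, this]
  exact (congrArg _ (map_zero (wedgeOneₗ b))).trans (add_zero _)

theorem cliff_cov (ξ : E →L[ℝ] ℝ) (b : Lam E) : cliff (0, ξ) b = wedgeOne (covForm ξ) b := by
  rw [cliff_apply]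
  have : contract (0 : E) b = 0 := by
    funext k
    rw [contract_apply]
    exact map_zero (b (k + 1)).curryLeft
  rw [this, zero_add]

/-- The forms are an irreducible representation of the Clifford algebra. -/
theorem eq_top_of_cliff_mem {N : Submodule ℂ (Lam E)} (hN : ∀ v, ∀ b ∈ N, cliff v b ∈ N)
    (h : N ≠ ⊥) : N = ⊤ := by
  have h1 : lamOne ∈ N := by
    obtain ⟨b, hb, hb0⟩ := Submodule.exists_mem_ne_zero_of_ne_bot h
    have key : ∀ (k : ℕ) (b : Lam E), b ∈ N → b k ≠ 0 → (∀ j, k < j → b j = 0) → lamOne ∈ N := by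
      intro k
      induction k with
      | zero =>
        intro b hb h0 hj
        have e : b = Pi.single 0 (b 0) := by
          funext j
          cases j with
          | zero => simp
          | succ j => rw [hj _ (Nat.succ_pos j), Pi.single_eq_of_ne (by simp)]
        have e2 : b 0 ![] ≠ 0 := fun h => h0 (by ext v; rw [Subsingleton.elim v ![], h]; rfl)
        rw [e, single_zero_eq] at hb
        have := N.smul_mem (b 0 ![])⁻¹ hb
        rwa [smul_smul, inv_mul_cancel₀ e2, one_smul] at this
      | succ k ih =>
        intro b hb h0 hj
        by_contra hcon
        refine h0 (ext_curryLeft fun X => ?_)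
        by_contra hX
        refine hcon (ih (cliff (X, 0) b) (hN _ _ hb) ?_ ?_)
        · rw [cliff_vec]
          exact hX
        · intro j hkj
          rw [cliff_vec, contract_apply, hj (j + 1) (by omega)]
          rfl
    have hex : ∃ k, b k ≠ 0 := by
      by_contra hcon
      push Not at hcon
      exact hb0 (funext hcon)
    classical
    have hbd : ∀ k, b k ≠ 0 → k ≤ Module.finrank ℝ E := fun k hk => by
      by_contra hcon
      exact hk (alternating_eq_zero_of_finrank_lt (by omega) _)
    obtain ⟨k₀, hk₀⟩ := hex
    refine key (Nat.findGreatest (fun k => b k ≠ 0) (Module.finrank ℝ E)) b hb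
      (Nat.findGreatest_spec (P := fun k => b k ≠ 0) (hbd _ hk₀) hk₀) fun j hj => ?_
    by_contra hcon
    exact Nat.findGreatest_is_greatest hj (hbd j hcon) hcon
  refine eq_top_iff.2 fun b _ => ?_
  rw [lam_eq_sum_single b]
  refine Submodule.sum_mem _ fun k _ => single_mem (P := fun _ => N) h1 (fun i _ b hb => ?_) _
  have := hN (0, LinearMap.toContinuousLinearMap ((Module.finBasis ℝ E).coord i)) b hb
  rwa [cliff_cov] at this

end Irreducible

section Spin
variable {E : Type*} [NormedAddCommGroup E] [NormedSpace ℝ E] [FiniteDimensional ℝ E]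

/-- The Clifford action on a fixed form. -/
def cliffₗ (b : Lam E) : GT E →ₗ[ℝ] Lam E where
  toFun v := cliff v b
  map_add' u v := by
    rw [cliff_apply, cliff_apply, cliff_apply]
    have h1 : covForm (u + v).2 = covForm u.2 + covForm v.2 := by ext; simp [covForm_apply]
    have h2 : contract (u + v).1 b = contract u.1 b + contract v.1 b :=
      funext fun k => map_add (b (k + 1)).curryLeft u.1 v.1
    rw [h1, h2, wedgeOne_add]
    abel
  map_smul' r v := by
    have h1 : covForm (r • v).2 = r • covForm v.2 := by ext; simp [covForm_apply]
    have h2 : contract (r • v).1 b = r • contract v.1 b :=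
      funext fun k => map_smul (b (k + 1)).curryLeft r v.1
    have h3 : wedgeOne (r • covForm v.2) b = r • wedgeOne (covForm v.2) b :=
      map_smul (wedgeOneₗ b) r _
    rw [cliff_apply, h1, h2, h3, cliff_apply]
    exact (smul_add r _ _).symm

theorem cliff_add (u v : GT E) (b : Lam E) : cliff (u + v) b = cliff u b + cliff v b :=
  map_add (cliffₗ b) u v

theorem cliff_neg (u : GT E) (b : Lam E) : cliff (-u) b = -cliff u b := map_neg (cliffₗ b) u

theorem cliff_sub (u v : GT E) (b : Lam E) : cliff (u - v) b = cliff u b - cliff v b :=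
  map_sub (cliffₗ b) u v

/-- Twice the natural pairing. -/
def form (v w : GT E) : ℝ := v.2 w.1 + w.2 v.1

theorem form_comm (v w : GT E) : form v w = form w v := add_comm _ _

theorem form_cliff (u v : GT E) (b : Lam E) :
    cliff u (cliff v b) = (form u v : ℂ) • b - cliff v (cliff u b) :=
  eq_sub_of_add_eq (cliff_cliff u v b)

theorem sum_dual_frame {W ι κ : Type*} [AddCommGroup W] [Module ℝ W] [Fintype ι] [Fintype κ]
    (β : E →ₗ[ℝ] (E →L[ℝ] ℝ) →ₗ[ℝ] W) {s : ι → E} {t : ι → E →L[ℝ] ℝ}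
    (h : ∀ X, ∑ i, t i X • s i = X) {s' : κ → E} {t' : κ → E →L[ℝ] ℝ}
    (h' : ∀ X, ∑ i, t' i X • s' i = X) : ∑ i, β (s i) (t i) = ∑ j, β (s' j) (t' j) := by
  have e1 : ∀ i, β (s i) (t i) = ∑ j, β (s' j) (t' j (s i) • t i) := fun i => by
    conv_lhs => rw [← h' (s i)]
    rw [map_sum, LinearMap.sum_apply]
    simp
  rw [Finset.sum_congr rfl fun i _ => e1 i, Finset.sum_comm]
  refine Finset.sum_congr rfl fun j _ => ?_
  rw [← map_sum]
  congr 1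
  ext X
  conv_rhs => rw [← h X, map_sum]
  simp [mul_comm]

theorem sum_finBasis_coord (X : E) : ∑ i, (LinearMap.toContinuousLinearMap
    ((Module.finBasis ℝ E).coord i)) X • Module.finBasis ℝ E i = X := by
  simp [Module.Basis.sum_repr]

theorem spin_apply_finBasis (J : GT E →ₗ[ℝ] GT E) (b : Lam E) :
    spin J b = (1 / 2 : ℂ) • ∑ i,
      (cliff (J (Module.finBasis ℝ E i, 0))
        (cliff (0, LinearMap.toContinuousLinearMap ((Module.finBasis ℝ E).coord i)) b) +
      cliff (J (0, LinearMap.toContinuousLinearMap ((Module.finBasis ℝ E).coord i)))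
        (cliff (Module.finBasis ℝ E i, 0) b)) := by
  simp only [spin, LinearMap.smul_apply, LinearMap.sum_apply, LinearMap.add_apply,
    LinearMap.comp_apply]

theorem cliff_comp_smul (u : GT E) (r : ℝ) (b : Lam E) : cliff u (r • b) = r • cliff u b := by
  have h : ∀ c : Lam E, r • c = (r : ℂ) • c := fun c => funext fun _ => (real_smul_complex r _).symm
  rw [h, h, map_smul]

/-- The bilinear expression whose trace is the spin action. -/
def spinForm (J : GT E →ₗ[ℝ] GT E) (b : Lam E) : E →ₗ[ℝ] (E →L[ℝ] ℝ) →ₗ[ℝ] Lam E :=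
  LinearMap.mk₂ ℝ (fun X ξ => cliff (J (X, 0)) (cliff (0, ξ) b) + cliff (J (0, ξ)) (cliff (X, 0) b))
    (fun X Y ξ => by
      have h : ((X + Y, 0) : GT E) = (X, 0) + (Y, 0) := by simp
      rw [h, map_add, cliff_add, cliff_add, map_add]
      abel)
    (fun r X ξ => by
      have h : ((r • X, 0) : GT E) = r • ((X, 0) : GT E) := by simp
      have h2 : ∀ (v : GT E) c, cliff (r • v) c = r • cliff v c := fun v c => map_smul (cliffₗ c) r v
      rw [h, map_smul]
      rw [h2, h2, cliff_comp_smul, smul_add])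
    (fun X ξ η => by
      have h : ((0, ξ + η) : GT E) = (0, ξ) + (0, η) := by simp
      rw [h, map_add, cliff_add, cliff_add, map_add]
      abel)
    (fun r X ξ => by
      have h : ((0, r • ξ) : GT E) = r • ((0, ξ) : GT E) := by simp
      have h2 : ∀ (v : GT E) c, cliff (r • v) c = r • cliff v c := fun v c => map_smul (cliffₗ c) r v
      rw [h, map_smul]
      rw [h2, h2, cliff_comp_smul, smul_add])

/-- The spin action does not depend on the choice of a frame. -/
theorem spin_eq_sum {ι : Type*} [Fintype ι] (J : GT E →ₗ[ℝ] GT E) (b : Lam E) {s : ι → E}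
    {t : ι → E →L[ℝ] ℝ} (h : ∀ X, ∑ i, t i X • s i = X) :
    spin J b = (1 / 2 : ℂ) • ∑ i,
      (cliff (J (s i, 0)) (cliff (0, t i) b) + cliff (J (0, t i)) (cliff (s i, 0) b)) := by
  rw [spin_apply_finBasis]
  exact congrArg ((1 / 2 : ℂ) • ·) (sum_dual_frame (spinForm J b) sum_finBasis_coord h)

theorem sum_frame {W : Type*} [AddCommGroup W] [Module ℝ W] (f : GT E →ₗ[ℝ] W) (v : GT E) :
    ∑ i, (form (0, LinearMap.toContinuousLinearMap ((Module.finBasis ℝ E).coord i)) v •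
        f (Module.finBasis ℝ E i, 0) + form (Module.finBasis ℝ E i, 0) v •
        f (0, LinearMap.toContinuousLinearMap ((Module.finBasis ℝ E).coord i))) = f v := by
  simp only [← map_smul, ← map_add, ← map_sum]
  congr 1
  rw [Finset.sum_add_distrib]
  refine Prod.ext ?_ ?_
  · simp [form, Prod.fst_sum, Module.Basis.sum_repr]
  · ext X
    simp only [form, Prod.snd_add, Prod.snd_sum, Prod.smul_mk, smul_zero, Finset.sum_const_zero,
      zero_add, zero_apply, sum_apply]
    conv_rhs => rw [← (Module.finBasis ℝ E).sum_repr X, map_sum]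
    simp [mul_comm]

theorem spin_cliff {J : GT E →ₗ[ℝ] GT E} (hJ : ∀ v w, form (J v) w = -form v (J w)) (v : GT E)
    (b : Lam E) : spin J (cliff v b) = cliff v (spin J b) + cliff (J v) b := by
  set e := Module.finBasis ℝ E
  set e' : Fin (Module.finrank ℝ E) → E →L[ℝ] ℝ := fun i =>
    LinearMap.toContinuousLinearMap (e.coord i)
  have key : ∀ u w : GT E, cliff (J u) (cliff w (cliff v b)) = cliff v (cliff (J u) (cliff w b)) +
      (form w v : ℂ) • cliff (J u) b + (form u (J v) : ℂ) • cliff w b := by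
    intro u w
    rw [form_cliff w v, map_sub, map_smul, form_cliff (J u) v, hJ u v]
    push_cast
    module
  have h1 := sum_frame (cliffₗ b ∘ₗ J) v
  have h2 := sum_frame (cliffₗ b) (J v)
  have hr : ∀ (r : ℝ) (c : Lam E), r • c = (r : ℂ) • c :=
    fun r c => funext fun _ => (real_smul_complex r _).symm
  rw [spin_apply_finBasis, spin_apply_finBasis, map_smul, map_sum]
  have h3 : cliff (J v) b = (1 / 2 : ℂ) • (cliff (J v) b + cliff (J v) b) := by module
  have h4 : cliff (J v) b + cliff (J v) b = ∑ i, (((form (0, e' i) v : ℂ) • cliff (J (e i, 0)) b +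
      (form (e i, 0) v : ℂ) • cliff (J (0, e' i)) b) +
      ((form (0, e' i) (J v) : ℂ) • cliff (e i, 0) b + (form (e i, 0) (J v) : ℂ) • cliff (0, e' i) b)) := by
    rw [Finset.sum_add_distrib]
    simp only [hr] at h1 h2
    exact congrArg₂ (· + ·) h1.symm h2.symm
  rw [h3, h4, ← lam_smul_add, ← Finset.sum_add_distrib]
  refine congrArg ((1 / 2 : ℂ) • ·) (Finset.sum_congr rfl fun i _ => ?_)
  rw [key, key, map_add]
  abel

/-- A form killed by the `-√-1`-eigenspace of `J` is an eigenvector of the spin action. -/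
theorem spin_of_vacuum {J : GT E →ₗ[ℝ] GT E} (hJ : ∀ v w, form (J v) w = -form v (J w))
    {b : Lam E} (hb : ∀ v, cliff v b + Complex.I • cliff (J v) b = 0) :
    spin J b = (-((Module.finrank ℝ E : ℂ) / 2) * Complex.I) • b := by
  have h1 : ∀ v, cliff (J v) b = Complex.I • cliff v b := fun v => by
    have := congrArg (Complex.I • ·) (hb v)
    simp only [smul_add, smul_smul, Complex.I_mul_I] at this
    have h0 : Complex.I • (0 : Lam E) = 0 := by module
    rw [h0] at this
    linear_combination (norm := module) -this
  have key : ∀ u w : GT E, cliff (J u) (cliff w b) = (form (J u) w : ℂ) • b -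
      Complex.I • cliff w (cliff u b) := by
    intro u w
    rw [form_cliff (J u) w, h1, map_smul]
  set e := Module.finBasis ℝ E
  set e' : Fin (Module.finrank ℝ E) → E →L[ℝ] ℝ := fun i =>
    LinearMap.toContinuousLinearMap (e.coord i)
  rw [spin_apply_finBasis, Finset.sum_congr rfl fun i _ => ?_, Finset.sum_const]
  rotate_left
  · exact -Complex.I • b
  · rw [key, key]
    have h2 : form (J (e i, 0)) (0, e' i) + form (J (0, e' i)) (e i, 0) = 0 := by
      rw [hJ, form_comm]
      ring
    have h3 := cliff_cliff (0, e' i) (e i, 0) b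
    have h4 : ((0, e' i) : GT E).2 ((e i, 0) : GT E).1 + ((e i, 0) : GT E).2 ((0, e' i) : GT E).1
        = 1 := by
      simp [e']
    rw [h4] at h3
    have h5 : (form (J (0, e' i)) (e i, 0) : ℂ) = -form (J (e i, 0)) (0, e' i) := by
      rw [← Complex.ofReal_neg]
      congr 1
      linarith
    rw [h5]
    push_cast at h3
    linear_combination (norm := module) -Complex.I • h3
  · simp only [Finset.card_univ, Fintype.card_fin]
    rw [← Nat.cast_smul_eq_nsmul ℂ, smul_smul, smul_smul]
    congr 1
    ring

end Spin
end GenEquivariant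
end

noncomputable section
namespace GenEquivariant
set_option linter.unusedSectionVars false

theorem even_finrank_of_sq_eq_neg_one {V : Type*} [AddCommGroup V] [Module ℝ V]
    [FiniteDimensional ℝ V] (A : V →ₗ[ℝ] V) (hA : ∀ v, A (A v) = -v) :
    Even (Module.finrank ℝ V) := by
  by_contra hodd
  rw [Nat.not_even_iff_odd] at hodd
  have h1 : A ∘ₗ A = (-1 : ℝ) • LinearMap.id := LinearMap.ext fun v => by simp [hA]
  have h2 := congrArg LinearMap.det h1
  rw [LinearMap.det_comp, LinearMap.det_smul, hodd.neg_one_pow, LinearMap.det_id] at h2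
  nlinarith [mul_self_nonneg (LinearMap.det A)]

theorem even_finrank_of_alternating {V : Type*} [AddCommGroup V] [Module ℝ V]
    [FiniteDimensional ℝ V] (C : V →ₗ[ℝ] V →ₗ[ℝ] ℝ) (hC : ∀ v w, C v w = -C w v)
    (hn : ∀ v, (∀ w, C v w = 0) → v = 0) : Even (Module.finrank ℝ V) := by
  by_contra hodd
  rw [Nat.not_even_iff_odd] at hodd
  let b := Module.finBasis ℝ V
  let N : Matrix (Fin (Module.finrank ℝ V)) (Fin (Module.finrank ℝ V)) ℝ := fun i j => C (b j) (b i)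
  have h1 : N.transpose = -N := by
    ext i j
    exact hC _ _
  have h2 := congrArg Matrix.det h1
  rw [Matrix.det_transpose, Matrix.det_neg, Fintype.card_fin, hodd.neg_one_pow] at h2
  have h3 : N.det = 0 := by linarith
  obtain ⟨v, hv0, hv⟩ := Matrix.exists_mulVec_eq_zero_iff.2 h3
  apply hv0
  have h4 : ∑ j, v j • b j = 0 := by
    refine hn _ fun w => ?_
    have h5 : C (∑ j, v j • b j) = 0 := by
      refine b.ext fun i => ?_
      have := congrFun hv i
      simp only [Matrix.mulVec, dotProduct, N, Pi.zero_apply] at this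
      simp only [map_sum, map_smul, LinearMap.sum_apply, LinearMap.smul_apply, smul_eq_mul,
        LinearMap.zero_apply]
      rw [← this]
      exact Finset.sum_congr rfl fun j _ => mul_comm _ _
    rw [h5]
    rfl
  funext j
  exact Fintype.linearIndependent_iff.1 b.linearIndependent v h4 j

section Decomposition
variable {E : Type*} [NormedAddCommGroup E] [NormedSpace ℝ E] [FiniteDimensional ℝ E]
  {J : GT E →ₗ[ℝ] GT E}

theorem even_finrank (hJ : ∀ v w, form (J v) w = -form v (J w)) (hsq : ∀ v, J (J v) = -v) :
    Even (Module.finrank ℝ E) := by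
  let C : E →ₗ[ℝ] E →ₗ[ℝ] ℝ := LinearMap.mk₂ ℝ (fun X Y => (J (X, 0)).2 Y)
    (fun X X' Y => by
      have h : ((X + X', 0) : GT E) = (X, 0) + (X', 0) := by simp
      rw [h, map_add]; rfl)
    (fun r X Y => by
      have h : ((r • X, 0) : GT E) = r • ((X, 0) : GT E) := by simp
      rw [h, map_smul]; rfl)
    (fun X Y Y' => map_add _ _ _) (fun r X Y => map_smul _ _ _)
  have hC : ∀ X Y, C X Y = -C Y X := fun X Y => by
    have := hJ (X, 0) (Y, 0)
    simp only [form, zero_apply, add_zero, zero_add] at this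
    exact this
  let K : Submodule ℝ E := LinearMap.ker C
  obtain ⟨W, hW⟩ := K.exists_isCompl
  have hK : ∀ X ∈ K, (J (X, 0)).2 = 0 := fun X hX => by
    ext Y
    exact LinearMap.congr_fun (LinearMap.mem_ker.1 hX) Y
  have hK2 : ∀ X ∈ K, J (X, 0) = ((J (X, 0)).1, 0) := fun X hX => Prod.ext rfl (hK X hX)
  have hK3 : ∀ X ∈ K, (J (X, 0)).1 ∈ K := fun X hX => by
    refine LinearMap.mem_ker.2 (LinearMap.ext fun Y => ?_)
    show (J ((J (X, 0)).1, 0)).2 Y = 0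
    rw [← hK2 X hX, hsq]
    simp
  have e1 : Even (Module.finrank ℝ K) := by
    let A : K →ₗ[ℝ] K :=
      { toFun := fun X => ⟨(J (X.1, 0)).1, hK3 _ X.2⟩
        map_add' := fun X Y => Subtype.ext (by
          have h : ((X.1 + Y.1, 0) : GT E) = (X.1, 0) + (Y.1, 0) := by simp
          show (J (X.1 + Y.1, 0)).1 = _
          rw [h, map_add]; rfl)
        map_smul' := fun r X => Subtype.ext (by
          have h : ((r • X.1, 0) : GT E) = r • ((X.1, 0) : GT E) := by simp
          show (J (r • X.1, 0)).1 = _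
          rw [h, map_smul]; rfl) }
    refine even_finrank_of_sq_eq_neg_one A fun X => Subtype.ext ?_
    show (J ((J (X.1, 0)).1, 0)).1 = -X.1
    rw [← hK2 X.1 X.2, hsq]
    rfl
  have e2 : Even (Module.finrank ℝ W) := by
    refine even_finrank_of_alternating (C.domRestrict₁₂ W W) (fun v w => hC _ _) fun v hv => ?_
    have : v.1 ∈ K := by
      refine LinearMap.mem_ker.2 (LinearMap.ext fun Y => ?_)
      obtain ⟨k, hk, w, hw, rfl⟩ := Submodule.mem_sup.1 (hW.sup_eq_top ▸ Submodule.mem_top (x := Y))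
      rw [map_add, hC v.1 k, LinearMap.mem_ker.1 hk]
      have h2 : C v.1 w = 0 := hv ⟨w, hw⟩
      rw [h2, LinearMap.zero_apply, neg_zero, add_zero]
      rfl
    exact Subtype.ext (Submodule.disjoint_def.1 hW.disjoint _ this v.2)
  rw [← Submodule.finrank_add_eq_of_isCompl hW]
  exact e1.add e2

/-- The eigenspaces of the spin action. -/
def eig (J : GT E →ₗ[ℝ] GT E) (k : ℤ) : Submodule ℂ (Lam E) :=
  Module.End.eigenspace (spin J) (-(k : ℂ) * Complex.I)

theorem mem_eig {k : ℤ} {b : Lam E} : b ∈ eig J k ↔ spin J b = (-(k : ℂ) * Complex.I) • b :=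
  Module.End.mem_eigenspace_iff

theorem form_neg_skew (hJ : ∀ v w, form (J v) w = -form v (J w)) (v w : GT E) :
    form ((-J) v) w = -form v ((-J) w) := by
  have := hJ v w
  simp only [form, LinearMap.neg_apply, Prod.fst_neg, Prod.snd_neg, map_neg, neg_apply] at *
  linarith

theorem spin_neg (b : Lam E) : spin (-J) b = -spin J b := by
  have h : ∀ v, ∀ c : Lam E, cliff ((-J) v) c = -cliff (J v) c := fun v c => cliff_neg (J v) c
  rw [spin_apply_finBasis, spin_apply_finBasis, ← lam_smul_neg, ← Finset.sum_neg_distrib]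
  refine congrArg ((1 / 2 : ℂ) • ·) (Finset.sum_congr rfl fun i _ => ?_)
  rw [h, h, neg_add]

theorem spin_raise (hJ : ∀ v w, form (J v) w = -form v (J w)) (hsq : ∀ v, J (J v) = -v) {c : ℂ}
    {b : Lam E} (hb : spin J b = c • b) (v : GT E) :
    spin J (cliff v b + Complex.I • cliff (J v) b) =
      (c - Complex.I) • (cliff v b + Complex.I • cliff (J v) b) := by
  rw [map_add, map_smul, spin_cliff hJ, spin_cliff hJ, hsq, cliff_neg, hb, map_smul, map_smul]
  have : Complex.I * Complex.I = -1 := Complex.I_mul_I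
  match_scalars
  · ring
  · linear_combination this

theorem eig_raise (hJ : ∀ v w, form (J v) w = -form v (J w)) (hsq : ∀ v, J (J v) = -v) {k : ℤ}
    {b : Lam E} (hb : b ∈ eig J k) (v : GT E) :
    cliff v b + Complex.I • cliff (J v) b ∈ eig J (k + 1) := by
  rw [mem_eig, spin_raise hJ hsq (mem_eig.1 hb)]
  push_cast
  congr 1
  ring

theorem eig_neg (k : ℤ) : eig (-J) k = eig J (-k) := by
  ext b
  rw [mem_eig, mem_eig, spin_neg, neg_eq_iff_eq_neg]
  have : -((-(k : ℂ) * Complex.I) • b) = (-((-k : ℤ) : ℂ) * Complex.I) • b := by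
    push_cast
    module
  rw [this]

theorem eig_lower (hJ : ∀ v w, form (J v) w = -form v (J w)) (hsq : ∀ v, J (J v) = -v) {k : ℤ}
    {b : Lam E} (hb : b ∈ eig J k) (v : GT E) :
    cliff v b - Complex.I • cliff (J v) b ∈ eig J (k - 1) := by
  have h := eig_raise (J := -J) (k := -k) (b := b) (form_neg_skew hJ)
    (fun v => by simp [hsq]) (by rwa [eig_neg, neg_neg]) v
  have e : ((-J) v) = -(J v) := rfl
  have e2 : Complex.I • -cliff (J v) b = -(Complex.I • cliff (J v) b) := lam_smul_neg _ _
  rw [eig_neg, e, cliff_neg, e2, ← sub_eq_add_neg] at h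
  convert h using 2
  ring

theorem top_of_killed (hJ : ∀ v w, form (J v) w = -form v (J w)) {m : ℕ}
    (hm : Module.finrank ℝ E = 2 * m) {k : ℤ} {b : Lam E} (hb : b ∈ eig J k) (h0 : b ≠ 0)
    (h : ∀ v, cliff v b + Complex.I • cliff (J v) b = 0) : k = m := by
  have h1 := spin_of_vacuum hJ h
  rw [mem_eig.1 hb, hm] at h1
  have h2 : ((-(k : ℂ) * Complex.I) - -((2 * m : ℕ) / 2) * Complex.I) • b = 0 := by
    linear_combination (norm := module) h1
  have h3 : (-(k : ℂ) * Complex.I) - -((2 * m : ℕ) / 2) * Complex.I = 0 := by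
    by_contra hne
    exact h0 ((smul_eq_zero_iff_right hne).1 h2)
  have h4 : (-(k : ℂ) + m) * Complex.I = 0 := by
    rw [← h3]; push_cast; ring
  have h5 := (mul_eq_zero.1 h4).resolve_right Complex.I_ne_zero
  have h6 : (k : ℂ) = ((m : ℤ) : ℂ) := by
    push_cast
    linear_combination -h5
  exact_mod_cast h6

theorem bottom_of_killed (hJ : ∀ v w, form (J v) w = -form v (J w)) {m : ℕ}
    (hm : Module.finrank ℝ E = 2 * m) {k : ℤ} {b : Lam E} (hb : b ∈ eig J k) (h0 : b ≠ 0)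
    (h : ∀ v, cliff v b - Complex.I • cliff (J v) b = 0) : k = -m := by
  have := top_of_killed (J := -J) (k := -k) (b := b) (form_neg_skew hJ) hm
    (by rwa [eig_neg, neg_neg]) h0 (fun v => by
      have e : ((-J) v) = -(J v) := rfl
      have e2 : Complex.I • -cliff (J v) b = -(Complex.I • cliff (J v) b) := lam_smul_neg _ _
      rw [e, cliff_neg, e2, ← sub_eq_add_neg]
      exact h v)
  omega

theorem exists_top_eigenvalue (T : Module.End ℂ (Lam E)) {c : ℂ} (hc : T.HasEigenvalue c) :
    ∃ j : ℕ, T.HasEigenvalue (c - j * Complex.I) ∧ ¬T.HasEigenvalue (c - (j + 1) * Complex.I) := by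
  by_contra hcon
  push Not at hcon
  have h : ∀ j : ℕ, T.HasEigenvalue (c - j * Complex.I) := by
    intro j
    induction j with
    | zero => simpa using hc
    | succ j ih => exact_mod_cast hcon j ih
  have hinj : Function.Injective (fun j : ℕ => c - j * Complex.I) := by
    intro i j hij
    have h1 : c - i * Complex.I = c - j * Complex.I := hij
    have h2 : ((i : ℂ) - j) * Complex.I = 0 := by linear_combination -h1
    have := (mul_eq_zero.1 h2).resolve_right Complex.I_ne_zero
    exact_mod_cast sub_eq_zero.1 this
  exact Set.infinite_range_of_injective hinj
    ((T.finite_hasEigenvalue).subset (by rintro _ ⟨j, rfl⟩; exact h j))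

theorem lamOne_ne_zero : (lamOne : Lam E) ≠ 0 := fun h => by
  have := DFunLike.congr_fun (congrFun h 0) ![]
  simp [lamOne] at this

theorem eig_le (hJ : ∀ v w, form (J v) w = -form v (J w)) (hsq : ∀ v, J (J v) = -v) {m : ℕ}
    (hm : Module.finrank ℝ E = 2 * m) {k : ℤ} {b : Lam E} (hb : b ∈ eig J k) (h0 : b ≠ 0) :
    k ≤ m := by
  have hc : Module.End.HasEigenvalue (spin J) (-(k : ℂ) * Complex.I) :=
    Module.End.hasEigenvalue_of_hasEigenvector ⟨hb, h0⟩
  obtain ⟨j, hj, hj'⟩ := exists_top_eigenvalue _ hc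
  obtain ⟨c, hc, hc0⟩ := hj.exists_hasEigenvector
  have hc' := Module.End.mem_eigenspace_iff.1 hc
  have hc2 : c ∈ eig J (k + j) := by
    rw [mem_eig, hc']
    push_cast
    congr 1
    ring
  have := top_of_killed hJ hm hc2 hc0 fun v => by
    by_contra hne
    refine hj' (Module.End.hasEigenvalue_of_hasEigenvector (x := _) ⟨?_, hne⟩)
    rw [Module.End.mem_eigenspace_iff, spin_raise hJ hsq hc']
    congr 1
    ring
  omega

theorem le_eig (hJ : ∀ v w, form (J v) w = -form v (J w)) (hsq : ∀ v, J (J v) = -v) {m : ℕ}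
    (hm : Module.finrank ℝ E = 2 * m) {k : ℤ} {b : Lam E} (hb : b ∈ eig J k) (h0 : b ≠ 0) :
    -m ≤ k := by
  have := eig_le (J := -J) (k := -k) (b := b) (form_neg_skew hJ) (fun v => by simp [hsq]) hm
    (by rwa [eig_neg, neg_neg]) h0
  omega

theorem cliff_eig (hJ : ∀ v w, form (J v) w = -form v (J w)) (hsq : ∀ v, J (J v) = -v) {k : ℤ}
    {b : Lam E} (hb : b ∈ eig J k) (v : GT E) : cliff v b ∈ eig J (k + 1) ⊔ eig J (k - 1) := by
  have : cliff v b = (1 / 2 : ℂ) • (cliff v b + Complex.I • cliff (J v) b) +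
      (1 / 2 : ℂ) • (cliff v b - Complex.I • cliff (J v) b) := by module
  rw [this]
  exact Submodule.add_mem_sup (Submodule.smul_mem _ _ (eig_raise hJ hsq hb v))
    (Submodule.smul_mem _ _ (eig_lower hJ hsq hb v))

theorem iSup_eig (hJ : ∀ v w, form (J v) w = -form v (J w)) (hsq : ∀ v, J (J v) = -v) :
    ⨆ k : ℤ, eig J k = ⊤ := by
  obtain ⟨m, hm⟩ := even_finrank hJ hsq
  have : Nontrivial (Lam E) := ⟨lamOne, 0, lamOne_ne_zero⟩
  refine eq_top_of_cliff_mem (fun v b hb => ?_) fun hbot => ?_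
  · induction hb using Submodule.iSup_induction' with
    | mem k b hb =>
      exact sup_le (le_iSup (eig J) _) (le_iSup (eig J) _) (cliff_eig hJ hsq hb v)
    | zero => rw [map_zero]; exact Submodule.zero_mem _
    | add b c _ _ h1 h2 => rw [map_add]; exact Submodule.add_mem _ h1 h2
  · obtain ⟨c, hc⟩ := Module.End.exists_eigenvalue (spin J : Module.End ℂ (Lam E))
    obtain ⟨j, hj, hj'⟩ := exists_top_eigenvalue _ hc
    obtain ⟨b, hb, hb0⟩ := hj.exists_hasEigenvector
    have hb' := Module.End.mem_eigenspace_iff.1 hb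
    have h1 := spin_of_vacuum hJ (b := b) fun v => by
      by_contra hne
      refine hj' (Module.End.hasEigenvalue_of_hasEigenvector (x := _) ⟨?_, hne⟩)
      rw [Module.End.mem_eigenspace_iff, spin_raise hJ hsq hb']
      congr 1
      ring
    have h2 : b ∈ eig J m := by
      rw [mem_eig, h1, hm]
      push_cast
      congr 1
      ring
    have h3 := le_iSup (eig J) _ h2
    rw [hbot] at h3
    exact hb0 ((Submodule.mem_bot ℂ).1 h3)

end Decomposition
end GenEquivariant
end

noncomputable section
namespace GenEquivariant
set_option linter.unusedSectionVars false
open ContinuousAlternatingMap (alternatizeUncurryFin alternatizeUncurryFin_apply)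
open scoped ContDiff Topology

section Assoc
variable {E : Type*} [NormedAddCommGroup E] [NormedSpace ℝ E] [FiniteDimensional ℝ E]

theorem sum_apply_smul_wedgeOne {ι : Type*} [Fintype ι] (e : Module.Basis ι ℝ E)
    (a : E [⋀^Fin 1]→L[ℝ] ℝ) (b : Lam E) :
    ∑ i, (a ![e i] : ℂ) • wedgeOne (dualForm e i) b = wedgeOne a b := by
  have h := congrArg (wedgeOneₗ b) (sum_smul_dualForm e a)
  rw [map_sum] at h
  refine Eq.trans (Finset.sum_congr rfl fun i _ => ?_) h
  exact (wedgeOne_smul _ _ b).symm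

theorem wedgeTwo_alternatize (A : E →L[ℝ] E [⋀^Fin 1]→L[ℝ] ℝ) (b : Lam E) :
    wedgeTwo (alternatizeUncurryFin A) b = ∑ i, wedgeOne (dualForm (Module.finBasis ℝ E) i)
      (wedgeOne (A (Module.finBasis ℝ E i)) b) := by
  set e := Module.finBasis ℝ E
  have h1 : ∀ X, (alternatizeUncurryFin A).curryLeft X =
      A X - ∑ i, (A (e i)) ![X] • dualForm e i := by
    intro X
    rw [alternatizeUncurryFin_eq_sum e]
    have h : ∀ i, (wedge 1 (dualForm e i) (A (e i))).curryLeft X =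
        e.repr X i • A (e i) - (A (e i)) ![X] • dualForm e i := fun i => by
      rw [curryLeft_wedge_one, dualForm_apply]
      congr 1
      ext v
      rw [wedge_one_apply]
      have hX : (Matrix.vecCons X (Fin.tail v) : Fin 1 → E) = ![X] :=
        congrArg _ (Subsingleton.elim _ _)
      simp [dualForm_apply, mul_comm, hX]
    have h2 : (∑ i, wedge 1 (dualForm e i) (A (e i))).curryLeft X =
        ∑ i, (wedge 1 (dualForm e i) (A (e i))).curryLeft X := by
      ext v
      simp
    rw [h2, Finset.sum_congr rfl fun i _ => h i, Finset.sum_sub_distrib]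
    congr 1
    conv_rhs => rw [← e.sum_repr X, map_sum]
    simp
  have h2 : ∀ j, wedgeOne ((alternatizeUncurryFin A).curryLeft (e j)) b =
      wedgeOne (A (e j)) b - ∑ i, ((A (e i)) ![e j] : ℂ) • wedgeOne (dualForm e i) b := by
    intro j
    rw [h1]
    refine (map_sub (wedgeOneₗ b) _ _).trans ?_
    rw [map_sum]
    congr 1
    refine Finset.sum_congr rfl fun i _ => ?_
    exact wedgeOne_smul _ _ b
  have h3 : ∑ j, wedgeOne (dualForm e j) (∑ i, ((A (e i)) ![e j] : ℂ) • wedgeOne (dualForm e i) b) =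
      -∑ i, wedgeOne (dualForm e i) (wedgeOne (A (e i)) b) := by
    simp only [map_sum, map_smul]
    rw [Finset.sum_comm, ← Finset.sum_neg_distrib]
    refine Finset.sum_congr rfl fun i _ => ?_
    rw [← sum_apply_smul_wedgeOne e (A (e i)) b, map_sum, ← Finset.sum_neg_distrib]
    refine Finset.sum_congr rfl fun j _ => ?_
    rw [wedgeOne_wedgeOne, map_smul]
    module
  rw [wedgeTwo_eq_sum e]
  simp only [h2, map_sub]
  rw [Finset.sum_sub_distrib, h3]
  module

theorem wedgeTwo_wedge_one (a c : E [⋀^Fin 1]→L[ℝ] ℝ) (b : Lam E) :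
    wedgeTwo (wedge 1 a c) b = wedgeOne a (wedgeOne c b) := by
  set e := Module.finBasis ℝ E
  have h2 : ∀ j, wedgeOne ((wedge 1 a c).curryLeft (e j)) b =
      (a ![e j] : ℂ) • wedgeOne c b - (c ![e j] : ℂ) • wedgeOne a b := fun j => by
    have : wedge 1 a (c.curryLeft (e j)) = c ![e j] • a := by
      ext v
      rw [wedge_one_apply]
      have hv : v = ![v 0] := by funext i; fin_cases i; rfl
      rw [hv]
      simp [mul_comm]
    rw [curryLeft_wedge_one, this]
    refine (map_sub (wedgeOneₗ b) _ _).trans ?_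
    exact congrArg₂ (· - ·) (wedgeOne_smul _ _ b) (wedgeOne_smul _ _ b)
  rw [wedgeTwo_eq_sum e]
  simp only [h2, map_sub, map_smul]
  rw [Finset.sum_sub_distrib, sum_apply_smul_wedgeOne, sum_apply_smul_wedgeOne,
    wedgeOne_wedgeOne c a]
  module

theorem wedgeThree_wedge_one (a : E [⋀^Fin 1]→L[ℝ] ℝ) (c : E [⋀^Fin 2]→L[ℝ] ℝ) (b : Lam E) :
    wedgeThree (wedge 1 a c) b = wedgeOne a (wedgeTwo c b) := by
  set e := Module.finBasis ℝ E
  have h2 : ∀ j, wedgeTwo ((wedge 1 a c).curryLeft (e j)) b =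
      (a ![e j] : ℂ) • wedgeTwo c b - wedgeOne a (wedgeOne (c.curryLeft (e j)) b) := fun j => by
    rw [curryLeft_wedge_one, ← wedgeTwo_wedge_one]
    refine (map_sub (wedgeTwoₗ b) _ _).trans ?_
    exact congrArg (· - _) (wedgeTwo_smul _ _ b)
  have h3 : ∀ j, wedgeOne (dualForm e j) (wedgeOne a (wedgeOne (c.curryLeft (e j)) b)) =
      -wedgeOne a (wedgeOne (dualForm e j) (wedgeOne (c.curryLeft (e j)) b)) :=
    fun j => wedgeOne_wedgeOne _ _ _
  have h4 : ∑ j, wedgeOne (dualForm e j) (wedgeOne (c.curryLeft (e j)) b) =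
      (2 : ℂ) • wedgeTwo c b := by
    rw [wedgeTwo_eq_sum e]
    module
  rw [wedgeThree_eq_sum e]
  simp only [h2, map_sub, map_smul, h3]
  rw [Finset.sum_sub_distrib, sum_apply_smul_wedgeOne, Finset.sum_neg_distrib, ← map_sum, h4,
    map_smul]
  module

theorem wedgeThree_add (a c : E [⋀^Fin 3]→L[ℝ] ℝ) (b : Lam E) :
    wedgeThree (a + c) b = wedgeThree a b + wedgeThree c b := by
  funext k
  rcases k with _ | _ | _ | k
  · exact (add_zero _).symm
  · exact (add_zero _).symm
  · exact (add_zero _).symm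
  · exact LinearMap.congr_fun (map_add (wedge 3) a c) (b k)

theorem wedgeThree_alternatize {A : E →L[ℝ] E [⋀^Fin 3]→L[ℝ] ℝ}
    (hA : alternatizeUncurryFin A = 0) (b : Lam E) :
    ∑ i, wedgeOne (dualForm (Module.finBasis ℝ E) i)
      (wedgeThree (A (Module.finBasis ℝ E i)) b) = 0 := by
  set e := Module.finBasis ℝ E
  have h1 : ∀ X, A X = ∑ i, wedge 1 (dualForm e i) ((A (e i)).curryLeft X) := by
    intro X
    have h0 : (alternatizeUncurryFin A).curryLeft X = 0 := by rw [hA]; rfl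
    rw [alternatizeUncurryFin_eq_sum e] at h0
    have h2 : (∑ i, wedge 1 (dualForm e i) (A (e i))).curryLeft X =
        ∑ i, (wedge 1 (dualForm e i) (A (e i))).curryLeft X := by
      ext v
      simp
    simp only [h2, curryLeft_wedge_one, Finset.sum_sub_distrib] at h0
    rw [← sub_eq_zero.1 h0]
    conv_lhs => rw [← e.sum_repr X, map_sum]
    simp [dualForm_apply]
  let T : (E [⋀^Fin 3]→L[ℝ] ℝ) →+ Lam E := ⟨⟨fun a => wedgeThree a b, by
    have := wedgeThree_add 0 0 b
    rw [add_zero] at this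
    exact left_eq_add.1 this⟩, fun a c => wedgeThree_add a c b⟩
  have h2 : ∀ j, wedgeThree (A (e j)) b =
      ∑ i, wedgeOne (dualForm e i) (wedgeTwo ((A (e i)).curryLeft (e j)) b) := fun j => by
    have := congrArg T (h1 (e j))
    rw [map_sum] at this
    refine this.trans (Finset.sum_congr rfl fun i _ => wedgeThree_wedge_one _ _ _)
  have h3 : ∑ j, wedgeOne (dualForm e j) (wedgeThree (A (e j)) b) =
      -((3 : ℂ) • ∑ i, wedgeOne (dualForm e i) (wedgeThree (A (e i)) b)) := by
    conv_lhs => simp only [h2, map_sum]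
    rw [Finset.sum_comm]
    have h4 : ∀ i, ∑ j, wedgeOne (dualForm e j) (wedgeTwo ((A (e i)).curryLeft (e j)) b) =
        (3 : ℂ) • wedgeThree (A (e i)) b := fun i => by
      rw [wedgeThree_eq_sum e]
      module
    have h5 : ∀ i, ∑ j, wedgeOne (dualForm e j) (wedgeOne (dualForm e i)
        (wedgeTwo ((A (e i)).curryLeft (e j)) b)) =
        -((3 : ℂ) • wedgeOne (dualForm e i) (wedgeThree (A (e i)) b)) := fun i => by
      rw [← map_smul, ← h4, map_sum, ← Finset.sum_neg_distrib]
      exact Finset.sum_congr rfl fun j _ => wedgeOne_wedgeOne _ _ _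
    rw [Finset.sum_congr rfl fun i _ => h5 i, Finset.sum_neg_distrib, Finset.smul_sum]
  set S := ∑ j, wedgeOne (dualForm e j) (wedgeThree (A (e j)) b)
  have h6 : S = (4 : ℂ)⁻¹ • (S + (3 : ℂ) • S) := by module
  have h7 : S + (3 : ℂ) • S = 0 := by
    nth_rewrite 1 [h3]
    exact neg_add_cancel _
  rw [h6, h7]
  module

end Assoc

section Local
variable {E : Type*} [NormedAddCommGroup E] [NormedSpace ℝ E] [FiniteDimensional ℝ E]

/-- Differentiability at a point of a function with values in the exterior algebra. -/
def LamDiff (u : E → Lam E) (y : E) : Prop := ∀ k, DifferentiableAt ℝ (fun z => u z k) y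

/-- The directional derivative of a function with values in the exterior algebra. -/
def pd (u : E → Lam E) (y v : E) : Lam E := fun k => fderiv ℝ (fun z => u z k) y v

/-- The exterior derivative of a form of mixed degree on the model space. -/
def dLoc (u : E → Lam E) (y : E) : Lam E :=
  ∑ i, wedgeOne (dualForm (Module.finBasis ℝ E) i) (pd u y (Module.finBasis ℝ E i))

theorem dLoc_zero (u : E → Lam E) (y : E) : dLoc u y 0 = 0 := by
  rw [dLoc, Finset.sum_apply]
  exact Finset.sum_eq_zero fun i _ => wedgeOne_zero _ _

theorem dLoc_succ (u : E → Lam E) (y : E) (k : ℕ) :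
    dLoc u y (k + 1) = extDeriv (fun z => u z k) y := by
  rw [dLoc, Finset.sum_apply, extDeriv, alternatizeUncurryFin_eq_sum (Module.finBasis ℝ E)]
  rfl

theorem sum_repr_pd (u : E → Lam E) (y X : E) :
    ∑ i, ((Module.finBasis ℝ E).repr X i : ℂ) • pd u y (Module.finBasis ℝ E i) = pd u y X := by
  funext k
  rw [Finset.sum_apply]
  conv_rhs => rw [← (Module.finBasis ℝ E).sum_repr X]
  simp only [pd, map_sum, map_smul]
  exact Finset.sum_congr rfl fun i _ => real_smul_complex _ _

theorem sum_repr_contract (X : E) (b : Lam E) (f : E →ₗ[ℝ] E) :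
    ∑ i, ((Module.finBasis ℝ E).repr X i : ℂ) • contract (f (Module.finBasis ℝ E i)) b =
      contract (f X) b := by
  funext k
  rw [Finset.sum_apply]
  conv_rhs => rw [← (Module.finBasis ℝ E).sum_repr X]
  simp only [contract_apply, map_sum, map_smul]
  exact Finset.sum_congr rfl fun i _ => real_smul_complex _ _

theorem pd_smul {f : E → ℝ} {u : E → Lam E} {y : E} (hf : DifferentiableAt ℝ f y)
    (hu : LamDiff u y) (v : E) :
    pd (fun z => (f z : ℂ) • u z) y v = (fderiv ℝ f y v : ℂ) • u y + (f y : ℂ) • pd u y v := by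
  funext k
  have h := (hf.hasFDerivAt.smul (hu k).hasFDerivAt).fderiv
  have e : (fun z => ((f z : ℂ) • u z) k) = fun z => f z • u z k :=
    funext fun z => real_smul_complex _ _
  show fderiv ℝ (fun z => ((f z : ℂ) • u z) k) y v = (fderiv ℝ f y v : ℂ) • u y k +
    (f y : ℂ) • fderiv ℝ (fun z => u z k) y v
  rw [e, real_smul_complex, real_smul_complex]
  refine (DFunLike.congr_fun h v).trans ?_
  simp [add_comm]

instance altC_finite_complex (k : ℕ) : Module.Finite ℂ (E [⋀^Fin k]→L[ℝ] ℂ) :=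
  Module.Finite.of_surjective (LinearMap.proj (R := ℂ) (φ := fun k => E [⋀^Fin k]→L[ℝ] ℂ) k)
    fun b => ⟨Pi.single k b, Pi.single_eq_same _ _⟩

instance altC_finite (k : ℕ) : FiniteDimensional ℝ (E [⋀^Fin k]→L[ℝ] ℂ) :=
  Module.Finite.trans ℂ _

instance altR_finite (k : ℕ) : FiniteDimensional ℝ (E [⋀^Fin k]→L[ℝ] ℝ) :=
  Module.Finite.of_injective
    ({ toFun := fun a => Complex.ofRealCLM.compContinuousAlternatingMap a
       map_add' := fun a b => by ext v; simp
       map_smul' := fun r a => by ext v; simp } :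
      (E [⋀^Fin k]→L[ℝ] ℝ) →ₗ[ℝ] E [⋀^Fin k]→L[ℝ] ℂ)
    fun a b h => by
      ext v
      have := DFunLike.congr_fun h v
      simpa using this

theorem fderiv_bilinear {A B C : Type*} [NormedAddCommGroup A] [NormedSpace ℝ A]
    [FiniteDimensional ℝ A] [NormedAddCommGroup B] [NormedSpace ℝ B] [FiniteDimensional ℝ B]
    [NormedAddCommGroup C] [NormedSpace ℝ C] (β : A →ₗ[ℝ] B →ₗ[ℝ] C) {a : E → A} {b : E → B} {y : E}
    (ha : DifferentiableAt ℝ a y) (hb : DifferentiableAt ℝ b y) :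
    DifferentiableAt ℝ (fun z => β (a z) (b z)) y ∧
    ∀ v, fderiv ℝ (fun z => β (a z) (b z)) y v = β (fderiv ℝ a y v) (b y) + β (a y) (fderiv ℝ b y v) := by
  let γ : A →L[ℝ] B →L[ℝ] C := LinearMap.toContinuousLinearMap ((LinearMap.toContinuousLinearMap
    (E := B) (F' := C)).toLinearMap ∘ₗ β)
  have h1 : HasFDerivAt (fun z => γ (a z)) (γ.comp (fderiv ℝ a y)) y :=
    γ.hasFDerivAt.comp y ha.hasFDerivAt
  have h := h1.clm_apply hb.hasFDerivAt
  refine ⟨h.differentiableAt, fun v => ?_⟩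
  refine (DFunLike.congr_fun h.fderiv v).trans ?_
  exact add_comm _ _

/-- The contraction of forms of fixed degree, as a bilinear map. -/
def contractBilin (k : ℕ) :
    (E [⋀^Fin (k + 1)]→L[ℝ] ℂ) →ₗ[ℝ] E →ₗ[ℝ] E [⋀^Fin k]→L[ℝ] ℂ :=
  LinearMap.mk₂ ℝ (fun a X => a.curryLeft X) (fun _ _ _ => rfl) (fun _ _ _ => rfl)
    (fun a _ _ => map_add a.curryLeft _ _) (fun _ a _ => map_smul a.curryLeft _ _)

theorem pd_contract {X : E → E} {u : E → Lam E} {y : E} (hX : DifferentiableAt ℝ X y)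
    (hu : LamDiff u y) (v : E) : pd (fun z => contract (X z) (u z)) y v =
      contract (fderiv ℝ X y v) (u y) + contract (X y) (pd u y v) := by
  funext k
  have h := (fderiv_bilinear (contractBilin k) (hu (k + 1)) hX).2 v
  exact h.trans (add_comm _ _)

theorem pd_wedgeOne {a : E → E [⋀^Fin 1]→L[ℝ] ℝ} {u : E → Lam E} {y : E}
    (ha : DifferentiableAt ℝ a y) (hu : LamDiff u y) (v : E) :
    pd (fun z => wedgeOne (a z) (u z)) y v =
      wedgeOne (fderiv ℝ a y v) (u y) + wedgeOne (a y) (pd u y v) := by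
  funext k
  cases k with
  | zero =>
    have : pd (fun z => wedgeOne (a z) (u z)) y v 0 =
      fderiv ℝ (fun _ : E => (0 : E [⋀^Fin 0]→L[ℝ] ℂ)) y v := rfl
    rw [this, fderiv_fun_const]
    exact (add_zero _).symm
  | succ k => exact (fderiv_bilinear (wedge 1) ha (hu k)).2 v

theorem pd_wedgeThree {a : E → E [⋀^Fin 3]→L[ℝ] ℝ} {u : E → Lam E} {y : E}
    (ha : DifferentiableAt ℝ a y) (hu : LamDiff u y) (v : E) :
    pd (fun z => wedgeThree (a z) (u z)) y v =
      wedgeThree (fderiv ℝ a y v) (u y) + wedgeThree (a y) (pd u y v) := by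
  funext k
  rcases k with _ | _ | _ | k
  · have : pd (fun z => wedgeThree (a z) (u z)) y v 0 =
      fderiv ℝ (fun _ : E => (0 : E [⋀^Fin 0]→L[ℝ] ℂ)) y v := rfl
    rw [this, fderiv_fun_const]
    exact (add_zero _).symm
  · have : pd (fun z => wedgeThree (a z) (u z)) y v 1 =
      fderiv ℝ (fun _ : E => (0 : E [⋀^Fin 1]→L[ℝ] ℂ)) y v := rfl
    rw [zero_add, this, fderiv_fun_const]
    exact (add_zero _).symm
  · have : pd (fun z => wedgeThree (a z) (u z)) y v 2 =
      fderiv ℝ (fun _ : E => (0 : E [⋀^Fin 2]→L[ℝ] ℂ)) y v := rfl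
    rw [zero_add, one_add_one_eq_two, this, fderiv_fun_const]
    exact (add_zero _).symm
  · exact (fderiv_bilinear (wedge 3) ha (hu k)).2 v

theorem dLoc_smul {f : E → ℝ} {u : E → Lam E} {y : E} (hf : DifferentiableAt ℝ f y)
    (hu : LamDiff u y) : dLoc (fun z => (f z : ℂ) • u z) y =
      wedgeOne (covForm (fderiv ℝ f y)) (u y) + (f y : ℂ) • dLoc u y := by
  simp only [dLoc, pd_smul hf hu, map_add, map_smul, Finset.sum_add_distrib]
  rw [← sum_apply_smul_wedgeOne (Module.finBasis ℝ E), ← Finset.smul_sum]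
  simp only [covForm_apply, Matrix.cons_val_zero]

theorem dLoc_wedgeOne {a : E → E [⋀^Fin 1]→L[ℝ] ℝ} {u : E → Lam E} {y : E}
    (ha : DifferentiableAt ℝ a y) (hu : LamDiff u y) : dLoc (fun z => wedgeOne (a z) (u z)) y =
      wedgeTwo (extDeriv a y) (u y) - wedgeOne (a y) (dLoc u y) := by
  simp only [dLoc, pd_wedgeOne ha hu, map_add, Finset.sum_add_distrib]
  rw [extDeriv, wedgeTwo_alternatize, sub_eq_add_neg, map_sum, ← Finset.sum_neg_distrib]
  refine congrArg _ (Finset.sum_congr rfl fun i _ => ?_)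
  rw [wedgeOne_wedgeOne]

theorem dLoc_wedgeThree {a : E → E [⋀^Fin 3]→L[ℝ] ℝ} {u : E → Lam E} {y : E}
    (ha : DifferentiableAt ℝ a y) (hu : LamDiff u y) (h : extDeriv a y = 0) :
    dLoc (fun z => wedgeThree (a z) (u z)) y = -wedgeThree (a y) (dLoc u y) := by
  simp only [dLoc, pd_wedgeThree ha hu, map_add, Finset.sum_add_distrib]
  rw [wedgeThree_alternatize h, zero_add, map_sum, ← Finset.sum_neg_distrib]
  exact Finset.sum_congr rfl fun i _ => wedgeOne_wedgeThree _ _ _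

/-- The local formula for the Lie derivative of a form along a vector field. -/
def lieLoc (X : E → E) (u : E → Lam E) (y : E) : Lam E :=
  pd u y (X y) + ∑ i, wedgeOne (dualForm (Module.finBasis ℝ E) i)
    (contract (fderiv ℝ X y (Module.finBasis ℝ E i)) (u y))

theorem contract_wedgeOne_dualForm (X : E) (i : Fin (Module.finrank ℝ E)) (b : Lam E) :
    contract X (wedgeOne (dualForm (Module.finBasis ℝ E) i) b) =
      ((Module.finBasis ℝ E).repr X i : ℂ) • b -
        wedgeOne (dualForm (Module.finBasis ℝ E) i) (contract X b) := by
  rw [contract_wedgeOne, dualForm_apply]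
  rfl

theorem dLoc_contract {X : E → E} {u : E → Lam E} {y : E} (hX : DifferentiableAt ℝ X y)
    (hu : LamDiff u y) : dLoc (fun z => contract (X z) (u z)) y + contract (X y) (dLoc u y) =
      lieLoc X u y := by
  simp only [dLoc, pd_contract hX hu, map_add, Finset.sum_add_distrib, map_sum,
    contract_wedgeOne_dualForm, Finset.sum_sub_distrib, sum_repr_pd, lieLoc]
  abel

theorem lieLoc_contract {X Y : E → E} {u : E → Lam E} {y : E} (hY : DifferentiableAt ℝ Y y)
    (hu : LamDiff u y) : lieLoc X (fun z => contract (Y z) (u z)) y - contract (Y y) (lieLoc X u y) =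
      contract (fderiv ℝ Y y (X y) - fderiv ℝ X y (Y y)) (u y) := by
  have h1 : contract (fderiv ℝ Y y (X y) - fderiv ℝ X y (Y y)) (u y) =
      contract (fderiv ℝ Y y (X y)) (u y) - contract (fderiv ℝ X y (Y y)) (u y) :=
    funext fun k => map_sub (u y (k + 1)).curryLeft _ _
  have h2 : ∀ i, contract (fderiv ℝ X y (Module.finBasis ℝ E i)) (contract (Y y) (u y)) =
      -contract (Y y) (contract (fderiv ℝ X y (Module.finBasis ℝ E i)) (u y)) :=
    fun i => contract_contract _ _ _
  have h3 := sum_repr_contract (Y y) (u y) (fderiv ℝ X y).toLinearMap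
  simp only [ContinuousLinearMap.coe_coe] at h3
  simp only [lieLoc, pd_contract hY hu, map_add, map_sum, contract_wedgeOne_dualForm,
    Finset.sum_sub_distrib, h1, h2, h3, map_neg, Finset.sum_neg_distrib]
  abel

end Local
end GenEquivariant
end

open scoped Manifold ContDiff Topology
noncomputable section
namespace GenEquivariant
set_option linter.unusedSectionVars false

section LamComp
variable {E : Type*} [NormedAddCommGroup E] [NormedSpace ℝ E] [FiniteDimensional ℝ E]

/-- The pullback of a form of mixed degree under a linear map. -/
def lamComp (L : E →L[ℝ] E) : Lam E →ₗ[ℂ] Lam E where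
  toFun b k := (b k).compContinuousLinearMap L
  map_add' _ _ := rfl
  map_smul' _ _ := rfl

theorem lamComp_apply (L : E →L[ℝ] E) (b : Lam E) (k : ℕ) :
    lamComp L b k = (b k).compContinuousLinearMap L := rfl

theorem lamComp_lamComp (L L' : E →L[ℝ] E) (b : Lam E) :
    lamComp L (lamComp L' b) = lamComp (L'.comp L) b := rfl

theorem lamComp_id (b : Lam E) : lamComp (ContinuousLinearMap.id ℝ E) b = b := rfl

theorem lamComp_contract (L : E →L[ℝ] E) (X : E) (b : Lam E) :
    lamComp L (contract (L X) b) = contract X (lamComp L b) := by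
  funext k
  rw [contract_apply, lamComp_apply, lamComp_apply,
    ContinuousAlternatingMap.curryLeft_compContinuousLinearMap]
  rfl

theorem lamComp_wedgeOne (L : E →L[ℝ] E) (a : E [⋀^Fin 1]→L[ℝ] ℝ) (b : Lam E) :
    lamComp L (wedgeOne a b) = wedgeOne (a.compContinuousLinearMap L) (lamComp L b) := by
  funext k
  cases k with
  | zero => rfl
  | succ k => exact wedge_comp 1 a (b k) L

theorem lamComp_wedgeTwo (L : E →L[ℝ] E) (a : E [⋀^Fin 2]→L[ℝ] ℝ) (b : Lam E) :
    lamComp L (wedgeTwo a b) = wedgeTwo (a.compContinuousLinearMap L) (lamComp L b) := by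
  funext k
  rcases k with _ | _ | k
  · rfl
  · rfl
  · exact wedge_comp 2 a (b k) L

theorem lamComp_wedgeThree (L : E →L[ℝ] E) (a : E [⋀^Fin 3]→L[ℝ] ℝ) (b : Lam E) :
    lamComp L (wedgeThree a b) = wedgeThree (a.compContinuousLinearMap L) (lamComp L b) := by
  funext k
  rcases k with _ | _ | _ | k
  · rfl
  · rfl
  · rfl
  · exact wedge_comp 3 a (b k) L

theorem covForm_comp (ξ : E →L[ℝ] ℝ) (L : E →L[ℝ] E) :
    (covForm ξ).compContinuousLinearMap L = covForm (ξ.comp L) := by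
  ext v; simp [covForm_apply]

theorem lamComp_cliff (L : E →L[ℝ] E) (X : E) (ξ : E →L[ℝ] ℝ) (b : Lam E) :
    lamComp L (cliff (L X, ξ) b) = cliff (X, ξ.comp L) (lamComp L b) := by
  rw [cliff_apply, cliff_apply, map_add, lamComp_contract, lamComp_wedgeOne, covForm_comp]

theorem dLoc_congr {u w : E → Lam E} {y : E} (h : u =ᶠ[𝓝 y] w) : dLoc u y = dLoc w y := by
  have : ∀ v, pd u y v = pd w y v := fun v => funext fun k => by
    have h' : (fun z => u z k) =ᶠ[𝓝 y] fun z => w z k := h.mono fun z hz => congrFun hz k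
    simp only [pd, h'.fderiv_eq]
  simp only [dLoc, this]

theorem extDeriv_zeroForm (g : E → ℝ) (y : E) :
    extDeriv (fun z => ContinuousAlternatingMap.constOfIsEmpty ℝ E (Fin 0) (g z)) y =
      covForm (fderiv ℝ g y) := extDeriv_constOfIsEmpty g y

end LamComp

section Local
variable {E : Type*} [NormedAddCommGroup E] [NormedSpace ℝ E] [FiniteDimensional ℝ E]
  {M : Type*} [TopologicalSpace M] [ChartedSpace E M] [IsManifold 𝓘(ℝ, E) ∞ M]

/-- A form of mixed degree on `M`, read in the chart at `x₀`. -/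
def loc (x₀ : M) (α : M → Lam E) (y : E) : Lam E :=
  lamComp (dchartSymm x₀ y) (α ((extChartAt 𝓘(ℝ, E) x₀).symm y))

/-- A vector field on `M`, read in the chart at `x₀`. -/
def locV (x₀ : M) (X : M → E) (y : E) : E :=
  dchart x₀ ((extChartAt 𝓘(ℝ, E) x₀).symm y) (X ((extChartAt 𝓘(ℝ, E) x₀).symm y))

theorem dchartSymm_comp_dchart {x₀ : M} {y : E} (hy : y ∈ (extChartAt 𝓘(ℝ, E) x₀).target) :
    (dchartSymm x₀ y).comp (dchart x₀ ((extChartAt 𝓘(ℝ, E) x₀).symm y)) =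
      ContinuousLinearMap.id ℝ E := by
  have h := mfderivWithin_extChartAt_symm_comp_mfderiv_extChartAt (I := 𝓘(ℝ, E)) hy
  simp only [modelWithCornersSelf_coe, Set.range_id, mfderivWithin_univ] at h
  exact h

theorem dchart_comp_dchartSymm {x₀ : M} {y : E} (hy : y ∈ (extChartAt 𝓘(ℝ, E) x₀).target) :
    (dchart x₀ ((extChartAt 𝓘(ℝ, E) x₀).symm y)).comp (dchartSymm x₀ y) =
      ContinuousLinearMap.id ℝ E := by
  have h := mfderiv_extChartAt_comp_mfderivWithin_extChartAt_symm (I := 𝓘(ℝ, E)) hy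
  simp only [modelWithCornersSelf_coe, Set.range_id, mfderivWithin_univ] at h
  exact h

theorem loc_apply (x₀ : M) (α : M → Lam E) (y : E) (k : ℕ) :
    loc x₀ α y k = inChart (fun x => α x k) x₀ y := rfl

theorem loc_contract {x₀ : M} {y : E} (hy : y ∈ (extChartAt 𝓘(ℝ, E) x₀).target) (X : M → E)
    (α : M → Lam E) : loc x₀ (fun x => contract (X x) (α x)) y =
      contract (locV x₀ X y) (loc x₀ α y) := by
  rw [loc, loc, ← lamComp_contract]
  have := DFunLike.congr_fun (dchartSymm_comp_dchart hy) (X ((extChartAt 𝓘(ℝ, E) x₀).symm y))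
  exact congrArg (fun Z => lamComp _ (contract Z _)) this.symm

theorem loc_wedgeOne (x₀ : M) (y : E) (a : M → E [⋀^Fin 1]→L[ℝ] ℝ) (α : M → Lam E) :
    loc x₀ (fun x => wedgeOne (a x) (α x)) y = wedgeOne (inChart a x₀ y) (loc x₀ α y) :=
  lamComp_wedgeOne _ _ _

theorem loc_wedgeTwo (x₀ : M) (y : E) (a : M → E [⋀^Fin 2]→L[ℝ] ℝ) (α : M → Lam E) :
    loc x₀ (fun x => wedgeTwo (a x) (α x)) y = wedgeTwo (inChart a x₀ y) (loc x₀ α y) :=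
  lamComp_wedgeTwo _ _ _

theorem loc_wedgeThree (x₀ : M) (y : E) (a : M → E [⋀^Fin 3]→L[ℝ] ℝ) (α : M → Lam E) :
    loc x₀ (fun x => wedgeThree (a x) (α x)) y = wedgeThree (inChart a x₀ y) (loc x₀ α y) :=
  lamComp_wedgeThree _ _ _

theorem lamComp_injective {L L' : E →L[ℝ] E} (h : L.comp L' = ContinuousLinearMap.id ℝ E) :
    Function.Injective (lamComp L) := fun b c hbc => by
  have := congrArg (lamComp L') hbc
  rwa [lamComp_lamComp, lamComp_lamComp, h, lamComp_id, lamComp_id] at this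

theorem eq_of_loc_eq {α β : M → Lam E} {x : M}
    (h : loc x α (extChartAt 𝓘(ℝ, E) x x) = loc x β (extChartAt 𝓘(ℝ, E) x x)) : α x = β x := by
  have := lamComp_injective (dchartSymm_comp_dchart (mem_extChartAt_target x)) h
  rwa [(extChartAt 𝓘(ℝ, E) x).left_inv (mem_extChartAt_source x)] at this

theorem Forms.ext {α β : Forms E M} (h : ∀ x, α.1 x = β.1 x) : α = β := Subtype.ext (funext h)

theorem Forms.ext_loc {α β : Forms E M} (h : ∀ (x₀ : M), ∀ y ∈ (extChartAt 𝓘(ℝ, E) x₀).target,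
    loc x₀ α.1 y = loc x₀ β.1 y) : α = β :=
  Forms.ext fun x => eq_of_loc_eq (h x _ (mem_extChartAt_target x))

theorem lamDiff_loc (α : Forms E M) {x₀ : M} {y : E} (hy : y ∈ (extChartAt 𝓘(ℝ, E) x₀).target) :
    LamDiff (loc x₀ α.1) y := fun k => ((α.2 k).contDiffAt hy).differentiableAt (by simp)

theorem loc_dTotal (α : Forms E M) {x₀ : M} {y : E}
    (hy : y ∈ (extChartAt 𝓘(ℝ, E) x₀).target) : loc x₀ (dTotal α).1 y = dLoc (loc x₀ α.1) y := by
  funext k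
  cases k with
  | zero => exact (dLoc_zero _ _).symm
  | succ k => exact (inChart_extd (α.2 k) hy).trans (dLoc_succ (loc x₀ α.1) y k).symm

theorem eventually_target {x₀ : M} {y : E} (hy : y ∈ (extChartAt 𝓘(ℝ, E) x₀).target) :
    ∀ᶠ z in 𝓝 y, z ∈ (extChartAt 𝓘(ℝ, E) x₀).target :=
  (isOpen_extChartAt_target (I := 𝓘(ℝ, E)) x₀).mem_nhds hy

theorem dTotal_dTotal (α : Forms E M) : dTotal (dTotal α) = 0 := by
  refine Forms.ext_loc fun x₀ y hy => ?_
  have h : loc x₀ (dTotal α).1 =ᶠ[𝓝 y] dLoc (loc x₀ α.1) :=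
    (eventually_target hy).mono fun z hz => loc_dTotal α hz
  rw [loc_dTotal _ hy, dLoc_congr h]
  funext k
  rcases k with _ | _ | k
  · exact dLoc_zero _ _
  · rw [dLoc_succ]
    have : (fun z => dLoc (loc x₀ α.1) z 0) = 0 := funext fun z => dLoc_zero _ _
    rw [this, extDeriv]
    have h0 : fderiv ℝ (0 : E → E [⋀^Fin 0]→L[ℝ] ℂ) y = 0 := fderiv_const_apply 0
    rw [h0]
    exact map_zero (ContinuousAlternatingMap.alternatizeUncurryFinCLM ℝ E ℂ)
  · rw [dLoc_succ]
    have : (fun z => dLoc (loc x₀ α.1) z (k + 1)) = extDeriv (fun z => loc x₀ α.1 z k) :=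
      funext fun z => dLoc_succ _ _ _
    rw [this]
    refine extDeriv_extDeriv_apply (r := ∞) ((α.2 k).contDiffAt hy) ?_
    simp only [minSmoothness_of_isRCLikeNormedField]
    exact WithTop.coe_le_coe.2 le_top

theorem IsSmooth.smul {k : ℕ} {f : M → ℝ} (hf : ContMDiff 𝓘(ℝ, E) 𝓘(ℝ, ℝ) ∞ f)
    {a : M → E [⋀^Fin k]→L[ℝ] ℂ} (ha : IsSmooth a) : IsSmooth (fun x => (f x : ℂ) • a x) := by
  have h := (isSmooth_zeroForm hf).wedge ha
  refine (congrArg IsSmooth (funext fun x => ?_)).mp h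
  rw [wedge_zero_apply, real_smul_complex]
  rfl

/-- Multiplication of forms by a smooth real function. -/
def mulOp (f : M → ℝ) (hf : ContMDiff 𝓘(ℝ, E) 𝓘(ℝ, ℝ) ∞ f) : Forms E M →ₗ[ℂ] Forms E M :=
  pointwise (fun x => (f x : ℂ) • LinearMap.id) fun _ hα k => IsSmooth.smul hf (hα k)

/-- Contraction with a smooth vector field. -/
def contractOp (X : M → E) (hX : IsSmoothVF X) : Forms E M →ₗ[ℂ] Forms E M :=
  pointwise (fun x => contract (X x)) fun _ hα k => (hα (k + 1)).curryLeft hX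

/-- Exterior multiplication by a smooth one-form. -/
def wedgeOneOp (a : M → E [⋀^Fin 1]→L[ℝ] ℝ) (ha : IsSmooth a) : Forms E M →ₗ[ℂ] Forms E M :=
  pointwise (fun x => wedgeOne (a x)) (wedgeOne_mem ha)

/-- Exterior multiplication by a smooth two-form. -/
def wedgeTwoOp (a : M → E [⋀^Fin 2]→L[ℝ] ℝ) (ha : IsSmooth a) : Forms E M →ₗ[ℂ] Forms E M :=
  pointwise (fun x => wedgeTwo (a x)) fun _ hα k => match k with
    | 0 => IsSmooth.zero
    | 1 => IsSmooth.zero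
    | k + 2 => ha.wedge (hα k)

/-- Exterior multiplication by a smooth three-form. -/
def wedgeThreeOp (a : M → E [⋀^Fin 3]→L[ℝ] ℝ) (ha : IsSmooth a) : Forms E M →ₗ[ℂ] Forms E M :=
  pointwise (fun x => wedgeThree (a x)) (wedgeThree_mem ha)

theorem locV_differentiableAt {X : M → E} (hX : IsSmoothVF X) {x₀ : M} {y : E}
    (hy : y ∈ (extChartAt 𝓘(ℝ, E) x₀).target) : DifferentiableAt ℝ (locV x₀ X) y :=
  (hX.chart hy).differentiableAt (by simp)

theorem dTotal_mulOp {f : M → ℝ} (hf : ContMDiff 𝓘(ℝ, E) 𝓘(ℝ, ℝ) ∞ f) (α : Forms E M) :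
    dTotal (mulOp f hf α) =
      wedgeOneOp (extd (zeroForm f)) (isSmooth_zeroForm hf).extd α + mulOp f hf (dTotal α) := by
  refine Forms.ext_loc fun x₀ y hy => ?_
  have hg : ContDiffAt ℝ ∞ (fun z => f ((extChartAt 𝓘(ℝ, E) x₀).symm z)) y := by
    have : ContDiffOn ℝ ∞ (fun y => f ((extChartAt 𝓘(ℝ, E) x₀).symm y))
        (extChartAt 𝓘(ℝ, E) x₀).target := by
      rw [← contMDiffOn_iff_contDiffOn]
      exact hf.comp_contMDiffOn (contMDiffOn_extChartAt_symm x₀)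
    exact this.contDiffAt (eventually_target hy)
  have hg' := hg.differentiableAt (by simp)
  have h1 : loc x₀ (mulOp f hf α).1 =
      fun z => (f ((extChartAt 𝓘(ℝ, E) x₀).symm z) : ℂ) • loc x₀ α.1 z := rfl
  rw [loc_dTotal _ hy, h1, dLoc_smul hg' (lamDiff_loc α hy), ← loc_dTotal _ hy]
  have h2 : inChart (extd (zeroForm f : M → E [⋀^Fin 0]→L[ℝ] ℝ)) x₀ y = covForm
      (fderiv ℝ (fun z => f ((extChartAt 𝓘(ℝ, E) x₀).symm z)) y) := by
    rw [inChart_extd (isSmooth_zeroForm hf) hy, ← extDeriv_zeroForm]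
    rfl
  rw [← h2, ← loc_wedgeOne]
  rfl

theorem dTotal_wedgeOneOp {a : M → E [⋀^Fin 1]→L[ℝ] ℝ} (ha : IsSmooth a) (α : Forms E M) :
    dTotal (wedgeOneOp a ha α) = wedgeTwoOp (extd a) ha.extd α - wedgeOneOp a ha (dTotal α) := by
  refine Forms.ext_loc fun x₀ y hy => ?_
  have h1 : loc x₀ (wedgeOneOp a ha α).1 = fun z => wedgeOne (inChart a x₀ z) (loc x₀ α.1 z) :=
    funext fun z => loc_wedgeOne _ _ _ _
  rw [loc_dTotal _ hy, h1, dLoc_wedgeOne ((ha.contDiffAt hy).differentiableAt (by simp))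
    (lamDiff_loc α hy), ← loc_dTotal _ hy, ← inChart_extd ha hy, ← loc_wedgeTwo, ← loc_wedgeOne]
  rfl

theorem dTotal_wedgeThreeOp {a : M → E [⋀^Fin 3]→L[ℝ] ℝ} (ha : IsSmooth a) (h : extd a = 0)
    (α : Forms E M) : dTotal (wedgeThreeOp a ha α) = -wedgeThreeOp a ha (dTotal α) := by
  refine Forms.ext_loc fun x₀ y hy => ?_
  have h1 : loc x₀ (wedgeThreeOp a ha α).1 = fun z => wedgeThree (inChart a x₀ z) (loc x₀ α.1 z) :=
    funext fun z => loc_wedgeThree _ _ _ _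
  have h2 : extDeriv (inChart a x₀) y = 0 := by
    rw [← inChart_extd ha hy, h]
    rfl
  rw [loc_dTotal _ hy, h1, dLoc_wedgeThree ((ha.contDiffAt hy).differentiableAt (by simp))
    (lamDiff_loc α hy) h2, ← loc_dTotal _ hy, ← loc_wedgeThree]
  rfl

/-- The Lie derivative of forms along a smooth vector field. -/
def lieOp (X : M → E) (hX : IsSmoothVF X) : Forms E M →ₗ[ℂ] Forms E M :=
  dTotal ∘ₗ contractOp X hX + contractOp X hX ∘ₗ dTotal

theorem loc_lieOp {X : M → E} (hX : IsSmoothVF X) (α : Forms E M) {x₀ : M} {y : E}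
    (hy : y ∈ (extChartAt 𝓘(ℝ, E) x₀).target) :
    loc x₀ (lieOp X hX α).1 y = lieLoc (locV x₀ X) (loc x₀ α.1) y := by
  rw [← dLoc_contract (locV_differentiableAt hX hy) (lamDiff_loc α hy), ← loc_dTotal α hy,
    ← loc_contract hy]
  have h1 : loc x₀ (contractOp X hX α).1 =ᶠ[𝓝 y] fun z => contract (locV x₀ X z) (loc x₀ α.1 z) :=
    (eventually_target hy).mono fun z hz => loc_contract hz _ _
  rw [← dLoc_congr h1, ← loc_dTotal _ hy]
  rfl

theorem lieLoc_congr {X : E → E} {u w : E → Lam E} {y : E} (h : u =ᶠ[𝓝 y] w) :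
    lieLoc X u y = lieLoc X w y := by
  have : ∀ v, pd u y v = pd w y v := fun v => funext fun k => by
    have h' : (fun z => u z k) =ᶠ[𝓝 y] fun z => w z k := h.mono fun z hz => congrFun hz k
    simp only [pd, h'.fderiv_eq]
  simp only [lieLoc, this, h.eq_of_nhds]

/-- The Lie bracket of vector fields. -/
def bracket (X Y : M → E) (x : M) : E := VectorField.mlieBracket 𝓘(ℝ, E) X Y x

theorem dchart_bracket (X Y : M → E) (x : M) :
    dchart x x (bracket X Y x) =
      fderiv ℝ (locV x Y) (extChartAt 𝓘(ℝ, E) x x) (locV x X (extChartAt 𝓘(ℝ, E) x x)) -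
      fderiv ℝ (locV x X) (extChartAt 𝓘(ℝ, E) x x) (locV x Y (extChartAt 𝓘(ℝ, E) x x)) := by
  let P (Z : M → E) (y : E) : E :=
    VectorField.mpullbackWithin 𝓘(ℝ, E) 𝓘(ℝ, E) (extChartAt 𝓘(ℝ, E) x).symm Z Set.univ y
  have hp : ∀ Z : M → E, P Z =ᶠ[𝓝 (extChartAt 𝓘(ℝ, E) x x)] locV x Z := by
    intro Z
    filter_upwards [eventually_target (mem_extChartAt_target (I := 𝓘(ℝ, E)) x)] with y hy
    have e : (dchartSymm x y).inverse = dchart x ((extChartAt 𝓘(ℝ, E) x).symm y) :=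
      ContinuousLinearMap.inverse_eq (dchartSymm_comp_dchart hy) (dchart_comp_dchartSymm hy)
    rw [locV, ← e]
    exact congrArg (fun L : E →L[ℝ] E => L.inverse (Z ((extChartAt 𝓘(ℝ, E) x).symm y)))
      (congrFun mfderivWithin_univ y)
  have hx := mem_extChartAt_target (I := 𝓘(ℝ, E)) x
  have e1 := dchart_comp_dchartSymm hx
  have e2 := dchartSymm_comp_dchart hx
  rw [(extChartAt 𝓘(ℝ, E) x).left_inv (mem_extChartAt_source x)] at e1 e2
  have e : (dchart x x).inverse = dchartSymm x (extChartAt 𝓘(ℝ, E) x x) :=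
    ContinuousLinearMap.inverse_eq e1 e2
  have h1 : bracket X Y x = (dchart x x).inverse
      (VectorField.lieBracketWithin ℝ (P X) (P Y) Set.univ (extChartAt 𝓘(ℝ, E) x x)) := by
    have h2 : (extChartAt 𝓘(ℝ, E) x).symm ⁻¹' Set.univ ∩ Set.range (𝓘(ℝ, E)) = Set.univ := by simp
    have h3 : Set.range (𝓘(ℝ, E)) = Set.univ := by simp
    have h4 : bracket X Y x = (dchart x x).inverse
      (VectorField.lieBracketWithin ℝ
        (VectorField.mpullbackWithin 𝓘(ℝ, E) 𝓘(ℝ, E) (extChartAt 𝓘(ℝ, E) x).symm X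
          (Set.range 𝓘(ℝ, E)))
        (VectorField.mpullbackWithin 𝓘(ℝ, E) 𝓘(ℝ, E) (extChartAt 𝓘(ℝ, E) x).symm Y
          (Set.range 𝓘(ℝ, E)))
        ((extChartAt 𝓘(ℝ, E) x).symm ⁻¹' Set.univ ∩ Set.range (𝓘(ℝ, E)))
        (extChartAt 𝓘(ℝ, E) x x)) := rfl
    rw [h2, h3] at h4
    exact h4
  rw [h1, e, VectorField.lieBracketWithin_univ,
    Filter.EventuallyEq.lieBracket_vectorField_eq (hp X) (hp Y)]
  exact DFunLike.congr_fun e1 _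

theorem lieOp_contractOp {X Y : M → E} (hX : IsSmoothVF X) (hY : IsSmoothVF Y) (α : Forms E M)
    (x : M) : (lieOp X hX (contractOp Y hY α)).1 x - contract (Y x) ((lieOp X hX α).1 x) =
      contract (bracket X Y x) (α.1 x) := by
  have hx := mem_extChartAt_target (I := 𝓘(ℝ, E)) x
  refine eq_of_loc_eq (α := fun x => (lieOp X hX (contractOp Y hY α)).1 x -
    contract (Y x) ((lieOp X hX α).1 x))
    (β := fun x => contract (bracket X Y x) (α.1 x)) ?_
  rw [loc_contract hx (bracket X Y) α.1]
  have h1 : loc x (contractOp Y hY α).1 =ᶠ[𝓝 (extChartAt 𝓘(ℝ, E) x x)]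
      fun z => contract (locV x Y z) (loc x α.1 z) :=
    (eventually_target hx).mono fun z hz => loc_contract hz _ _
  have h2 : loc x (fun x => (lieOp X hX (contractOp Y hY α)).1 x -
      contract (Y x) ((lieOp X hX α).1 x)) (extChartAt 𝓘(ℝ, E) x x) =
      loc x (lieOp X hX (contractOp Y hY α)).1 (extChartAt 𝓘(ℝ, E) x x) -
      loc x (fun x => contract (Y x) ((lieOp X hX α).1 x)) (extChartAt 𝓘(ℝ, E) x x) :=
    map_sub (lamComp _) _ _
  rw [h2, loc_contract hx, loc_lieOp hX _ hx, loc_lieOp hX _ hx, lieLoc_congr h1,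
    lieLoc_contract (locV_differentiableAt hY hx) (lamDiff_loc α hx), ← dchart_bracket]
  rw [locV, (extChartAt 𝓘(ℝ, E) x).left_inv (mem_extChartAt_source x)]

end Local
end GenEquivariant
end

open scoped Manifold ContDiff Topology
noncomputable section
namespace GenEquivariant
set_option linter.unusedSectionVars false

section Cartan
variable {E : Type*} [NormedAddCommGroup E] [NormedSpace ℝ E] [FiniteDimensional ℝ E]
  {M : Type*} [TopologicalSpace M] [ChartedSpace E M] [IsManifold 𝓘(ℝ, E) ∞ M]

theorem zeroForm_apply {F : Type*} [NormedAddCommGroup F] [NormedSpace ℝ F] (g : M → F) (x : M)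
    (v : Fin 0 → E) : zeroForm g x v = g x := rfl

theorem zeroForm_eval {F : Type*} [NormedAddCommGroup F] [NormedSpace ℝ F]
    (a : M → E [⋀^Fin 0]→L[ℝ] F) : zeroForm (fun x => a x ![]) = a := by
  funext x; ext v
  exact congrArg (a x) (Subsingleton.elim _ _)

theorem IsSmooth.contMDiff_eval {F : Type*} [NormedAddCommGroup F] [NormedSpace ℝ F]
    {a : M → E [⋀^Fin 0]→L[ℝ] F} (ha : IsSmooth a) :
    ContMDiff 𝓘(ℝ, E) 𝓘(ℝ, F) ∞ (fun x => a x ![]) := by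
  intro x
  have h1 : ContMDiffAt 𝓘(ℝ, E) 𝓘(ℝ, F) ∞ (fun y => inChart a x y ![])
      (extChartAt 𝓘(ℝ, E) x x) :=
    (contDiffAt_eval (ha.contDiffAt (mem_extChartAt_target x)) contDiffAt_const).contMDiffAt
  refine (h1.comp x (contMDiffAt_extChartAt (n := ∞))).congr_of_eventuallyEq ?_
  filter_upwards [extChartAt_source_mem_nhds (I := 𝓘(ℝ, E)) x] with z hz
  simp only [Function.comp_def, inChart, (extChartAt 𝓘(ℝ, E) x).left_inv hz,
    ContinuousAlternatingMap.compContinuousLinearMap_apply]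
  exact congrArg (a z) (Subsingleton.elim _ _)

theorem interior_eq_zeroForm (X : M → E) (a : M → E [⋀^Fin 1]→L[ℝ] ℝ) :
    interior X a = zeroForm (fun x => a x ![X x]) := by
  rw [← zeroForm_eval (interior X a)]
  rfl

theorem contMDiff_interior {X : M → E} (hX : IsSmoothVF X) {a : M → E [⋀^Fin 1]→L[ℝ] ℝ}
    (ha : IsSmooth a) : ContMDiff 𝓘(ℝ, E) 𝓘(ℝ, ℝ) ∞ (fun x => a x ![X x]) :=
  (ha.curryLeft hX).contMDiff_eval

theorem interior_smooth {F : Type*} [NormedAddCommGroup F] [NormedSpace ℝ F] {k : ℕ} {X : M → E}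
    (hX : IsSmoothVF X) {a : M → E [⋀^Fin (k + 1)]→L[ℝ] F} (ha : IsSmooth a) :
    IsSmooth (interior X a) := ha.curryLeft hX

theorem lieD_smooth {k : ℕ} {X : M → E} (hX : IsSmoothVF X) {a : M → E [⋀^Fin (k + 1)]→L[ℝ] ℝ}
    (ha : IsSmooth a) : IsSmooth (lieD X a) :=
  (interior_smooth hX ha).extd.add (interior_smooth hX ha.extd)

theorem lieOp_apply {X : M → E} (hX : IsSmoothVF X) (α : Forms E M) :
    lieOp X hX α = dTotal (contractOp X hX α) + contractOp X hX (dTotal α) := rfl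

theorem contractOp_wedgeOneOp {X : M → E} (hX : IsSmoothVF X) {a : M → E [⋀^Fin 1]→L[ℝ] ℝ}
    (ha : IsSmooth a) (α : Forms E M) : contractOp X hX (wedgeOneOp a ha α) =
      mulOp _ (contMDiff_interior hX ha) α - wedgeOneOp a ha (contractOp X hX α) :=
  Forms.ext fun _ => contract_wedgeOne _ _ _

theorem contractOp_wedgeTwoOp {X : M → E} (hX : IsSmoothVF X) {a : M → E [⋀^Fin 2]→L[ℝ] ℝ}
    (ha : IsSmooth a) (α : Forms E M) : contractOp X hX (wedgeTwoOp a ha α) =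
      wedgeOneOp _ (interior_smooth hX ha) α + wedgeTwoOp a ha (contractOp X hX α) :=
  Forms.ext fun _ => contract_wedgeTwo _ _ _

theorem contractOp_wedgeThreeOp {X : M → E} (hX : IsSmoothVF X) {a : M → E [⋀^Fin 3]→L[ℝ] ℝ}
    (ha : IsSmooth a) (α : Forms E M) : contractOp X hX (wedgeThreeOp a ha α) =
      wedgeTwoOp _ (interior_smooth hX ha) α - wedgeThreeOp a ha (contractOp X hX α) :=
  Forms.ext fun _ => contract_wedgeThree _ _ _

theorem wedgeOneOp_add {a b : M → E [⋀^Fin 1]→L[ℝ] ℝ} (ha : IsSmooth a) (hb : IsSmooth b)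
    (α : Forms E M) : wedgeOneOp (a + b) (ha.add hb) α = wedgeOneOp a ha α + wedgeOneOp b hb α :=
  Forms.ext fun _ => wedgeOne_add _ _ _

theorem lieOp_wedgeOneOp {X : M → E} (hX : IsSmoothVF X) {a : M → E [⋀^Fin 1]→L[ℝ] ℝ}
    (ha : IsSmooth a) (α : Forms E M) : lieOp X hX (wedgeOneOp a ha α) =
      wedgeOneOp a ha (lieOp X hX α) + wedgeOneOp (lieD X a) (lieD_smooth hX ha) α := by
  have h : wedgeOneOp (lieD X a) (lieD_smooth hX ha) α =
      wedgeOneOp (extd (zeroForm fun x => a x ![X x]))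
        (isSmooth_zeroForm (contMDiff_interior hX ha)).extd α +
      wedgeOneOp (interior X (extd a)) (interior_smooth hX ha.extd) α := by
    have e : lieD X a = extd (zeroForm fun x => a x ![X x]) + interior X (extd a) := by
      rw [lieD, interior_eq_zeroForm]
    rw [← wedgeOneOp_add]
    simp only [e]
  have e1 : contractOp X hX (wedgeTwoOp (extd a) ha.extd α) =
      wedgeOneOp (interior X (extd a)) (interior_smooth hX ha.extd) α +
      wedgeTwoOp (extd a) ha.extd (contractOp X hX α) := contractOp_wedgeTwoOp _ _ _
  rw [h, lieOp_apply, lieOp_apply, contractOp_wedgeOneOp, dTotal_wedgeOneOp, map_sub, map_sub,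
    dTotal_mulOp, dTotal_wedgeOneOp, e1, contractOp_wedgeOneOp, map_add]
  abel

theorem dH_apply (H : ClosedThreeForm E M) (α : Forms E M) :
    dH H α = dTotal α - wedgeThreeOp H.toFun H.smooth α := rfl

theorem lam_eq_zero_of_eq_neg {b : Lam E} (h : b = -b) : b = 0 := by
  have h1 : b = (1 / 2 : ℂ) • (b - -b) := by module
  rw [← h] at h1
  rw [h1]
  module

theorem dH_dH (H : ClosedThreeForm E M) (α : Forms E M) : dH H (dH H α) = 0 := by
  have h : wedgeThreeOp H.toFun H.smooth (wedgeThreeOp H.toFun H.smooth α) = 0 := by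
    refine Forms.ext fun x => ?_
    have := wedgeThree_wedgeThree (H.toFun x) (H.toFun x) (α.1 x)
    exact lam_eq_zero_of_eq_neg this
  rw [dH_apply, dH_apply, map_sub, map_sub, dTotal_dTotal, dTotal_wedgeThreeOp H.smooth H.closed, h]
  abel

theorem dH_mulOp (H : ClosedThreeForm E M) {f : M → ℝ} (hf : ContMDiff 𝓘(ℝ, E) 𝓘(ℝ, ℝ) ∞ f)
    (α : Forms E M) : dH H (mulOp f hf α) =
      wedgeOneOp (extd (zeroForm f)) (isSmooth_zeroForm hf).extd α + mulOp f hf (dH H α) := by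
  have h : wedgeThreeOp H.toFun H.smooth (mulOp f hf α) =
      mulOp f hf (wedgeThreeOp H.toFun H.smooth α) :=
    Forms.ext fun x => map_smul (wedgeThree (H.toFun x)) (f x : ℂ) (α.1 x)
  rw [dH_apply, dH_apply, dTotal_mulOp, h, map_sub]
  abel

theorem vec_smooth {s : M → GT E} (hs : IsSmoothSection s) : IsSmoothVF (vec s) := hs.1

theorem cov_smooth {s : M → GT E} (hs : IsSmoothSection s) : IsSmooth (cov s) := hs.2

theorem cliffOp_apply {s : M → GT E} (hs : IsSmoothSection s) (α : Forms E M) :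
    cliffOp s hs α = contractOp (vec s) (vec_smooth hs) α + wedgeOneOp (cov s) (cov_smooth hs) α := rfl

theorem wedgeOneOp_wedgeThreeOp {a : M → E [⋀^Fin 1]→L[ℝ] ℝ} (ha : IsSmooth a)
    {c : M → E [⋀^Fin 3]→L[ℝ] ℝ} (hc : IsSmooth c) (α : Forms E M) :
    wedgeOneOp a ha (wedgeThreeOp c hc α) = -wedgeThreeOp c hc (wedgeOneOp a ha α) :=
  Forms.ext fun _ => wedgeOne_wedgeThree _ _ _

theorem dH_cliffOp (H : ClosedThreeForm E M) {s : M → GT E} (hs : IsSmoothSection s)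
    (α : Forms E M) : dH H (cliffOp s hs α) + cliffOp s hs (dH H α) =
      lieOp (vec s) (vec_smooth hs) α + wedgeTwoOp (extd (cov s)) (IsSmooth.extd (cov_smooth hs)) α -
        wedgeTwoOp (interior (vec s) H.toFun) (interior_smooth (vec_smooth hs) H.smooth) α := by
  have e := contractOp_wedgeThreeOp (vec_smooth hs) H.smooth α
  have e' : contractOp (vec s) (vec_smooth hs) (wedgeThreeOp H.toFun H.smooth α) =
    wedgeTwoOp (interior (vec s) H.toFun) (interior_smooth (vec_smooth hs) H.smooth) α -
      wedgeThreeOp H.toFun H.smooth (contractOp (vec s) (vec_smooth hs) α) := e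
  rw [lieOp_apply, cliffOp_apply, cliffOp_apply, dH_apply, dH_apply, map_sub, map_sub, map_add,
    map_add, dTotal_wedgeOneOp, wedgeOneOp_wedgeThreeOp, e']
  abel

/-- Twice the pairing of two sections. -/
def formFun (s t : M → GT E) (x : M) : ℝ := form (s x) (t x)

theorem zeroForm_formFun (s t : M → GT E) : zeroForm (formFun s t) =
    interior (vec s) (cov t) + interior (vec t) (cov s) := by
  rw [interior_eq_zeroForm, interior_eq_zeroForm]
  funext x; ext v
  simp only [Pi.add_apply, ContinuousAlternatingMap.add_apply, zeroForm_apply, formFun, form, cov,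
    covForm_apply, vec, Matrix.cons_val_zero]
  ring

theorem isSmooth_formFun {s t : M → GT E} (hs : IsSmoothSection s) (ht : IsSmoothSection t) :
    IsSmooth (zeroForm (formFun s t) : M → E [⋀^Fin 0]→L[ℝ] ℝ) := by
  rw [zeroForm_formFun]
  exact (interior_smooth (vec_smooth hs) (cov_smooth ht)).add (interior_smooth (vec_smooth ht) (cov_smooth hs))

theorem courant_cov (H : M → E [⋀^Fin 3]→L[ℝ] ℝ) {s t : M → GT E} (hs : IsSmoothSection s)
    (ht : IsSmoothSection t) (x : M) :
    covForm (courant H s t x).2 + (1 / 2 : ℝ) • extd (zeroForm (formFun s t)) x =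
      (lieD (vec s) (cov t) - interior (vec t) (extd (cov s)) + interior (vec t)
        (interior (vec s) H)) x := by
  have hs' := interior_smooth (vec_smooth ht) (cov_smooth hs)
  have ht' := interior_smooth (vec_smooth hs) (cov_smooth ht)
  have hneg : IsSmooth (-interior (vec t) (cov s)) := fun x₀ => (hs' x₀).neg
  have e1 : extd (zeroForm (formFun s t)) =
      extd (interior (vec s) (cov t)) + extd (interior (vec t) (cov s)) := by
    rw [zeroForm_formFun]
    exact extd_add ht' hs'
  have e2 : extd (interior (vec s) (cov t) - interior (vec t) (cov s)) +
      extd (interior (vec t) (cov s)) = extd (interior (vec s) (cov t)) := by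
    rw [← extd_add (by rw [sub_eq_add_neg]; exact ht'.add hneg) hs', sub_add_cancel]
  have e3 : covForm (courant H s t x).2 = (lieD (vec s) (cov t) - lieD (vec t) (cov s)
        - (1 / 2 : ℝ) • extd (interior (vec s) (cov t) - interior (vec t) (cov s))
        + interior (vec t) (interior (vec s) H)) x :=
    (ContinuousAlternatingMap.ofSubsingleton ℝ E ℝ (0 : Fin 1)).apply_symm_apply _
  rw [e3, e1, eq_sub_of_add_eq e2]
  simp only [Pi.add_apply, Pi.sub_apply, Pi.smul_apply, lieD]
  module

/-- The twisted bracket of sections is the derived bracket of `d_H`. -/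
theorem derived_bracket (H : ClosedThreeForm E M) {s t : M → GT E} (hs : IsSmoothSection s)
    (ht : IsSmoothSection t) (α : Forms E M) (x : M) :
    (dH H (cliffOp s hs (cliffOp t ht α)) + cliffOp s hs (dH H (cliffOp t ht α)) -
      cliffOp t ht (dH H (cliffOp s hs α)) - cliffOp t ht (cliffOp s hs (dH H α))).1 x =
      cliff (courant H.toFun s t x) (α.1 x) +
        wedgeOne ((1 / 2 : ℝ) • extd (zeroForm (formFun s t)) x) (α.1 x) := by
  have h1 : dH H (cliffOp s hs (cliffOp t ht α)) + cliffOp s hs (dH H (cliffOp t ht α)) -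
      cliffOp t ht (dH H (cliffOp s hs α)) - cliffOp t ht (cliffOp s hs (dH H α)) =
      (lieOp (vec s) (vec_smooth hs) (contractOp (vec t) (vec_smooth ht) α) -
        contractOp (vec t) (vec_smooth ht) (lieOp (vec s) (vec_smooth hs) α)) +
      wedgeOneOp (lieD (vec s) (cov t)) (lieD_smooth (vec_smooth hs) (cov_smooth ht)) α -
      wedgeOneOp (interior (vec t) (extd (cov s))) (interior_smooth (vec_smooth ht) (IsSmooth.extd (cov_smooth hs))) α +
      wedgeOneOp (interior (vec t) (interior (vec s) H.toFun))
        (interior_smooth (vec_smooth ht) (interior_smooth (vec_smooth hs) H.smooth)) α := by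
    have e : ∀ {c : M → E [⋀^Fin 2]→L[ℝ] ℝ} (hc : IsSmooth c),
        cliffOp t ht (wedgeTwoOp c hc α) =
        wedgeOneOp (interior (vec t) c) (interior_smooth (vec_smooth ht) hc) α +
          wedgeTwoOp c hc (cliffOp t ht α) := by
      intro c hc
      have e2 : wedgeOneOp (cov t) (cov_smooth ht) (wedgeTwoOp c hc α) =
        wedgeTwoOp c hc (wedgeOneOp (cov t) (cov_smooth ht) α) := Forms.ext fun _ => wedgeOne_wedgeTwo _ _ _
      have e3 : contractOp (vec t) (vec_smooth ht) (wedgeTwoOp c hc α) =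
        wedgeOneOp (interior (vec t) c) (interior_smooth (vec_smooth ht) hc) α +
          wedgeTwoOp c hc (contractOp (vec t) (vec_smooth ht) α) := contractOp_wedgeTwoOp _ _ _
      rw [cliffOp_apply, cliffOp_apply, e2, e3, map_add]
      abel
    rw [dH_cliffOp H hs (cliffOp t ht α), sub_sub, ← map_add, dH_cliffOp H hs α, map_sub, map_add,
      e, e]
    have e4 : lieOp (vec s) (vec_smooth hs) (cliffOp t ht α) - cliffOp t ht (lieOp (vec s) (vec_smooth hs) α) =
        lieOp (vec s) (vec_smooth hs) (contractOp (vec t) (vec_smooth ht) α) -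
        contractOp (vec t) (vec_smooth ht) (lieOp (vec s) (vec_smooth hs) α) +
      wedgeOneOp (lieD (vec s) (cov t)) (lieD_smooth (vec_smooth hs) (cov_smooth ht)) α := by
      rw [cliffOp_apply, cliffOp_apply, map_add, lieOp_wedgeOneOp (vec_smooth hs) (cov_smooth ht)]
      abel
    rw [← sub_eq_zero] at e4 ⊢
    rw [← e4]
    abel
  rw [h1]
  have h2 := lieOp_contractOp (vec_smooth hs) (vec_smooth ht) α x
  have h3 := courant_cov H.toFun hs ht x
  have h4 : cliff (courant H.toFun s t x) (α.1 x) =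
      contract (bracket (vec s) (vec t) x) (α.1 x) +
        wedgeOne (covForm (courant H.toFun s t x).2) (α.1 x) := rfl
  rw [h4, add_assoc, ← wedgeOne_add, h3, ← h2]
  have h5 : ∀ a b c : E [⋀^Fin 1]→L[ℝ] ℝ, wedgeOne (a - b + c) (α.1 x) =
      wedgeOne a (α.1 x) - wedgeOne b (α.1 x) + wedgeOne c (α.1 x) := fun a b c =>
    (map_add (wedgeOneₗ (α.1 x)) (a - b) c).trans
      (congrArg (· + wedgeOne c (α.1 x)) (map_sub (wedgeOneₗ (α.1 x)) a b))
  have h6 : ∀ p q r t : Lam E, p + q - r + t = p + (q - r + t) := fun p q r t => by abel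
  rw [Pi.add_apply, Pi.sub_apply, h5]
  exact h6 _ _ _ _

end Cartan
end GenEquivariant
end

open scoped Manifold ContDiff Topology
noncomputable section
namespace GenEquivariant
set_option linter.unusedSectionVars false

section Frames
variable {E : Type*} [NormedAddCommGroup E] [NormedSpace ℝ E] [FiniteDimensional ℝ E]
  {M : Type*} [TopologicalSpace M] [ChartedSpace E M] [IsManifold 𝓘(ℝ, E) ∞ M]

theorem isSmooth_of_locally {F : Type*} [NormedAddCommGroup F] [NormedSpace ℝ F] {k : ℕ}
    {α : M → E [⋀^Fin k]→L[ℝ] F}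
    (h : ∀ x, ∃ β : M → E [⋀^Fin k]→L[ℝ] F, IsSmooth β ∧ ∀ᶠ z in 𝓝 x, α z = β z) : IsSmooth α := by
  intro x₀ y hy
  obtain ⟨β, hβ, he⟩ := h ((extChartAt 𝓘(ℝ, E) x₀).symm y)
  refine ContDiffAt.contDiffWithinAt ((hβ.contDiffAt hy).congr_of_eventuallyEq ?_)
  have c := continuousAt_extChartAt_symm'' (I := 𝓘(ℝ, E)) hy
  filter_upwards [c.eventually he] with z hz
  rw [inChart, inChart, hz]

variable [T2Space M]

theorem exists_vectorField (x₀ : M) (v : E) : ∃ X : M → E, IsSmoothVF X ∧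
    ∀ᶠ x in 𝓝 x₀, X x = dchartSymm x₀ (extChartAt 𝓘(ℝ, E) x₀ x) v := by
  obtain ⟨ρ⟩ : Nonempty (SmoothBumpFunction 𝓘(ℝ, E) x₀) := inferInstance
  refine ⟨fun x => ρ x • dchartSymm x₀ (extChartAt 𝓘(ℝ, E) x₀ x) v, ?_, ?_⟩
  · let V : (x : M) → TangentSpace 𝓘(ℝ, E) x := fun x =>
      dchartSymm x₀ (extChartAt 𝓘(ℝ, E) x₀ x) v
    have hs : ContMDiffOn 𝓘(ℝ, E) 𝓘(ℝ, E).tangent ∞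
        (fun x => (⟨x, V x⟩ : TangentBundle 𝓘(ℝ, E) M)) (chartAt E x₀).source := by
      intro x hx
      refine ContMDiffAt.contMDiffWithinAt ?_
      refine ((trivializationAt E (TangentSpace 𝓘(ℝ, E)) x₀).contMDiffAt_section_iff
        (IB := 𝓘(ℝ, E)) (by simpa using hx)).2 ?_
      refine (contMDiffAt_const (c := v)).congr_of_eventuallyEq ?_
      filter_upwards [(chartAt E x₀).open_source.mem_nhds hx] with z hz
      have hz' : z ∈ (extChartAt 𝓘(ℝ, E) x₀).source := by simpa using hz
      have h3 := DFunLike.congr_fun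
        (TangentBundle.continuousLinearMapAt_trivializationAt (I := 𝓘(ℝ, E)) hz) (V z)
      have h4 := (trivializationAt E (TangentSpace 𝓘(ℝ, E)) x₀).coe_linearMapAt_of_mem (R := ℝ)
        (show z ∈ _ by simpa using hz)
      refine (congrFun h4 (V z)).symm.trans (h3.trans ?_)
      have h5 := dchart_comp_dchartSymm ((extChartAt 𝓘(ℝ, E) x₀).map_source hz')
      rw [(extChartAt 𝓘(ℝ, E) x₀).left_inv hz'] at h5
      exact DFunLike.congr_fun h5 v
    exact ContMDiffOn.smul_section_of_tsupport (s := V) ρ.contMDiff.contMDiffOn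
      (chartAt E x₀).open_source ρ.tsupport_subset_chartAt_source hs
  · filter_upwards [ρ.eventuallyEq_one] with x hx
    simp [hx]

theorem exists_oneForm (x₀ : M) (ξ : E →L[ℝ] ℝ) : ∃ a : M → E →L[ℝ] ℝ,
    IsSmooth (fun x => covForm (a x)) ∧ ∀ᶠ x in 𝓝 x₀, a x = ξ.comp (dchart x₀ x) := by
  obtain ⟨ρ⟩ : Nonempty (SmoothBumpFunction 𝓘(ℝ, E) x₀) := inferInstance
  have hg : ContMDiff 𝓘(ℝ, E) 𝓘(ℝ, ℝ) ∞ (fun x => ρ x • ξ (extChartAt 𝓘(ℝ, E) x₀ x)) := by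
    refine ρ.contMDiff_smul (g := fun x => ξ (extChartAt 𝓘(ℝ, E) x₀ x)) ?_
    exact ξ.contMDiff.comp_contMDiffOn (contMDiffOn_extChartAt (x := x₀))
  refine ⟨fun x => ofOneForm (extd (zeroForm fun x => ρ x • ξ (extChartAt 𝓘(ℝ, E) x₀ x)) x), ?_, ?_⟩
  · simp only [covForm_ofOneForm]
    exact (isSmooth_zeroForm hg).extd
  · filter_upwards [ρ.eventuallyEq_one.eventually_nhds,
      extChartAt_source_mem_nhds (I := 𝓘(ℝ, E)) x₀] with x hx hs
    have hy := (extChartAt 𝓘(ℝ, E) x₀).map_source hs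
    have e := inChart_extd (isSmooth_zeroForm hg) hy
    have e2 : extDeriv (inChart (zeroForm fun x => ρ x • ξ (extChartAt 𝓘(ℝ, E) x₀ x)) x₀)
        (extChartAt 𝓘(ℝ, E) x₀ x) = covForm ξ := by
      have c := continuousAt_extChartAt_symm'' (I := 𝓘(ℝ, E)) hy
      rw [ContinuousAt, (extChartAt 𝓘(ℝ, E) x₀).left_inv hs] at c
      have h1 : (fun y => ρ ((extChartAt 𝓘(ℝ, E) x₀).symm y) •
          ξ (extChartAt 𝓘(ℝ, E) x₀ ((extChartAt 𝓘(ℝ, E) x₀).symm y)))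
          =ᶠ[𝓝 (extChartAt 𝓘(ℝ, E) x₀ x)] ξ := by
        filter_upwards [c.eventually hx, eventually_target hy] with y h1 h2
        rw [h1, Pi.one_apply, one_smul, (extChartAt 𝓘(ℝ, E) x₀).right_inv h2]
      have h2 := extDeriv_zeroForm (fun y => ρ ((extChartAt 𝓘(ℝ, E) x₀).symm y) •
          ξ (extChartAt 𝓘(ℝ, E) x₀ ((extChartAt 𝓘(ℝ, E) x₀).symm y))) (extChartAt 𝓘(ℝ, E) x₀ x)
      rw [h1.fderiv_eq, ξ.fderiv] at h2
      exact h2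
    rw [e2] at e
    have e1 := covForm_ofOneForm (E := E)
      (extd (zeroForm fun x => ρ x • ξ (extChartAt 𝓘(ℝ, E) x₀ x)) x)
    rw [inChart, (extChartAt 𝓘(ℝ, E) x₀).left_inv hs, ← e1, covForm_comp] at e
    have e3 : ∀ ζ ζ' : E →L[ℝ] ℝ, covForm ζ = covForm ζ' → ζ = ζ' := fun ζ ζ' h =>
      (ContinuousAlternatingMap.ofSubsingleton ℝ E ℝ (0 : Fin 1)).injective h
    have h5 := dchartSymm_comp_dchart hy
    rw [(extChartAt 𝓘(ℝ, E) x₀).left_inv hs] at h5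
    refine Eq.trans ?_ (congrArg (fun ζ => ContinuousLinearMap.comp ζ (dchart x₀ x)) (e3 _ _ e))
    show _ = ContinuousLinearMap.comp (ContinuousLinearMap.comp _ _) _
    rw [ContinuousLinearMap.comp_assoc, h5, ContinuousLinearMap.comp_id]

theorem isSmooth_zeroVF : IsSmoothVF (fun _ : M => (0 : E)) :=
  Bundle.contMDiff_zeroSection ℝ (TangentSpace 𝓘(ℝ, E) : M → Type _)

theorem isSmooth_zeroCov : IsSmooth (fun _ : M => covForm (0 : E →L[ℝ] ℝ)) := by
  have : (fun _ : M => covForm (0 : E →L[ℝ] ℝ)) = 0 := by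
    funext x; ext v; simp [covForm_apply]
  rw [this]
  exact IsSmooth.zero

theorem exists_section (x₀ : M) (v : GT E) : ∃ s : M → GT E, IsSmoothSection s ∧ s x₀ = v := by
  obtain ⟨X, hX, hXv⟩ := exists_vectorField x₀ (dchart x₀ x₀ v.1)
  obtain ⟨a, ha, hav⟩ := exists_oneForm x₀ (v.2.comp (dchartSymm x₀ (extChartAt 𝓘(ℝ, E) x₀ x₀)))
  have h5 := dchartSymm_comp_dchart (mem_extChartAt_target (I := 𝓘(ℝ, E)) x₀)
  rw [(extChartAt 𝓘(ℝ, E) x₀).left_inv (mem_extChartAt_source x₀)] at h5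
  refine ⟨fun x => (X x, a x), ⟨hX, ha⟩, Prod.ext ?_ ?_⟩
  · refine hXv.self_of_nhds.trans ?_
    exact DFunLike.congr_fun h5 v.1
  · refine hav.self_of_nhds.trans ?_
    rw [ContinuousLinearMap.comp_assoc, h5, ContinuousLinearMap.comp_id]

theorem exists_dual_frame (x₀ : M) : ∃ (s : Fin (Module.finrank ℝ E) → M → E)
    (t : Fin (Module.finrank ℝ E) → M → E →L[ℝ] ℝ), (∀ i, IsSmoothVF (s i)) ∧
    (∀ i, IsSmooth (fun x => covForm (t i x))) ∧
    ∀ᶠ x in 𝓝 x₀, ∀ X, ∑ i, t i x X • s i x = X := by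
  set b := Module.finBasis ℝ E
  choose s hs hs' using fun i => exists_vectorField x₀ (b i)
  choose t ht ht' using fun i => exists_oneForm x₀ (LinearMap.toContinuousLinearMap (b.coord i))
  refine ⟨s, t, hs, ht, ?_⟩
  filter_upwards [Filter.eventually_all.2 hs', Filter.eventually_all.2 ht',
    extChartAt_source_mem_nhds (I := 𝓘(ℝ, E)) x₀] with x h1 h2 hsrc X
  have h5 := dchartSymm_comp_dchart ((extChartAt 𝓘(ℝ, E) x₀).map_source hsrc)
  rw [(extChartAt 𝓘(ℝ, E) x₀).left_inv hsrc] at h5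
  have h6 : ∑ i, b.repr (dchart x₀ x X) i • dchartSymm x₀ (extChartAt 𝓘(ℝ, E) x₀ x) (b i) = X := by
    simp only [← map_smul]
    rw [← map_sum, b.sum_repr]
    exact DFunLike.congr_fun h5 X
  rw [← h6]
  conv_lhs => rw [h6]
  refine Finset.sum_congr rfl fun i _ => ?_
  rw [h1, h2]
  rfl

theorem spin_mem {J : M → GT E →ₗ[ℝ] GT E}
    (hJ : ∀ s : M → GT E, IsSmoothSection s → IsSmoothSection (fun x => J x (s x))) :
    ∀ α ∈ Omega E M, (fun x => spin (J x) (α x)) ∈ Omega E M := by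
  intro α hα k
  refine isSmooth_of_locally fun x₀ => ?_
  obtain ⟨s, t, hs, ht, hst⟩ := exists_dual_frame (E := E) x₀
  have hs' : ∀ i, IsSmoothSection (fun x => ((s i x, 0) : GT E)) := fun i => ⟨hs i, isSmooth_zeroCov (E := E) (M := M)⟩
  have ht' : ∀ i, IsSmoothSection (fun x => ((0, t i x) : GT E)) := fun i => ⟨isSmooth_zeroVF (E := E) (M := M), ht i⟩
  have key : (fun x => (1 / 2 : ℂ) • ∑ i, (cliff (J x (s i x, 0)) (cliff (0, t i x) (α x)) +
      cliff (J x (0, t i x)) (cliff (s i x, 0) (α x)))) ∈ Omega E M := by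
    have h : ∀ i, (fun x => cliff (J x (s i x, 0)) (cliff (0, t i x) (α x)) +
      cliff (J x (0, t i x)) (cliff (s i x, 0) (α x))) ∈ Omega E M := fun i =>
      Submodule.add_mem _ (cliff_mem (hJ _ (hs' i)) _ (cliff_mem (ht' i) α hα))
        (cliff_mem (hJ _ (ht' i)) _ (cliff_mem (hs' i) α hα))
    have h2 := Submodule.smul_mem _ (1 / 2 : ℂ) (Submodule.sum_mem _ fun i (_ : i ∈ Finset.univ) => h i)
    refine (congrArg (· ∈ Omega E M) (funext fun x => ?_)).mp h2
    rw [Pi.smul_apply, Finset.sum_apply]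
  refine ⟨_, key k, ?_⟩
  filter_upwards [hst] with x hx
  exact congrFun (spin_eq_sum (J x) (α x) hx) k

end Frames

section Decomposition
variable {V : Type*} [AddCommGroup V] [Module ℂ V]

theorem ker_aeval_prod_le (T : Module.End ℂ V) {ι : Type*} (c : ι → ℂ) (hc : Function.Injective c)
    (s : Finset ι) : LinearMap.ker (Polynomial.aeval T (∏ i ∈ s, (Polynomial.X - Polynomial.C (c i)))) ≤
      ⨆ i, Module.End.eigenspace T (c i) := by
  classical
  induction s using Finset.induction_on with
  | empty =>
    rw [Finset.prod_empty, map_one]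
    intro x hx
    have : x = 0 := hx
    rw [this]
    exact Submodule.zero_mem _
  | insert i s hi ih =>
    rw [Finset.prod_insert hi, ← Polynomial.sup_ker_aeval_eq_ker_aeval_mul_of_coprime]
    · refine sup_le ?_ ih
      refine le_trans (fun x hx => ?_) (le_iSup (fun i => Module.End.eigenspace T (c i)) i)
      rw [LinearMap.mem_ker, map_sub, Polynomial.aeval_X, Polynomial.aeval_C] at hx
      exact Module.End.mem_eigenspace_iff.2 (sub_eq_zero.1 hx)
    · refine IsCoprime.prod_right fun j hj => ?_
      exact Polynomial.isCoprime_X_sub_C_of_isUnit_sub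
        (sub_ne_zero.2 (hc.ne (ne_of_mem_of_not_mem hj hi).symm)).isUnit

theorem aeval_prod_eigenvector (T : Module.End ℂ V) {ι : Type*} (c : ι → ℂ) {s : Finset ι} {i : ι}
    (hi : i ∈ s) {x : V} (hx : T x = c i • x) :
    Polynomial.aeval T (∏ i ∈ s, (Polynomial.X - Polynomial.C (c i))) x = 0 := by
  classical
  rw [← Finset.prod_erase_mul s _ hi, map_mul, Module.End.mul_apply, map_sub, Polynomial.aeval_X,
    Polynomial.aeval_C]
  have : (T - algebraMap ℂ (Module.End ℂ V) (c i)) x = 0 := sub_eq_zero.2 hx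
  rw [this, map_zero]

end Decomposition

section Internal
variable {E : Type*} [NormedAddCommGroup E] [NormedSpace ℝ E] [FiniteDimensional ℝ E]
  {M : Type*} [TopologicalSpace M] [ChartedSpace E M] [IsManifold 𝓘(ℝ, E) ∞ M]
  {H : ClosedThreeForm E M} (𝒥 : GCStructure E M H)

theorem GCStructure.skew (x : M) (v w : GT E) : form (𝒥.J x v) w = -form v (𝒥.J x w) := by
  have h := 𝒥.orthogonal x v (𝒥.J x w)
  rw [𝒥.sq] at h
  simp only [pairing, form, Prod.fst_neg, Prod.snd_neg, neg_apply, map_neg] at *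
  linarith

theorem aeval_pointwise {T : M → Lam E →ₗ[ℂ] Lam E}
    (hT : ∀ α ∈ Omega E M, (fun x => T x (α x)) ∈ Omega E M) (p : Polynomial ℂ) (α : Forms E M)
    (x : M) : (Polynomial.aeval (pointwise T hT : Module.End ℂ (Forms E M)) p α).1 x =
      Polynomial.aeval (T x : Module.End ℂ (Lam E)) p (α.1 x) := by
  induction p using Polynomial.induction_on' generalizing α with
  | add p q hp hq =>
    rw [map_add, map_add, LinearMap.add_apply, LinearMap.add_apply, ← hp, ← hq]
    rfl
  | monomial n c =>
    rw [Polynomial.aeval_monomial, Polynomial.aeval_monomial, Module.End.mul_apply,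
      Module.End.mul_apply]
    have h : ∀ (n : ℕ) (α : Forms E M), (((pointwise T hT : Module.End ℂ (Forms E M)) ^ n) α).1 x =
        ((T x : Module.End ℂ (Lam E)) ^ n) (α.1 x) := by
      intro n
      induction n with
      | zero => intro α; rfl
      | succ n ih =>
        intro α
        rw [pow_succ, pow_succ, Module.End.mul_apply, Module.End.mul_apply, ih]
        rfl
    exact congrArg (c • ·) (h n α)

variable [T2Space M]

/-- The Clifford action of `𝒥` on forms. -/
def spinOp : Module.End ℂ (Forms E M) := pointwise (fun x => spin (𝒥.J x)) (spin_mem 𝒥.smooth)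

theorem mem_UDeg {k : ℤ} {α : Forms E M} : α ∈ UDeg 𝒥.J k ↔ ∀ x, α.1 x ∈ eig (𝒥.J x) k :=
  forall_congr' fun _ => mem_eig.symm

theorem UDeg_eq (k : ℤ) :
    UDeg 𝒥.J k = Module.End.eigenspace (spinOp 𝒥) (-(k : ℂ) * Complex.I) := by
  ext α
  rw [Module.End.mem_eigenspace_iff]
  exact ⟨fun h => Forms.ext h, fun h x => congrFun (congrArg Subtype.val h) x⟩

theorem injective_weights : Function.Injective (fun k : ℤ => -(k : ℂ) * Complex.I) := by
  intro a b h
  have := mul_right_cancel₀ Complex.I_ne_zero h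
  exact_mod_cast neg_injective this

theorem iSupIndep_eig (J : GT E →ₗ[ℝ] GT E) : iSupIndep (eig J) :=
  (Module.End.eigenspaces_iSupIndep (spin J)).comp injective_weights

theorem iSup_UDeg : ⨆ k, UDeg 𝒥.J k = ⊤ := by
  rcases isEmpty_or_nonempty M with hM | ⟨⟨x₀⟩⟩
  · exact eq_top_iff.2 fun α _ => by
      have : α = 0 := Forms.ext fun x => hM.elim x
      rw [this]
      exact Submodule.zero_mem _
  obtain ⟨m, hm⟩ := even_finrank (𝒥.skew x₀) (𝒥.sq x₀)
  rw [← two_mul] at hm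
  refine eq_top_iff.2 fun α _ => ?_
  simp only [UDeg_eq]
  refine ker_aeval_prod_le (spinOp 𝒥) _ injective_weights (Finset.Icc (-m : ℤ) m) ?_
  refine LinearMap.mem_ker.2 (Forms.ext fun x => ?_)
  refine (aeval_pointwise (spin_mem 𝒥.smooth) _ α x).trans ?_
  have h : α.1 x ∈ ⨆ k, eig (𝒥.J x) k := by
    rw [iSup_eig (𝒥.skew x) (𝒥.sq x)]
    trivial
  generalize α.1 x = a at h ⊢
  induction h using Submodule.iSup_induction' with
  | mem k b hb =>
    rcases eq_or_ne b 0 with rfl | hb0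
    · exact map_zero _
    · exact aeval_prod_eigenvector _ _ (Finset.mem_Icc.2
        ⟨le_eig (𝒥.skew x) (𝒥.sq x) hm hb hb0, eig_le (𝒥.skew x) (𝒥.sq x) hm hb hb0⟩) (mem_eig.1 hb)
  | zero => exact map_zero _
  | add b c _ _ hb hc => exact (map_add _ _ _).trans ((congrArg₂ (· + ·) hb hc).trans (add_zero _))

theorem isInternal_UDeg : DirectSum.IsInternal (UDeg 𝒥.J) := by
  classical
  refine DirectSum.isInternal_submodule_of_iSupIndep_of_iSup_eq_top ?_ (iSup_UDeg 𝒥)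
  have : UDeg 𝒥.J = Module.End.eigenspace (spinOp 𝒥) ∘ fun k : ℤ => -(k : ℂ) * Complex.I :=
    funext fun k => UDeg_eq 𝒥 k
  rw [this]
  exact (Module.End.eigenspaces_iSupIndep (spinOp 𝒥)).comp injective_weights

end Internal
end GenEquivariant
end

open scoped Manifold ContDiff Topology
noncomputable section
namespace GenEquivariant
set_option linter.unusedSectionVars false

section GradedProj
variable {V W : Type*} [AddCommGroup V] [Module ℂ V] [AddCommGroup W] [Module ℂ W]
  {U : ℤ → Submodule ℂ V}

/-- The projection onto a summand of a direct sum decomposition. -/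
def gproj (hU : DirectSum.IsInternal U) (k : ℤ) : V →ₗ[ℂ] V :=
  (U k).subtype ∘ₗ DirectSum.component ℂ ℤ (fun k => U k) k ∘ₗ
    (LinearEquiv.ofBijective (DirectSum.coeLinearMap U) hU).symm.toLinearMap

theorem gproj_mem (hU : DirectSum.IsInternal U) (k : ℤ) (x : V) : gproj hU k x ∈ U k := Subtype.property _

theorem symm_eq_of (hU : DirectSum.IsInternal U) {k : ℤ} {x : V} (hx : x ∈ U k) :
    (LinearEquiv.ofBijective (DirectSum.coeLinearMap U) hU).symm x =
      DirectSum.lof ℂ ℤ (fun k => U k) k ⟨x, hx⟩ := by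
  rw [LinearEquiv.symm_apply_eq]
  exact (DirectSum.coeLinearMap_lof U k ⟨x, hx⟩).symm

theorem gproj_same (hU : DirectSum.IsInternal U) {k : ℤ} {x : V} (hx : x ∈ U k) : gproj hU k x = x := by
  simp only [gproj, LinearMap.comp_apply, LinearEquiv.coe_coe, symm_eq_of hU hx,
    DirectSum.component.lof_self]
  rfl

theorem gproj_ne (hU : DirectSum.IsInternal U) {k j : ℤ} {x : V} (hx : x ∈ U j) (h : j ≠ k) : gproj hU k x = 0 := by
  simp only [gproj, LinearMap.comp_apply, LinearEquiv.coe_coe, symm_eq_of hU hx]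
  rw [DirectSum.component.of, dif_neg h]
  rfl

theorem graded_ext (hU : DirectSum.IsInternal U) {R : Type*} [Semiring R] [Module R W] {σ : ℂ →+* R} {S T : V →ₛₗ[σ] W}
    (h : ∀ k, ∀ x ∈ U k, S x = T x) : S = T := by
  ext x
  have hx : x ∈ ⨆ k, U k := by
    rw [hU.submodule_iSup_eq_top]
    trivial
  induction hx using Submodule.iSup_induction' with
  | mem k x hx => exact h k x hx
  | zero => rw [map_zero, map_zero]
  | add x y _ _ hx hy => rw [map_add, map_add, hx, hy]

theorem eq_zero_of_gproj (hU : DirectSum.IsInternal U) {x : V} (h : ∀ k, gproj hU k x = 0) : x = 0 := by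
  rw [← (LinearEquiv.ofBijective (DirectSum.coeLinearMap U) hU).symm.map_eq_zero_iff]
  refine DFinsupp.ext fun k => ?_
  exact Subtype.ext (h k)

theorem gradedPart_apply (hU : DirectSum.IsInternal U) (T : V →ₗ[ℂ] V) (s : ℤ) {k : ℤ} {x : V} (hx : x ∈ U k) :
    gradedPart U T s x = gproj hU (k + s) (T x) := by
  rw [gradedPart, dif_pos hU]
  simp only [LinearMap.comp_apply, LinearEquiv.coe_coe]
  rw [symm_eq_of hU hx, DirectSum.toModule_lof]
  rfl

theorem gradedPart_mem (hU : DirectSum.IsInternal U) (T : V →ₗ[ℂ] V) (s : ℤ) {k : ℤ} {x : V} (hx : x ∈ U k) :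
    gradedPart U T s x ∈ U (k + s) := by
  rw [gradedPart_apply hU T s hx]
  exact gproj_mem hU _ _

/-- An operator homogeneous of degree `d` commutes with projections up to a shift. -/
theorem gproj_homogeneous (hU : DirectSum.IsInternal U) {T : V →ₗ[ℂ] V} {d : ℤ} (hT : ∀ k, ∀ x ∈ U k, T x ∈ U (k + d)) (k : ℤ)
    (x : V) : gproj hU (k + d) (T x) = T (gproj hU k x) := by
  have : gproj hU (k + d) ∘ₗ T = T ∘ₗ gproj hU k := by
    refine graded_ext hU fun j x hx => ?_
    rw [LinearMap.comp_apply, LinearMap.comp_apply]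
    by_cases hj : j = k
    · subst hj
      rw [gproj_same hU (hT j x hx), gproj_same hU hx]
    · rw [gproj_ne hU (hT j x hx) (by omega), gproj_ne hU hx hj, map_zero]
  exact LinearMap.congr_fun this x

end GradedProj

section Parity
variable {E : Type*} [NormedAddCommGroup E] [NormedSpace ℝ E] [FiniteDimensional ℝ E]

variable (E) in
/-- The parity operator on forms, `(-1)^k` in degree `k`. -/
def par : Lam E →ₗ[ℂ] Lam E where
  toFun b k := (-1 : ℂ) ^ k • b k
  map_add' b c := funext fun k => by
    rw [Pi.add_apply, Pi.add_apply]
    module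
  map_smul' c b := funext fun k => by
    rw [RingHom.id_apply, lam_smul_apply, lam_smul_apply, smul_comm]

theorem par_apply (b : Lam E) (k : ℕ) : par E b k = (-1 : ℂ) ^ k • b k := rfl

theorem par_par (b : Lam E) : par E (par E b) = b := by
  funext k
  rw [par_apply, par_apply, smul_smul, ← mul_pow]
  norm_num

theorem par_contract (X : E) (b : Lam E) : par E (contract X b) = -contract X (par E b) := by
  funext k
  have : (contract X (par E b)) k = (-1 : ℂ) ^ (k + 1) • (contract X b) k := rfl
  rw [par_apply, Pi.neg_apply, this, pow_succ]
  module

theorem par_wedgeOne (a : E [⋀^Fin 1]→L[ℝ] ℝ) (b : Lam E) :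
    par E (wedgeOne a b) = -wedgeOne a (par E b) := by
  funext k
  cases k with
  | zero =>
    rw [par_apply, Pi.neg_apply, wedgeOne_zero, wedgeOne_zero, neg_zero]
    exact smul_zero (A := E [⋀^Fin 0]→L[ℝ] ℂ) ((-1 : ℂ) ^ 0)
  | succ k =>
    rw [par_apply, Pi.neg_apply, wedgeOne_succ, wedgeOne_succ, par_apply, wedge_complex_smul,
      pow_succ]
    module

theorem par_wedgeThree (a : E [⋀^Fin 3]→L[ℝ] ℝ) (b : Lam E) :
    par E (wedgeThree a b) = -wedgeThree a (par E b) := by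
  have h : ∀ (e : Module.Basis (Fin (Module.finrank ℝ E)) ℝ E) (a : E [⋀^Fin 2]→L[ℝ] ℝ) (b : Lam E),
      par E (wedgeTwo a b) = wedgeTwo a (par E b) := by
    intro e a b
    rw [wedgeTwo_eq_sum e, wedgeTwo_eq_sum e, map_smul, map_sum]
    refine congrArg ((2 : ℂ)⁻¹ • ·) (Finset.sum_congr rfl fun i _ => ?_)
    rw [par_wedgeOne, par_wedgeOne, map_neg, neg_neg]
  set e := Module.finBasis ℝ E
  rw [wedgeThree_eq_sum e, wedgeThree_eq_sum e, map_smul, map_sum, ← lam_smul_neg,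
    ← Finset.sum_neg_distrib]
  refine congrArg ((3 : ℂ)⁻¹ • ·) (Finset.sum_congr rfl fun i _ => ?_)
  rw [par_wedgeOne, h e]

theorem par_cliff (v : GT E) (b : Lam E) : par E (cliff v b) = -cliff v (par E b) := by
  rw [cliff_apply, cliff_apply, map_add, par_contract, par_wedgeOne, neg_add]

theorem par_spin (J : GT E →ₗ[ℝ] GT E) (b : Lam E) : par E (spin J b) = spin J (par E b) := by
  rw [spin_apply_finBasis, spin_apply_finBasis, map_smul, map_sum]
  refine congrArg ((1 / 2 : ℂ) • ·) (Finset.sum_congr rfl fun i _ => ?_)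
  rw [map_add, par_cliff, par_cliff, par_cliff, par_cliff, map_neg, neg_neg, map_neg, neg_neg]

theorem par_eig {J : GT E →ₗ[ℝ] GT E} {k : ℤ} {b : Lam E} (hb : b ∈ eig J k) :
    par E b ∈ eig J k := by
  rw [mem_eig, ← par_spin, mem_eig.1 hb, map_smul]

/-- In each eigenspace of the spin action all elements have the same parity. -/
theorem eig_parity {J : GT E →ₗ[ℝ] GT E} (hJ : ∀ v w, form (J v) w = -form v (J w))
    (hsq : ∀ v, J (J v) = -v) {k : ℤ} {c : ℂ} (hc : c ≠ 0) {b b' : Lam E} (hb : b ∈ eig J k)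
    (hb' : b' ∈ eig J k) (h0 : b ≠ 0) (h : par E b = c • b) (h' : par E b' = -c • b') : b' = 0 := by
  let N (j : ℤ) : Submodule ℂ (Lam E) :=
    eig J j ⊓ Module.End.eigenspace (par E) ((-1 : ℂ) ^ (j - k) * c)
  have hpar : ∀ (j : ℤ) (b : Lam E), b ∈ Module.End.eigenspace (par E) ((-1 : ℂ) ^ (j - k) * c) →
      ∀ (e : ℂ) (v w : GT E), ∀ j', (j' = j + 1 ∨ j' = j - 1) → cliff v b + e • cliff w b ∈
        Module.End.eigenspace (par E) ((-1 : ℂ) ^ (j' - k) * c) := by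
    intro j b hb e v w j' hj'
    rw [Module.End.mem_eigenspace_iff] at hb ⊢
    have hs : (-1 : ℂ) ^ (j' - k) = -(-1) ^ (j - k) := by
      rcases hj' with rfl | rfl
      · rw [show j + 1 - k = j - k + 1 by ring, zpow_add₀ (by norm_num)]
        norm_num
      · rw [show j - 1 - k = j - k - 1 by ring, zpow_sub₀ (by norm_num), zpow_one, div_neg,
          div_one]
    rw [map_add, map_smul, par_cliff, par_cliff, hb, hs, map_smul, map_smul]
    module
  have htop : ⨆ j, N j = ⊤ := by
    refine eq_top_of_cliff_mem (fun v b hb => ?_) fun hbot => h0 ?_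
    · induction hb using Submodule.iSup_induction' with
      | mem j b hb =>
        have : cliff v b = (1 / 2 : ℂ) • (cliff v b + Complex.I • cliff (J v) b) +
          (1 / 2 : ℂ) • (cliff v b + (-Complex.I) • cliff (J v) b) := by module
        rw [this]
        have e : cliff v b + (-Complex.I) • cliff (J v) b = cliff v b - Complex.I • cliff (J v) b := by
          module
        refine Submodule.add_mem _ (Submodule.smul_mem _ _ (Submodule.mem_iSup_of_mem (j + 1)
          ⟨eig_raise hJ hsq hb.1 v, hpar j b hb.2 _ _ _ _ (Or.inl rfl)⟩))
          (Submodule.smul_mem _ _ (Submodule.mem_iSup_of_mem (j - 1)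
          ⟨by rw [e]; exact eig_lower hJ hsq hb.1 v, hpar j b hb.2 _ _ _ _ (Or.inr rfl)⟩))
      | zero => rw [map_zero]; exact Submodule.zero_mem _
      | add x y _ _ hx hy => rw [map_add]; exact Submodule.add_mem _ hx hy
    · have : b ∈ ⨆ j, N j := Submodule.mem_iSup_of_mem k
        ⟨hb, Module.End.mem_eigenspace_iff.2 (by rw [sub_self, zpow_zero, one_mul, h])⟩
      rwa [hbot, Submodule.mem_bot] at this
  have hmem : b' ∈ ⨆ j, N j := by rw [htop]; trivial
  rw [iSup_split_single N k] at hmem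
  obtain ⟨y, hy, z, hz, hyz⟩ := Submodule.mem_sup.1 hmem
  have hz' : z ∈ ⨆ j, ⨆ (_ : j ≠ k), eig J j :=
    iSup_mono (fun j => iSup_mono fun _ => (inf_le_left : N j ≤ eig J j)) hz
  have hz0 : z = 0 := by
    refine Submodule.disjoint_def.1 (iSupIndep_eig J k) z ?_ hz'
    rw [← hyz] at hb'
    exact (Submodule.add_mem_iff_right _ hy.1).1 hb'
  rw [hz0, add_zero] at hyz
  subst hyz
  have h2 := Module.End.mem_eigenspace_iff.1 hy.2
  rw [sub_self, zpow_zero, one_mul, h'] at h2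
  have h3 : (2 * c) • y = 0 := by linear_combination (norm := module) -h2
  exact (smul_eq_zero_iff_right (mul_ne_zero two_ne_zero hc)).1 h3

end Parity

section ParityForms
variable {E : Type*} [NormedAddCommGroup E] [NormedSpace ℝ E] [FiniteDimensional ℝ E]
  {M : Type*} [TopologicalSpace M] [ChartedSpace E M] [IsManifold 𝓘(ℝ, E) ∞ M]

variable (E M) in
/-- The parity operator on differential forms. -/
def parOp : Forms E M →ₗ[ℂ] Forms E M :=
  pointwise (fun _ => par E) fun _ hα k => (hα k).complex_smul _

theorem dTotal_parOp (α : Forms E M) : dTotal (parOp E M α) = -parOp E M (dTotal α) := by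
  refine Forms.ext fun x => funext fun k => ?_
  cases k with
  | zero =>
    show (0 : E [⋀^Fin 0]→L[ℝ] ℂ) = -((-1 : ℂ) ^ 0 • (0 : E [⋀^Fin 0]→L[ℝ] ℂ))
    module
  | succ k =>
    have := congrFun (extd_complex_smul ((-1 : ℂ) ^ k) (α.2 k)) x
    refine this.trans ?_
    show (-1 : ℂ) ^ k • extd (fun x => α.1 x k) x = -((-1 : ℂ) ^ (k + 1) • extd (fun x => α.1 x k) x)
    rw [pow_succ]
    module

theorem dH_parOp (H : ClosedThreeForm E M) (α : Forms E M) :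
    dH H (parOp E M α) = -parOp E M (dH H α) := by
  have h : wedgeThreeOp H.toFun H.smooth (parOp E M α) =
      -parOp E M (wedgeThreeOp H.toFun H.smooth α) := by
    rw [eq_neg_iff_add_eq_zero, add_comm, ← eq_neg_iff_add_eq_zero]
    exact Forms.ext fun x => par_wedgeThree _ _
  rw [dH_apply, dH_apply, dTotal_parOp, h, map_sub]
  abel

theorem eventually_ne_zero (α : Forms E M) {x : M} (hx : α.1 x ≠ 0) :
    ∀ᶠ z in 𝓝 x, α.1 z ≠ 0 := by
  obtain ⟨k, hk⟩ := Function.ne_iff.1 hx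
  have hy := mem_extChartAt_target (I := 𝓘(ℝ, E)) x
  have c : ContinuousAt (fun z => inChart (fun x => α.1 x k) x (extChartAt 𝓘(ℝ, E) x z)) x :=
    ContinuousAt.comp (f := extChartAt 𝓘(ℝ, E) x) ((α.2 k).contDiffAt hy).continuousAt
      (continuousAt_extChartAt x)
  have h0 : inChart (fun x => α.1 x k) x (extChartAt 𝓘(ℝ, E) x x) ≠ 0 := by
    intro h
    apply hk
    have h5 := dchartSymm_comp_dchart hy
    have h6 := congrArg (fun a => ContinuousAlternatingMap.compContinuousLinearMap a
      (dchart x ((extChartAt 𝓘(ℝ, E) x).symm (extChartAt 𝓘(ℝ, E) x x)))) h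
    have h7 : (α.1 ((extChartAt 𝓘(ℝ, E) x).symm (extChartAt 𝓘(ℝ, E) x x)) k).compContinuousLinearMap
      ((dchartSymm x (extChartAt 𝓘(ℝ, E) x x)).comp
        (dchart x ((extChartAt 𝓘(ℝ, E) x).symm (extChartAt 𝓘(ℝ, E) x x)))) = 0 := h6
    rw [h5, (extChartAt 𝓘(ℝ, E) x).left_inv (mem_extChartAt_source x)] at h7
    exact h7
  filter_upwards [c.eventually_ne h0, extChartAt_source_mem_nhds (I := 𝓘(ℝ, E)) x] with z hz hs h
  apply hz
  rw [inChart, (extChartAt 𝓘(ℝ, E) x).left_inv hs, h]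
  rfl

theorem dH_eq_zero_of_eventually (H : ClosedThreeForm E M) {α : Forms E M} {x : M}
    (h : ∀ᶠ z in 𝓝 x, α.1 z = 0) : (dH H α).1 x = 0 := by
  have h1 : (dTotal α).1 x = (0 : Forms E M).1 x := by
    refine eq_of_loc_eq ?_
    have hy := mem_extChartAt_target (I := 𝓘(ℝ, E)) x
    have c := continuousAt_extChartAt_symm (I := 𝓘(ℝ, E)) x
    rw [ContinuousAt, (extChartAt 𝓘(ℝ, E) x).left_inv (mem_extChartAt_source x)] at c
    have e : loc x α.1 =ᶠ[𝓝 (extChartAt 𝓘(ℝ, E) x x)] loc x (0 : Forms E M).1 := by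
      filter_upwards [c.eventually h] with y hy
      exact congrArg (lamComp _) hy
    rw [loc_dTotal α hy, dLoc_congr e, ← loc_dTotal _ hy, map_zero]
  have h2 : (dH H α).1 x = (dTotal α).1 x - wedgeThree (H.toFun x) (α.1 x) := rfl
  rw [h2, h1, h.self_of_nhds, map_zero, sub_zero]
  rfl

variable [T2Space M] {H : ClosedThreeForm E M} (𝒥 : GCStructure E M H)

/-- The projections onto the spaces `Γ(U^k)`. -/
def proj (k : ℤ) : Forms E M →ₗ[ℂ] Forms E M := gproj (isInternal_UDeg 𝒥) k

theorem proj_mem (k : ℤ) (α : Forms E M) : proj 𝒥 k α ∈ UDeg 𝒥.J k := gproj_mem _ _ _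

theorem proj_apply_eq_zero (k : ℤ) {α : Forms E M} {x : M} (h : α.1 x = 0) :
    (proj 𝒥 k α).1 x = 0 := by
  have h1 : α - proj 𝒥 k α ∈ ⨆ j, ⨆ (_ : j ≠ k), UDeg 𝒥.J j := by
    have : α ∈ ⨆ j, UDeg 𝒥.J j := by rw [iSup_UDeg]; trivial
    clear h
    induction this using Submodule.iSup_induction' with
    | mem j b hb =>
      by_cases hj : j = k
      · subst hj
        rw [proj, gproj_same _ hb, sub_self]
        exact Submodule.zero_mem _
      · rw [proj, gproj_ne _ hb hj, sub_zero]
        exact Submodule.mem_iSup_of_mem j (Submodule.mem_iSup_of_mem hj hb)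
    | zero => rw [map_zero, sub_zero]; exact Submodule.zero_mem _
    | add a b _ _ ha hb => rw [map_add, add_sub_add_comm]; exact Submodule.add_mem _ ha hb
  have h2 : ∀ β ∈ ⨆ j, ⨆ (_ : j ≠ k), UDeg 𝒥.J j,
      β.1 x ∈ ⨆ j, ⨆ (_ : j ≠ k), eig (𝒥.J x) j := by
    intro β hβ
    let ev : Forms E M →ₗ[ℂ] Lam E :=
      { toFun := fun α => α.1 x, map_add' := fun _ _ => rfl, map_smul' := fun _ _ => rfl }
    have : (⨆ j, ⨆ (_ : j ≠ k), UDeg 𝒥.J j) ≤ (⨆ j, ⨆ (_ : j ≠ k), eig (𝒥.J x) j).comap ev :=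
      iSup_le fun j => iSup_le fun hj => fun γ hγ =>
        Submodule.mem_iSup_of_mem j (Submodule.mem_iSup_of_mem hj ((mem_UDeg 𝒥).1 hγ x))
    exact this hβ
  have h3 := h2 _ h1
  have h4 : (α - proj 𝒥 k α).1 x = -(proj 𝒥 k α).1 x := by
    show α.1 x - (proj 𝒥 k α).1 x = _
    rw [h, zero_sub]
  rw [h4] at h3
  exact Submodule.disjoint_def.1 (iSupIndep_eig (𝒥.J x) k) _ ((mem_UDeg 𝒥).1 (proj_mem 𝒥 k α) x)
    ((Submodule.neg_mem_iff _).1 h3)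

theorem parOp_UDeg {k : ℤ} {α : Forms E M} (h : α ∈ UDeg 𝒥.J k) : parOp E M α ∈ UDeg 𝒥.J k :=
  (mem_UDeg 𝒥).2 fun x => par_eig ((mem_UDeg 𝒥).1 h x)

/-- The component of degree zero of `d_H` vanishes. -/
theorem proj_dH_self {k : ℤ} {α : Forms E M} (hα : α ∈ UDeg 𝒥.J k) : proj 𝒥 k (dH H α) = 0 := by
  have key : ∀ (c : ℂ) (β : Forms E M), c ≠ 0 → β ∈ UDeg 𝒥.J k → parOp E M β = c • β →
      proj 𝒥 k (dH H β) = 0 := by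
    intro c β hc hβ h
    refine Forms.ext fun x => ?_
    by_contra hx
    have h1 : parOp E M (proj 𝒥 k (dH H β)) = -c • proj 𝒥 k (dH H β) := by
      have := gproj_homogeneous (isInternal_UDeg 𝒥) (T := parOp E M) (d := 0)
        (fun j γ hγ => by rw [add_zero]; exact parOp_UDeg 𝒥 hγ) k (dH H β)
      rw [add_zero] at this
      rw [proj, ← this, ← neg_eq_iff_eq_neg.2 (dH_parOp H β), h, map_smul, map_neg, map_smul]
      module
    have h2 : ∀ᶠ z in 𝓝 x, β.1 z = 0 := by
      filter_upwards [eventually_ne_zero _ hx] with z hz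
      by_contra hβz
      refine hz (eig_parity (𝒥.skew z) (𝒥.sq z) hc ((mem_UDeg 𝒥).1 hβ z)
        ((mem_UDeg 𝒥).1 (proj_mem 𝒥 k _) z) hβz ?_ ?_)
      · exact congrFun (congrArg Subtype.val h) z
      · exact congrFun (congrArg Subtype.val h1) z
    exact hx (proj_apply_eq_zero 𝒥 k (dH_eq_zero_of_eventually H h2))
  have hpp : parOp E M (parOp E M α) = α := Forms.ext fun x => par_par _
  have h1 := key 1 (α + parOp E M α) one_ne_zero (Submodule.add_mem _ hα (parOp_UDeg 𝒥 hα))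
    (by rw [map_add, hpp, one_smul, add_comm])
  have h2 := key (-1) (α - parOp E M α) (by norm_num) (Submodule.sub_mem _ hα (parOp_UDeg 𝒥 hα))
    (by rw [map_sub, hpp]; module)
  rw [map_add, map_add] at h1
  rw [map_sub, map_sub] at h2
  have h3 : (2 : ℂ) • proj 𝒥 k (dH H α) = 0 := by linear_combination (norm := module) h1 + h2
  exact (smul_eq_zero_iff_right two_ne_zero).1 h3

end ParityForms
end GenEquivariant
end

open scoped Manifold ContDiff Topology
noncomputable section
namespace GenEquivariant
set_option linter.unusedSectionVars false

section TwoSteps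
variable {E : Type*} [NormedAddCommGroup E] [NormedSpace ℝ E] [FiniteDimensional ℝ E]

/-- The operators `v + d√-1 Jv` of degree `d = ±1` on the eigenspaces of the spin action. -/
def semi (d : ℤ) (J : GT E →ₗ[ℝ] GT E) (v : GT E) : Lam E →ₗ[ℂ] Lam E :=
  cliff v + ((d : ℂ) * Complex.I) • cliff (J v)

theorem semi_apply (d : ℤ) (J : GT E →ₗ[ℝ] GT E) (v : GT E) (b : Lam E) :
    semi d J v b = cliff v b + ((d : ℂ) * Complex.I) • cliff (J v) b := rfl

theorem semi_mem {d : ℤ} (hd : d = 1 ∨ d = -1) {J : GT E →ₗ[ℝ] GT E}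
    (hJ : ∀ v w, form (J v) w = -form v (J w)) (hsq : ∀ v, J (J v) = -v) {k : ℤ} {b : Lam E}
    (hb : b ∈ eig J k) (v : GT E) : semi d J v b ∈ eig J (k + d) := by
  rw [semi_apply]
  rcases hd with rfl | rfl
  · have := eig_raise hJ hsq hb v
    rwa [Int.cast_one, one_mul]
  · have := eig_lower hJ hsq hb v
    have e : cliff v b + (((-1 : ℤ) : ℂ) * Complex.I) • cliff (J v) b =
        cliff v b - Complex.I • cliff (J v) b := by
      push_cast
      module
    rwa [e]

theorem eq_of_semi_killed {d : ℤ} (hd : d = 1 ∨ d = -1) {J : GT E →ₗ[ℝ] GT E}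
    (hJ : ∀ v w, form (J v) w = -form v (J w)) {m : ℕ} (hm : Module.finrank ℝ E = 2 * m) {k : ℤ}
    {b : Lam E} (hb : b ∈ eig J k) (h0 : b ≠ 0) (h : ∀ v, semi d J v b = 0) : k = d * m := by
  rcases hd with rfl | rfl
  · rw [top_of_killed hJ hm hb h0 fun v => ?_, one_mul]
    have := h v
    rwa [semi_apply, Int.cast_one, one_mul] at this
  · rw [bottom_of_killed hJ hm hb h0 fun v => ?_]
    · ring
    · rw [← h v, semi_apply]
      push_cast
      module

end TwoSteps

section DerivedBracket
variable {V : Type*} [AddCommGroup V] [Module ℂ V]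

/-- The derived bracket `[{D, P}, Q]` of odd operators. -/
def derived (D P Q : V →ₗ[ℂ] V) : V →ₗ[ℂ] V :=
  D ∘ₗ P ∘ₗ Q + P ∘ₗ D ∘ₗ Q - Q ∘ₗ D ∘ₗ P - Q ∘ₗ P ∘ₗ D

theorem derived_apply (D P Q : V →ₗ[ℂ] V) (x : V) :
    derived D P Q x = D (P (Q x)) + P (D (Q x)) - Q (D (P x)) - Q (P (D x)) := rfl

theorem derived_add_smul (D P P' Q Q' : V →ₗ[ℂ] V) (e : ℂ) (x : V) :
    derived D (P + e • P') (Q + e • Q') x = derived D P Q x + (e * e) • derived D P' Q' x +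
      e • (derived D P Q' x + derived D P' Q x) := by
  simp only [derived_apply, LinearMap.add_apply, LinearMap.smul_apply, map_add, map_smul]
  module

end DerivedBracket

section Decompose
variable {E : Type*} [NormedAddCommGroup E] [NormedSpace ℝ E] [FiniteDimensional ℝ E]
  {M : Type*} [TopologicalSpace M] [ChartedSpace E M] [IsManifold 𝓘(ℝ, E) ∞ M]
  {H : ClosedThreeForm E M} (𝒥 : GCStructure E M H)

theorem extd_zero {k : ℕ} : extd (0 : M → E [⋀^Fin k]→L[ℝ] ℝ) = 0 := by
  have := extd_add (IsSmooth.zero (F := ℝ) (M := M) (E := E) (k := k)) IsSmooth.zero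
  rw [add_zero] at this
  exact left_eq_add.1 this

theorem Forms.add_apply (α β : Forms E M) (x : M) : (α + β).1 x = α.1 x + β.1 x := rfl

theorem Forms.smul_apply (c : ℂ) (α : Forms E M) (x : M) : (c • α).1 x = c • α.1 x := rfl

/-- The operators `s + d√-1 𝒥s` on forms. -/
def semiOp (d : ℤ) {s : M → GT E} (hs : IsSmoothSection s) : Forms E M →ₗ[ℂ] Forms E M :=
  cliffOp s hs + ((d : ℂ) * Complex.I) • cliffOp (fun x => 𝒥.J x (s x)) (𝒥.smooth s hs)

theorem derived_semiOp {d : ℤ} (hd : d = 1 ∨ d = -1) {s t : M → GT E} (hs : IsSmoothSection s)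
    (ht : IsSmoothSection t) (α : Forms E M) (x : M) : ∃ v : GT E,
    (derived (dH H) (semiOp 𝒥 d hs) (semiOp 𝒥 d ht) α).1 x = semi d (𝒥.J x) v (α.1 x) := by
  set js : M → GT E := fun x => 𝒥.J x (s x) with hjs
  set jt : M → GT E := fun x => 𝒥.J x (t x) with hjt
  have sjs : IsSmoothSection js := 𝒥.smooth s hs
  have sjt : IsSmoothSection jt := 𝒥.smooth t ht
  have hL : ∀ s : M → GT E, ∀ x, InL (𝒥.J x) (𝒥.J x (s x)) (s x) := fun s x => ⟨𝒥.sq _ _, rfl⟩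
  obtain ⟨h1, h2⟩ := 𝒥.integrable js s jt t sjs hs sjt ht (hL s) (hL t) x
  have e1 : formFun js jt = formFun s t := funext fun x => by
    rw [formFun, hjs, hjt, 𝒥.skew, 𝒥.sq, formFun]
    simp [form, add_comm]
  have e2 : (extd (zeroForm (formFun s jt)) + extd (zeroForm (formFun js t)) :
      M → E [⋀^Fin 1]→L[ℝ] ℝ) = 0 := by
    refine (extd_add (isSmooth_formFun hs sjt) (isSmooth_formFun sjs ht)).symm.trans ?_
    refine Eq.trans (congrArg extd ?_) extd_zero
    funext x; ext v
    have : form (𝒥.J x (s x)) (t x) = -form (s x) (𝒥.J x (t x)) := 𝒥.skew x _ _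
    show form (s x) (𝒥.J x (t x)) + form (𝒥.J x (s x)) (t x) = 0
    rw [this, add_neg_cancel]
  have he : ((d : ℂ) * Complex.I) * ((d : ℂ) * Complex.I) = -1 := by
    have := Complex.I_mul_I
    rcases hd with rfl | rfl <;> push_cast <;> linear_combination this
  refine ⟨-((courant H.toFun js jt - courant H.toFun s t) x), ?_⟩
  have h3 : (derived (dH H) (semiOp 𝒥 d hs) (semiOp 𝒥 d ht) α).1 x =
      (derived (dH H) (cliffOp s hs) (cliffOp t ht) α).1 x +
      (-1 : ℂ) • (derived (dH H) (cliffOp js sjs) (cliffOp jt sjt) α).1 x +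
      ((d : ℂ) * Complex.I) • ((derived (dH H) (cliffOp s hs) (cliffOp jt sjt) α).1 x +
        (derived (dH H) (cliffOp js sjs) (cliffOp t ht) α).1 x) := by
    have hs' : semiOp 𝒥 d hs = cliffOp s hs + ((d : ℂ) * Complex.I) • cliffOp js sjs := rfl
    have ht' : semiOp 𝒥 d ht = cliffOp t ht + ((d : ℂ) * Complex.I) • cliffOp jt sjt := rfl
    have h := derived_add_smul (dH H) (cliffOp s hs) (cliffOp js sjs)
      (cliffOp t ht) (cliffOp jt sjt) ((d : ℂ) * Complex.I) α
    rw [he] at h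
    rw [hs', ht', h, Forms.add_apply, Forms.add_apply, Forms.smul_apply, Forms.smul_apply, Forms.add_apply]
  have hb : ∀ {s t : M → GT E} (hs : IsSmoothSection s) (ht : IsSmoothSection t),
      (derived (dH H) (cliffOp s hs) (cliffOp t ht) α).1 x = cliff (courant H.toFun s t x) (α.1 x) +
        wedgeOne ((1 / 2 : ℝ) • extd (zeroForm (formFun s t)) x) (α.1 x) := fun hs ht =>
    derived_bracket H hs ht α x
  have e3 : wedgeOne ((1 / 2 : ℝ) • extd (zeroForm (formFun s jt)) x) (α.1 x) =
      -wedgeOne ((1 / 2 : ℝ) • extd (zeroForm (formFun js t)) x) (α.1 x) := by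
    rw [eq_neg_iff_add_eq_zero, ← wedgeOne_add, ← smul_add]
    have : (extd (zeroForm (formFun s jt)) x + extd (zeroForm (formFun js t)) x :
      E [⋀^Fin 1]→L[ℝ] ℝ) = 0 := congrFun e2 x
    rw [this, smul_zero]
    exact map_zero (wedgeOneₗ (α.1 x))
  have h4 : 𝒥.J x (-((courant H.toFun js jt - courant H.toFun s t) x)) =
      (courant H.toFun js t + courant H.toFun s jt) x := by
    rw [map_neg, h1, neg_neg]
  rw [h3, hb, hb, hb, hb, e1, e3, semi_apply, h4, cliff_neg]
  simp only [Pi.sub_apply, Pi.add_apply, cliff_sub, cliff_add]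
  module

variable [T2Space M]

theorem semiOp_UDeg {d : ℤ} (hd : d = 1 ∨ d = -1) {s : M → GT E} (hs : IsSmoothSection s) (k : ℤ)
    (α : Forms E M) (hα : α ∈ UDeg 𝒥.J k) : semiOp 𝒥 d hs α ∈ UDeg 𝒥.J (k + d) :=
  (mem_UDeg 𝒥).2 fun x => semi_mem hd (𝒥.skew x) (𝒥.sq x) ((mem_UDeg 𝒥).1 hα x) _

theorem eq_zero_of_semiOp {d : ℤ} (hd : d = 1 ∨ d = -1) {m : ℕ} (hm : Module.finrank ℝ E = 2 * m)
    {k : ℤ} (hk : k ≠ d * m) {α : Forms E M} (hα : α ∈ UDeg 𝒥.J k)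
    (h : ∀ (s : M → GT E) (hs : IsSmoothSection s), semiOp 𝒥 d hs α = 0) : α = 0 := by
  refine Forms.ext fun x => ?_
  by_contra h0
  refine hk (eq_of_semi_killed hd (𝒥.skew x) hm ((mem_UDeg 𝒥).1 hα x) h0 fun v => ?_)
  obtain ⟨s, hs, rfl⟩ := exists_section x v
  exact congrFun (congrArg Subtype.val (h s hs)) x

theorem UDeg_eq_zero {d : ℤ} (hd : d = 1 ∨ d = -1) {m : ℕ} (hm : Module.finrank ℝ E = 2 * m)
    {k : ℤ} (hk : m < d * k) {α : Forms E M} (hα : α ∈ UDeg 𝒥.J k) : α = 0 := by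
  refine Forms.ext fun x => ?_
  by_contra h0
  have h1 := le_eig (𝒥.skew x) (𝒥.sq x) hm ((mem_UDeg 𝒥).1 hα x) h0
  have h2 := eig_le (𝒥.skew x) (𝒥.sq x) hm ((mem_UDeg 𝒥).1 hα x) h0
  rcases hd with rfl | rfl <;> omega

theorem proj_dH_shift {d : ℤ} (hd : d = 1 ∨ d = -1) {r : ℤ} (hr : d * r ≤ -2) {k : ℤ}
    {α : Forms E M} (hα : α ∈ UDeg 𝒥.J k) : proj 𝒥 (k + r) (dH H α) = 0 := by
  rcases isEmpty_or_nonempty M with hM | ⟨⟨x₀⟩⟩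
  · exact Forms.ext fun x => hM.elim x
  obtain ⟨m, hm⟩ := even_finrank (𝒥.skew x₀) (𝒥.sq x₀)
  rw [← two_mul] at hm
  have hdd : d * d = 1 := by rcases hd with rfl | rfl <;> norm_num
  have main : ∀ n : ℕ, ∀ k : ℤ, (m : ℤ) - n < d * k → ∀ α ∈ UDeg 𝒥.J k,
      proj 𝒥 (k + r) (dH H α) = 0 := by
    intro n
    induction n with
    | zero =>
      intro k hk α hα
      rw [UDeg_eq_zero 𝒥 hd hm (by simpa using hk) hα, map_zero, map_zero]
    | succ n ih =>
      intro k hk α hα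
      by_cases hkm : (m : ℤ) < d * k
      · rw [UDeg_eq_zero 𝒥 hd hm hkm hα, map_zero, map_zero]
      have hG : ∀ {s : M → GT E} (hs : IsSmoothSection s) (j : ℤ) (β : Forms E M),
          proj 𝒥 (j + d) (semiOp 𝒥 d hs β) = semiOp 𝒥 d hs (proj 𝒥 j β) := fun hs j β =>
        gproj_homogeneous (isInternal_UDeg 𝒥) (semiOp_UDeg 𝒥 hd hs) j β
      have hα1 : ∀ {s : M → GT E} (hs : IsSmoothSection s), semiOp 𝒥 d hs α ∈ UDeg 𝒥.J (k + d) :=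
        fun hs => semiOp_UDeg 𝒥 hd hs k α hα
      have key : ∀ {s t : M → GT E} (hs : IsSmoothSection s) (ht : IsSmoothSection t),
          semiOp 𝒥 d ht (semiOp 𝒥 d hs (proj 𝒥 (k + r) (dH H α))) = 0 := by
        intro s t hs ht
        have h1 : derived (dH H) (semiOp 𝒥 d hs) (semiOp 𝒥 d ht) α ∈ UDeg 𝒥.J (k + d) :=
          (mem_UDeg 𝒥).2 fun x => by
            obtain ⟨v, hv⟩ := derived_semiOp 𝒥 hd hs ht α x
            rw [hv]
            exact semi_mem hd (𝒥.skew x) (𝒥.sq x) ((mem_UDeg 𝒥).1 hα x) _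
        have h2 : proj 𝒥 (k + r + d + d) (derived (dH H) (semiOp 𝒥 d hs) (semiOp 𝒥 d ht) α) = 0 :=
          gproj_ne _ h1 (by rcases hd with rfl | rfl <;> omega)
        have h3 : proj 𝒥 (k + r + d + d) (dH H (semiOp 𝒥 d hs (semiOp 𝒥 d ht α))) = 0 := by
          have := ih (k + d + d) (by rw [mul_add, mul_add, hdd]; push_cast at hk; linarith) _
            (semiOp_UDeg 𝒥 hd hs _ _ (hα1 ht))
          rwa [show k + d + d + r = k + r + d + d by ring] at this
        have h4 : ∀ {t : M → GT E} (ht : IsSmoothSection t),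
            proj 𝒥 (k + r + d) (dH H (semiOp 𝒥 d ht α)) = 0 := by
          intro t ht
          have := ih (k + d) (by rw [mul_add, hdd]; push_cast at hk; linarith) _ (hα1 ht)
          rwa [show k + d + r = k + r + d by ring] at this
        have h5 := derived_apply (dH H) (semiOp 𝒥 d hs) (semiOp 𝒥 d ht) α
        rw [h5, map_sub, map_sub, map_add, h3, hG, h4, hG, h4, hG, hG, map_zero,
          map_zero] at h2
        rw [add_zero, sub_zero, zero_sub, neg_eq_zero] at h2
        exact h2
      have hmem := proj_mem 𝒥 (k + r) (dH H α)
      refine eq_zero_of_semiOp 𝒥 hd hm ?_ hmem fun s hs => ?_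
      · intro h
        have : d * (k + r) = m := by rw [h, ← mul_assoc, hdd, one_mul]
        rw [mul_add] at this
        omega
      · refine eq_zero_of_semiOp 𝒥 hd hm ?_ (semiOp_UDeg 𝒥 hd hs _ _ hmem) fun t ht => key hs ht
        intro h
        have : d * (k + r + d) = m := by rw [h, ← mul_assoc, hdd, one_mul]
        rw [mul_add, mul_add, hdd] at this
        omega
  refine main (m - d * k + 1).toNat k ?_ α hα
  have := Int.self_le_toNat (m - d * k + 1)
  omega

theorem del_mem {k : ℤ} {α : Forms E M} (hα : α ∈ UDeg 𝒥.J k) : del 𝒥 α ∈ UDeg 𝒥.J (k - 1) :=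
  gradedPart_mem (isInternal_UDeg 𝒥) _ _ hα

theorem delbar_mem {k : ℤ} {α : Forms E M} (hα : α ∈ UDeg 𝒥.J k) :
    delbar 𝒥 α ∈ UDeg 𝒥.J (k + 1) :=
  gradedPart_mem (isInternal_UDeg 𝒥) _ _ hα

theorem dH_eq (α : Forms E M) : dH H α = del 𝒥 α + delbar 𝒥 α := by
  have : dH H = del 𝒥 + delbar 𝒥 := by
    refine graded_ext (isInternal_UDeg 𝒥) fun k α hα => ?_
    rw [← sub_eq_zero]
    refine eq_zero_of_gproj (isInternal_UDeg 𝒥) fun j => ?_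
    have h1 : del 𝒥 α = proj 𝒥 (k - 1) (dH H α) := gradedPart_apply (isInternal_UDeg 𝒥) _ _ hα
    have h2 : delbar 𝒥 α = proj 𝒥 (k + 1) (dH H α) := gradedPart_apply (isInternal_UDeg 𝒥) _ _ hα
    have m1 := del_mem 𝒥 hα
    have m2 := delbar_mem 𝒥 hα
    rw [LinearMap.add_apply, map_sub, map_add]
    by_cases hj1 : j = k - 1
    · rw [gproj_ne _ m2 (by omega), add_zero, hj1, gproj_same _ m1, h1]
      exact sub_self _
    by_cases hj2 : j = k + 1
    · rw [gproj_ne _ m1 (by omega), zero_add, hj2, gproj_same _ m2, h2]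
      exact sub_self _
    rw [gproj_ne _ m1 (by omega), gproj_ne _ m2 (by omega), add_zero, sub_zero]
    have h3 : ∃ r, j = k + r := ⟨j - k, by ring⟩
    obtain ⟨r, rfl⟩ := h3
    rcases lt_trichotomy r 0 with hr | rfl | hr
    · exact proj_dH_shift 𝒥 (Or.inl rfl) (by omega) hα
    · rw [add_zero]
      exact proj_dH_self 𝒥 hα
    · exact proj_dH_shift 𝒥 (Or.inr rfl) (by omega) hα
  exact LinearMap.congr_fun this α

theorem del_del_and (α : Forms E M) : del 𝒥 (del 𝒥 α) = 0 ∧ delbar 𝒥 (delbar 𝒥 α) = 0 ∧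
    del 𝒥 (delbar 𝒥 α) = -delbar 𝒥 (del 𝒥 α) := by
  have hU := isInternal_UDeg 𝒥
  have h : ∀ k, ∀ α ∈ UDeg 𝒥.J k, del 𝒥 (del 𝒥 α) = 0 ∧ delbar 𝒥 (delbar 𝒥 α) = 0 ∧
      del 𝒥 (delbar 𝒥 α) + delbar 𝒥 (del 𝒥 α) = 0 := by
    intro k α hα
    have h0 := dH_dH H α
    rw [dH_eq 𝒥, dH_eq 𝒥 α, map_add, map_add] at h0
    have m1 := del_mem 𝒥 (del_mem 𝒥 hα)
    have m2 := delbar_mem 𝒥 (delbar_mem 𝒥 hα)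
    have m3 := del_mem 𝒥 (delbar_mem 𝒥 hα)
    have m4 := delbar_mem 𝒥 (del_mem 𝒥 hα)
    rw [add_sub_cancel_right] at m3
    rw [sub_add_cancel] at m4
    have h1 := congrArg (gproj hU (k - 1 - 1)) h0
    have h2 := congrArg (gproj hU (k + 1 + 1)) h0
    have h3 := congrArg (gproj hU k) h0
    rw [map_add, map_add, map_add, map_zero, gproj_same _ m1, gproj_ne _ m2 (by omega),
      gproj_ne _ m3 (by omega), gproj_ne _ m4 (by omega)] at h1
    rw [map_add, map_add, map_add, map_zero, gproj_same _ m2, gproj_ne _ m1 (by omega),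
      gproj_ne _ m3 (by omega), gproj_ne _ m4 (by omega)] at h2
    rw [map_add, map_add, map_add, map_zero, gproj_same _ m3, gproj_same _ m4,
      gproj_ne _ m1 (by omega), gproj_ne _ m2 (by omega)] at h3
    exact ⟨by simpa using h1, by simpa using h2, by simpa using h3⟩
  have e1 : del 𝒥 ∘ₗ del 𝒥 = 0 := graded_ext hU fun k α hα => (h k α hα).1
  have e2 : delbar 𝒥 ∘ₗ delbar 𝒥 = 0 := graded_ext hU fun k α hα => (h k α hα).2.1
  have e3 : del 𝒥 ∘ₗ delbar 𝒥 + delbar 𝒥 ∘ₗ del 𝒥 = 0 :=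
    graded_ext hU fun k α hα => (h k α hα).2.2
  exact ⟨LinearMap.congr_fun e1 α, LinearMap.congr_fun e2 α,
    eq_neg_of_add_eq_zero_left (LinearMap.congr_fun e3 α)⟩

theorem del_del (α : Forms E M) : del 𝒥 (del 𝒥 α) = 0 := (del_del_and 𝒥 α).1

theorem delbar_delbar (α : Forms E M) : delbar 𝒥 (delbar 𝒥 α) = 0 := (del_del_and 𝒥 α).2.1

theorem del_delbar (α : Forms E M) : del 𝒥 (delbar 𝒥 α) = -delbar 𝒥 (del 𝒥 α) :=
  (del_del_and 𝒥 α).2.2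

theorem mulOp_UDeg {f : M → ℝ} (hf : ContMDiff 𝓘(ℝ, E) 𝓘(ℝ, ℝ) ∞ f) {k : ℤ} {α : Forms E M}
    (hα : α ∈ UDeg 𝒥.J k) : mulOp f hf α ∈ UDeg 𝒥.J k :=
  (mem_UDeg 𝒥).2 fun x => Submodule.smul_mem _ (f x : ℂ) ((mem_UDeg 𝒥).1 hα x)

/-- The commutators of `∂`, `∂̄` with multiplication by `f` are the components of `df ∧`. -/
theorem commutator_mulOp {f : M → ℝ} (hf : ContMDiff 𝓘(ℝ, E) 𝓘(ℝ, ℝ) ∞ f) {s : M → GT E}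
    (hs : IsSmoothSection s) (hsf : ∀ x, s x = (0, ofOneForm (extd (zeroForm f) x)))
    (α : Forms E M) :
    del 𝒥 (mulOp f hf α) - mulOp f hf (del 𝒥 α) = (1 / 2 : ℂ) • semiOp 𝒥 (-1) hs α ∧
    delbar 𝒥 (mulOp f hf α) - mulOp f hf (delbar 𝒥 α) = (1 / 2 : ℂ) • semiOp 𝒥 1 hs α := by
  have hU := isInternal_UDeg 𝒥
  have h : ∀ k, ∀ α ∈ UDeg 𝒥.J k,
      del 𝒥 (mulOp f hf α) - mulOp f hf (del 𝒥 α) = (1 / 2 : ℂ) • semiOp 𝒥 (-1) hs α ∧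
      delbar 𝒥 (mulOp f hf α) - mulOp f hf (delbar 𝒥 α) = (1 / 2 : ℂ) • semiOp 𝒥 1 hs α := by
    intro k α hα
    have hw : wedgeOneOp (extd (zeroForm f)) (isSmooth_zeroForm hf).extd α = cliffOp s hs α := by
      refine Forms.ext fun x => ?_
      show wedgeOne (extd (zeroForm f) x) (α.1 x) = cliff (s x) (α.1 x)
      rw [hsf, cliff_cov]
      exact congrArg (fun a => wedgeOne a (α.1 x))
        (covForm_ofOneForm (E := E) (extd (zeroForm f) x)).symm
    have h0 : del 𝒥 (mulOp f hf α) - mulOp f hf (del 𝒥 α) - (1 / 2 : ℂ) • semiOp 𝒥 (-1) hs α +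
        (delbar 𝒥 (mulOp f hf α) - mulOp f hf (delbar 𝒥 α) - (1 / 2 : ℂ) • semiOp 𝒥 1 hs α) = 0 := by
      have h1 := dH_mulOp H hf α
      rw [dH_eq 𝒥, dH_eq 𝒥 α, hw, map_add] at h1
      have h2 : cliffOp s hs α =
          (1 / 2 : ℂ) • semiOp 𝒥 (-1) hs α + (1 / 2 : ℂ) • semiOp 𝒥 1 hs α := by
        simp only [semiOp, LinearMap.add_apply, LinearMap.smul_apply]
        push_cast
        module
      rw [h2] at h1
      linear_combination (norm := module) h1
    have m1 : del 𝒥 (mulOp f hf α) - mulOp f hf (del 𝒥 α) - (1 / 2 : ℂ) • semiOp 𝒥 (-1) hs α ∈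
        UDeg 𝒥.J (k - 1) :=
      Submodule.sub_mem _ (Submodule.sub_mem _ (del_mem 𝒥 (mulOp_UDeg 𝒥 hf hα))
        (mulOp_UDeg 𝒥 hf (del_mem 𝒥 hα))) (Submodule.smul_mem _ _
        (semiOp_UDeg 𝒥 (Or.inr rfl) hs k α hα))
    have m2 : delbar 𝒥 (mulOp f hf α) - mulOp f hf (delbar 𝒥 α) - (1 / 2 : ℂ) • semiOp 𝒥 1 hs α ∈
        UDeg 𝒥.J (k + 1) :=
      Submodule.sub_mem _ (Submodule.sub_mem _ (delbar_mem 𝒥 (mulOp_UDeg 𝒥 hf hα))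
        (mulOp_UDeg 𝒥 hf (delbar_mem 𝒥 hα))) (Submodule.smul_mem _ _
        (semiOp_UDeg 𝒥 (Or.inl rfl) hs k α hα))
    have h1 := congrArg (gproj hU (k - 1)) h0
    have h2 := congrArg (gproj hU (k + 1)) h0
    rw [map_add, map_zero, gproj_same _ m1, gproj_ne _ m2 (by omega), add_zero] at h1
    rw [map_add, map_zero, gproj_same _ m2, gproj_ne _ m1 (by omega), zero_add] at h2
    exact ⟨sub_eq_zero.1 h1, sub_eq_zero.1 h2⟩
  have e1 : del 𝒥 ∘ₗ mulOp f hf - mulOp f hf ∘ₗ del 𝒥 = (1 / 2 : ℂ) • semiOp 𝒥 (-1) hs :=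
    graded_ext hU fun k α hα => (h k α hα).1
  have e2 : delbar 𝒥 ∘ₗ mulOp f hf - mulOp f hf ∘ₗ delbar 𝒥 = (1 / 2 : ℂ) • semiOp 𝒥 1 hs :=
    graded_ext hU fun k α hα => (h k α hα).2
  exact ⟨LinearMap.congr_fun e1 α, LinearMap.congr_fun e2 α⟩

end Decompose
end GenEquivariant
end

open scoped Manifold ContDiff Topology
noncomputable section
namespace GenEquivariant
set_option linter.unusedSectionVars false

section Pull
variable {E : Type*} [NormedAddCommGroup E] [NormedSpace ℝ E] [FiniteDimensional ℝ E]
  {F : Type*} [NormedAddCommGroup F] [NormedSpace ℝ F]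
  {M : Type*} [TopologicalSpace M] [ChartedSpace E M] [IsManifold 𝓘(ℝ, E) ∞ M]

theorem eq_of_inChart_eq {k : ℕ} {α β : M → E [⋀^Fin k]→L[ℝ] F} {x : M}
    (h : inChart α x (extChartAt 𝓘(ℝ, E) x x) = inChart β x (extChartAt 𝓘(ℝ, E) x x)) :
    α x = β x := by
  have hl := (extChartAt 𝓘(ℝ, E) x).left_inv (mem_extChartAt_source x)
  have h5 := dchartSymm_comp_dchart (mem_extChartAt_target (I := 𝓘(ℝ, E)) x)
  rw [hl] at h5
  have h9 : ∀ β : M → E [⋀^Fin k]→L[ℝ] F, β x =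
      (inChart β x (extChartAt 𝓘(ℝ, E) x x)).compContinuousLinearMap (dchart x x) := by
    intro β
    ext v
    simp only [inChart, ContinuousAlternatingMap.compContinuousLinearMap_apply]
    rw [hl]
    refine congrArg (β x) (funext fun i => ?_)
    exact (DFunLike.congr_fun h5 (v i)).symm
  rw [h9 α, h9 β, h]

theorem extd_pull {φ : M → M} (hφ : ContMDiff 𝓘(ℝ, E) 𝓘(ℝ, E) ∞ φ) {k : ℕ}
    {α : M → E [⋀^Fin k]→L[ℝ] F} (h : IsSmooth α) : extd (pull φ α) = pull φ (extd α) := by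
  funext x
  have hy := mem_extChartAt_target (I := 𝓘(ℝ, E)) x
  have hz := mem_extChartAt_source (I := 𝓘(ℝ, E))
    (φ ((extChartAt 𝓘(ℝ, E) x).symm (extChartAt 𝓘(ℝ, E) x x)))
  have hz2 : extChartAt 𝓘(ℝ, E) (φ ((extChartAt 𝓘(ℝ, E) x).symm (extChartAt 𝓘(ℝ, E) x x)))
      (φ ((extChartAt 𝓘(ℝ, E) x).symm (extChartAt 𝓘(ℝ, E) x x))) ∈ (extChartAt 𝓘(ℝ, E) _).target :=
    mem_extChartAt_target _
  obtain ⟨h1, h2, h3⟩ := trans_facts hφ hy hz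
  have h4 := inChart_pull_eventually hφ α hy hz
  have key : inChart (extd (pull φ α)) x (extChartAt 𝓘(ℝ, E) x x) =
      inChart (pull φ (extd α)) x (extChartAt 𝓘(ℝ, E) x x) := by
    rw [inChart_extd (h.pull hφ) hy, h4.extDeriv_eq, extDeriv_pullback (r := ∞)]
    · rw [inChart_pull hφ (extd α) hy hz]
      refine congrArg (fun a => ContinuousAlternatingMap.compContinuousLinearMap a _) ?_
      exact (inChart_extd h hz2).symm
    · exact (h.contDiffAt hz2).differentiableAt (by simp)
    · exact h1
    · simp only [minSmoothness_of_isRCLikeNormedField]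
      exact WithTop.coe_le_coe.2 le_top
  exact eq_of_inChart_eq key

theorem spin_lamComp {J J' : GT E →ₗ[ℝ] GT E} {L L' : E →L[ℝ] E}
    (hL : L'.comp L = ContinuousLinearMap.id ℝ E) (hL' : L.comp L' = ContinuousLinearMap.id ℝ E)
    (h : ∀ v : GT E, J' (L v.1, v.2.comp L') = (L (J v).1, (J v).2.comp L')) (b : Lam E) :
    spin J (lamComp L b) = lamComp L (spin J' b) := by
  have hc : ∀ (v : GT E) (b : Lam E),
      lamComp L (cliff (L v.1, v.2.comp L') b) = cliff v (lamComp L b) := by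
    intro v b
    rw [lamComp_cliff, ContinuousLinearMap.comp_assoc, hL, ContinuousLinearMap.comp_id]
  have hfr : ∀ X, ∑ i, (LinearMap.toContinuousLinearMap ((Module.finBasis ℝ E).coord i)).comp L' X •
      L (Module.finBasis ℝ E i) = X := by
    intro X
    have h1 := sum_finBasis_coord (L' X)
    simp only [← map_smul]
    rw [← map_sum]
    refine (congrArg L h1).trans ?_
    exact DFunLike.congr_fun hL' X
  have e1 : ∀ X : E, J' (L X, 0) = (L (J (X, 0)).1, (J (X, 0)).2.comp L') := fun X => by
    have := h (X, 0)
    rwa [ContinuousLinearMap.zero_comp] at this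
  have e2 : ∀ ξ : E →L[ℝ] ℝ, J' (0, ξ.comp L') = (L (J (0, ξ)).1, (J (0, ξ)).2.comp L') := fun ξ => by
    have := h (0, ξ)
    rwa [map_zero] at this
  have e3 : ∀ (X : E) (b : Lam E), lamComp L (cliff (L X, 0) b) = cliff (X, 0) (lamComp L b) :=
    fun X b => by
      have := hc (X, 0) b
      rwa [ContinuousLinearMap.zero_comp] at this
  have e4 : ∀ (ξ : E →L[ℝ] ℝ) (b : Lam E), lamComp L (cliff (0, ξ.comp L') b) =
      cliff (0, ξ) (lamComp L b) := fun ξ b => by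
      have := hc (0, ξ) b
      rwa [map_zero] at this
  rw [spin_eq_sum J' b hfr, spin_apply_finBasis, map_smul, map_sum]
  refine congrArg ((1 / 2 : ℂ) • ·) (Finset.sum_congr rfl fun i _ => ?_)
  rw [map_add, e1, e2, hc, hc, e3, e4]

theorem dTotal_pullOp {φ : M → M} (hφ : ContMDiff 𝓘(ℝ, E) 𝓘(ℝ, E) ∞ φ) (α : Forms E M) :
    dTotal (pullOp φ hφ α) = pullOp φ hφ (dTotal α) := by
  refine Forms.ext fun x => funext fun k => ?_
  cases k with
  | zero => rfl
  | succ k => exact congrFun (extd_pull hφ (α.2 k)) x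

theorem dH_pullOp (H : ClosedThreeForm E M) {φ : M → M} (hφ : ContMDiff 𝓘(ℝ, E) 𝓘(ℝ, E) ∞ φ)
    (h : pull φ H.toFun = H.toFun) (α : Forms E M) :
    dH H (pullOp φ hφ α) = pullOp φ hφ (dH H α) := by
  have : wedgeThreeOp H.toFun H.smooth (pullOp φ hφ α) =
      pullOp φ hφ (wedgeThreeOp H.toFun H.smooth α) := Forms.ext fun x => by
    refine Eq.trans ?_ (lamComp_wedgeThree (tmap φ x) (H.toFun (φ x)) (α.1 (φ x))).symm
    exact congrArg (fun a => wedgeThree a (lamComp (tmap φ x) (α.1 (φ x)))) (congrFun h x).symm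
  rw [dH_apply, dH_apply, dTotal_pullOp, this, map_sub]

end Pull

section SmulConst
variable {E : Type*} [NormedAddCommGroup E] [NormedSpace ℝ E] [FiniteDimensional ℝ E]
  {M : Type*} [TopologicalSpace M] [ChartedSpace E M] [IsManifold 𝓘(ℝ, E) ∞ M]

theorem contMDiff_smul_const (𝔤 : Type*) [NormedAddCommGroup 𝔤] [NormedSpace ℝ 𝔤]
    {G : Type*} [TopologicalSpace G] [ChartedSpace 𝔤 G] [Group G]
    [MulAction G M] [ContMDiffSMul 𝓘(ℝ, 𝔤) 𝓘(ℝ, E) ∞ G M] (g : G) :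
    ContMDiff 𝓘(ℝ, E) 𝓘(ℝ, E) ∞ (fun x : M => g • x) :=
  (ContMDiffSMul.contMDiff_smul (I := 𝓘(ℝ, 𝔤)) (I' := 𝓘(ℝ, E)) (n := ∞) (G := G) (M := M)).comp
      (contMDiff_const.prodMk contMDiff_id)

theorem tmap_smul_comp (𝔤 : Type*) [NormedAddCommGroup 𝔤] [NormedSpace ℝ 𝔤]
    {G : Type*} [TopologicalSpace G] [ChartedSpace 𝔤 G] [Group G]
    [MulAction G M] [ContMDiffSMul 𝓘(ℝ, 𝔤) 𝓘(ℝ, E) ∞ G M] (g : G) (x : M) :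
    (tmap (fun y : M => g • y) (g⁻¹ • x)).comp
      (tmap (fun y : M => g⁻¹ • y) x) = ContinuousLinearMap.id ℝ E := by
  have h1 := (contMDiff_smul_const (E := E) (M := M) 𝔤 g).mdifferentiableAt (by simp)
    (x := g⁻¹ • x)
  have h2 := (contMDiff_smul_const (E := E) (M := M) 𝔤 g⁻¹).mdifferentiableAt (by simp)
    (x := x)
  have h := mfderiv_comp x h1 h2
  have e : (fun y : M => g • y) ∘ (fun y : M => g⁻¹ • y) = id := funext fun y => smul_inv_smul g y
  rw [e, mfderiv_id] at h
  exact h.symm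

end SmulConst

section Action
variable {E : Type*} [NormedAddCommGroup E] [NormedSpace ℝ E] [FiniteDimensional ℝ E]
  {M : Type*} [TopologicalSpace M] [ChartedSpace E M] [IsManifold 𝓘(ℝ, E) ∞ M]
  {𝔤 : Type*} [NormedAddCommGroup 𝔤] [NormedSpace ℝ 𝔤] [FiniteDimensional ℝ 𝔤]
  {G : Type*} [TopologicalSpace G] [ChartedSpace 𝔤 G] [Group G] [LieGroup 𝓘(ℝ, 𝔤) ∞ G]
  [MulAction G M] [ContMDiffSMul 𝓘(ℝ, 𝔤) 𝓘(ℝ, E) ∞ G M]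
  [T2Space M] {H : ClosedThreeForm E M} {𝒥 : GCStructure E M H} (A : HamiltonianAction 𝔤 G 𝒥)

theorem translate_apply (g : G) (α : Forms E M) (x : M) :
    (translate E M 𝔤 g α).1 x = lamComp (tmap (fun y : M => g⁻¹ • y) x) (α.1 (g⁻¹ • x)) := rfl

theorem spin_translate (A : HamiltonianAction 𝔤 G 𝒥) (g : G) (α : Forms E M) (x : M) :
    spin (𝒥.J x) ((translate E M 𝔤 g α).1 x) =
      lamComp (tmap (fun y : M => g⁻¹ • y) x) (spin (𝒥.J (g⁻¹ • x)) (α.1 (g⁻¹ • x))) := by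
  have h1 := tmap_smul_comp (E := E) 𝔤 g x
  have h2 := tmap_smul_comp (E := E) 𝔤 g⁻¹ (g⁻¹ • x)
  rw [inv_inv, smul_inv_smul] at h2
  refine spin_lamComp h1 h2 (fun v => ?_) _
  have h3 := A.invariant g⁻¹ x v
  simp only [push, inv_inv] at h3
  exact h3

theorem translate_UDeg (A : HamiltonianAction 𝔤 G 𝒥) (g : G) {k : ℤ} {α : Forms E M} (hα : α ∈ UDeg 𝒥.J k) :
    translate E M 𝔤 g α ∈ UDeg 𝒥.J k := fun x => by
  rw [spin_translate A, hα, map_smul]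
  rfl

theorem dH_translate (A : HamiltonianAction 𝔤 G 𝒥) (g : G) (α : Forms E M) :
    dH H (translate E M 𝔤 g α) = translate E M 𝔤 g (dH H α) :=
  dH_pullOp H _ (A.invariant_three g⁻¹) α

/-- The operators `f^ξ` on forms. -/
def HamiltonianAction.mulF (ξ : 𝔤) : Forms E M →ₗ[ℂ] Forms E M :=
  mulOp (fun x => A.f x ξ) ((ContinuousLinearMap.apply ℝ ℝ ξ).contMDiff.comp A.f_smooth)

theorem mulF_apply (ξ : 𝔤) (α : Forms E M) (x : M) : (A.mulF ξ α).1 x = (A.f x ξ : ℂ) • α.1 x := rfl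

theorem mulF_add (ξ ζ : 𝔤) (α : Forms E M) : A.mulF (ξ + ζ) α = A.mulF ξ α + A.mulF ζ α :=
  Forms.ext fun x => by
    rw [mulF_apply, Forms.add_apply, mulF_apply, mulF_apply, map_add]
    push_cast
    module

theorem mulF_smul (r : ℝ) (ξ : 𝔤) (α : Forms E M) : A.mulF (r • ξ) α = (r : ℂ) • A.mulF ξ α :=
  Forms.ext fun x => by
    rw [mulF_apply, Forms.smul_apply, mulF_apply, map_smul, smul_eq_mul]
    push_cast
    module

theorem translate_mulF (g : G) (ξ : 𝔤) (α : Forms E M) :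
    translate E M 𝔤 g (A.mulF ξ α) = A.mulF (Ad g ξ) (translate E M 𝔤 g α) :=
  Forms.ext fun x => by
    have h := A.f_equivariant g (g⁻¹ • x) ξ
    rw [smul_inv_smul] at h
    rw [translate_apply, mulF_apply, mulF_apply, map_smul, h]
    rfl

/-- The section `ξ_M + η^ξ`. -/
def HamiltonianAction.fundSection (ξ : 𝔤) (x : M) : GT E :=
  (fundVF E M G ξ x, ofOneForm (evalOne A.η ξ x))

theorem fundSection_smooth (ξ : 𝔤) : IsSmoothSection (A.fundSection ξ) :=
  ⟨isSmoothVF_fundVF ξ, by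
    simpa only [HamiltonianAction.fundSection, covForm_ofOneForm] using isSmooth_evalOne A.η_smooth ξ⟩

/-- The section `df^ξ`. -/
def HamiltonianAction.dfSection (ξ : 𝔤) (x : M) : GT E := (0, ofOneForm (dMoment A.f ξ x))

theorem dfSection_smooth (ξ : 𝔤) : IsSmoothSection (A.dfSection ξ) :=
  ⟨isSmooth_zeroVF (E := E) (M := M), by
    simpa only [HamiltonianAction.dfSection, covForm_ofOneForm] using isSmooth_dMoment A.f_smooth ξ⟩

theorem J_dfSection (ξ : 𝔤) (x : M) : 𝒥.J x (A.dfSection ξ x) = -A.fundSection ξ x := by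
  have h := (A.moment ξ x).2
  have e : ((0, -ofOneForm (dMoment A.f ξ x)) : GT E) = -A.dfSection ξ x := by
    rw [HamiltonianAction.dfSection, Prod.neg_mk, neg_zero]
  rw [e, map_neg] at h
  rw [← neg_eq_iff_eq_neg, h]
  rfl

/-- The Lie derivative of forms along `ξ_M`. -/
def HamiltonianAction.lie (_ : HamiltonianAction 𝔤 G 𝒥) (ξ : 𝔤) : Forms E M →ₗ[ℂ] Forms E M :=
  lieOp (fundVF E M G ξ) (isSmoothVF_fundVF ξ)

theorem lie_eq (ξ : 𝔤) (α : Forms E M) : A.lie ξ α =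
    dH H (cliffOp _ (fundSection_smooth A ξ) α) + cliffOp _ (fundSection_smooth A ξ) (dH H α) := by
  have h := dH_cliffOp H (fundSection_smooth A ξ) α
  have e : extd (cov (A.fundSection ξ)) = interior (vec (A.fundSection ξ)) H.toFun := by
    refine Eq.trans ?_ (A.twist ξ).symm
    refine congrArg extd (funext fun x => ?_)
    exact covForm_ofOneForm _
  simp only [e] at h
  rw [h, add_sub_cancel_right]
  rfl

theorem cliffA_apply (ξ : 𝔤) (α : Forms E M) : A.cliffA ξ α =
    Complex.I • cliffOp _ (dfSection_smooth A ξ) α - cliffOp _ (fundSection_smooth A ξ) α := by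
  have h : cliffOp _ (dfSection_smooth A ξ) α =
      wedgeOneOp (dMoment A.f ξ) (isSmooth_dMoment A.f_smooth ξ) α := Forms.ext fun x => by
    show cliff (A.dfSection ξ x) (α.1 x) = wedgeOne (dMoment A.f ξ x) (α.1 x)
    rw [HamiltonianAction.dfSection, cliff_cov, covForm_ofOneForm]
  rw [h, sub_eq_neg_add]
  rfl

theorem cliffA_mulF (ξ ζ : 𝔤) (α : Forms E M) :
    A.cliffA ξ (A.mulF ζ α) = A.mulF ζ (A.cliffA ξ α) := by
  have h : ∀ {s : M → GT E} (hs : IsSmoothSection s), cliffOp s hs (A.mulF ζ α) =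
      A.mulF ζ (cliffOp s hs α) := fun hs => Forms.ext fun x => map_smul (cliff _) _ _
  rw [cliffA_apply, cliffA_apply, h, h, map_sub, map_smul]

theorem proj_comm {T : Forms E M →ₗ[ℂ] Forms E M} (hT : ∀ k, ∀ α ∈ UDeg 𝒥.J k, T α ∈ UDeg 𝒥.J k)
    (k : ℤ) (α : Forms E M) : proj 𝒥 k (T α) = T (proj 𝒥 k α) := by
  have h := gproj_homogeneous (isInternal_UDeg 𝒥) (T := T) (d := 0)
    (fun j γ hγ => by rw [add_zero]; exact hT j γ hγ) k α
  rwa [add_zero] at h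

theorem del_comm {T : Forms E M →ₗ[ℂ] Forms E M} (hT : ∀ k, ∀ α ∈ UDeg 𝒥.J k, T α ∈ UDeg 𝒥.J k)
    (hd : ∀ α, dH H (T α) = T (dH H α)) (α : Forms E M) : del 𝒥 (T α) = T (del 𝒥 α) := by
  have : del 𝒥 ∘ₗ T = T ∘ₗ del 𝒥 := by
    refine graded_ext (isInternal_UDeg 𝒥) fun k α hα => ?_
    rw [LinearMap.comp_apply, LinearMap.comp_apply, del,
      gradedPart_apply (isInternal_UDeg 𝒥) _ _ hα,
      gradedPart_apply (isInternal_UDeg 𝒥) _ _ (hT k α hα), hd]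
    exact proj_comm hT _ _
  exact LinearMap.congr_fun this α

theorem delbar_comm {T : Forms E M →ₗ[ℂ] Forms E M}
    (hT : ∀ k, ∀ α ∈ UDeg 𝒥.J k, T α ∈ UDeg 𝒥.J k)
    (hd : ∀ α, dH H (T α) = T (dH H α)) (α : Forms E M) : delbar 𝒥 (T α) = T (delbar 𝒥 α) := by
  have h := hd α
  rw [dH_eq 𝒥, dH_eq 𝒥, map_add, del_comm hT hd] at h
  exact add_left_cancel h

theorem proj_translate (A : HamiltonianAction 𝔤 G 𝒥) (g : G) (k : ℤ) (α : Forms E M) :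
    proj 𝒥 k (translate E M 𝔤 g α) = translate E M 𝔤 g (proj 𝒥 k α) :=
  proj_comm (fun _ _ hα => translate_UDeg A g hα) k α

theorem del_translate (A : HamiltonianAction 𝔤 G 𝒥) (g : G) (α : Forms E M) :
    del 𝒥 (translate E M 𝔤 g α) = translate E M 𝔤 g (del 𝒥 α) :=
  del_comm (fun _ _ hα => translate_UDeg A g hα) (dH_translate A g) α

theorem delbar_translate (A : HamiltonianAction 𝔤 G 𝒥) (g : G) (α : Forms E M) :
    delbar 𝒥 (translate E M 𝔤 g α) = translate E M 𝔤 g (delbar 𝒥 α) :=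
  delbar_comm (fun _ _ hα => translate_UDeg A g hα) (dH_translate A g) α

theorem commutator_mulF (ξ : 𝔤) (α : Forms E M) :
    del 𝒥 (A.mulF ξ α) - A.mulF ξ (del 𝒥 α) = (1 / 2 : ℂ) •
      (cliffOp _ (dfSection_smooth A ξ) α + Complex.I • cliffOp _ (fundSection_smooth A ξ) α) ∧
    delbar 𝒥 (A.mulF ξ α) - A.mulF ξ (delbar 𝒥 α) = (1 / 2 : ℂ) •
      (cliffOp _ (dfSection_smooth A ξ) α - Complex.I • cliffOp _ (fundSection_smooth A ξ) α) := by
  have h := commutator_mulOp 𝒥 ((ContinuousLinearMap.apply ℝ ℝ ξ).contMDiff.comp A.f_smooth)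
    (dfSection_smooth A ξ) (fun x => rfl) α
  have e : cliffOp (fun x => 𝒥.J x (A.dfSection ξ x)) (𝒥.smooth _ (dfSection_smooth A ξ)) α =
      -cliffOp _ (fundSection_smooth A ξ) α := by
    rw [eq_neg_iff_add_eq_zero, add_comm, ← eq_neg_iff_add_eq_zero]
    refine Forms.ext fun x => ?_
    have : cliff (𝒥.J x (A.dfSection ξ x)) (α.1 x) = -cliff (A.fundSection ξ x) (α.1 x) := by
      rw [J_dfSection, cliff_neg]
    exact eq_neg_of_add_eq_zero_left (by
      show cliff (A.fundSection ξ x) (α.1 x) + cliff (𝒥.J x (A.dfSection ξ x)) (α.1 x) = 0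
      rw [this, add_neg_cancel])
  refine ⟨h.1.trans ?_, h.2.trans ?_⟩
  · simp only [semiOp, LinearMap.add_apply, LinearMap.smul_apply, e]
    push_cast
    module
  · simp only [semiOp, LinearMap.add_apply, LinearMap.smul_apply, e]
    push_cast
    module

theorem cliffA_eq (ξ : 𝔤) (α : Forms E M) :
    A.cliffA ξ α = (2 * Complex.I) • (del 𝒥 (A.mulF ξ α) - A.mulF ξ (del 𝒥 α)) := by
  rw [(commutator_mulF A ξ α).1, cliffA_apply]
  match_scalars
  · ring
  · linear_combination (-1) * Complex.I_mul_I

theorem lie_eq_delbar (ξ : 𝔤) (α : Forms E M) :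
    A.lie ξ α = -(delbar 𝒥 (A.cliffA ξ α) + A.cliffA ξ (delbar 𝒥 α)) := by
  have hc : ∀ β, cliffOp _ (fundSection_smooth A ξ) β = (-Complex.I) •
      ((del 𝒥 (A.mulF ξ β) - A.mulF ξ (del 𝒥 β)) -
        (delbar 𝒥 (A.mulF ξ β) - A.mulF ξ (delbar 𝒥 β))) := by
    intro β
    rw [(commutator_mulF A ξ β).1, (commutator_mulF A ξ β).2]
    match_scalars
    · linear_combination Complex.I_mul_I
    · ring
  rw [lie_eq, hc, hc, cliffA_eq, cliffA_eq]
  simp only [dH_eq 𝒥, map_add, map_sub, map_smul, del_del, delbar_delbar, del_delbar, map_zero,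
    map_neg]
  module

theorem lie_eq_del (ξ : 𝔤) (α : Forms E M) : A.lie ξ α = (2 * Complex.I) •
    (del 𝒥 (delbar 𝒥 (A.mulF ξ α) - A.mulF ξ (delbar 𝒥 α)) +
      (delbar 𝒥 (A.mulF ξ (del 𝒥 α)) - A.mulF ξ (delbar 𝒥 (del 𝒥 α)))) := by
  rw [lie_eq_delbar, cliffA_eq, cliffA_eq]
  simp only [map_sub, map_smul, del_delbar, map_neg]
  module

end Action
end GenEquivariant
end

open scoped Manifold ContDiff Topology
noncomputable section
namespace GenEquivariant
set_option linter.unusedSectionVars false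

section JointSmoothness
variable {E : Type*} [NormedAddCommGroup E] [NormedSpace ℝ E] [FiniteDimensional ℝ E]
  {F : Type*} [NormedAddCommGroup F] [NormedSpace ℝ F]
  {M : Type*} [TopologicalSpace M] [ChartedSpace E M] [IsManifold 𝓘(ℝ, E) ∞ M]
  {𝔤 : Type*} [NormedAddCommGroup 𝔤] [NormedSpace ℝ 𝔤] [FiniteDimensional ℝ 𝔤]
  {G : Type*} [TopologicalSpace G] [ChartedSpace 𝔤 G] [Group G] [LieGroup 𝓘(ℝ, 𝔤) ∞ G]
  [MulAction G M] [ContMDiffSMul 𝓘(ℝ, 𝔤) 𝓘(ℝ, E) ∞ G M]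
  {X : Type*} [NormedAddCommGroup X] [NormedSpace ℝ X]

theorem contDiffAt_trans_smul {e : X → G} {s₀ : X} (he : ContMDiffAt 𝓘(ℝ, X) 𝓘(ℝ, 𝔤) ∞ e s₀)
    {x₀ z₀ : M} {y₀ : E} (hy : y₀ ∈ (extChartAt 𝓘(ℝ, E) x₀).target)
    (hz : e s₀ • (extChartAt 𝓘(ℝ, E) x₀).symm y₀ ∈ (extChartAt 𝓘(ℝ, E) z₀).source) :
    ContDiffAt ℝ ∞ (fun q : X × E => trans (fun x : M => e q.1 • x) x₀ z₀ q.2) (s₀, y₀) := by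
  have h1 : ContMDiffAt 𝓘(ℝ, X × E) 𝓘(ℝ, E) ∞
      (fun q : X × E => (extChartAt 𝓘(ℝ, E) x₀).symm q.2) (s₀, y₀) :=
    ContMDiffAt.comp (s₀, y₀) ((contMDiffOn_extChartAt_symm x₀).contMDiffAt
      ((isOpen_extChartAt_target x₀).mem_nhds hy)) contDiff_snd.contMDiff.contMDiffAt
  have h2 : ContMDiffAt 𝓘(ℝ, X × E) 𝓘(ℝ, 𝔤) ∞ (fun q : X × E => e q.1) (s₀, y₀) :=
    ContMDiffAt.comp (s₀, y₀) he contDiff_fst.contMDiff.contMDiffAt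
  have h3 := (ContMDiffSMul.contMDiff_smul (I := 𝓘(ℝ, 𝔤)) (I' := 𝓘(ℝ, E)) (n := ∞) (G := G)
    (M := M)).contMDiffAt.comp (s₀, y₀) (h2.prodMk h1)
  have h4 : ContMDiffAt 𝓘(ℝ, E) 𝓘(ℝ, E) ∞ (extChartAt 𝓘(ℝ, E) z₀)
      (e s₀ • (extChartAt 𝓘(ℝ, E) x₀).symm y₀) := contMDiffAt_extChartAt' (by simpa using hz)
  rw [← contMDiffAt_iff_contDiffAt]
  exact ContMDiffAt.comp (s₀, y₀) h4 h3

theorem inChart_pull_smul_eventually {e : X → G} {s₀ : X}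
    (he : ContMDiffAt 𝓘(ℝ, X) 𝓘(ℝ, 𝔤) ∞ e s₀)
    {k : ℕ} (α : M → E [⋀^Fin k]→L[ℝ] F) {x₀ z₀ : M} {y₀ : E}
    (hy : y₀ ∈ (extChartAt 𝓘(ℝ, E) x₀).target)
    (hz : e s₀ • (extChartAt 𝓘(ℝ, E) x₀).symm y₀ ∈ (extChartAt 𝓘(ℝ, E) z₀).source) :
    (fun q : X × E => inChart (pull (fun x : M => e q.1 • x) α) x₀ q.2) =ᶠ[𝓝 (s₀, y₀)]
    fun q => (inChart α z₀ (trans (fun x : M => e q.1 • x) x₀ z₀ q.2)).compContinuousLinearMap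
      (fderiv ℝ (trans (fun x : M => e q.1 • x) x₀ z₀) q.2) := by
  have h1 : ContinuousAt (fun q : X × E => (extChartAt 𝓘(ℝ, E) x₀).symm q.2) (s₀, y₀) :=
    (continuousAt_extChartAt_symm'' hy).comp (f := Prod.snd) (x := (s₀, y₀)) continuousAt_snd
  have h2 : ContinuousAt (fun q : X × E => e q.1) (s₀, y₀) :=
    he.continuousAt.comp (f := Prod.fst) (x := (s₀, y₀)) continuousAt_fst
  have hs : Continuous (fun p : G × M => p.1 • p.2) :=
    (ContMDiffSMul.contMDiff_smul (I := 𝓘(ℝ, 𝔤)) (I' := 𝓘(ℝ, E)) (n := ∞) (G := G)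
      (M := M)).continuous
  have h3 : ContinuousAt (fun q : X × E => e q.1 • (extChartAt 𝓘(ℝ, E) x₀).symm q.2) (s₀, y₀) :=
    ContinuousAt.comp (f := fun q : X × E => (e q.1, (extChartAt 𝓘(ℝ, E) x₀).symm q.2))
      (g := fun p : G × M => p.1 • p.2) hs.continuousAt (h2.prodMk h1)
  filter_upwards [(continuousAt_snd (p := (s₀, y₀))).preimage_mem_nhds
    ((isOpen_extChartAt_target (I := 𝓘(ℝ, E)) x₀).mem_nhds hy),
    h3 ((isOpen_extChartAt_source (I := 𝓘(ℝ, E)) z₀).mem_nhds hz)] with q hq1 hq2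
  exact inChart_pull (contMDiff_smul_const 𝔤 (e q.1)) α hq1 hq2

theorem contDiffAt_fderiv_trans_smul {e : X → G} {s₀ : X}
    (he : ContMDiffAt 𝓘(ℝ, X) 𝓘(ℝ, 𝔤) ∞ e s₀)
    {x₀ z₀ : M} {y₀ : E} (hy : y₀ ∈ (extChartAt 𝓘(ℝ, E) x₀).target)
    (hz : e s₀ • (extChartAt 𝓘(ℝ, E) x₀).symm y₀ ∈ (extChartAt 𝓘(ℝ, E) z₀).source) :
    ContDiffAt ℝ ∞ (fun q : X × E => fderiv ℝ (trans (fun x : M => e q.1 • x) x₀ z₀) q.2)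
      (s₀, y₀) := by
  refine ContDiffAt.fderiv (f := fun (q : X × E) y => trans (fun x : M => e q.1 • x) x₀ z₀ y)
    (g := fun q => q.2) (n := ∞) ?_ contDiffAt_snd (by simp)
  exact (contDiffAt_trans_smul he hy hz).comp ((s₀, y₀), y₀)
    (f := fun p : (X × E) × E => (p.1.1, p.2))
    ((contDiff_fst.comp contDiff_fst).prodMk contDiff_snd).contDiffAt

theorem contDiffAt_inChart_pull_smul {e : X → G} {s₀ : X}
    (he : ContMDiffAt 𝓘(ℝ, X) 𝓘(ℝ, 𝔤) ∞ e s₀) {k : ℕ} {α : M → E [⋀^Fin k]→L[ℝ] F}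
    (hα : IsSmooth α) {x₀ : M} {y₀ : E} (hy : y₀ ∈ (extChartAt 𝓘(ℝ, E) x₀).target) :
    ContDiffAt ℝ ∞ (fun q : X × E => inChart (pull (fun x : M => e q.1 • x) α) x₀ q.2)
      (s₀, y₀) := by
  have hz := mem_extChartAt_source (I := 𝓘(ℝ, E)) (e s₀ • (extChartAt 𝓘(ℝ, E) x₀).symm y₀)
  refine ContDiffAt.congr_of_eventuallyEq ?_ (inChart_pull_smul_eventually he α hy hz)
  refine contDiffAt_comp ?_ (contDiffAt_fderiv_trans_smul he hy hz)
  exact (hα.contDiffAt ((extChartAt 𝓘(ℝ, E) _).map_source hz)).comp (s₀, y₀)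
    (contDiffAt_trans_smul he hy hz)

theorem dchart_self (x : M) : dchart x x = ContinuousLinearMap.id ℝ E :=
  mfderiv_extChartAt_self (I := 𝓘(ℝ, E)) (x := x)

theorem dchartSymm_self (x : M) :
    dchartSymm x (extChartAt 𝓘(ℝ, E) x x) = ContinuousLinearMap.id ℝ E := by
  have h := dchartSymm_comp_dchart (mem_extChartAt_target (I := 𝓘(ℝ, E)) x)
  rwa [(extChartAt 𝓘(ℝ, E) x).left_inv (mem_extChartAt_source x), dchart_self,
    ContinuousLinearMap.comp_id] at h

theorem inChart_self {k : ℕ} (α : M → E [⋀^Fin k]→L[ℝ] F) (x : M) :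
    inChart α x (extChartAt 𝓘(ℝ, E) x x) = α x := by
  ext v
  rw [inChart, dchartSymm_self, (extChartAt 𝓘(ℝ, E) x).left_inv (mem_extChartAt_source x)]
  rfl

theorem fderiv_trans_curve {e : ℝ → G} (he : ContMDiffAt 𝓘(ℝ, ℝ) 𝓘(ℝ, 𝔤) ∞ e 0) (h0 : e 0 = 1)
    {ξ : 𝔤} (hξ : mfderiv 𝓘(ℝ, ℝ) 𝓘(ℝ, 𝔤) e 0 (1 : ℝ) = ξ) {x₀ : M} {y : E}
    (hy : y ∈ (extChartAt 𝓘(ℝ, E) x₀).target) :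
    fderiv ℝ (fun s => trans (fun x : M => e s • x) x₀ x₀ y) 0 1 =
      locV x₀ (fundVF E M G ξ) y := by
  set p := (extChartAt 𝓘(ℝ, E) x₀).symm y
  have hp : p ∈ (extChartAt 𝓘(ℝ, E) x₀).source := (extChartAt 𝓘(ℝ, E) x₀).map_target hy
  have d1 : MDifferentiableAt 𝓘(ℝ, ℝ) 𝓘(ℝ, 𝔤) e 0 := he.mdifferentiableAt (by simp)
  have d2 : MDifferentiableAt 𝓘(ℝ, 𝔤) 𝓘(ℝ, E) (fun g : G => g • p) 1 :=
    (((ContMDiffSMul.contMDiff_smul (I := 𝓘(ℝ, 𝔤)) (I' := 𝓘(ℝ, E)) (n := ∞) (G := G)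
      (M := M)).comp (contMDiff_id.prodMk contMDiff_const)).mdifferentiableAt (by simp))
  have d3 : MDifferentiableAt 𝓘(ℝ, E) 𝓘(ℝ, E) (extChartAt 𝓘(ℝ, E) x₀) ((1 : G) • p) :=
    (contMDiffAt_extChartAt' (n := ∞) (by simpa using hp)).mdifferentiableAt (by simp)
  have e1 := mfderiv_comp_apply_of_eq (0 : ℝ) (g := fun g : G => g • p) d2 d1 h0 (1 : ℝ)
  have e2 := mfderiv_comp_apply_of_eq (0 : ℝ) (g := extChartAt 𝓘(ℝ, E) x₀)
    (f := (fun g : G => g • p) ∘ e) d3 ((by rw [h0]; exact d2 : MDifferentiableAt 𝓘(ℝ, 𝔤) 𝓘(ℝ, E)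
      (fun g : G => g • p) (e 0)).comp _ d1) (by simp [h0]) (1 : ℝ)
  rw [← mfderiv_eq_fderiv]
  refine e2.trans ?_
  rw [e1]
  have e4 : (mfderiv 𝓘(ℝ, 𝔤) 𝓘(ℝ, E) (fun g : G => g • p) 1
    (mfderiv 𝓘(ℝ, ℝ) 𝓘(ℝ, 𝔤) e 0 (1 : ℝ)) : E) = fundVF E M G ξ p := congrArg
    (fun ζ : 𝔤 => (mfderiv 𝓘(ℝ, 𝔤) 𝓘(ℝ, E) (fun g : G => g • p) 1 ζ : E)) hξ
  exact (congrArg (dchart (E := E) x₀ ((1 : G) • p)) e4).trans (by rw [one_smul]; rfl)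

theorem lieLoc_apply (Y : E → E) (u : E → Lam E) (y : E) (k : ℕ) (v : Fin k → E) :
    lieLoc Y u y k v = fderiv ℝ (fun z => u z k) y (Y y) v +
      ∑ i, u y k (Function.update v i (fderiv ℝ Y y (v i))) := by
  rw [lieLoc, Pi.add_apply, ContinuousAlternatingMap.add_apply, Finset.sum_apply]
  congr 1
  cases k with
  | zero => simp [wedgeOne_zero]
  | succ k =>
    have h := alternatizeUncurryFin_eq_sum (Module.finBasis ℝ E)
      ((u y (k + 1)).curryLeft.comp (fderiv ℝ Y y))
    refine (DFunLike.congr_fun h v).symm.trans ?_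
    rw [ContinuousAlternatingMap.alternatizeUncurryFin_apply]
    refine Finset.sum_congr rfl fun i _ => ?_
    have h2 := AlternatingMap.neg_one_pow_smul_map_insertNth (u y (k + 1)).toAlternatingMap i
      (fderiv ℝ Y y (v i)) (i.removeNth v)
    rw [Fin.insertNth_removeNth] at h2
    refine Eq.trans (congrArg ((-1 : ℤ) ^ (i : ℕ) • ·) h2.symm) ?_
    rw [smul_smul, ← pow_add, Even.neg_one_pow ⟨_, rfl⟩, one_smul]
    rfl

theorem hasDerivAt_pull_curve {e : ℝ → G} (he : ContMDiffAt 𝓘(ℝ, ℝ) 𝓘(ℝ, 𝔤) ∞ e 0)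
    (h0 : e 0 = 1) {ξ : 𝔤} (hξ : mfderiv 𝓘(ℝ, ℝ) 𝓘(ℝ, 𝔤) e 0 (1 : ℝ) = ξ) (α : Forms E M)
    (x : M) (k : ℕ) :
    HasDerivAt (fun s => pull (fun x : M => e s • x) (fun x => α.1 x k) x)
      ((lieOp (fundVF E M G ξ) (isSmoothVF_fundVF ξ) α).1 x k) 0 := by
  set y := extChartAt 𝓘(ℝ, E) x x with hy'
  have hy : y ∈ (extChartAt 𝓘(ℝ, E) x).target := mem_extChartAt_target x
  set u := inChart (fun x => α.1 x k) x with hu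
  set T : ℝ × E → E := fun q => trans (fun x : M => e q.1 • x) x x q.2 with hT
  have hz : e 0 • (extChartAt 𝓘(ℝ, E) x).symm y ∈ (extChartAt 𝓘(ℝ, E) x).source := by
    rw [h0, one_smul]
    exact (extChartAt 𝓘(ℝ, E) x).map_target hy
  have cT : ContDiffAt ℝ ∞ T (0, y) := contDiffAt_trans_smul he hy hz
  have T0 : ∀ z ∈ (extChartAt 𝓘(ℝ, E) x).target, T (0, z) = z := fun z hz => by
    simp only [hT, trans, h0, one_smul]
    exact (extChartAt 𝓘(ℝ, E) x).right_inv hz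
  have cD : ContDiffAt ℝ ∞ (fderiv ℝ T) (0, y) := cT.fderiv_right (by simp)
  have dT : ∀ᶠ q in 𝓝 ((0, y) : ℝ × E), DifferentiableAt ℝ T q := by
    filter_upwards [(cT.of_le (m := 1) (by simp)).eventually (by simp)] with q hq
    exact hq.differentiableAt (by simp)
  have dD : HasFDerivAt (fderiv ℝ T) (fderiv ℝ (fderiv ℝ T) (0, y)) (0, y) :=
    (cD.differentiableAt (by simp)).hasFDerivAt
  have inlD : ∀ z, HasFDerivAt (fun s : ℝ => ((s, z) : ℝ × E)) (ContinuousLinearMap.inl ℝ ℝ E) 0 :=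
    fun z => hasFDerivAt_prodMk_left 0 z
  have inrD : ∀ s z, HasFDerivAt (fun z : E => ((s, z) : ℝ × E)) (ContinuousLinearMap.inr ℝ ℝ E) z :=
    fun s z => hasFDerivAt_prodMk_right s z
  -- the vector field in the chart
  have hX : locV x (fundVF E M G ξ) =ᶠ[𝓝 y] fun z => fderiv ℝ T (0, z) (1, 0) := by
    filter_upwards [(inrD 0 y).continuousAt dT, eventually_target hy] with z hz1 hz2
    rw [← fderiv_trans_curve he h0 hξ hz2]
    have hz1 : DifferentiableAt ℝ T (0, z) := hz1
    have := (HasFDerivAt.comp (0 : ℝ) hz1.hasFDerivAt (inlD z)).fderiv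
    exact DFunLike.congr_fun this 1
  have hDX : ∀ w, fderiv ℝ (locV x (fundVF E M G ξ)) y w =
      fderiv ℝ (fderiv ℝ T) (0, y) (0, w) (1, 0) := fun w => by
    rw [hX.fderiv_eq]
    have := ((HasFDerivAt.comp y dD (inrD 0 y)).clm_apply
      (hasFDerivAt_const ((1, 0) : ℝ × E) y)).fderiv
    refine (DFunLike.congr_fun this w).trans ?_
    simp
  have hsymm := cT.isSymmSndFDerivAt (by
    simp only [minSmoothness_of_isRCLikeNormedField]; exact WithTop.coe_le_coe.2 le_top)
  -- the two factors
  have hf : HasFDerivAt (fun s : ℝ => u (T (s, y)))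
      ((fderiv ℝ u y).comp ((fderiv ℝ T (0, y)).comp (ContinuousLinearMap.inl ℝ ℝ E))) 0 := by
    have h1 : HasFDerivAt u (fderiv ℝ u y) (T (0, y)) := by
      rw [T0 y hy]
      exact (((α.2 k).contDiffAt hy).differentiableAt (by simp)).hasFDerivAt
    exact h1.comp (0 : ℝ) (HasFDerivAt.comp (0 : ℝ) dT.self_of_nhds.hasFDerivAt (inlD y))
  have hg : HasFDerivAt (fun s : ℝ => fderiv ℝ (trans (fun x : M => e s • x) x x) y)
      (((ContinuousLinearMap.compL ℝ E (ℝ × E) E).flip (ContinuousLinearMap.inr ℝ ℝ E)).comp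
        ((fderiv ℝ (fderiv ℝ T) (0, y)).comp (ContinuousLinearMap.inl ℝ ℝ E))) 0 := by
    have h1 := ((ContinuousLinearMap.compL ℝ E (ℝ × E) E).flip
      (ContinuousLinearMap.inr ℝ ℝ E)).hasFDerivAt.comp (0 : ℝ)
      (HasFDerivAt.comp (0 : ℝ) dD (inlD y))
    refine h1.congr_of_eventuallyEq ?_
    filter_upwards [(inlD y).continuousAt dT] with s hs
    have hs : DifferentiableAt ℝ T (s, y) := hs
    exact (HasFDerivAt.comp y hs.hasFDerivAt (inrD s y)).fderiv
  have hmain := (hf.continuousAlternatingMapCompContinuousLinearMap hg).hasDerivAt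
  have e0 : fderiv ℝ (trans (fun x : M => e 0 • x) x x) y = ContinuousLinearMap.id ℝ E := by
    have : (trans (fun x : M => e 0 • x) x x) =ᶠ[𝓝 y] id :=
      (eventually_target hy).mono fun z hz => T0 z hz
    rw [this.fderiv_eq, fderiv_id]
  have hval : ∀ v, (lieOp (fundVF E M G ξ) (isSmoothVF_fundVF ξ) α).1 x k v =
      fderiv ℝ u y (locV x (fundVF E M G ξ) y) v +
      ∑ i, u y (Function.update v i (fderiv ℝ (locV x (fundVF E M G ξ)) y (v i))) := by
    intro v
    have h1 := loc_lieOp (isSmoothVF_fundVF (G := G) (M := M) ξ) α hy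
    have h2 := congrFun h1 k
    rw [loc_apply, inChart_self] at h2
    rw [h2, lieLoc_apply]
    rfl
  refine HasDerivAt.congr_of_eventuallyEq (f := fun s => (u (T (s, y))).compContinuousLinearMap
    (fderiv ℝ (trans (fun x : M => e s • x) x x) y)) ?_ ?_
  · refine hmain.congr_deriv ?_
    ext v
    rw [hval]
    simp only [e0, T0 y hy]
    simp only [hDX, hX.eq_of_nhds]
    simp only [ContinuousAlternatingMap.fderivCompContinuousLinearMap]
    simp
    refine Finset.sum_congr rfl fun i _ => congrArg (u y) (funext fun j => ?_)
    by_cases hj : j = i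
    · subst hj
      simp [hsymm.eq (0, v j) (1, 0)]
    · simp [hj]
  · have h1 := inChart_pull_smul_eventually he (fun x => α.1 x k) hy hz
    filter_upwards [(inlD y).continuousAt h1] with s hs
    exact (inChart_self _ x).symm.trans hs

end JointSmoothness
end GenEquivariant
end

open scoped Manifold ContDiff Topology
noncomputable section
namespace GenEquivariant
set_option linter.unusedSectionVars false

theorem second_deriv_line {X : Type*} [NormedAddCommGroup X] [NormedSpace ℝ X]
    {Y : Type*} [NormedAddCommGroup Y] [NormedSpace ℝ Y] {F : X → Y} {v : X} {w : Y}
    (hF : ContDiffAt ℝ ∞ F 0)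
    (h : (fun s : ℝ => F (s • v)) =ᶠ[𝓝 0] fun s => F 0 + s • w) :
    fderiv ℝ (fderiv ℝ F) 0 v v = 0 := by
  have hl : ∀ s : ℝ, HasDerivAt (fun s : ℝ => s • v) v s := fun s => by
    simpa using (hasDerivAt_id s).smul_const v
  have hl' : ∀ s : ℝ, HasDerivAt (fun s : ℝ => F 0 + s • w) w s := fun s => by
    simpa using ((hasDerivAt_id s).smul_const w).const_add (F 0)
  have hl0 : (0 : ℝ) • v = 0 := zero_smul ℝ v
  have d1 : ∀ᶠ s in 𝓝 (0 : ℝ), DifferentiableAt ℝ F (s • v) := by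
    have : ∀ᶠ z in 𝓝 ((0 : ℝ) • v), DifferentiableAt ℝ F z := by
      rw [hl0]
      filter_upwards [(hF.of_le (m := 1) (by simp)).eventually (by simp)] with q hq
      exact hq.differentiableAt (by simp)
    exact (hl 0).continuousAt this
  have h1 : (fun s : ℝ => fderiv ℝ F (s • v) v) =ᶠ[𝓝 0] fun _ => w := by
    filter_upwards [d1, h.eventuallyEq_nhds] with s hs1 hs2
    have a := hs1.hasFDerivAt.comp_hasDerivAt s (hl s)
    rw [← a.deriv]
    refine (Filter.EventuallyEq.deriv_eq hs2).trans ?_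
    exact (hl' s).deriv
  have d2 : DifferentiableAt ℝ (fderiv ℝ F) ((0 : ℝ) • v) := by
    rw [hl0]
    exact (hF.fderiv_right (m := ∞) (by simp)).differentiableAt (by simp)
  have h20 : HasDerivAt (fun s : ℝ => fderiv ℝ F (s • v))
      (fderiv ℝ (fderiv ℝ F) ((0 : ℝ) • v) v) 0 := d2.hasFDerivAt.comp_hasDerivAt 0 (hl 0)
  have h2 := h20.clm_apply (hasDerivAt_const (0 : ℝ) v)
  have h2' : HasDerivAt (fun _ : ℝ => w) _ 0 := h2.congr_of_eventuallyEq h1.symm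
  have h3 := h2'.deriv
  rw [deriv_const, hl0, map_zero, add_zero] at h3
  exact h3.symm

section LieGroupCurves
variable {𝔤 : Type*} [NormedAddCommGroup 𝔤] [NormedSpace ℝ 𝔤] [FiniteDimensional ℝ 𝔤]
  {G : Type*} [TopologicalSpace G] [ChartedSpace 𝔤 G] [Group G] [LieGroup 𝓘(ℝ, 𝔤) ∞ G]

theorem isManifold_lieGroup : IsManifold 𝓘(ℝ, 𝔤) ∞ G := LieGroup.toContMDiffMul.toIsManifold

theorem contMDiff_conj (g : G) :
    ContMDiff 𝓘(ℝ, 𝔤) 𝓘(ℝ, 𝔤) ∞ (fun h : G => g * h * g⁻¹) := by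
  have h1 : ContMDiff 𝓘(ℝ, 𝔤) 𝓘(ℝ, 𝔤) ∞ (fun _ : G => g) := contMDiff_const
  exact (h1.mul contMDiff_id).mul contMDiff_const

theorem Ad_one : (Ad (1 : G) : 𝔤 →L[ℝ] 𝔤) = ContinuousLinearMap.id ℝ 𝔤 := by
  have : (fun h : G => (1 : G) * h * 1⁻¹) = id := by funext h; simp
  rw [Ad, this, mfderiv_id]
  rfl

theorem Ad_mul (g h : G) (ξ : 𝔤) : Ad (g * h) ξ = Ad g (Ad h ξ) := by
  have e1 : (fun k : G => g * h * k * (g * h)⁻¹) =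
      (fun k : G => g * k * g⁻¹) ∘ fun k : G => h * k * h⁻¹ := by
    funext k; simp [mul_assoc]
  have := mfderiv_comp_apply_of_eq (1 : G) (g := fun k : G => g * k * g⁻¹) (y := 1)
    ((contMDiff_conj (𝔤 := 𝔤) g).mdifferentiableAt (by simp))
    ((contMDiff_conj (𝔤 := 𝔤) h).mdifferentiableAt (by simp)) (by simp) ξ
  rw [← e1] at this
  exact this

theorem Ad_Ad_inv (g : G) (ξ : 𝔤) : Ad g (Ad g⁻¹ ξ) = ξ := by
  rw [← Ad_mul, mul_inv_cancel, Ad_one]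
  rfl

theorem mfderiv_curve {e : ℝ → G} (he : MDifferentiableAt 𝓘(ℝ, ℝ) 𝓘(ℝ, 𝔤) e 0) (h0 : e 0 = 1) :
    (mfderiv 𝓘(ℝ, ℝ) 𝓘(ℝ, 𝔤) e 0 (1 : ℝ) : 𝔤) =
      fderiv ℝ (fun s => extChartAt 𝓘(ℝ, 𝔤) (1 : G) (e s)) 0 1 := by
  have : IsManifold 𝓘(ℝ, 𝔤) ∞ G := isManifold_lieGroup
  have : IsManifold 𝓘(ℝ, 𝔤) 1 G := IsManifold.of_le (n := ∞) (by simp)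
  have d : MDifferentiableAt 𝓘(ℝ, 𝔤) 𝓘(ℝ, 𝔤) (extChartAt 𝓘(ℝ, 𝔤) (1 : G)) 1 :=
    (contMDiffAt_extChartAt (n := ∞)).mdifferentiableAt (by simp)
  have h := mfderiv_comp_apply_of_eq (0 : ℝ) d he h0 (1 : ℝ)
  rw [mfderiv_extChartAt_self] at h
  rw [← mfderiv_eq_fderiv]
  exact h.symm

theorem Ad_curve {e : ℝ → G} (he : MDifferentiableAt 𝓘(ℝ, ℝ) 𝓘(ℝ, 𝔤) e 0) (h0 : e 0 = 1) {ξ : 𝔤}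
    (hξ : mfderiv 𝓘(ℝ, ℝ) 𝓘(ℝ, 𝔤) e 0 (1 : ℝ) = ξ) (g : G) :
    Ad g ξ = fderiv ℝ (fun s => extChartAt 𝓘(ℝ, 𝔤) (1 : G) (g * e s * g⁻¹)) 0 1 := by
  have d := (contMDiff_conj (𝔤 := 𝔤) g).mdifferentiableAt (by simp) (x := (1 : G))
  have h := mfderiv_comp_apply_of_eq (0 : ℝ) d he h0 (1 : ℝ)
  rw [← mfderiv_curve (e := fun s => g * e s * g⁻¹)
    (MDifferentiableAt.comp (0 : ℝ) (by rwa [h0]) he) (by simp [h0])]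
  rw [← hξ]
  exact h.symm

/-- The curve through `1` that is a straight line with velocity `ξ` in the chart at `1`. -/
def chartCurve (G : Type*) [TopologicalSpace G] [ChartedSpace 𝔤 G] [Group G] (ξ : 𝔤) (s : ℝ) : G :=
  (extChartAt 𝓘(ℝ, 𝔤) (1 : G)).symm (extChartAt 𝓘(ℝ, 𝔤) (1 : G) 1 + s • ξ)

theorem chartCurve_zero (ξ : 𝔤) : chartCurve G ξ 0 = 1 := by
  rw [chartCurve, zero_smul, add_zero]
  exact (extChartAt 𝓘(ℝ, 𝔤) (1 : G)).left_inv (mem_extChartAt_source (1 : G))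

theorem chartCurve_contMDiffAt (ξ : 𝔤) {s : ℝ}
    (hs : extChartAt 𝓘(ℝ, 𝔤) (1 : G) 1 + s • ξ ∈ (extChartAt 𝓘(ℝ, 𝔤) (1 : G)).target) :
    ContMDiffAt 𝓘(ℝ, ℝ) 𝓘(ℝ, 𝔤) ∞ (chartCurve G ξ) s := by
  have : IsManifold 𝓘(ℝ, 𝔤) ∞ G := isManifold_lieGroup
  have h : ContDiff ℝ ∞ (fun s : ℝ => extChartAt 𝓘(ℝ, 𝔤) (1 : G) 1 + s • ξ) :=
    contDiff_const.add (contDiff_id.smul contDiff_const)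
  exact ContMDiffAt.comp s ((contMDiffOn_extChartAt_symm (1 : G)).contMDiffAt
    ((isOpen_extChartAt_target (1 : G)).mem_nhds hs)) h.contMDiff.contMDiffAt

theorem chartCurve_mem_target (ξ : 𝔤) :
    extChartAt 𝓘(ℝ, 𝔤) (1 : G) 1 + (0 : ℝ) • ξ ∈ (extChartAt 𝓘(ℝ, 𝔤) (1 : G)).target := by
  rw [zero_smul, add_zero]
  exact mem_extChartAt_target (1 : G)

theorem chart_chartCurve_eventually (ξ : 𝔤) :
    (fun s => extChartAt 𝓘(ℝ, 𝔤) (1 : G) (chartCurve G ξ s)) =ᶠ[𝓝 0]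
      fun s => extChartAt 𝓘(ℝ, 𝔤) (1 : G) 1 + s • ξ := by
  have c : Continuous (fun s : ℝ => extChartAt 𝓘(ℝ, 𝔤) (1 : G) 1 + s • ξ) := by fun_prop
  filter_upwards [c.continuousAt.preimage_mem_nhds
    ((isOpen_extChartAt_target (I := 𝓘(ℝ, 𝔤)) (1 : G)).mem_nhds (chartCurve_mem_target ξ))] with s hs
  exact (extChartAt 𝓘(ℝ, 𝔤) (1 : G)).right_inv hs

theorem hasDerivAt_line (a ξ : 𝔤) (s : ℝ) : HasDerivAt (fun s : ℝ => a + s • ξ) ξ s := by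
  simpa using ((hasDerivAt_id s).smul_const ξ).const_add a

theorem mfderiv_chartCurve (ξ : 𝔤) :
    (mfderiv 𝓘(ℝ, ℝ) 𝓘(ℝ, 𝔤) (chartCurve G ξ) 0 (1 : ℝ) : 𝔤) = ξ := by
  rw [mfderiv_curve ((chartCurve_contMDiffAt ξ (chartCurve_mem_target ξ)).mdifferentiableAt
    (by simp)) (chartCurve_zero ξ), (chart_chartCurve_eventually ξ).fderiv_eq]
  exact (hasDerivAt_line _ ξ 0).deriv

theorem hasDerivAt_Ad_chartCurve (ξ : 𝔤) : HasDerivAt (fun s => Ad (chartCurve G ξ s) ξ) 0 0 := by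
  have : IsManifold 𝓘(ℝ, 𝔤) ∞ G := isManifold_lieGroup
  set c := chartCurve G ξ with hc
  have c0 : c 0 = 1 := chartCurve_zero ξ
  have cs := chartCurve_contMDiffAt (G := G) ξ (chartCurve_mem_target ξ)
  let F : ℝ × ℝ → 𝔤 := fun q => extChartAt 𝓘(ℝ, 𝔤) (1 : G) (c q.1 * c q.2 * (c q.1)⁻¹)
  have sF : ContDiffAt ℝ ∞ F 0 := by
    rw [← contMDiffAt_iff_contDiffAt]
    have h1 : ContMDiffAt 𝓘(ℝ, ℝ × ℝ) 𝓘(ℝ, 𝔤) ∞ (fun q : ℝ × ℝ => c q.1) 0 :=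
      ContMDiffAt.comp (0 : ℝ × ℝ) (g := c) (f := Prod.fst) cs contDiff_fst.contMDiff.contMDiffAt
    have h2 : ContMDiffAt 𝓘(ℝ, ℝ × ℝ) 𝓘(ℝ, 𝔤) ∞ (fun q : ℝ × ℝ => c q.2) 0 :=
      ContMDiffAt.comp (0 : ℝ × ℝ) (g := c) (f := Prod.snd) cs contDiff_snd.contMDiff.contMDiffAt
    have h3 := (h1.mul h2).mul h1.inv
    refine ContMDiffAt.comp (0 : ℝ × ℝ) (g := extChartAt 𝓘(ℝ, 𝔤) (1 : G))
      (f := fun q : ℝ × ℝ => c q.1 * c q.2 * (c q.1)⁻¹) ?_ h3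
    have : c (0 : ℝ × ℝ).1 * c (0 : ℝ × ℝ).2 * (c (0 : ℝ × ℝ).1)⁻¹ = 1 := by simp [c0]
    rw [this]
    exact contMDiffAt_extChartAt
  have F0 : F 0 = extChartAt 𝓘(ℝ, 𝔤) (1 : G) 1 := by simp [F, c0]
  have D1 : fderiv ℝ (fderiv ℝ F) 0 (1, 0) (1, 0) = 0 := by
    refine second_deriv_line (w := 0) sF ?_
    exact Filter.Eventually.of_forall fun s => by simp [F, c0]
  have D2 : fderiv ℝ (fderiv ℝ F) 0 (0, 1) (0, 1) = 0 := by
    refine second_deriv_line (w := ξ) sF ?_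
    filter_upwards [chart_chartCurve_eventually (G := G) ξ] with s hs
    rw [F0, ← hs]
    show extChartAt 𝓘(ℝ, 𝔤) (1 : G) (c (s • 0) * c (s • 1) * (c (s • 0))⁻¹) = _
    rw [smul_zero, smul_eq_mul, mul_one, c0, one_mul, inv_one, mul_one]
  have D3 : fderiv ℝ (fderiv ℝ F) 0 (1, 1) (1, 1) = 0 := by
    refine second_deriv_line (w := ξ) sF ?_
    filter_upwards [chart_chartCurve_eventually (G := G) ξ] with s hs
    rw [F0, ← hs]
    simp [F, hc]
  have hsymm := sF.isSymmSndFDerivAt (by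
    simp only [minSmoothness_of_isRCLikeNormedField]; exact WithTop.coe_le_coe.2 le_top)
  have D : fderiv ℝ (fderiv ℝ F) 0 (1, 0) (0, 1) = 0 := by
    have e : ((1, 1) : ℝ × ℝ) = (1, 0) + (0, 1) := by simp
    have h2 := hsymm.eq (1, 0) (0, 1)
    rw [e] at D3
    simp only [map_add, add_apply, D1, D2, ← h2, zero_add, add_zero] at D3
    rw [← two_smul ℝ] at D3
    exact (smul_eq_zero.1 D3).resolve_left two_ne_zero
  have inlD : HasDerivAt (fun s : ℝ => ((s, 0) : ℝ × ℝ)) (1, 0) 0 :=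
    (hasDerivAt_id 0).prodMk (hasDerivAt_const 0 0)
  have dF : ∀ᶠ q in 𝓝 ((0 : ℝ), (0 : ℝ)), DifferentiableAt ℝ F q := by
    filter_upwards [(sF.of_le (m := 1) (by simp)).eventually (by simp)] with q hq
    exact hq.differentiableAt (by simp)
  have h1 : (fun s => Ad (c s) ξ) =ᶠ[𝓝 0] fun s => fderiv ℝ F (s, 0) (0, 1) := by
    filter_upwards [inlD.continuousAt dF] with s hs
    have hs : DifferentiableAt ℝ F (s, 0) := hs
    have a := Ad_curve (cs.mdifferentiableAt (by simp)) c0 (mfderiv_chartCurve ξ) (c s)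
    rw [a]
    have b := (hs.hasFDerivAt.comp (0 : ℝ) (hasFDerivAt_prodMk_right s (0 : ℝ))).fderiv
    refine (DFunLike.congr_fun b 1).trans ?_
    simp
  have d2 : DifferentiableAt ℝ (fderiv ℝ F) (0, 0) :=
    (sF.fderiv_right (m := ∞) (by simp)).differentiableAt (by simp)
  have h2 := (HasFDerivAt.comp_hasDerivAt (0 : ℝ) (f := fun s : ℝ => ((s, 0) : ℝ × ℝ))
    d2.hasFDerivAt inlD).clm_apply
    (hasDerivAt_const (0 : ℝ) ((0, 1) : ℝ × ℝ))
  refine HasDerivAt.congr_of_eventuallyEq (h2.congr_deriv ?_) h1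
  have e0 : ((0, 0) : ℝ × ℝ) = 0 := rfl
  rw [map_zero, add_zero, e0]
  exact D

end LieGroupCurves
end GenEquivariant
end

open scoped Manifold ContDiff Topology
noncomputable section
namespace GenEquivariant
set_option linter.unusedSectionVars false
open MeasureTheory

universe u

section Families
variable {𝔤 : Type*} [NormedAddCommGroup 𝔤] [NormedSpace ℝ 𝔤]
  {G : Type*} [TopologicalSpace G] [ChartedSpace 𝔤 G]
  {E : Type u} [NormedAddCommGroup E] [NormedSpace ℝ E]
  {F : Type u} [NormedAddCommGroup F] [NormedSpace ℝ F]

/-- A family of functions on `U ⊆ E` with parameter in the manifold `G`, jointly smooth. -/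
def SmoothFamily (𝔤 : Type*) [NormedAddCommGroup 𝔤] [NormedSpace ℝ 𝔤] [ChartedSpace 𝔤 G]
    (Φ : G → E → F) (U : Set E) : Prop :=
  ∀ g₀ : G, ∀ y ∈ U, ContDiffAt ℝ ∞
    (fun q : 𝔤 × E => Φ ((extChartAt 𝓘(ℝ, 𝔤) g₀).symm q.1) q.2) (extChartAt 𝓘(ℝ, 𝔤) g₀ g₀, y)

theorem SmoothFamily.fderiv {Φ : G → E → F} {U : Set E} (h : SmoothFamily 𝔤 Φ U) :
    SmoothFamily 𝔤 (fun g => fderiv ℝ (Φ g)) U := by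
  intro g₀ y hy
  refine ContDiffAt.fderiv (f := fun (q : 𝔤 × E) z => Φ ((extChartAt 𝓘(ℝ, 𝔤) g₀).symm q.1) z)
    (g := fun q => q.2) (n := ∞) ?_ contDiffAt_snd (by simp)
  exact (h g₀ y hy).comp ((extChartAt 𝓘(ℝ, 𝔤) g₀ g₀, y), y)
    (f := fun p : (𝔤 × E) × E => (p.1.1, p.2))
    ((contDiff_fst.comp contDiff_fst).prodMk contDiff_snd).contDiffAt

theorem SmoothFamily.continuousAt {Φ : G → E → F} {U : Set E} (h : SmoothFamily 𝔤 Φ U) (g₀ : G)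
    {y : E} (hy : y ∈ U) : ContinuousAt (fun p : G × E => Φ p.1 p.2) (g₀, y) := by
  have h1 : ContinuousAt (fun p : G × E => (extChartAt 𝓘(ℝ, 𝔤) g₀ p.1, p.2)) (g₀, y) :=
    ((continuousAt_extChartAt (I := 𝓘(ℝ, 𝔤)) g₀).comp (f := Prod.fst) (x := (g₀, y))
      continuousAt_fst).prodMk continuousAt_snd
  have h2 := ContinuousAt.comp (f := fun p : G × E => (extChartAt 𝓘(ℝ, 𝔤) g₀ p.1, p.2))
    (g := fun q : 𝔤 × E => Φ ((extChartAt 𝓘(ℝ, 𝔤) g₀).symm q.1) q.2) (x := (g₀, y))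
    (h g₀ y hy).continuousAt h1
  refine h2.congr ?_
  filter_upwards [(continuousAt_fst (p := (g₀, y))).preimage_mem_nhds
    (extChartAt_source_mem_nhds (I := 𝓘(ℝ, 𝔤)) g₀)] with p hp
  simp only [Function.comp_apply]
  rw [(extChartAt 𝓘(ℝ, 𝔤) g₀).left_inv hp]

theorem SmoothFamily.continuous {Φ : G → E → F} {U : Set E} (h : SmoothFamily 𝔤 Φ U)
    {y : E} (hy : y ∈ U) : Continuous (fun g : G => Φ g y) :=
  continuous_iff_continuousAt.2 fun g => ContinuousAt.comp (f := fun g : G => (g, y))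
    (g := fun p : G × E => Φ p.1 p.2) (h.continuousAt g hy) (by fun_prop)

theorem SmoothFamily.differentiableAt {Φ : G → E → F} {U : Set E} (h : SmoothFamily 𝔤 Φ U) (g₀ : G)
    {y : E} (hy : y ∈ U) : DifferentiableAt ℝ (Φ g₀) y := by
  have h1 := (h g₀ y hy).comp y
    (f := fun z : E => (extChartAt 𝓘(ℝ, 𝔤) g₀ g₀, z)) (contDiff_prodMk_right _).contDiffAt
  have h2 : (fun z : E => Φ g₀ z) = (fun q : 𝔤 × E => Φ ((extChartAt 𝓘(ℝ, 𝔤) g₀).symm q.1) q.2) ∘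
      fun z : E => (extChartAt 𝓘(ℝ, 𝔤) g₀ g₀, z) := by
    funext z
    simp only [Function.comp_apply]
    rw [(extChartAt 𝓘(ℝ, 𝔤) g₀).left_inv (mem_extChartAt_source g₀)]
  rw [← h2] at h1
  exact h1.differentiableAt (by simp)

theorem SmoothFamily.bound [CompactSpace G] {Φ : G → E → F} {U : Set E} (h : SmoothFamily 𝔤 Φ U)
    {y : E} (hy : y ∈ U) : ∃ C, ∀ᶠ z in 𝓝 y, ∀ g, ‖Φ g z‖ ≤ C := by
  obtain ⟨C, hC⟩ := (isCompact_range (h.continuous hy).norm).bddAbove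
  refine ⟨C + 1, ?_⟩
  have := (isCompact_univ (X := G)).eventually_forall_of_forall_eventually (x₀ := y)
    (P := fun z g => ‖Φ g z‖ ≤ C + 1) fun g _ => by
      have h1 : ContinuousAt (fun p : E × G => ‖Φ p.2 p.1‖) (y, g) :=
        ContinuousAt.norm (ContinuousAt.comp (f := fun p : E × G => (p.2, p.1))
          (g := fun p : G × E => Φ p.1 p.2) (x := (y, g)) (h.continuousAt g hy) (by fun_prop))
      have h2 : ‖Φ g y‖ < C + 1 := (hC ⟨g, rfl⟩).trans_lt (by linarith)
      exact (h1.eventually_lt_const h2).mono fun p hp => hp.le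
  exact this.mono fun z hz g => hz g (Set.mem_univ g)

variable [CompactSpace G] [T2Space G] [FiniteDimensional ℝ 𝔤] [MeasurableSpace G] [BorelSpace G]
  {P : Type*} [MeasurableSpace P] {μ : Measure P} {γ : P → G} {c : P → ℝ}

theorem secondCountable_of_charted (𝔤 G : Type*) [NormedAddCommGroup 𝔤] [NormedSpace ℝ 𝔤]
    [FiniteDimensional ℝ 𝔤] [TopologicalSpace G] [ChartedSpace 𝔤 G] [CompactSpace G] :
    SecondCountableTopology G :=
  have : ProperSpace 𝔤 := FiniteDimensional.proper ℝ 𝔤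
  ChartedSpace.secondCountable_of_sigmaCompact 𝔤 G

theorem integrable_smul_continuous (𝔤 : Type*) [NormedAddCommGroup 𝔤] [NormedSpace ℝ 𝔤]
    [FiniteDimensional ℝ 𝔤] [ChartedSpace 𝔤 G] (hγ : Measurable γ) (hc : Integrable c μ)
    {f : G → F} (hf : Continuous f) : Integrable (fun p => c p • f (γ p)) μ := by
  have := secondCountable_of_charted 𝔤 G
  obtain ⟨C, hC⟩ := (isCompact_range hf.norm).bddAbove
  have h1 : AEStronglyMeasurable (fun p => f (γ p)) μ :=
    (hf.stronglyMeasurable.comp_measurable hγ).aestronglyMeasurable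
  refine (hc.norm.mul_const C).mono' (hc.aestronglyMeasurable.smul h1)
    (Filter.Eventually.of_forall fun p => ?_)
  rw [norm_smul]
  exact mul_le_mul_of_nonneg_left (hC ⟨γ p, rfl⟩) (norm_nonneg _)

theorem SmoothFamily.hasFDerivAt_integral {Φ : G → E → F} {U : Set E} (h : SmoothFamily 𝔤 Φ U)
    (hU : IsOpen U) (hγ : Measurable γ) (hc : Integrable c μ) {y : E} (hy : y ∈ U) :
    HasFDerivAt (fun z => ∫ p, c p • Φ (γ p) z ∂μ)
      (∫ p, c p • _root_.fderiv ℝ (Φ (γ p)) y ∂μ) y := by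
  obtain ⟨C, hC⟩ := h.fderiv.bound hy
  refine hasFDerivAt_integral_of_dominated_of_fderiv_le (F := fun z p => c p • Φ (γ p) z)
    (F' := fun z p => c p • _root_.fderiv ℝ (Φ (γ p)) z) (bound := fun p => ‖c p‖ * C)
    (Filter.inter_mem hC (hU.mem_nhds hy)) ?_ ?_ ?_ ?_ ?_ ?_
  · filter_upwards [hU.mem_nhds hy] with z hz
    exact (integrable_smul_continuous 𝔤 hγ hc (h.continuous hz)).aestronglyMeasurable
  · exact integrable_smul_continuous 𝔤 hγ hc (h.continuous hy)
  · exact (integrable_smul_continuous 𝔤 hγ hc (h.fderiv.continuous hy)).aestronglyMeasurable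
  · refine Filter.Eventually.of_forall fun p z hz => ?_
    rw [norm_smul]
    exact mul_le_mul_of_nonneg_left (hz.1 _) (norm_nonneg _)
  · exact hc.norm.mul_const C
  · exact Filter.Eventually.of_forall fun p z hz =>
      (h.differentiableAt (γ p) hz.2).hasFDerivAt.const_smul (c p)

theorem SmoothFamily.contDiffOn_integral_nat (n : ℕ) : ∀ {F : Type u} [NormedAddCommGroup F]
    [NormedSpace ℝ F] {Φ : G → E → F} {U : Set E}, SmoothFamily 𝔤 Φ U → IsOpen U →
    Measurable γ → Integrable c μ →
    ContDiffOn ℝ n (fun z => ∫ p, c p • Φ (γ p) z ∂μ) U := by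
  induction n with
  | zero =>
    intro F _ _ Φ U h hU hγ hc
    exact contDiffOn_zero.2 fun y hy =>
      (h.hasFDerivAt_integral hU hγ hc hy).continuousAt.continuousWithinAt
  | succ n ih =>
    intro F _ _ Φ U h hU hγ hc
    rw [Nat.cast_succ]
    refine (contDiffOn_succ_iff_fderiv_of_isOpen hU).2 ⟨fun y hy =>
      (h.hasFDerivAt_integral hU hγ hc hy).differentiableAt.differentiableWithinAt,
      fun hn => absurd hn WithTop.coe_ne_top, ?_⟩
    exact (ih h.fderiv hU hγ hc).congr fun y hy => (h.hasFDerivAt_integral hU hγ hc hy).fderiv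

theorem SmoothFamily.contDiffOn_integral {Φ : G → E → F} {U : Set E} (h : SmoothFamily 𝔤 Φ U)
    (hU : IsOpen U) (hγ : Measurable γ) (hc : Integrable c μ) :
    ContDiffOn ℝ ∞ (fun z => ∫ p, c p • Φ (γ p) z ∂μ) U :=
  contDiffOn_infty.2 fun n => contDiffOn_integral_nat n h hU hγ hc

end Families

section Integration
variable {E : Type u} [NormedAddCommGroup E] [NormedSpace ℝ E] [FiniteDimensional ℝ E]
  {M : Type*} [TopologicalSpace M] [ChartedSpace E M] [IsManifold 𝓘(ℝ, E) ∞ M]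
  {𝔤 : Type*} [NormedAddCommGroup 𝔤] [NormedSpace ℝ 𝔤] [FiniteDimensional ℝ 𝔤]
  {G : Type*} [TopologicalSpace G] [ChartedSpace 𝔤 G] [Group G] [LieGroup 𝓘(ℝ, 𝔤) ∞ G]
  [MulAction G M] [ContMDiffSMul 𝓘(ℝ, 𝔤) 𝓘(ℝ, E) ∞ G M]

theorem smoothFamily_translate (α : Forms E M) (x₀ : M) (k : ℕ) :
    SmoothFamily 𝔤 (fun (g : G) y => loc x₀ (translate E M 𝔤 g α).1 y k)
      (extChartAt 𝓘(ℝ, E) x₀).target := by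
  intro g₀ y hy
  have : IsManifold 𝓘(ℝ, 𝔤) ∞ G := isManifold_lieGroup
  have he : ContMDiffAt 𝓘(ℝ, 𝔤) 𝓘(ℝ, 𝔤) ∞ (fun z => ((extChartAt 𝓘(ℝ, 𝔤) g₀).symm z)⁻¹)
      (extChartAt 𝓘(ℝ, 𝔤) g₀ g₀) :=
    ((contMDiffOn_extChartAt_symm g₀).contMDiffAt
      ((isOpen_extChartAt_target g₀).mem_nhds (mem_extChartAt_target g₀))).inv
  exact contDiffAt_inChart_pull_smul he (α.2 k) hy

theorem continuous_translate (𝔤 : Type*) [NormedAddCommGroup 𝔤] [NormedSpace ℝ 𝔤]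
    [FiniteDimensional ℝ 𝔤] [ChartedSpace 𝔤 G] [LieGroup 𝓘(ℝ, 𝔤) ∞ G]
    [ContMDiffSMul 𝓘(ℝ, 𝔤) 𝓘(ℝ, E) ∞ G M] (α : Forms E M) (x : M) (k : ℕ) :
    Continuous (fun g : G => (translate E M 𝔤 g α).1 x k) := by
  have h := (smoothFamily_translate (𝔤 := 𝔤) (G := G) α x k).continuous
    (mem_extChartAt_target (I := 𝓘(ℝ, E)) x)
  simp only [loc_apply, inChart_self] at h
  exact h

variable [CompactSpace G] [T2Space G] [MeasurableSpace G] [BorelSpace G]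
  {P : Type*} [MeasurableSpace P] {μ : Measure P} {γ : P → G} {c : P → ℝ}

theorem integrable_translate (hγ : Measurable γ) (hc : Integrable c μ) (α : Forms E M) (x : M)
    (k : ℕ) : Integrable (fun p => c p • (translate E M 𝔤 (γ p) α).1 x k) μ :=
  integrable_smul_continuous (F := E [⋀^Fin k]→L[ℝ] ℂ) (f := fun g : G =>
    (translate E M 𝔤 g α).1 x k) 𝔤 hγ hc (continuous_translate 𝔤 α x k)

theorem inChart_integral_translate (hγ : Measurable γ) (hc : Integrable c μ) (α : Forms E M)
    (x₀ : M) (k : ℕ) (y : E) :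
    inChart (fun x => ∫ p, c p • (translate E M 𝔤 (γ p) α).1 x k ∂μ) x₀ y =
      ∫ p, c p • loc x₀ (translate E M 𝔤 (γ p) α).1 y k ∂μ := by
  have h := ContinuousLinearMap.integral_comp_comm
    (ContinuousAlternatingMap.compContinuousLinearMapCLM (𝕜 := ℝ) (ι := Fin k) (F := ℂ)
      (dchartSymm x₀ y)) (integrable_translate (𝔤 := 𝔤) hγ hc α ((extChartAt 𝓘(ℝ, E) x₀).symm y) k)
  exact h.symm

/-- The integral `∫ c(p) (γ(p) · α) dμ(p)` of translates of a form. -/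
def integ (𝔤 : Type*) [NormedAddCommGroup 𝔤] [NormedSpace ℝ 𝔤]
    [FiniteDimensional ℝ 𝔤] [ChartedSpace 𝔤 G] [LieGroup 𝓘(ℝ, 𝔤) ∞ G]
    [ContMDiffSMul 𝓘(ℝ, 𝔤) 𝓘(ℝ, E) ∞ G M] (hγ : Measurable γ) (hc : Integrable c μ) :
    Forms E M →ₗ[ℂ] Forms E M where
  toFun α := mkForm (fun x k => ∫ p, c p • (translate E M 𝔤 (γ p) α).1 x k ∂μ) fun k x₀ => by
    refine ((smoothFamily_translate (𝔤 := 𝔤) (G := G) α x₀ k).contDiffOn_integral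
      (isOpen_extChartAt_target x₀) hγ hc).congr fun y _ => ?_
    exact inChart_integral_translate hγ hc α x₀ k y
  map_add' α β := Forms.ext fun x => funext fun k => by
    refine Eq.trans ?_ (integral_add (integrable_translate (𝔤 := 𝔤) hγ hc α x k)
      (integrable_translate (𝔤 := 𝔤) hγ hc β x k))
    refine integral_congr_ae (Filter.Eventually.of_forall fun p => ?_)
    simp only [map_add]
    exact smul_add (A := E [⋀^Fin k]→L[ℝ] ℂ) _ _ _
  map_smul' a α := Forms.ext fun x => funext fun k => by
    refine Eq.trans ?_ (integral_smul a fun p => c p • (translate E M 𝔤 (γ p) α).1 x k)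
    refine integral_congr_ae (Filter.Eventually.of_forall fun p => ?_)
    simp only [map_smul]
    exact smul_comm (c p) a ((translate E M 𝔤 (γ p) α).1 x k)

theorem integ_apply (hγ : Measurable γ) (hc : Integrable c μ) (α : Forms E M) (x : M) (k : ℕ) :
    (integ 𝔤 hγ hc α).1 x k = ∫ p, c p • (translate E M 𝔤 (γ p) α).1 x k ∂μ := rfl

theorem loc_integ (hγ : Measurable γ) (hc : Integrable c μ) (α : Forms E M) (x₀ : M) (y : E)
    (k : ℕ) : loc x₀ (integ 𝔤 hγ hc α).1 y k =
      ∫ p, c p • loc x₀ (translate E M 𝔤 (γ p) α).1 y k ∂μ :=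
  inChart_integral_translate hγ hc α x₀ k y

theorem lam_linear_integral (T : Lam E →ₗ[ℂ] Lam E) {f : P → Lam E}
    (hf : ∀ k, Integrable (fun p => f p k) μ) (k : ℕ) :
    T (fun k => ∫ p, f p k ∂μ) k = ∫ p, T (f p) k ∂μ := by
  let L : ∀ j, (E [⋀^Fin j]→L[ℝ] ℂ) →L[ℂ] (E [⋀^Fin k]→L[ℝ] ℂ) := fun j =>
    LinearMap.toContinuousLinearMap (LinearMap.proj k ∘ₗ T ∘ₗ LinearMap.single ℂ (fun j => E [⋀^Fin j]→L[ℝ] ℂ) j)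
  have key : ∀ b : Lam E, T b k = ∑ j ∈ Finset.range (Module.finrank ℝ E + 1), L j (b j) := by
    intro b
    conv_lhs => rw [lam_eq_sum_single b]
    rw [map_sum, Finset.sum_apply]
    rfl
  rw [key]
  simp only [key]
  rw [integral_finsetSum _ fun j _ => (L j).integrable_comp (hf j)]
  exact Finset.sum_congr rfl fun j _ => ((L j).integral_comp_comm (hf j)).symm

theorem dTotal_translate (𝔤 : Type*) [NormedAddCommGroup 𝔤] [NormedSpace ℝ 𝔤]
    [FiniteDimensional ℝ 𝔤] [ChartedSpace 𝔤 G] [LieGroup 𝓘(ℝ, 𝔤) ∞ G]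
    [ContMDiffSMul 𝓘(ℝ, 𝔤) 𝓘(ℝ, E) ∞ G M] (g : G) (α : Forms E M) :
    dTotal (translate E M 𝔤 g α) = translate E M 𝔤 g (dTotal α) :=
  dTotal_pullOp _ α

theorem dTotal_integ (hγ : Measurable γ) (hc : Integrable c μ) (α : Forms E M) :
    dTotal (integ 𝔤 hγ hc α) = integ 𝔤 hγ hc (dTotal α) := by
  refine Forms.ext fun x => funext fun k => ?_
  cases k with
  | zero =>
    rw [integ_apply]
    refine Eq.symm ((integral_congr_ae (g := fun _ => 0) (Filter.Eventually.of_forall fun p => ?_)).trans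
      (integral_zero _ _))
    show c p • (translate E M 𝔤 (γ p) (dTotal α)).1 x 0 = 0
    rw [← dTotal_translate]
    exact smul_zero (A := E [⋀^Fin 0]→L[ℝ] ℂ) (c p)
  | succ k =>
    have hy := mem_extChartAt_target (I := 𝓘(ℝ, E)) x
    have hF := smoothFamily_translate (𝔤 := 𝔤) (G := G) α x k
    have h1 := hF.hasFDerivAt_integral (isOpen_extChartAt_target x) hγ hc hy
    have e1 : ∀ β : Forms E M, (dTotal β).1 x (k + 1) =
        ContinuousAlternatingMap.alternatizeUncurryFinCLM ℝ E ℂ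
          (fderiv ℝ (fun y => loc x β.1 y k) (extChartAt 𝓘(ℝ, E) x x)) := by
      intro β
      have := inChart_extd (β.2 k) hy
      rw [inChart_self] at this
      exact this
    rw [e1, integ_apply]
    have e2 : (fun y => loc x (integ 𝔤 hγ hc α).1 y k) =
        fun y => ∫ p, c p • loc x (translate E M 𝔤 (γ p) α).1 y k ∂μ :=
      funext fun y => loc_integ hγ hc α x y k
    rw [e2, h1.fderiv, ← ContinuousLinearMap.integral_comp_comm _
      (integrable_smul_continuous 𝔤 hγ hc (hF.fderiv.continuous hy))]
    refine integral_congr_ae (Filter.Eventually.of_forall fun p => ?_)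
    simp only [map_smul]
    rw [← dTotal_translate, e1]

theorem pointwise_integ (hγ : Measurable γ) (hc : Integrable c μ) {T : M → Lam E →ₗ[ℂ] Lam E}
    (hT : ∀ α ∈ Omega E M, (fun x => T x (α x)) ∈ Omega E M)
    (h : ∀ (g : G) (α : Forms E M), pointwise T hT (translate E M 𝔤 g α) =
      translate E M 𝔤 g (pointwise T hT α)) (α : Forms E M) :
    pointwise T hT (integ 𝔤 hγ hc α) = integ 𝔤 hγ hc (pointwise T hT α) := by
  refine Forms.ext fun x => funext fun k => ?_
  rw [integ_apply]
  let f : P → Lam E := fun p => (c p : ℂ) • ((translate E M 𝔤 (γ p) α).1 x : Lam E)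
  have hf : ∀ k, Integrable (fun p => f p k) μ := fun k => integrable_translate (𝔤 := 𝔤) hγ hc α x k
  refine Eq.trans ?_ ((lam_linear_integral (T x) hf k).trans ?_)
  · refine congrFun (congrArg (T x) (funext fun k => ?_)) k
    rw [integ_apply]
    rfl
  refine integral_congr_ae (Filter.Eventually.of_forall fun p => ?_)
  simp only [f, map_smul]
  rw [← h]
  rfl

end Integration
end GenEquivariant
end

open scoped Manifold ContDiff Topology
noncomputable section
namespace GenEquivariant
set_option linter.unusedSectionVars false
open MeasureTheory

universe u

section Action
variable {E : Type u} [NormedAddCommGroup E] [NormedSpace ℝ E] [FiniteDimensional ℝ E]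
  {M : Type*} [TopologicalSpace M] [T2Space M] [ChartedSpace E M] [IsManifold 𝓘(ℝ, E) ∞ M]
  {𝔤 : Type*} [NormedAddCommGroup 𝔤] [NormedSpace ℝ 𝔤] [FiniteDimensional ℝ 𝔤]
  {G : Type*} [TopologicalSpace G] [ChartedSpace 𝔤 G] [Group G] [LieGroup 𝓘(ℝ, 𝔤) ∞ G]
  [MulAction G M] [ContMDiffSMul 𝓘(ℝ, 𝔤) 𝓘(ℝ, E) ∞ G M]

theorem translate_one (α : Forms E M) : translate E M 𝔤 (1 : G) α = α := Forms.ext fun x => by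
  have e : (fun y : M => (1 : G)⁻¹ • y) = id := by funext y; simp
  rw [translate_apply, e, tmap, mfderiv_id]
  rw [inv_one, one_smul]
  rfl

theorem tmap_smul_mul (𝔤 : Type*) [NormedAddCommGroup 𝔤] [NormedSpace ℝ 𝔤]
    [ChartedSpace 𝔤 G] [ContMDiffSMul 𝓘(ℝ, 𝔤) 𝓘(ℝ, E) ∞ G M] (g h : G) (x : M) :
    tmap (E := E) (fun y : M => (g * h) • y) x =
      (tmap (E := E) (fun y : M => g • y) (h • x)).comp (tmap (fun y : M => h • y) x) := by
  have h1 := (contMDiff_smul_const (E := E) (M := M) 𝔤 g).mdifferentiableAt (by simp) (x := h • x)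
  have h2 := (contMDiff_smul_const (E := E) (M := M) 𝔤 h).mdifferentiableAt (by simp) (x := x)
  have h3 := mfderiv_comp x h1 h2
  have e : (fun y : M => g • y) ∘ (fun y : M => h • y) = fun y : M => (g * h) • y :=
    funext fun y => (mul_smul g h y).symm
  rw [e] at h3
  exact h3

theorem translate_mul (g h : G) (α : Forms E M) :
    translate E M 𝔤 (g * h) α = translate E M 𝔤 g (translate E M 𝔤 h α) := Forms.ext fun x => by
  rw [translate_apply, translate_apply, translate_apply, lamComp_lamComp, mul_inv_rev,
    tmap_smul_mul 𝔤, mul_smul]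

section Integration
variable {H : ClosedThreeForm E M} {𝒥 : GCStructure E M H}
  [CompactSpace G] [T2Space G] [MeasurableSpace G] [BorelSpace G]
  {P : Type*} [MeasurableSpace P] {μ : Measure P} {γ : P → G} {c : P → ℝ}

theorem dH_integ (A : HamiltonianAction 𝔤 G 𝒥) (hγ : Measurable γ) (hc : Integrable c μ)
    (α : Forms E M) : dH H (integ 𝔤 hγ hc α) = integ 𝔤 hγ hc (dH H α) := by
  have h : ∀ β : Forms E M, wedgeThreeOp H.toFun H.smooth β = dTotal β - dH H β := fun β => by
    rw [dH_apply, sub_sub_cancel]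
  have := pointwise_integ (𝔤 := 𝔤) hγ hc (wedgeThree_mem H.smooth) (fun g β => by
    refine (h _).trans (Eq.trans ?_ (congrArg (translate E M 𝔤 g) (h β)).symm)
    rw [dTotal_translate, dH_translate A, map_sub]) α
  have h2 : wedgeThreeOp H.toFun H.smooth (integ 𝔤 hγ hc α) =
    integ 𝔤 hγ hc (wedgeThreeOp H.toFun H.smooth α) := this
  rw [dH_apply, dH_apply, dTotal_integ, h2, map_sub]

theorem integ_UDeg (A : HamiltonianAction 𝔤 G 𝒥) (hγ : Measurable γ) (hc : Integrable c μ) {k : ℤ}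
    {α : Forms E M} (hα : α ∈ UDeg 𝒥.J k) : integ 𝔤 hγ hc α ∈ UDeg 𝒥.J k := by
  rw [UDeg_eq, Module.End.mem_eigenspace_iff] at hα ⊢
  have := pointwise_integ (𝔤 := 𝔤) hγ hc (spin_mem 𝒥.smooth)
    (fun g β => Forms.ext fun x => spin_translate A g β x) α
  refine this.trans ?_
  rw [← map_smul, ← hα]
  rfl

theorem del_integ (A : HamiltonianAction 𝔤 G 𝒥) (hγ : Measurable γ) (hc : Integrable c μ)
    (α : Forms E M) : del 𝒥 (integ 𝔤 hγ hc α) = integ 𝔤 hγ hc (del 𝒥 α) :=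
  del_comm (fun _ _ hα => integ_UDeg A hγ hc hα) (dH_integ A hγ hc) α

theorem delbar_integ (A : HamiltonianAction 𝔤 G 𝒥) (hγ : Measurable γ) (hc : Integrable c μ)
    (α : Forms E M) : delbar 𝒥 (integ 𝔤 hγ hc α) = integ 𝔤 hγ hc (delbar 𝒥 α) :=
  delbar_comm (fun _ _ hα => integ_UDeg A hγ hc hα) (dH_integ A hγ hc) α

theorem measurable_mul_left' (𝔤 : Type*) [NormedAddCommGroup 𝔤] [NormedSpace ℝ 𝔤]
    [ChartedSpace 𝔤 G] [LieGroup 𝓘(ℝ, 𝔤) ∞ G] (g : G) (hγ : Measurable γ) :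
    Measurable (fun p => g * γ p) := by
  have := topologicalGroup_of_lieGroup 𝓘(ℝ, 𝔤) ∞ (G := G)
  exact (continuous_const_mul g).measurable.comp hγ

theorem translate_integ (g : G) (hγ : Measurable γ) (hc : Integrable c μ) (α : Forms E M) :
    translate E M 𝔤 g (integ 𝔤 hγ hc α) =
      integ 𝔤 (measurable_mul_left' 𝔤 g hγ) hc α := Forms.ext fun x => funext fun k => by
  rw [integ_apply]
  have h := ContinuousLinearMap.integral_comp_comm
    (ContinuousAlternatingMap.compContinuousLinearMapCLM (𝕜 := ℝ) (ι := Fin k) (F := ℂ)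
      (tmap (fun y : M => g⁻¹ • y) x)) (integrable_translate (𝔤 := 𝔤) hγ hc α (g⁻¹ • x) k)
  refine h.symm.trans (integral_congr_ae (Filter.Eventually.of_forall fun p => ?_))
  simp only [map_smul, translate_mul]
  rfl

theorem integ_congr {γ' : P → G} (hγ : Measurable γ) (hγ' : Measurable γ') (hc : Integrable c μ)
    (h : ∀ᵐ p ∂μ, γ p = γ' p) (α : Forms E M) :
    (integ 𝔤 hγ hc α : Forms E M) = integ 𝔤 hγ' hc α := Forms.ext fun x => funext fun k => by
  rw [integ_apply, integ_apply]
  refine integral_congr_ae ?_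
  filter_upwards [h] with p hp
  rw [hp]

end Integration

section Path

/-- The velocity, transported to the identity, of the curve `chartCurve G ζ` at time `s`. -/
def velocity (G : Type*) [TopologicalSpace G] [ChartedSpace 𝔤 G] [Group G] (q : 𝔤 × ℝ) : 𝔤 :=
  fderiv ℝ (fun h : ℝ => extChartAt 𝓘(ℝ, 𝔤) (1 : G)
    (chartCurve G q.1 (q.2 + h) * (chartCurve G q.1 q.2)⁻¹)) 0 1

theorem chartCurve_contMDiffAt_prod {q : 𝔤 × ℝ}
    (hq : extChartAt 𝓘(ℝ, 𝔤) (1 : G) 1 + q.2 • q.1 ∈ (extChartAt 𝓘(ℝ, 𝔤) (1 : G)).target) :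
    ContMDiffAt 𝓘(ℝ, 𝔤 × ℝ) 𝓘(ℝ, 𝔤) ∞ (fun q : 𝔤 × ℝ => chartCurve G q.1 q.2) q := by
  have : IsManifold 𝓘(ℝ, 𝔤) ∞ G := isManifold_lieGroup
  have h : ContDiff ℝ ∞ (fun q : 𝔤 × ℝ => extChartAt 𝓘(ℝ, 𝔤) (1 : G) 1 + q.2 • q.1) :=
    contDiff_const.add (contDiff_snd.smul contDiff_fst)
  exact ContMDiffAt.comp q ((contMDiffOn_extChartAt_symm (1 : G)).contMDiffAt
    ((isOpen_extChartAt_target (1 : G)).mem_nhds hq)) h.contMDiff.contMDiffAt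

theorem continuousAt_velocity {q : 𝔤 × ℝ}
    (hq : extChartAt 𝓘(ℝ, 𝔤) (1 : G) 1 + q.2 • q.1 ∈ (extChartAt 𝓘(ℝ, 𝔤) (1 : G)).target) :
    ContinuousAt (velocity G : 𝔤 × ℝ → 𝔤) q := by
  have : IsManifold 𝓘(ℝ, 𝔤) ∞ G := isManifold_lieGroup
  have h0 := chartCurve_contMDiffAt_prod hq
  have h1 : ContMDiffAt 𝓘(ℝ, (𝔤 × ℝ) × ℝ) 𝓘(ℝ, 𝔤) ∞
      (fun r : (𝔤 × ℝ) × ℝ => chartCurve G r.1.1 (r.1.2 + r.2)) (q, 0) := by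
    have a : ContDiff ℝ ∞ (fun r : (𝔤 × ℝ) × ℝ => (r.1.1, r.1.2 + r.2)) :=
      (contDiff_fst.comp contDiff_fst).prodMk ((contDiff_snd.comp contDiff_fst).add contDiff_snd)
    refine ContMDiffAt.comp ((q, 0) : (𝔤 × ℝ) × ℝ)
      (g := fun q : 𝔤 × ℝ => chartCurve G q.1 q.2)
      (f := fun r : (𝔤 × ℝ) × ℝ => (r.1.1, r.1.2 + r.2)) ?_ a.contMDiff.contMDiffAt
    simpa only [add_zero] using h0
  have h2 : ContMDiffAt 𝓘(ℝ, (𝔤 × ℝ) × ℝ) 𝓘(ℝ, 𝔤) ∞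
      (fun r : (𝔤 × ℝ) × ℝ => chartCurve G r.1.1 r.1.2) (q, 0) :=
    ContMDiffAt.comp ((q, 0) : (𝔤 × ℝ) × ℝ)
      (g := fun q : 𝔤 × ℝ => chartCurve G q.1 q.2)
      (f := fun r : (𝔤 × ℝ) × ℝ => r.1) h0 contDiff_fst.contMDiff.contMDiffAt
  have h3 : ContDiffAt ℝ ∞ (fun r : (𝔤 × ℝ) × ℝ => extChartAt 𝓘(ℝ, 𝔤) (1 : G)
      (chartCurve G r.1.1 (r.1.2 + r.2) * (chartCurve G r.1.1 r.1.2)⁻¹)) (q, 0) := by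
    rw [← contMDiffAt_iff_contDiffAt]
    refine ContMDiffAt.comp ((q, 0) : (𝔤 × ℝ) × ℝ) (g := extChartAt 𝓘(ℝ, 𝔤) (1 : G))
      (f := fun r : (𝔤 × ℝ) × ℝ =>
        chartCurve G r.1.1 (r.1.2 + r.2) * (chartCurve G r.1.1 r.1.2)⁻¹) ?_ (h1.mul h2.inv)
    have : chartCurve G q.1 (q.2 + 0) * (chartCurve G q.1 q.2)⁻¹ = 1 := by simp
    simp only [this]
    exact contMDiffAt_extChartAt
  have h4 : ContDiffAt ℝ ∞ (fun q : 𝔤 × ℝ => fderiv ℝ (fun h : ℝ => extChartAt 𝓘(ℝ, 𝔤) (1 : G)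
    (chartCurve G q.1 (q.2 + h) * (chartCurve G q.1 q.2)⁻¹)) 0) q :=
    ContDiffAt.fderiv (f := fun (q : 𝔤 × ℝ) (h : ℝ) => extChartAt 𝓘(ℝ, 𝔤) (1 : G)
      (chartCurve G q.1 (q.2 + h) * (chartCurve G q.1 q.2)⁻¹)) (g := fun _ => 0) (n := ∞)
      h3 contDiffAt_const (by simp)
  exact (h4.clm_apply contDiffAt_const).continuousAt

theorem hasDerivAt_translate_chartCurve {H : ClosedThreeForm E M}
    {𝒥 : GCStructure E M H} (A : HamiltonianAction 𝔤 G 𝒥) (α : Forms E M) (x : M) (k : ℕ)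
    {ζ : 𝔤} {s : ℝ}
    (hs : extChartAt 𝓘(ℝ, 𝔤) (1 : G) 1 + s • ζ ∈ (extChartAt 𝓘(ℝ, 𝔤) (1 : G)).target) :
    HasDerivAt (fun s => (translate E M 𝔤 (chartCurve G ζ s)⁻¹ α).1 x k)
      ((translate E M 𝔤 (chartCurve G ζ s)⁻¹ (A.lie (velocity G (ζ, s)) α)).1 x k) s := by
  set c := chartCurve G ζ s with hc
  let e : ℝ → G := fun h => chartCurve G ζ (s + h) * c⁻¹
  have e0 : e 0 = 1 := by simp [e, hc]
  have h1 : ContMDiffAt 𝓘(ℝ, ℝ) 𝓘(ℝ, 𝔤) ∞ (fun h : ℝ => chartCurve G ζ (s + h)) 0 := by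
    have a : ContDiff ℝ ∞ (fun h : ℝ => s + h) := contDiff_const.add contDiff_id
    refine ContMDiffAt.comp (0 : ℝ) (g := chartCurve G ζ) (f := fun h : ℝ => s + h) ?_
      a.contMDiff.contMDiffAt
    rw [add_zero]
    exact chartCurve_contMDiffAt ζ hs
  have he : ContMDiffAt 𝓘(ℝ, ℝ) 𝓘(ℝ, 𝔤) ∞ e 0 := h1.mul contMDiffAt_const
  have h2 := hasDerivAt_pull_curve he e0
    (mfderiv_curve (he.mdifferentiableAt (by simp)) e0) α (c • x) k
  have h3 := (ContinuousAlternatingMap.compContinuousLinearMapCLM (𝕜 := ℝ) (ι := Fin k) (F := ℂ)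
    (tmap (fun y : M => c • y) x)).hasFDerivAt.comp_hasDerivAt (0 : ℝ) h2
  have h4 : HasDerivAt (fun t => t - s) 1 s := (hasDerivAt_id s).sub_const s
  have h5 := HasDerivAt.scomp s (h := fun t => t - s) (by rw [sub_self]; exact h3) h4
  rw [one_smul] at h5
  refine HasDerivAt.congr_deriv (f := fun s => (translate E M 𝔤 (chartCurve G ζ s)⁻¹ α).1 x k)
    (h5.congr_of_eventuallyEq (Filter.Eventually.of_forall fun t => ?_)) ?_
  · have : (translate E M 𝔤 (chartCurve G ζ t)⁻¹ α) =
        translate E M 𝔤 c⁻¹ (translate E M 𝔤 (e (t - s))⁻¹ α) := by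
      rw [← translate_mul, ← mul_inv_rev]
      simp [e]
    show (translate E M 𝔤 (chartCurve G ζ t)⁻¹ α).1 x k = _
    rw [this, translate_apply, translate_apply, inv_inv, inv_inv]
    rfl
  · rw [translate_apply, inv_inv]
    rfl

end Path
end Action
end GenEquivariant
end

open scoped Manifold ContDiff Topology
noncomputable section
namespace GenEquivariant
set_option linter.unusedSectionVars false
open MeasureTheory

universe u

section Homotopy
variable {E : Type u} [NormedAddCommGroup E] [NormedSpace ℝ E] [FiniteDimensional ℝ E]
  {M : Type*} [TopologicalSpace M] [T2Space M] [ChartedSpace E M] [IsManifold 𝓘(ℝ, E) ∞ M]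
  {𝔤 : Type*} [NormedAddCommGroup 𝔤] [NormedSpace ℝ 𝔤] [FiniteDimensional ℝ 𝔤]
  {G : Type*} [TopologicalSpace G] [ChartedSpace 𝔤 G] [Group G] [LieGroup 𝓘(ℝ, 𝔤) ∞ G]
  [MulAction G M] [ContMDiffSMul 𝓘(ℝ, 𝔤) 𝓘(ℝ, E) ∞ G M]
  {H : ClosedThreeForm E M} {𝒥 : GCStructure E M H}

theorem lie_eq_del_of_closed (A : HamiltonianAction 𝔤 G 𝒥) (ξ : 𝔤) {α : Forms E M}
    (hα : del 𝒥 α = 0) : A.lie ξ α =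
      del 𝒥 ((2 * Complex.I) • (delbar 𝒥 (A.mulF ξ α) - A.mulF ξ (delbar 𝒥 α))) := by
  rw [lie_eq_del, hα]
  simp only [map_zero, sub_zero, add_zero, map_smul]

theorem lie_add (A : HamiltonianAction 𝔤 G 𝒥) (ξ ζ : 𝔤) (α : Forms E M) :
    A.lie (ξ + ζ) α = A.lie ξ α + A.lie ζ α := by
  simp only [lie_eq_del, mulF_add, map_add, map_sub]
  module

theorem lie_smul (A : HamiltonianAction 𝔤 G 𝒥) (r : ℝ) (ξ : 𝔤) (α : Forms E M) :
    A.lie (r • ξ) α = (r : ℂ) • A.lie ξ α := by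
  simp only [lie_eq_del, mulF_smul, map_smul, map_sub]
  module

theorem lie_eq_sum (A : HamiltonianAction 𝔤 G 𝒥) {ι : Type*} [Fintype ι]
    (b : Module.Basis ι ℝ 𝔤) (ξ : 𝔤) (α : Forms E M) :
    A.lie ξ α = ∑ a, (b.repr ξ a : ℂ) • A.lie (b a) α := by
  let L : 𝔤 →ₗ[ℝ] Forms E M :=
    { toFun := fun ξ => A.lie ξ α
      map_add' := fun ξ ζ => lie_add A ξ ζ α
      map_smul' := fun r ξ => lie_smul A r ξ α }
  have h := congrArg L (b.sum_repr ξ)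
  rw [map_sum] at h
  refine h.symm.trans (Finset.sum_congr rfl fun a _ => ?_)
  exact lie_smul A _ _ α

/-- The evaluation of the component of degree `k` at a point. -/
def evalForm (x : M) (k : ℕ) : Forms E M →ₗ[ℂ] E [⋀^Fin k]→L[ℝ] ℂ where
  toFun α := α.1 x k
  map_add' _ _ := rfl
  map_smul' _ _ := rfl

theorem evalForm_apply (x : M) (k : ℕ) (α : Forms E M) : evalForm x k α = α.1 x k := rfl

theorem measurable_comp_of_continuousOn {X Y Q : Type*} [TopologicalSpace X] [TopologicalSpace Y]
    [MeasurableSpace X] [OpensMeasurableSpace X] [MeasurableSpace Y] [BorelSpace Y]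
    [MeasurableSpace Q] {S : Set X} {f : X → Y} (hf : ContinuousOn f S) {u : Q → X}
    (hu : Measurable u) (huS : ∀ q, u q ∈ S) : Measurable (fun q => f (u q)) :=
  (continuousOn_iff_continuous_domRestrict.1 hf).measurable.comp (hu.subtype_mk (h := huS))

variable [CompactSpace G] [T2Space G] [MeasurableSpace G] [BorelSpace G]

section Segment
variable [MeasurableSpace 𝔤] [BorelSpace 𝔤] {K : Set 𝔤}

theorem measurable_chartCurve
    (hK : ∀ w ∈ K, ∀ s ∈ Set.Icc (0 : ℝ) 1,
      extChartAt 𝓘(ℝ, 𝔤) (1 : G) 1 + s • w ∈ (extChartAt 𝓘(ℝ, 𝔤) (1 : G)).target)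
    {Q : Type*} [MeasurableSpace Q] {u : Q → 𝔤 × ℝ} (hu : Measurable u)
    (huS : ∀ q, u q ∈ K ×ˢ Set.Icc (0 : ℝ) 1) :
    Measurable (fun q => (chartCurve G (u q).1 (u q).2)⁻¹) := by
  have : IsTopologicalGroup G := topologicalGroup_of_lieGroup 𝓘(ℝ, 𝔤) ∞
  have h : ContinuousOn (fun q : 𝔤 × ℝ => (chartCurve G q.1 q.2)⁻¹) (K ×ˢ Set.Icc (0 : ℝ) 1) :=
    fun q hq => (chartCurve_contMDiffAt_prod (hK _ hq.1 _ hq.2)).continuousAt.inv.continuousWithinAt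
  exact measurable_comp_of_continuousOn h hu huS

theorem integrable_velocity (hKc : IsCompact K)
    (hK : ∀ w ∈ K, ∀ s ∈ Set.Icc (0 : ℝ) 1,
      extChartAt 𝓘(ℝ, 𝔤) (1 : G) 1 + s • w ∈ (extChartAt 𝓘(ℝ, 𝔤) (1 : G)).target)
    {Q : Type*} [MeasurableSpace Q] {u : Q → 𝔤 × ℝ} (hu : Measurable u)
    (huS : ∀ q, u q ∈ K ×ˢ Set.Icc (0 : ℝ) 1) {ν : Measure Q} [IsFiniteMeasure ν]
    (l : 𝔤 →L[ℝ] ℝ) : Integrable (fun q => l (velocity G (u q))) ν := by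
  have h : ContinuousOn (fun q : 𝔤 × ℝ => l (velocity G q)) (K ×ˢ Set.Icc (0 : ℝ) 1) :=
    fun q hq => (l.continuous.continuousAt.comp
      (continuousAt_velocity (hK _ hq.1 _ hq.2))).continuousWithinAt
  obtain ⟨C, hC⟩ := ((hKc.prod isCompact_Icc).image_of_continuousOn h.norm).bddAbove
  refine Integrable.of_bound
    (measurable_comp_of_continuousOn h hu huS).aestronglyMeasurable C
    (Filter.Eventually.of_forall fun q => hC ⟨u q, huS q, rfl⟩)

/-- The projection of the line onto the unit interval. -/
def clamp (s : ℝ) : ℝ := max 0 (min 1 s)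

theorem clamp_mem (s : ℝ) : clamp s ∈ Set.Icc (0 : ℝ) 1 :=
  ⟨le_max_left _ _, max_le zero_le_one (min_le_left _ _)⟩

theorem clamp_eq {s : ℝ} (hs : s ∈ Set.Icc (0 : ℝ) 1) : clamp s = s := by
  rw [clamp, min_eq_right hs.2, max_eq_right hs.1]

theorem measurable_clamp : Measurable clamp :=
  (continuous_const.max (continuous_const.min continuous_id)).measurable

theorem integral_translate_segment (A : HamiltonianAction 𝔤 G 𝒥) (α : Forms E M) (x : M) (k : ℕ)
    (hKc : IsCompact K)
    (hK : ∀ w ∈ K, ∀ s ∈ Set.Icc (0 : ℝ) 1,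
      extChartAt 𝓘(ℝ, 𝔤) (1 : G) 1 + s • w ∈ (extChartAt 𝓘(ℝ, 𝔤) (1 : G)).target)
    {ι : Type*} [Fintype ι] (b : Module.Basis ι ℝ 𝔤) {w : 𝔤} (hw : w ∈ K) :
    ∫ s in Set.Ioc (0 : ℝ) 1, ∑ a, LinearMap.toContinuousLinearMap (b.coord a)
        (velocity G (w, clamp s)) •
          (translate E M 𝔤 (chartCurve G w (clamp s))⁻¹ (A.lie (b a) α)).1 x k =
      (translate E M 𝔤 (chartCurve G w 1)⁻¹ α).1 x k - α.1 x k := by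
  have hd : ∀ s ∈ Set.uIcc (0 : ℝ) 1,
      HasDerivAt (fun s => (translate E M 𝔤 (chartCurve G w s)⁻¹ α).1 x k)
      (∑ a, LinearMap.toContinuousLinearMap (b.coord a) (velocity G (w, clamp s)) •
          (translate E M 𝔤 (chartCurve G w (clamp s))⁻¹ (A.lie (b a) α)).1 x k) s := by
    intro s hs
    rw [Set.uIcc_of_le zero_le_one] at hs
    refine (hasDerivAt_translate_chartCurve A α x k (hK _ hw s hs)).congr_deriv ?_
    rw [lie_eq_sum A b, map_sum, ← evalForm_apply, map_sum]
    refine Finset.sum_congr rfl fun a _ => ?_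
    rw [clamp_eq hs, map_smul, map_smul]
    rfl
  have hu' : Measurable (fun s : ℝ => (w, clamp s)) := measurable_const.prodMk measurable_clamp
  have huS' : ∀ s, (w, clamp s) ∈ K ×ˢ Set.Icc (0 : ℝ) 1 := fun s => ⟨hw, clamp_mem s⟩
  have hint := fun a => integrable_translate (μ := volume.restrict (Set.Ioc (0 : ℝ) 1))
      (𝔤 := 𝔤) (measurable_chartCurve (G := G) hK hu' huS')
      (integrable_velocity (G := G) hKc hK hu' huS' (LinearMap.toContinuousLinearMap (b.coord a)))
      (A.lie (b a) α) x k
  have h := intervalIntegral.integral_eq_sub_of_hasDerivAt hd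
    ((intervalIntegrable_iff_integrableOn_Ioc_of_le zero_le_one).2
      (integrable_finsetSum _ fun a _ => hint a))
  rw [intervalIntegral.integral_of_le zero_le_one] at h
  rw [h, chartCurve_zero, inv_one, translate_one]

variable {P : Type*} [MeasurableSpace P]

theorem integral_integ_lie (A : HamiltonianAction 𝔤 G 𝒥) (α : Forms E M) (x : M) (k : ℕ)
    (hKc : IsCompact K)
    (hK : ∀ w ∈ K, ∀ s ∈ Set.Icc (0 : ℝ) 1,
      extChartAt 𝓘(ℝ, 𝔤) (1 : G) 1 + s • w ∈ (extChartAt 𝓘(ℝ, 𝔤) (1 : G)).target)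
    {ι : Type*} [Fintype ι] (b : Module.Basis ι ℝ 𝔤)
    {μ : Measure P} [IsFiniteMeasure μ] {w : P → 𝔤} (hwK : ∀ p, w p ∈ K)
    (hγ : Measurable (fun p => (chartCurve G (w p) 1)⁻¹))
    (hm : Measurable (fun q : P × ℝ => (chartCurve G (w q.1) (clamp q.2))⁻¹))
    (hi : ∀ a, Integrable (fun q : P × ℝ => LinearMap.toContinuousLinearMap (b.coord a)
      (velocity G (w q.1, clamp q.2))) (μ.prod (volume.restrict (Set.Ioc (0 : ℝ) 1)))) :
    (∑ a, integ 𝔤 hm (hi a) (A.lie (b a) α)).1 x k =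
      (integ 𝔤 hγ (integrable_const (1 : ℝ) : Integrable (fun _ => (1 : ℝ)) μ) α -
        ((μ Set.univ).toReal : ℂ) • α).1 x k := by
  have hint := fun a => integrable_translate (𝔤 := 𝔤) hm (hi a) (A.lie (b a) α) x k
  have s1 : (∑ a, integ 𝔤 hm (hi a) (A.lie (b a) α)).1 x k =
      ∑ a, ∫ q : P × ℝ, LinearMap.toContinuousLinearMap (b.coord a)
        (velocity G (w q.1, clamp q.2)) •
          (translate E M 𝔤 (chartCurve G (w q.1) (clamp q.2))⁻¹ (A.lie (b a) α)).1 x k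
        ∂(μ.prod (volume.restrict (Set.Ioc (0 : ℝ) 1))) := by
    rw [← evalForm_apply, map_sum]
    rfl
  have s2 : Integrable (fun p => (translate E M 𝔤 (chartCurve G (w p) 1)⁻¹ α).1 x k) μ :=
    (integrable_translate (𝔤 := 𝔤) hγ
      (integrable_const (1 : ℝ) : Integrable (fun _ => (1 : ℝ)) μ) α x k).congr
      (Filter.Eventually.of_forall fun p => one_smul ℝ (_ : E [⋀^Fin k]→L[ℝ] ℂ))
  rw [s1, ← integral_finsetSum _ fun a _ => hint a,
    integral_prod _ (integrable_finsetSum _ fun a _ => hint a)]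
  refine (integral_congr_ae (Filter.Eventually.of_forall fun p =>
    integral_translate_segment A α x k hKc hK b (hwK p))).trans ?_
  rw [integral_sub s2 (integrable_const _), integral_const]
  refine congrArg₂ (fun u v : E [⋀^Fin k]→L[ℝ] ℂ => u - v)
    (integral_congr_ae (Filter.Eventually.of_forall fun p => ?_)) rfl
  exact (one_smul ℝ (_ : E [⋀^Fin k]→L[ℝ] ℂ)).symm

/-- Averages of a `∂`-closed form over a family of translates along segments are `∂`-homologous to
multiples of the form. -/
theorem integ_chartCurve_sub_mem (A : HamiltonianAction 𝔤 G 𝒥) {α : Forms E M}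
    (hα : del 𝒥 α = 0) (hKc : IsCompact K)
    (hK : ∀ w ∈ K, ∀ s ∈ Set.Icc (0 : ℝ) 1,
      extChartAt 𝓘(ℝ, 𝔤) (1 : G) 1 + s • w ∈ (extChartAt 𝓘(ℝ, 𝔤) (1 : G)).target)
    {μ : Measure P} [IsFiniteMeasure μ] {w : P → 𝔤} (hw : Measurable w) (hwK : ∀ p, w p ∈ K)
    (hγ : Measurable (fun p => (chartCurve G (w p) 1)⁻¹)) :
    integ 𝔤 hγ (integrable_const (1 : ℝ) : Integrable (fun _ => (1 : ℝ)) μ) α -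
      ((μ Set.univ).toReal : ℂ) • α ∈ LinearMap.range (del 𝒥) := by
  let b := Module.finBasis ℝ 𝔤
  have hu : Measurable (fun q : P × ℝ => (w q.1, clamp q.2)) :=
    (hw.comp measurable_fst).prodMk (measurable_clamp.comp measurable_snd)
  have huS : ∀ q : P × ℝ, (w q.1, clamp q.2) ∈ K ×ˢ Set.Icc (0 : ℝ) 1 :=
    fun q => ⟨hwK q.1, clamp_mem q.2⟩
  have hm := measurable_chartCurve (G := G) hK hu huS
  have hi := fun a => integrable_velocity (G := G) hKc hK hu huS
    (ν := μ.prod (volume.restrict (Set.Ioc (0 : ℝ) 1))) (LinearMap.toContinuousLinearMap (b.coord a))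
  refine ⟨∑ a, integ 𝔤 hm (hi a) ((2 * Complex.I) •
    (delbar 𝒥 (A.mulF (b a) α) - A.mulF (b a) (delbar 𝒥 α))), ?_⟩
  rw [map_sum]
  refine (Finset.sum_congr rfl fun a _ => ?_).trans (Forms.ext fun x => funext fun k =>
    integral_integ_lie A α x k hKc hK b hwK hγ hm hi)
  rw [del_integ A, ← lie_eq_del_of_closed A (b a) hα]

end Segment

theorem exists_radius (𝔤 G : Type*) [NormedAddCommGroup 𝔤] [NormedSpace ℝ 𝔤] [TopologicalSpace G]
    [ChartedSpace 𝔤 G] [Group G] : ∃ r > 0, ∀ w ∈ Metric.closedBall (0 : 𝔤) r,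
      ∀ s ∈ Set.Icc (0 : ℝ) 1,
        extChartAt 𝓘(ℝ, 𝔤) (1 : G) 1 + s • w ∈ (extChartAt 𝓘(ℝ, 𝔤) (1 : G)).target := by
  obtain ⟨r, hr, h⟩ := Metric.nhds_basis_closedBall.mem_iff.1
    ((isOpen_extChartAt_target (I := 𝓘(ℝ, 𝔤)) (1 : G)).mem_nhds (mem_extChartAt_target (1 : G)))
  refine ⟨r, hr, fun w hw s hs => h ?_⟩
  rw [mem_closedBall_zero_iff] at hw
  rw [Metric.mem_closedBall, dist_eq_norm, add_sub_cancel_left, norm_smul, Real.norm_eq_abs,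
    abs_of_nonneg hs.1]
  exact (mul_le_of_le_one_left (norm_nonneg _) hs.2).trans hw

theorem chartCurve_one {h : G} (hh : h ∈ (extChartAt 𝓘(ℝ, 𝔤) (1 : G)).source) :
    chartCurve G (extChartAt 𝓘(ℝ, 𝔤) (1 : G) h - extChartAt 𝓘(ℝ, 𝔤) (1 : G) 1) 1 = h := by
  rw [chartCurve, one_smul, add_sub_cancel]
  exact (extChartAt 𝓘(ℝ, 𝔤) (1 : G)).left_inv hh

/-- A neighbourhood of `g₀`, contained in a translate of the chart at `1`. -/
def chartNhd (𝔤 : Type*) [NormedAddCommGroup 𝔤] [NormedSpace ℝ 𝔤] [ChartedSpace 𝔤 G] (r : ℝ)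
    (g₀ : G) : Set G :=
  (fun g => g⁻¹ * g₀) ⁻¹' ((extChartAt 𝓘(ℝ, 𝔤) (1 : G)).source ∩
    extChartAt 𝓘(ℝ, 𝔤) (1 : G) ⁻¹' Metric.ball (extChartAt 𝓘(ℝ, 𝔤) (1 : G) 1) r)

theorem isOpen_chartNhd (r : ℝ) (g₀ : G) : IsOpen (chartNhd 𝔤 r g₀) := by
  have : IsTopologicalGroup G := topologicalGroup_of_lieGroup 𝓘(ℝ, 𝔤) ∞
  rw [chartNhd, extChartAt_source]
  exact (isOpen_extChartAt_preimage (I := 𝓘(ℝ, 𝔤)) (1 : G)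
    (Metric.isOpen_ball (x := extChartAt 𝓘(ℝ, 𝔤) (1 : G) 1) (ε := r))).preimage
    (f := fun g => g⁻¹ * g₀) (continuous_inv.mul continuous_const)

theorem mem_chartNhd {r : ℝ} (hr : 0 < r) (g₀ : G) : g₀ ∈ chartNhd 𝔤 r g₀ := by
  rw [chartNhd, Set.mem_preimage, inv_mul_cancel]
  exact ⟨mem_extChartAt_source (1 : G), Metric.mem_ball_self hr⟩

open Classical in
/-- The logarithm of `g⁻¹ g₀` in the chart at `1`. -/
def chartLog (𝔤 : Type*) [NormedAddCommGroup 𝔤] [NormedSpace ℝ 𝔤] [ChartedSpace 𝔤 G] (r : ℝ)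
    (g₀ : G) : G → 𝔤 :=
  (chartNhd 𝔤 r g₀).piecewise
    (fun g => extChartAt 𝓘(ℝ, 𝔤) (1 : G) (g⁻¹ * g₀) - extChartAt 𝓘(ℝ, 𝔤) (1 : G) 1) 0

theorem chartLog_mem {r : ℝ} (hr : 0 < r) (g₀ g : G) :
    chartLog 𝔤 r g₀ g ∈ Metric.closedBall (0 : 𝔤) r := by
  classical
  by_cases h : g ∈ chartNhd 𝔤 r g₀
  · rw [chartLog, Set.piecewise_eq_of_mem _ _ _ h, mem_closedBall_zero_iff, ← dist_eq_norm]
    exact (Metric.mem_ball.1 h.2).le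
  · rw [chartLog, Set.piecewise_eq_of_notMem _ _ _ h]
    exact Metric.mem_closedBall_self hr.le

theorem measurable_chartLog [MeasurableSpace 𝔤] [BorelSpace 𝔤] (r : ℝ) (g₀ : G) :
    Measurable (chartLog 𝔤 r g₀) := by
  classical
  have : IsTopologicalGroup G := topologicalGroup_of_lieGroup 𝓘(ℝ, 𝔤) ∞
  refine ContinuousOn.measurable_piecewise (ContinuousOn.sub ?_ continuousOn_const)
    continuousOn_const (isOpen_chartNhd r g₀).measurableSet
  exact (continuousOn_extChartAt (1 : G)).comp (continuous_inv.mul continuous_const).continuousOn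
    fun g hg => hg.1

theorem chartCurve_chartLog {r : ℝ} {g₀ g : G} (h : g ∈ chartNhd 𝔤 r g₀) :
    g₀ * (chartCurve G (chartLog 𝔤 r g₀ g) 1)⁻¹ = g := by
  classical
  rw [chartLog, Set.piecewise_eq_of_mem _ _ _ h, chartCurve_one h.1, mul_inv_rev, inv_inv,
    mul_inv_cancel_left]

/-- The connected group `G` acts trivially on the homology of `∂`. -/
theorem translate_sub_mem [ConnectedSpace G] (A : HamiltonianAction 𝔤 G 𝒥) (g : G) {α : Forms E M}
    (hα : del 𝒥 α = 0) : translate E M 𝔤 g α - α ∈ LinearMap.range (del 𝒥) := by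
  have : IsTopologicalGroup G := topologicalGroup_of_lieGroup 𝓘(ℝ, 𝔤) ∞
  have : ProperSpace 𝔤 := FiniteDimensional.proper ℝ 𝔤
  borelize 𝔤
  let S : Subgroup G :=
    { carrier := {g | ∀ α : Forms E M, del 𝒥 α = 0 →
        translate E M 𝔤 g α - α ∈ LinearMap.range (del 𝒥)}
      one_mem' := fun α _ => by
        rw [translate_one, sub_self]
        exact Submodule.zero_mem _
      mul_mem' := fun {g h} hg hh α hα => by
        rw [translate_mul, ← sub_add_sub_cancel _ (translate E M 𝔤 h α)]
        refine Submodule.add_mem _ (hg _ ?_) (hh α hα)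
        rw [del_translate A, hα, map_zero]
      inv_mem' := fun {g} hg α hα => by
        obtain ⟨β, hβ⟩ := hg α hα
        refine ⟨-translate E M 𝔤 g⁻¹ β, ?_⟩
        rw [map_neg, del_translate A, hβ, map_sub, ← translate_mul, inv_mul_cancel, translate_one,
          neg_sub] }
  obtain ⟨r, hr, hK⟩ := exists_radius 𝔤 G
  have hS : (S : Set G) ∈ 𝓝 (1 : G) := by
    filter_upwards [(isOpen_chartNhd r 1).mem_nhds (mem_chartNhd (𝔤 := 𝔤) hr (1 : G))] with g hg α hα
    have h := integ_chartCurve_sub_mem (P := Unit) (μ := Measure.dirac ()) A hα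
      (isCompact_closedBall 0 r) hK (w := fun _ => chartLog 𝔤 r 1 g) measurable_const
      (fun _ => chartLog_mem hr 1 g) measurable_const
    have e := chartCurve_chartLog hg
    rw [one_mul] at e
    have e2 : integ 𝔤 (measurable_const : Measurable fun _ : Unit =>
        (chartCurve G (chartLog 𝔤 r 1 g) 1)⁻¹)
        (integrable_const (1 : ℝ) : Integrable (fun _ => (1 : ℝ)) (Measure.dirac ())) α =
          translate E M 𝔤 g α := Forms.ext fun x => funext fun k => by
      rw [integ_apply, integral_dirac, e]
      exact one_smul ℝ (_ : E [⋀^Fin k]→L[ℝ] ℂ)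
    rw [e2] at h
    simpa using h
  have ho := S.isOpen_of_mem_nhds hS
  have hu : (S : Set G) = Set.univ :=
    IsClopen.eq_univ ⟨S.isClosed_of_isOpen ho, ho⟩ ⟨1, S.one_mem⟩
  have hg : g ∈ (S : Set G) := hu ▸ Set.mem_univ g
  exact hg α hα

/-- The average of a `∂`-closed form is `∂`-homologous to the form. -/
theorem integ_sub_mem [ConnectedSpace G] (A : HamiltonianAction 𝔤 G 𝒥) (μ : Measure G)
    [IsProbabilityMeasure μ] {α : Forms E M} (hα : del 𝒥 α = 0) :
    integ 𝔤 measurable_id (integrable_const (1 : ℝ) : Integrable (fun _ => (1 : ℝ)) μ) α - α ∈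
      LinearMap.range (del 𝒥) := by
  have : IsTopologicalGroup G := topologicalGroup_of_lieGroup 𝓘(ℝ, 𝔤) ∞
  have : ProperSpace 𝔤 := FiniteDimensional.proper ℝ 𝔤
  borelize 𝔤
  let good : Set G → Prop := fun s => integ 𝔤 measurable_id
    (integrable_const (1 : ℝ) : Integrable (fun _ => (1 : ℝ)) (μ.restrict s)) α -
      ((μ s).toReal : ℂ) • α ∈ LinearMap.range (del 𝒥)
  have hsplit : ∀ s t, MeasurableSet s → good (t ∩ s) → good (t \ s) → good t := by
    intro s t hs h1 h2
    have h := Submodule.add_mem _ h1 h2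
    have e1 : ((μ t).toReal : ℂ) = ((μ (t ∩ s)).toReal : ℂ) + ((μ (t \ s)).toReal : ℂ) := by
      have := measureReal_inter_add_sdiff (μ := μ) (s := t) hs
      rw [← Complex.ofReal_add]
      exact congrArg Complex.ofReal this.symm
    have e2 : integ 𝔤 measurable_id
        (integrable_const (1 : ℝ) : Integrable (fun _ => (1 : ℝ)) (μ.restrict t)) α =
        integ 𝔤 measurable_id
          (integrable_const (1 : ℝ) : Integrable (fun _ => (1 : ℝ)) (μ.restrict (t ∩ s))) α +
        integ 𝔤 measurable_id
          (integrable_const (1 : ℝ) : Integrable (fun _ => (1 : ℝ)) (μ.restrict (t \ s))) α :=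
      Forms.ext fun x => funext fun k => by
        rw [Forms.add_apply, integ_apply]
        exact (integral_inter_add_sdiff hs (integrable_translate (𝔤 := 𝔤) measurable_id
          (integrable_const (1 : ℝ) : Integrable (fun _ => (1 : ℝ)) (μ.restrict t)) α x k)).symm
    show _ - _ ∈ _
    rw [e1, e2, add_smul]
    convert h using 1
    abel
  obtain ⟨r, hr, hK⟩ := exists_radius 𝔤 G
  have hloc : ∀ (g₀ : G) (t : Set G), MeasurableSet t → t ⊆ chartNhd 𝔤 r g₀ → good t := by
    intro g₀ t ht hts
    have hmeas : Measurable (fun g => (chartCurve G (chartLog 𝔤 r g₀ g) 1)⁻¹) :=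
      measurable_chartCurve (G := G) hK (u := fun g => (chartLog 𝔤 r g₀ g, (1 : ℝ)))
        ((measurable_chartLog r g₀).prodMk measurable_const)
        (fun g => ⟨chartLog_mem hr g₀ g, zero_le_one, le_rfl⟩)
    obtain ⟨β, hβ⟩ := integ_chartCurve_sub_mem (μ := μ.restrict t) A hα (isCompact_closedBall 0 r) hK
      (measurable_chartLog r g₀) (chartLog_mem hr g₀) hmeas
    obtain ⟨β', hβ'⟩ := translate_sub_mem A g₀ hα
    have e := integ_congr (𝔤 := 𝔤) (μ := μ.restrict t) measurable_id
      (measurable_mul_left' 𝔤 g₀ hmeas) (integrable_const (1 : ℝ)) (by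
        filter_upwards [ae_restrict_mem ht] with g hg
        exact (chartCurve_chartLog (hts hg)).symm) α
    rw [← translate_integ g₀ hmeas] at e
    refine ⟨translate E M 𝔤 g₀ β + ((μ t).toReal : ℂ) • β', ?_⟩
    rw [e, map_add, del_translate A, hβ, map_smul, hβ', map_sub, map_smul, Measure.restrict_apply_univ]
    module
  have hcomp : ∃ s', MeasurableSet s' ∧ Set.univ ⊆ s' ∧ ∀ t, MeasurableSet t → t ⊆ s' → good t := by
    refine (isCompact_univ (X := G)).induction_on
      (p := fun s => ∃ s', MeasurableSet s' ∧ s ⊆ s' ∧ ∀ t, MeasurableSet t → t ⊆ s' → good t) ?_ ?_ ?_ ?_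
    · refine ⟨∅, MeasurableSet.empty, subset_rfl, fun t _ ht => ?_⟩
      rw [Set.subset_empty_iff.1 ht]
      refine ⟨0, ?_⟩
      rw [map_zero, measure_empty, ENNReal.toReal_zero, Complex.ofReal_zero, zero_smul, sub_zero]
      refine Forms.ext fun x => funext fun k => ?_
      rw [integ_apply, Measure.restrict_empty, integral_zero_measure]
      rfl
    · rintro s t hst ⟨s', h1, h2, h3⟩
      exact ⟨s', h1, hst.trans h2, h3⟩
    · rintro s t ⟨s', h1, h2, h3⟩ ⟨t', h1', h2', h3'⟩
      refine ⟨s' ∪ t', h1.union h1', Set.union_subset_union h2 h2', fun q hq hqs => ?_⟩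
      refine hsplit s' q h1 (h3 _ (hq.inter h1) Set.inter_subset_right) (h3' _ (hq.diff h1) ?_)
      exact fun g hg => (hqs hg.1).resolve_left hg.2
    · intro g₀ _
      exact ⟨chartNhd 𝔤 r g₀,
        mem_nhdsWithin_of_mem_nhds ((isOpen_chartNhd r g₀).mem_nhds (mem_chartNhd hr g₀)),
        chartNhd 𝔤 r g₀, (isOpen_chartNhd r g₀).measurableSet, subset_rfl, hloc g₀⟩
  obtain ⟨s', -, h2, h3⟩ := hcomp
  have h : good Set.univ := h3 _ MeasurableSet.univ h2
  have h' : integ 𝔤 measurable_id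
    (integrable_const (1 : ℝ) : Integrable (fun _ => (1 : ℝ)) (μ.restrict Set.univ)) α -
      ((μ Set.univ).toReal : ℂ) • α ∈ LinearMap.range (del 𝒥) := h
  simp only [Measure.restrict_univ, measure_univ, ENNReal.toReal_one, Complex.ofReal_one,
    one_smul] at h'
  exact h'

end Homotopy
end GenEquivariant
end

open scoped Manifold ContDiff Topology TensorProduct
noncomputable section
namespace GenEquivariant
set_option linter.unusedSectionVars false
open MeasureTheory

universe u

section Polynomials
variable {𝔤 : Type*} [NormedAddCommGroup 𝔤] [NormedSpace ℝ 𝔤]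

/-- The value at `ζ` of an element of `S𝔤^*`, regarded as a polynomial on `𝔤`. -/
def evPoly (ζ : 𝔤) : SymDual 𝔤 →ₐ[ℝ] ℝ :=
  SymmetricAlgebra.lift (ContinuousLinearMap.apply ℝ ℝ ζ).toLinearMap

theorem evPoly_ι (ζ : 𝔤) (l : 𝔤 →L[ℝ] ℝ) : evPoly ζ (SymmetricAlgebra.ι ℝ _ l) = l ζ :=
  SymmetricAlgebra.lift_ι_apply _ _

variable {W : Type*} [AddCommGroup W] [Module ℝ W]

/-- The value at `ζ` of an element of `S𝔤^* ⊗ W`, regarded as a `W`-valued polynomial on `𝔤`. -/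
def evTensor (ζ : 𝔤) : SymDual 𝔤 ⊗[ℝ] W →ₗ[ℝ] W :=
  (TensorProduct.lid ℝ W).toLinearMap ∘ₗ LinearMap.rTensor W (evPoly ζ).toLinearMap

theorem evTensor_tmul (ζ : 𝔤) (p : SymDual 𝔤) (w : W) :
    evTensor ζ (p ⊗ₜ[ℝ] w) = evPoly ζ p • w := by
  rw [evTensor, LinearMap.comp_apply, LinearMap.rTensor_tmul, LinearEquiv.coe_coe,
    TensorProduct.lid_tmul]
  rfl

theorem evTensor_lTensor {W' : Type*} [AddCommGroup W'] [Module ℝ W'] (T : W →ₗ[ℝ] W') (ζ : 𝔤)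
    (t : SymDual 𝔤 ⊗[ℝ] W) :
    evTensor ζ (LinearMap.lTensor (SymDual 𝔤) T t) = T (evTensor ζ t) := by
  induction t using TensorProduct.induction_on with
  | zero => simp only [map_zero]
  | add a b ha hb => rw [map_add, map_add, ha, hb, map_add, map_add]
  | tmul p w => rw [LinearMap.lTensor_tmul, evTensor_tmul, evTensor_tmul, map_smul]

variable [FiniteDimensional ℝ 𝔤]

theorem eq_zero_of_evPoly {p : SymDual 𝔤} (h : ∀ ζ, evPoly ζ p = 0) : p = 0 := by
  let e := Module.finBasis ℝ 𝔤
  let b : Module.Basis _ ℝ (𝔤 →L[ℝ] ℝ) := e.dualBasis.map LinearMap.toContinuousLinearMap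
  let Φ := SymmetricAlgebra.equivMvPolynomial b
  refine (map_eq_zero_iff Φ Φ.injective).1 ?_
  refine MvPolynomial.funext fun x => ?_
  rw [map_zero, ← h (∑ i, x i • e i)]
  have : (MvPolynomial.aeval x).comp Φ.toAlgHom = evPoly (∑ i, x i • e i) := by
    refine SymmetricAlgebra.algHom_ext (b.ext fun i => ?_)
    show MvPolynomial.aeval x (Φ (SymmetricAlgebra.ι ℝ _ (b i))) = evPoly _ (SymmetricAlgebra.ι ℝ _ (b i))
    rw [SymmetricAlgebra.equivMvPolynomial_ι_apply, MvPolynomial.aeval_X, evPoly_ι]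
    have : b i (∑ j, x j • e j) = e.coord i (∑ j, x j • e j) := by
      simp [b]
    rw [this]
    simp [Finsupp.single_apply]
  exact DFunLike.congr_fun this p

theorem eq_zero_of_evTensor {t : SymDual 𝔤 ⊗[ℝ] W} (h : ∀ ζ, evTensor ζ t = 0) : t = 0 := by
  classical
  let b := Module.Basis.ofVectorSpace ℝ W
  refine (TensorProduct.equivFinsuppOfBasisRight (M := SymDual 𝔤) b).map_eq_zero_iff.1 ?_
  refine Finsupp.ext fun i => eq_zero_of_evPoly fun ζ => ?_
  rw [TensorProduct.equivFinsuppOfBasisRight_apply]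
  have : ∀ s : SymDual 𝔤 ⊗[ℝ] ℝ, evPoly ζ (TensorProduct.rid ℝ _ s) = evTensor ζ s := by
    intro s
    induction s using TensorProduct.induction_on with
    | zero => simp only [map_zero]
    | add a b ha hb => rw [map_add, map_add, ha, hb, map_add]
    | tmul p r => rw [TensorProduct.rid_tmul, evTensor_tmul, map_smul, smul_eq_mul, smul_eq_mul,
        mul_comm]
  rw [this, evTensor_lTensor, h, map_zero]

theorem evTensor_ext {t s : SymDual 𝔤 ⊗[ℝ] W} (h : ∀ ζ, evTensor ζ t = evTensor ζ s) : t = s := by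
  rw [← sub_eq_zero]
  refine eq_zero_of_evTensor fun ζ => ?_
  rw [map_sub, h, sub_self]

theorem evTensor_smul (ζ : 𝔤) (p : SymDual 𝔤) (t : SymDual 𝔤 ⊗[ℝ] W) :
    evTensor ζ (p • t) = evPoly ζ p • evTensor ζ t := by
  induction t using TensorProduct.induction_on with
  | zero => simp only [map_zero, smul_zero]
  | add a b ha hb => rw [smul_add, map_add, ha, hb, map_add, smul_add]
  | tmul q w => rw [TensorProduct.smul_tmul', evTensor_tmul, evTensor_tmul, smul_eq_mul, map_mul,
      mul_smul]

theorem differentiable_evPoly (p : SymDual 𝔤) : Differentiable ℝ (fun ζ : 𝔤 => evPoly ζ p) := by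
  induction p using SymmetricAlgebra.induction with
  | algebraMap r => simp only [AlgHom.commutes]; exact differentiable_const _
  | ι l => simp only [evPoly_ι]; exact l.differentiable
  | mul a b ha hb => simp only [map_mul]; exact ha.mul hb
  | add a b ha hb => simp only [map_add]; exact ha.add hb

end Polynomials

section Action
variable {E : Type u} [NormedAddCommGroup E] [NormedSpace ℝ E] [FiniteDimensional ℝ E]
  {M : Type*} [TopologicalSpace M] [T2Space M] [ChartedSpace E M] [IsManifold 𝓘(ℝ, E) ∞ M]
  {𝔤 : Type*} [NormedAddCommGroup 𝔤] [NormedSpace ℝ 𝔤] [FiniteDimensional ℝ 𝔤]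
  {G : Type*} [TopologicalSpace G] [ChartedSpace 𝔤 G] [Group G] [LieGroup 𝓘(ℝ, 𝔤) ∞ G]
  [MulAction G M] [ContMDiffSMul 𝓘(ℝ, 𝔤) 𝓘(ℝ, E) ∞ G M]
  {H : ClosedThreeForm E M} {𝒥 : GCStructure E M H}

theorem coadPoly_ι (g : G) (l : 𝔤 →L[ℝ] ℝ) :
    coadPoly g (SymmetricAlgebra.ι ℝ _ l) = SymmetricAlgebra.ι ℝ _ (l.comp (Ad g⁻¹)) :=
  SymmetricAlgebra.lift_ι_apply _ _

theorem evPoly_coadPoly (g : G) (ζ : 𝔤) (p : SymDual 𝔤) :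
    evPoly ζ (coadPoly g p) = evPoly (Ad g⁻¹ ζ) p := by
  have : (evPoly ζ).comp (coadPoly g) = evPoly (Ad g⁻¹ ζ) := by
    refine SymmetricAlgebra.algHom_ext (LinearMap.ext fun l => ?_)
    show evPoly ζ (coadPoly g (SymmetricAlgebra.ι ℝ _ l)) = evPoly _ (SymmetricAlgebra.ι ℝ _ l)
    rw [coadPoly_ι, evPoly_ι, evPoly_ι]
    rfl
  exact DFunLike.congr_fun this p

theorem evTensor_act (g : G) (ζ : 𝔤) (t : PolyForms E M 𝔤) :
    evTensor ζ (act E M g t) = translate E M 𝔤 g (evTensor (Ad g⁻¹ ζ) t) := by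
  induction t using TensorProduct.induction_on with
  | zero => simp only [map_zero]
  | add a b ha hb => rw [map_add, map_add, ha, hb, map_add, map_add]
  | tmul p α =>
    rw [act, TensorProduct.map_tmul, evTensor_tmul, evTensor_tmul, AlgHom.toLinearMap_apply,
      evPoly_coadPoly]
    exact (LinearMap.map_smul ((translate E M 𝔤 g).restrictScalars ℝ) _ _).symm

theorem mem_UG {t : PolyForms E M 𝔤} : t ∈ UG E M 𝔤 G ↔
    ∀ (g : G) (ζ : 𝔤), translate E M 𝔤 g (evTensor (Ad g⁻¹ ζ) t) = evTensor ζ t := by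
  refine ⟨fun h g ζ => ?_, fun h g => evTensor_ext fun ζ => ?_⟩
  · rw [← evTensor_act, h g]
  · rw [evTensor_act, h g]

theorem evTensor_extendOp (T : Forms E M →ₗ[ℂ] Forms E M) (ζ : 𝔤) (t : PolyForms E M 𝔤) :
    evTensor ζ (extendOp T t) = T (evTensor ζ t) :=
  evTensor_lTensor (T.restrictScalars ℝ) ζ t

theorem extendOp_tmul (T : Forms E M →ₗ[ℂ] Forms E M) (p : SymDual 𝔤) (α : Forms E M) :
    extendOp T (p ⊗ₜ[ℝ] α) = p ⊗ₜ[ℝ] T α := rfl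

theorem act_extendOp {T : Forms E M →ₗ[ℂ] Forms E M}
    (hT : ∀ (g : G) α, T (translate E M 𝔤 g α) = translate E M 𝔤 g (T α)) {t : PolyForms E M 𝔤}
    (ht : t ∈ UG E M 𝔤 G) : extendOp T t ∈ UG E M 𝔤 G :=
  mem_UG.2 fun g ζ => by
    rw [evTensor_extendOp, evTensor_extendOp, ← hT, mem_UG.1 ht]

/-- The operator `Σ_a x_a ⊗ T_a` for a linear family `T` of operators. -/
def polyOp (T : 𝔤 → Forms E M →ₗ[ℂ] Forms E M) : PolyForms E M 𝔤 →ₗ[SymDual 𝔤] PolyForms E M 𝔤 :=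
  let b := Module.finBasis ℝ 𝔤
  ∑ a, SymmetricAlgebra.ι ℝ (𝔤 →L[ℝ] ℝ) (LinearMap.toContinuousLinearMap (b.coord a)) •
    extendOp (T (b a))

theorem evTensor_polyOp (T : 𝔤 → Forms E M →ₗ[ℂ] Forms E M)
    (hadd : ∀ ξ ζ α, T (ξ + ζ) α = T ξ α + T ζ α)
    (hsmul : ∀ (r : ℝ) ξ α, T (r • ξ) α = (r : ℂ) • T ξ α)
    (ζ : 𝔤) (t : PolyForms E M 𝔤) : evTensor ζ (polyOp T t) = T ζ (evTensor ζ t) := by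
  let b := Module.finBasis ℝ 𝔤
  let L : 𝔤 →ₗ[ℝ] Forms E M :=
    { toFun := fun ξ => T ξ (evTensor ζ t)
      map_add' := fun ξ ζ' => hadd ξ ζ' _
      map_smul' := fun r ξ => hsmul r ξ _ }
  have h := congrArg L (b.sum_repr ζ)
  rw [map_sum] at h
  refine Eq.trans ?_ h
  rw [polyOp, LinearMap.sum_apply, map_sum]
  refine Finset.sum_congr rfl fun a _ => ?_
  rw [LinearMap.smul_apply, evTensor_smul, evPoly_ι, evTensor_extendOp, map_smul]
  rfl

theorem cliffA_add (A : HamiltonianAction 𝔤 G 𝒥) (ξ ζ : 𝔤) (α : Forms E M) :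
    A.cliffA (ξ + ζ) α = A.cliffA ξ α + A.cliffA ζ α := by
  simp only [cliffA_eq, mulF_add, map_add]
  module

theorem cliffA_smul (A : HamiltonianAction 𝔤 G 𝒥) (r : ℝ) (ξ : 𝔤) (α : Forms E M) :
    A.cliffA (r • ξ) α = (r : ℂ) • A.cliffA ξ α := by
  simp only [cliffA_eq, mulF_smul, map_smul]
  module

theorem evTensor_calA (A : HamiltonianAction 𝔤 G 𝒥) (ζ : 𝔤) (t : PolyForms E M 𝔤) :
    evTensor ζ (A.calA t) = A.cliffA ζ (evTensor ζ t) :=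
  evTensor_polyOp A.cliffA (cliffA_add A) (cliffA_smul A) ζ t

/-- The operator `2√-1 f`, `(f α)(ξ) = f^ξ α(ξ)`. -/
def HamiltonianAction.polyF (A : HamiltonianAction 𝔤 G 𝒥) :
    PolyForms E M 𝔤 →ₗ[SymDual 𝔤] PolyForms E M 𝔤 :=
  polyOp fun ξ => (2 * Complex.I) • A.mulF ξ

theorem evTensor_polyF (A : HamiltonianAction 𝔤 G 𝒥) (ζ : 𝔤) (t : PolyForms E M 𝔤) :
    evTensor ζ (A.polyF t) = (2 * Complex.I) • A.mulF ζ (evTensor ζ t) :=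
  evTensor_polyOp (fun ξ => (2 * Complex.I) • A.mulF ξ)
    (fun ξ ζ α => by simp only [LinearMap.smul_apply, mulF_add, smul_add])
    (fun r ξ α => by simp only [LinearMap.smul_apply, mulF_smul]; exact smul_comm _ _ _) ζ t

theorem calA_eq (A : HamiltonianAction 𝔤 G 𝒥) (t : PolyForms E M 𝔤) :
    A.calA t = extendOp (del 𝒥) (A.polyF t) - A.polyF (extendOp (del 𝒥) t) :=
  evTensor_ext fun ζ => by
    rw [evTensor_calA, map_sub, evTensor_extendOp, evTensor_polyF, evTensor_polyF,
      evTensor_extendOp, cliffA_eq, map_smul, smul_sub]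

theorem calA_polyF (A : HamiltonianAction 𝔤 G 𝒥) (t : PolyForms E M 𝔤) :
    A.calA (A.polyF t) = A.polyF (A.calA t) :=
  evTensor_ext fun ζ => by
    rw [evTensor_calA, evTensor_polyF, evTensor_polyF, evTensor_calA, map_smul, cliffA_mulF]

theorem extendOp_del_del (𝒥 : GCStructure E M H) (t : PolyForms E M 𝔤) :
    extendOp (del 𝒥) (extendOp (del 𝒥) t) = 0 :=
  evTensor_ext fun ζ => by rw [evTensor_extendOp, evTensor_extendOp, del_del, map_zero]

theorem extendOp_delbar_delbar (𝒥 : GCStructure E M H) (t : PolyForms E M 𝔤) :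
    extendOp (delbar 𝒥) (extendOp (delbar 𝒥) t) = 0 :=
  evTensor_ext fun ζ => by rw [evTensor_extendOp, evTensor_extendOp, delbar_delbar, map_zero]

theorem extendOp_del_delbar (𝒥 : GCStructure E M H) (t : PolyForms E M 𝔤) :
    extendOp (del 𝒥) (extendOp (delbar 𝒥) t) = -extendOp (delbar 𝒥) (extendOp (del 𝒥) t) :=
  evTensor_ext fun ζ => by
    rw [map_neg, evTensor_extendOp, evTensor_extendOp, evTensor_extendOp, evTensor_extendOp,
      del_delbar]

theorem polyF_mem (A : HamiltonianAction 𝔤 G 𝒥) {t : PolyForms E M 𝔤} (ht : t ∈ UG E M 𝔤 G) :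
    A.polyF t ∈ UG E M 𝔤 G :=
  mem_UG.2 fun g ζ => by
    rw [evTensor_polyF, evTensor_polyF, map_smul, translate_mulF, mem_UG.1 ht, Ad_Ad_inv]

theorem extendOp_del_mem (A : HamiltonianAction 𝔤 G 𝒥) {t : PolyForms E M 𝔤}
    (ht : t ∈ UG E M 𝔤 G) : extendOp (del 𝒥) t ∈ UG E M 𝔤 G :=
  act_extendOp (del_translate A) ht

theorem extendOp_delbar_mem (A : HamiltonianAction 𝔤 G 𝒥) {t : PolyForms E M 𝔤}
    (ht : t ∈ UG E M 𝔤 G) : extendOp (delbar 𝒥) t ∈ UG E M 𝔤 G :=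
  act_extendOp (delbar_translate A) ht

theorem calA_mem (A : HamiltonianAction 𝔤 G 𝒥) {t : PolyForms E M 𝔤} (ht : t ∈ UG E M 𝔤 G) :
    A.calA t ∈ UG E M 𝔤 G := by
  rw [calA_eq]
  exact Submodule.sub_mem _ (extendOp_del_mem A (polyF_mem A ht))
    (polyF_mem A (extendOp_del_mem A ht))

theorem hasDerivAt_evTensor (A : HamiltonianAction 𝔤 G 𝒥) (ζ : 𝔤) (t : PolyForms E M 𝔤) (x : M)
    (k : ℕ) : HasDerivAt
      (fun s => (translate E M 𝔤 (chartCurve G ζ s)⁻¹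
        (evTensor (Ad (chartCurve G ζ s) ζ) t)).1 x k)
      ((A.lie ζ (evTensor ζ t)).1 x k) 0 := by
  induction t using TensorProduct.induction_on with
  | zero =>
    simp only [map_zero]
    exact hasDerivAt_const 0 (0 : E [⋀^Fin k]→L[ℝ] ℂ)
  | add a b ha hb =>
    simp only [map_add]
    exact ha.add hb
  | tmul p α =>
    have h1 : HasDerivAt (fun s => evPoly (Ad (chartCurve G ζ s) ζ) p) 0 0 := by
      have := (differentiable_evPoly p _).hasFDerivAt.comp_hasDerivAt (0 : ℝ)
        (hasDerivAt_Ad_chartCurve (G := G) ζ)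
      rwa [map_zero] at this
    have h2 := hasDerivAt_pull_curve (chartCurve_contMDiffAt (G := G) ζ (chartCurve_mem_target ζ))
      (chartCurve_zero ζ) (mfderiv_chartCurve ζ) α x k
    have h3 := h1.smul h2
    have e : Ad (chartCurve G ζ 0) ζ = ζ := by rw [chartCurve_zero, Ad_one]; rfl
    rw [e, zero_smul, add_zero] at h3
    refine (h3.congr_of_eventuallyEq (Filter.Eventually.of_forall fun s => ?_)).congr_deriv ?_
    · rw [evTensor_tmul, LinearMap.map_smul_of_tower]
      show evPoly (Ad (chartCurve G ζ s) ζ) p • (translate E M 𝔤 (chartCurve G ζ s)⁻¹ α).1 x k = _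
      rw [translate_apply, inv_inv]
      rfl
    · rw [evTensor_tmul, LinearMap.map_smul_of_tower]
      rfl

/-- Equivariance makes the Lie derivatives vanish on the diagonal. -/
theorem lie_evTensor (A : HamiltonianAction 𝔤 G 𝒥) {t : PolyForms E M 𝔤} (ht : t ∈ UG E M 𝔤 G)
    (ζ : 𝔤) : A.lie ζ (evTensor ζ t) = 0 := by
  refine Forms.ext fun x => funext fun k => ?_
  have h1 := hasDerivAt_evTensor A ζ t x k
  have h2 : (fun s => (translate E M 𝔤 (chartCurve G ζ s)⁻¹
      (evTensor (Ad (chartCurve G ζ s) ζ) t)).1 x k) = fun _ => (evTensor ζ t).1 x k := by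
    funext s
    have := mem_UG.1 ht (chartCurve G ζ s)⁻¹ ζ
    rw [inv_inv] at this
    rw [this]
  rw [h2] at h1
  exact h1.unique (hasDerivAt_const 0 _)

theorem delbar_calA (A : HamiltonianAction 𝔤 G 𝒥) {t : PolyForms E M 𝔤} (ht : t ∈ UG E M 𝔤 G) :
    extendOp (delbar 𝒥) (A.calA t) + A.calA (extendOp (delbar 𝒥) t) = 0 :=
  evTensor_ext fun ζ => by
    have := lie_evTensor A ht ζ
    rw [lie_eq_delbar, neg_eq_zero] at this
    rw [map_add, evTensor_extendOp, evTensor_calA, evTensor_calA, evTensor_extendOp, this, map_zero]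

end Action
end GenEquivariant
end

open scoped Manifold ContDiff Topology TensorProduct
noncomputable section
namespace GenEquivariant
set_option linter.unusedSectionVars false
open MeasureTheory

universe u

section AdContinuous
variable {𝔤 : Type*} [NormedAddCommGroup 𝔤] [NormedSpace ℝ 𝔤] [FiniteDimensional ℝ 𝔤]
  {G : Type*} [TopologicalSpace G] [ChartedSpace 𝔤 G] [Group G] [LieGroup 𝓘(ℝ, 𝔤) ∞ G]

theorem continuous_Ad (ξ : 𝔤) : Continuous (fun g : G => (Ad g ξ : 𝔤)) := by
  have : IsManifold 𝓘(ℝ, 𝔤) ∞ G := isManifold_lieGroup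
  refine continuous_iff_continuousAt.2 fun g₀ => ?_
  have cs := chartCurve_contMDiffAt (G := G) ξ (chartCurve_mem_target ξ)
  set z₀ := extChartAt 𝓘(ℝ, 𝔤) g₀ g₀ with hz₀
  let F : 𝔤 → ℝ → 𝔤 := fun z s => extChartAt 𝓘(ℝ, 𝔤) (1 : G)
    ((extChartAt 𝓘(ℝ, 𝔤) g₀).symm z * chartCurve G ξ s * ((extChartAt 𝓘(ℝ, 𝔤) g₀).symm z)⁻¹)
  have h1 : ContMDiffAt 𝓘(ℝ, 𝔤 × ℝ) 𝓘(ℝ, 𝔤) ∞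
      (fun q : 𝔤 × ℝ => (extChartAt 𝓘(ℝ, 𝔤) g₀).symm q.1) (z₀, 0) :=
    ContMDiffAt.comp ((z₀, 0) : 𝔤 × ℝ) (g := (extChartAt 𝓘(ℝ, 𝔤) g₀).symm) (f := Prod.fst)
      ((contMDiffOn_extChartAt_symm g₀).contMDiffAt
        (show _ ∈ 𝓝 z₀ from extChartAt_target_mem_nhds g₀))
      contDiff_fst.contMDiff.contMDiffAt
  have h2 : ContMDiffAt 𝓘(ℝ, 𝔤 × ℝ) 𝓘(ℝ, 𝔤) ∞ (fun q : 𝔤 × ℝ => chartCurve G ξ q.2) (z₀, 0) :=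
    ContMDiffAt.comp ((z₀, 0) : 𝔤 × ℝ) (g := chartCurve G ξ) (f := Prod.snd) cs
      contDiff_snd.contMDiff.contMDiffAt
  have h3 : ContDiffAt ℝ ∞ (Function.uncurry F) (z₀, 0) := by
    rw [← contMDiffAt_iff_contDiffAt]
    refine ContMDiffAt.comp ((z₀, 0) : 𝔤 × ℝ) (g := extChartAt 𝓘(ℝ, 𝔤) (1 : G))
      (f := fun q : 𝔤 × ℝ => (extChartAt 𝓘(ℝ, 𝔤) g₀).symm q.1 * chartCurve G ξ q.2 *
        ((extChartAt 𝓘(ℝ, 𝔤) g₀).symm q.1)⁻¹) ?_ ((h1.mul h2).mul h1.inv)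
    have : (extChartAt 𝓘(ℝ, 𝔤) g₀).symm z₀ * chartCurve G ξ 0 *
        ((extChartAt 𝓘(ℝ, 𝔤) g₀).symm z₀)⁻¹ = 1 := by
      rw [chartCurve_zero, mul_one, mul_inv_cancel]
    simp only [this]
    exact contMDiffAt_extChartAt
  have h4 : ContDiffAt ℝ ∞ (fun z => fderiv ℝ (F z) 0) z₀ :=
    ContDiffAt.fderiv (f := F) (g := fun _ => 0) (n := ∞) h3 contDiffAt_const (by simp)
  have h5 : ContDiffAt ℝ ∞ (fun z => fderiv ℝ (F z) 0 1) z₀ := h4.clm_apply contDiffAt_const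
  have h6 : ContinuousAt (fun g => fderiv ℝ (F (extChartAt 𝓘(ℝ, 𝔤) g₀ g)) 0 1) g₀ :=
    ContinuousAt.comp (g := fun z => fderiv ℝ (F z) 0 1) (f := extChartAt 𝓘(ℝ, 𝔤) g₀) (x := g₀)
      h5.continuousAt (continuousAt_extChartAt g₀)
  refine h6.congr ?_
  filter_upwards [extChartAt_source_mem_nhds (I := 𝓘(ℝ, 𝔤)) g₀] with g hg
  rw [Ad_curve (cs.mdifferentiableAt (by simp)) (chartCurve_zero ξ) (mfderiv_chartCurve ξ) g]
  simp only [F, (extChartAt 𝓘(ℝ, 𝔤) g₀).left_inv hg]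

variable (𝔤 G) in
/-- The families of polynomials spanned by the products of continuous functions and polynomials. -/
def contFamilies : Submodule ℝ (G → SymDual 𝔤) :=
  Submodule.span ℝ {f | ∃ (h : G → ℝ) (p : SymDual 𝔤), Continuous h ∧ f = fun g => h g • p}

theorem coadPoly_contFamilies (p : SymDual 𝔤) :
    (fun g => coadPoly g p) ∈ contFamilies 𝔤 G := by
  have : IsTopologicalGroup G := topologicalGroup_of_lieGroup 𝓘(ℝ, 𝔤) ∞
  induction p using SymmetricAlgebra.induction with
  | algebraMap r =>
    refine Submodule.subset_span ⟨fun _ => 1, algebraMap ℝ _ r, continuous_const, funext fun g => ?_⟩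
    rw [AlgHom.commutes, one_smul]
  | ι l =>
    let b := Module.finBasis ℝ 𝔤
    have : (fun g : G => coadPoly g (SymmetricAlgebra.ι ℝ _ l)) = ∑ a, fun g : G =>
        l (Ad g⁻¹ (b a)) •
          SymmetricAlgebra.ι ℝ (𝔤 →L[ℝ] ℝ) (LinearMap.toContinuousLinearMap (b.coord a)) := by
      funext g
      rw [coadPoly_ι, Finset.sum_apply]
      simp only [← map_smul, ← map_sum]
      refine congrArg _ (ContinuousLinearMap.coe_injective (b.ext fun i => ?_))
      simp [Finsupp.single_apply]
    rw [this]
    refine Submodule.sum_mem _ fun a _ => Submodule.subset_span ⟨_, _, ?_, rfl⟩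
    exact l.continuous.comp ((continuous_Ad (b a)).comp continuous_inv)
  | mul a b ha hb =>
    have h := Submodule.mul_mem_mul ha hb
    rw [contFamilies, Submodule.span_mul_span] at h
    have e : (fun g : G => coadPoly g (a * b)) = (fun g => coadPoly g a) * fun g => coadPoly g b :=
      funext fun g => map_mul _ _ _
    rw [e]
    refine Submodule.span_mono (Set.mul_subset_iff.2 ?_) h
    rintro _ ⟨h₁, p₁, c₁, rfl⟩ _ ⟨h₂, p₂, c₂, rfl⟩
    exact ⟨fun g => h₁ g * h₂ g, p₁ * p₂, c₁.mul c₂, funext fun g => smul_mul_smul_comm _ _ _ _⟩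
  | add a b ha hb =>
    have e : (fun g : G => coadPoly g (a + b)) = (fun g => coadPoly g a) + fun g => coadPoly g b :=
      funext fun g => map_add _ _ _
    rw [e]
    exact Submodule.add_mem _ ha hb

theorem continuous_evPoly {f : G → SymDual 𝔤} (hf : f ∈ contFamilies 𝔤 G) (ζ : 𝔤) :
    Continuous (fun g => evPoly ζ (f g)) := by
  induction hf using Submodule.span_induction with
  | mem f hf =>
    obtain ⟨h, p, c, rfl⟩ := hf
    simp only [map_smul]
    exact c.smul continuous_const
  | zero => simp only [Pi.zero_apply, map_zero]; exact continuous_const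
  | add f f' _ _ h h' => simp only [Pi.add_apply, map_add]; exact h.add h'
  | smul r f _ h => simp only [Pi.smul_apply, map_smul]; exact h.const_smul r

end AdContinuous

section Average
variable {E : Type u} [NormedAddCommGroup E] [NormedSpace ℝ E] [FiniteDimensional ℝ E]
  {M : Type*} [TopologicalSpace M] [T2Space M] [ChartedSpace E M] [IsManifold 𝓘(ℝ, E) ∞ M]
  {𝔤 : Type*} [NormedAddCommGroup 𝔤] [NormedSpace ℝ 𝔤] [FiniteDimensional ℝ 𝔤]
  {G : Type*} [TopologicalSpace G] [ChartedSpace 𝔤 G] [Group G] [LieGroup 𝓘(ℝ, 𝔤) ∞ G]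
  [MulAction G M] [ContMDiffSMul 𝓘(ℝ, 𝔤) 𝓘(ℝ, E) ∞ G M]
  {H : ClosedThreeForm E M} {𝒥 : GCStructure E M H}
  [CompactSpace G] [T2Space G] [MeasurableSpace G] [BorelSpace G]

theorem integrable_of_continuous (μ : Measure G) [IsFiniteMeasure μ] {h : G → ℝ}
    (hh : Continuous h) : Integrable h μ :=
  hh.integrable_of_hasCompactSupport (HasCompactSupport.of_compactSpace h)

/-- `T` commutes with averaging over `G`. -/
def CommutesWithInteg (𝔤 : Type*) [NormedAddCommGroup 𝔤] [NormedSpace ℝ 𝔤] [FiniteDimensional ℝ 𝔤]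
    [ChartedSpace 𝔤 G] [LieGroup 𝓘(ℝ, 𝔤) ∞ G] [ContMDiffSMul 𝓘(ℝ, 𝔤) 𝓘(ℝ, E) ∞ G M]
    (μ : Measure G) (T : Forms E M →ₗ[ℂ] Forms E M) : Prop :=
  ∀ (h : G → ℝ) (hh : Integrable h μ) (α : Forms E M),
    T (integ 𝔤 measurable_id hh α) = integ 𝔤 measurable_id hh (T α)

theorem integrable_evPoly_translate (μ : Measure G) [IsFiniteMeasure μ] {f : G → SymDual 𝔤}
    (hf : f ∈ contFamilies 𝔤 G) (ζ : 𝔤) (α : Forms E M) (x : M) (k : ℕ) :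
    Integrable (fun g => evPoly ζ (f g) • (translate E M 𝔤 g α).1 x k) μ :=
  integrable_translate (𝔤 := 𝔤) measurable_id
    (integrable_of_continuous μ (continuous_evPoly hf ζ)) α x k

theorem exists_integ_family (E M : Type*) [NormedAddCommGroup E] [NormedSpace ℝ E]
    [FiniteDimensional ℝ E] [TopologicalSpace M] [T2Space M] [ChartedSpace E M]
    [IsManifold 𝓘(ℝ, E) ∞ M] [MulAction G M] [ContMDiffSMul 𝓘(ℝ, 𝔤) 𝓘(ℝ, E) ∞ G M]
    (μ : Measure G) [IsFiniteMeasure μ] {f : G → SymDual 𝔤}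
    (hf : f ∈ contFamilies 𝔤 G) : ∃ B : Forms E M →ₗ[ℝ] PolyForms E M 𝔤,
      (∀ α ζ x k, (evTensor ζ (B α)).1 x k =
        ∫ g, evPoly ζ (f g) • (translate E M 𝔤 g α).1 x k ∂μ) ∧
      ∀ T, CommutesWithInteg 𝔤 μ T → ∀ α, extendOp T (B α) = B (T α) := by
  induction hf using Submodule.span_induction with
  | mem f hf =>
    obtain ⟨h, p, c, rfl⟩ := hf
    refine ⟨TensorProduct.mk ℝ _ _ p ∘ₗ
      (integ 𝔤 measurable_id (integrable_of_continuous μ c)).restrictScalars ℝ,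
      fun α ζ x k => ?_, fun T hT α => ?_⟩
    · rw [LinearMap.comp_apply, TensorProduct.mk_apply, evTensor_tmul]
      simp only [map_smul, smul_eq_mul, mul_comm (h _), mul_smul]
      exact (integral_smul (evPoly ζ p) fun g => h g • (translate E M 𝔤 g α).1 x k).symm
    · rw [LinearMap.comp_apply, TensorProduct.mk_apply, extendOp_tmul]
      exact congrArg _ (hT h (integrable_of_continuous μ c) α)
  | zero =>
    refine ⟨0, fun α ζ x k => ?_, fun T hT α => ?_⟩
    · simp only [Pi.zero_apply, map_zero, LinearMap.zero_apply]
      refine Eq.symm ((integral_congr_ae (Filter.Eventually.of_forall fun g => ?_)).trans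
        (integral_zero _ _))
      exact zero_smul ℝ (_ : E [⋀^Fin k]→L[ℝ] ℂ)
    · simp only [map_zero, LinearMap.zero_apply]
  | add f f' hf hf' h h' =>
    obtain ⟨B, h1, h2⟩ := h
    obtain ⟨B', h1', h2'⟩ := h'
    refine ⟨B + B', fun α ζ x k => ?_, fun T hT α => ?_⟩
    · rw [LinearMap.add_apply, map_add, Forms.add_apply, Pi.add_apply, h1, h1',
        ← integral_add (integrable_evPoly_translate μ hf ζ α x k)
          (integrable_evPoly_translate μ hf' ζ α x k)]
      refine integral_congr_ae (Filter.Eventually.of_forall fun g => ?_)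
      simp only [Pi.add_apply, map_add]
      exact (add_smul (M := E [⋀^Fin k]→L[ℝ] ℂ) _ _ _).symm
    · rw [LinearMap.add_apply, map_add, h2 T hT, h2' T hT, LinearMap.add_apply]
  | smul r f hf h =>
    obtain ⟨B, h1, h2⟩ := h
    refine ⟨r • B, fun α ζ x k => ?_, fun T hT α => ?_⟩
    · rw [LinearMap.smul_apply, map_smul]
      refine (congrArg (fun v : E [⋀^Fin k]→L[ℝ] ℂ => r • v) (h1 α ζ x k)).trans ?_
      rw [← integral_smul]
      refine integral_congr_ae (Filter.Eventually.of_forall fun g => ?_)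
      simp only [Pi.smul_apply, map_smul, smul_eq_mul]
      exact (mul_smul (α := ℝ) (β := E [⋀^Fin k]→L[ℝ] ℂ) _ _ _).symm
    · rw [LinearMap.smul_apply, LinearMap.map_smul_of_tower, h2 T hT, LinearMap.smul_apply]

theorem exists_average (E M 𝔤 : Type*) [NormedAddCommGroup E] [NormedSpace ℝ E]
    [FiniteDimensional ℝ E] [TopologicalSpace M] [T2Space M] [ChartedSpace E M]
    [IsManifold 𝓘(ℝ, E) ∞ M] [NormedAddCommGroup 𝔤] [NormedSpace ℝ 𝔤] [FiniteDimensional ℝ 𝔤]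
    [ChartedSpace 𝔤 G] [LieGroup 𝓘(ℝ, 𝔤) ∞ G]
    [MulAction G M] [ContMDiffSMul 𝓘(ℝ, 𝔤) 𝓘(ℝ, E) ∞ G M]
    (μ : Measure G) [IsFiniteMeasure μ] :
    ∃ Av : PolyForms E M 𝔤 →ₗ[ℝ] PolyForms E M 𝔤,
      (∀ (t : PolyForms E M 𝔤) (ζ : 𝔤) (x : M) (k : ℕ), (evTensor ζ (Av t)).1 x k =
        ∫ g, (translate E M 𝔤 g (evTensor (Ad g⁻¹ ζ) t)).1 x k ∂μ) ∧
      (∀ (t : PolyForms E M 𝔤) (ζ : 𝔤) (x : M) (k : ℕ),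
        Integrable (fun g => (translate E M 𝔤 g (evTensor (Ad g⁻¹ ζ) t)).1 x k) μ) ∧
      ∀ T, CommutesWithInteg 𝔤 μ T → ∀ t, extendOp T (Av t) = Av (extendOp T t) := by
  choose B h1 h2 using fun p : SymDual 𝔤 =>
    exists_integ_family E M μ (coadPoly_contFamilies (G := G) p)
  have hi := fun (p : SymDual 𝔤) => integrable_evPoly_translate (E := E) (M := M) μ
    (coadPoly_contFamilies (G := G) p)
  have hadd : ∀ p q α, B (p + q) α = B p α + B q α := fun p q α =>
    evTensor_ext fun ζ => Forms.ext fun x => funext fun k => by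
      rw [map_add, Forms.add_apply, Pi.add_apply, h1, h1, h1, ← integral_add (hi p ζ α x k)
        (hi q ζ α x k)]
      refine integral_congr_ae (Filter.Eventually.of_forall fun g => ?_)
      simp only [map_add]
      exact add_smul (M := E [⋀^Fin k]→L[ℝ] ℂ) _ _ _
  have hsmul : ∀ (r : ℝ) p α, B (r • p) α = r • B p α := fun r p α =>
    evTensor_ext fun ζ => Forms.ext fun x => funext fun k => by
      rw [map_smul]
      refine Eq.trans ?_ (congrArg (fun v : E [⋀^Fin k]→L[ℝ] ℂ => r • v) (h1 p α ζ x k)).symm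
      rw [h1, ← integral_smul]
      refine integral_congr_ae (Filter.Eventually.of_forall fun g => ?_)
      simp only [map_smul, smul_eq_mul]
      exact mul_smul (α := ℝ) (β := E [⋀^Fin k]→L[ℝ] ℂ) _ _ _
  let Av : PolyForms E M 𝔤 →ₗ[ℝ] PolyForms E M 𝔤 := TensorProduct.lift
    (LinearMap.mk₂ ℝ (fun p α => B p α) hadd hsmul (fun p α β => map_add _ _ _)
      fun r p α => map_smul _ _ _)
  have hAv : ∀ p α, Av (p ⊗ₜ[ℝ] α) = B p α := fun p α => TensorProduct.lift.tmul _ _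
  have hp : ∀ (p : SymDual 𝔤) (α : Forms E M) (ζ : 𝔤) (x : M) (k : ℕ) (g : G),
      (translate E M 𝔤 g (evTensor (Ad g⁻¹ ζ) (p ⊗ₜ[ℝ] α))).1 x k =
        evPoly ζ (coadPoly g p) • (translate E M 𝔤 g α).1 x k := fun p α ζ x k g => by
    rw [evTensor_tmul, LinearMap.map_smul_of_tower, evPoly_coadPoly]
    rfl
  have hint : ∀ (t : PolyForms E M 𝔤) (ζ : 𝔤) (x : M) (k : ℕ),
      Integrable (fun g => (translate E M 𝔤 g (evTensor (Ad g⁻¹ ζ) t)).1 x k) μ := by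
    intro t ζ x k
    induction t using TensorProduct.induction_on with
    | zero =>
      simp only [map_zero]
      exact integrable_zero G (E [⋀^Fin k]→L[ℝ] ℂ) μ
    | add a b ha hb =>
      simp only [map_add]
      exact Integrable.add (ε' := E [⋀^Fin k]→L[ℝ] ℂ) ha hb
    | tmul p α =>
      simp only [hp]
      exact hi p ζ α x k
  refine ⟨Av, fun t ζ x k => ?_, hint, fun T hT t => ?_⟩
  · induction t using TensorProduct.induction_on with
    | zero =>
      simp only [map_zero]
      exact (integral_zero G (E [⋀^Fin k]→L[ℝ] ℂ)).symm
    | add a b ha hb =>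
      rw [map_add, map_add, Forms.add_apply, Pi.add_apply, ha, hb,
        ← integral_add (hint a ζ x k) (hint b ζ x k)]
      simp only [map_add]
      rfl
    | tmul p α =>
      rw [hAv, h1]
      simp only [hp]
  · induction t using TensorProduct.induction_on with
    | zero => simp only [map_zero]
    | add a b ha hb => rw [map_add, map_add, ha, hb, map_add, map_add]
    | tmul p α => rw [extendOp_tmul, hAv, hAv, h2 p T hT]

end Average

section Haar
variable {E : Type u} [NormedAddCommGroup E] [NormedSpace ℝ E] [FiniteDimensional ℝ E]
  {M : Type*} [TopologicalSpace M] [T2Space M] [ChartedSpace E M] [IsManifold 𝓘(ℝ, E) ∞ M]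
  {𝔤 : Type*} [NormedAddCommGroup 𝔤] [NormedSpace ℝ 𝔤] [FiniteDimensional ℝ 𝔤]
  {G : Type*} [TopologicalSpace G] [ChartedSpace 𝔤 G] [Group G] [LieGroup 𝓘(ℝ, 𝔤) ∞ G]
  [MulAction G M] [ContMDiffSMul 𝓘(ℝ, 𝔤) 𝓘(ℝ, E) ∞ G M]
  {H : ClosedThreeForm E M} {𝒥 : GCStructure E M H}
  [CompactSpace G] [T2Space G]

/-- Averaging over the compact connected group `G`. -/
theorem exists_projection_UG [ConnectedSpace G] (A : HamiltonianAction 𝔤 G 𝒥) :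
    ∃ Av : PolyForms E M 𝔤 →ₗ[ℝ] PolyForms E M 𝔤,
      (∀ t, Av t ∈ UG E M 𝔤 G) ∧ (∀ t ∈ UG E M 𝔤 G, Av t = t) ∧
      (∀ t, extendOp (del 𝒥) (Av t) = Av (extendOp (del 𝒥) t)) ∧
      (∀ t, extendOp (delbar 𝒥) (Av t) = Av (extendOp (delbar 𝒥) t)) ∧
      ∀ p ∈ InvPoly 𝔤 G, ∀ α : Forms E M, del 𝒥 α = 0 →
        ∃ β, Av (p ⊗ₜ[ℝ] α) = p ⊗ₜ[ℝ] (α + del 𝒥 β) := by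
  have : IsTopologicalGroup G := topologicalGroup_of_lieGroup 𝓘(ℝ, 𝔤) ∞
  have := secondCountable_of_charted 𝔤 G
  borelize G
  let K : TopologicalSpace.PositiveCompacts G := ⊤
  let μ := Measure.haarMeasure K
  have : IsProbabilityMeasure μ := ⟨Measure.haarMeasure_self (K₀ := K)⟩
  obtain ⟨Av, h1, h2, h3⟩ := exists_average E M 𝔤 μ (G := G)
  refine ⟨Av, fun t => mem_UG.2 fun h ζ => Forms.ext fun x => funext fun k => ?_,
    fun t ht => evTensor_ext fun ζ => Forms.ext fun x => funext fun k => ?_,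
    h3 _ fun h hh α => del_integ A measurable_id hh α,
    h3 _ fun h hh α => delbar_integ A measurable_id hh α, fun p hp α hα => ?_⟩
  · have c := ContinuousLinearMap.integral_comp_comm
      (ContinuousAlternatingMap.compContinuousLinearMapCLM (𝕜 := ℝ) (ι := Fin k) (F := ℂ)
        (tmap (fun y : M => h⁻¹ • y) x)) (h2 t (Ad h⁻¹ ζ) (h⁻¹ • x) k)
    rw [h1, ← integral_mul_left_eq_self _ h, translate_apply]
    refine (congrArg (fun v : E [⋀^Fin k]→L[ℝ] ℂ => v.compContinuousLinearMap
      (tmap (fun y : M => h⁻¹ • y) x)) (h1 t (Ad h⁻¹ ζ) (h⁻¹ • x) k)).trans ?_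
    refine c.symm.trans (integral_congr_ae (Filter.Eventually.of_forall fun g => ?_))
    beta_reduce
    rw [translate_mul, mul_inv_rev, Ad_mul]
    rfl
  · rw [h1]
    simp only [mem_UG.1 ht, integral_const, probReal_univ]
    exact one_smul ℝ (_ : E [⋀^Fin k]→L[ℝ] ℂ)
  · obtain ⟨β, hβ⟩ := integ_sub_mem A μ hα
    refine ⟨β, evTensor_ext fun ζ => Forms.ext fun x => funext fun k => ?_⟩
    rw [hβ, add_sub_cancel, h1, evTensor_tmul]
    refine Eq.trans ?_ (integral_smul (evPoly ζ p)
      fun g => (1 : ℝ) • (translate E M 𝔤 g α).1 x k)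
    refine integral_congr_ae (Filter.Eventually.of_forall fun g => ?_)
    beta_reduce
    rw [evTensor_tmul, LinearMap.map_smul_of_tower, ← evPoly_coadPoly, hp g]
    exact congrArg (fun v : E [⋀^Fin k]→L[ℝ] ℂ => evPoly ζ p • v) (one_smul ℝ _).symm

end Haar
end GenEquivariant
end

open scoped Manifold ContDiff Topology TensorProduct
noncomputable section
namespace GenEquivariant
set_option linter.unusedSectionVars false

universe u

section Slices
variable {S W W' : Type*} [AddCommGroup S] [Module ℝ S] [AddCommGroup W] [Module ℝ W]
  [AddCommGroup W'] [Module ℝ W']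

/-- The contraction of an element of `S ⊗ W` with a linear form on `S`. -/
def slice (φ : S →ₗ[ℝ] ℝ) : S ⊗[ℝ] W →ₗ[ℝ] W :=
  (TensorProduct.lid ℝ W).toLinearMap ∘ₗ LinearMap.rTensor W φ

theorem slice_tmul (φ : S →ₗ[ℝ] ℝ) (p : S) (w : W) : slice φ (p ⊗ₜ[ℝ] w) = φ p • w := by
  rw [slice, LinearMap.comp_apply, LinearMap.rTensor_tmul, LinearEquiv.coe_coe,
    TensorProduct.lid_tmul]

theorem slice_lTensor (T : W →ₗ[ℝ] W') (φ : S →ₗ[ℝ] ℝ) (t : S ⊗[ℝ] W) :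
    slice φ (LinearMap.lTensor S T t) = T (slice φ t) := by
  induction t using TensorProduct.induction_on with
  | zero => simp only [map_zero]
  | add a b ha hb => rw [map_add, map_add, ha, hb, map_add, map_add]
  | tmul p w => rw [LinearMap.lTensor_tmul, slice_tmul, slice_tmul, map_smul]

/-- An element of `S ⊗ W'` all of whose slices are in the image of `T` is in the image of `1 ⊗ T`. -/
theorem exists_lTensor_eq (T : W →ₗ[ℝ] W') {t : S ⊗[ℝ] W'}
    (h : ∀ φ : S →ₗ[ℝ] ℝ, slice φ t ∈ LinearMap.range T) : ∃ v, LinearMap.lTensor S T v = t := by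
  classical
  let b := Module.Basis.ofVectorSpace ℝ S
  let e := TensorProduct.equivFinsuppOfBasisLeft (N := W') b
  choose w hw using fun i => h (b.coord i)
  have he : ∀ i, e t i = slice (b.coord i) t := fun i =>
    TensorProduct.equivFinsuppOfBasisLeft_apply b t i
  refine ⟨∑ i ∈ (e t).support, b i ⊗ₜ[ℝ] w i, ?_⟩
  have ht : t = ∑ i ∈ (e t).support, b i ⊗ₜ[ℝ] e t i :=
    (e.symm_apply_apply t).symm.trans (TensorProduct.equivFinsuppOfBasisLeft_symm_apply b (e t))
  rw [map_sum]
  refine Eq.trans ?_ ht.symm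
  refine Finset.sum_congr rfl fun i _ => ?_
  rw [LinearMap.lTensor_tmul, hw, he]

end Slices

section PolyDegree
variable {𝔤 : Type*} [NormedAddCommGroup 𝔤] [NormedSpace ℝ 𝔤]

open Polynomial

variable (𝔤) in
/-- The homomorphism `S𝔤^* → S𝔤^*[X]` with `l ↦ l X`, which exhibits the grading of `S𝔤^*`. -/
def gradingHom : SymDual 𝔤 →ₐ[ℝ] (SymDual 𝔤)[X] :=
  SymmetricAlgebra.lift
    { toFun := fun l => C (SymmetricAlgebra.ι ℝ (𝔤 →L[ℝ] ℝ) l) * X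
      map_add' := fun l l' => by rw [map_add, C_add, add_mul]
      map_smul' := fun r l => by
        rw [map_smul, ← smul_C, smul_mul_assoc]
        rfl }

theorem gradingHom_ι (l : 𝔤 →L[ℝ] ℝ) :
    gradingHom 𝔤 (SymmetricAlgebra.ι ℝ _ l) = C (SymmetricAlgebra.ι ℝ (𝔤 →L[ℝ] ℝ) l) * X :=
  SymmetricAlgebra.lift_ι_apply _ _

/-- The homogeneous component of degree `j` of a polynomial. -/
def polyDeg (j : ℕ) : SymDual 𝔤 →ₗ[ℝ] SymDual 𝔤 where
  toFun p := (gradingHom 𝔤 p).coeff j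
  map_add' p q := by rw [map_add, coeff_add]
  map_smul' r p := by rw [map_smul, coeff_smul]; rfl

theorem polyDeg_apply (j : ℕ) (p : SymDual 𝔤) : polyDeg j p = (gradingHom 𝔤 p).coeff j := rfl

variable (𝔤) in
/-- The polynomials homogeneous of degree `i`. -/
abbrev HomPoly (i : ℕ) : Submodule ℝ (SymDual 𝔤) :=
  LinearMap.range (SymmetricAlgebra.ι ℝ (𝔤 →L[ℝ] ℝ)) ^ i

theorem gradingHom_of_mem {i : ℕ} : ∀ {p : SymDual 𝔤}, p ∈ HomPoly 𝔤 i →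
    gradingHom 𝔤 p = C p * X ^ i := by
  induction i with
  | zero =>
    intro p hp
    obtain ⟨r, rfl⟩ := Submodule.mem_one.1 (by rwa [HomPoly, pow_zero] at hp)
    rw [AlgHom.commutes, pow_zero, mul_one]
    rfl
  | succ i ih =>
    intro p hp
    rw [HomPoly, pow_succ] at hp
    induction hp using Submodule.mul_induction_on' with
    | mem_mul_mem a ha b hb =>
      obtain ⟨l, rfl⟩ := hb
      rw [map_mul, ih ha, gradingHom_ι, C_mul, pow_succ]
      ring
    | add a _ b _ ha hb => rw [map_add, ha, hb, C_add, add_mul]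

theorem polyDeg_same {i : ℕ} {p : SymDual 𝔤} (hp : p ∈ HomPoly 𝔤 i) : polyDeg i p = p := by
  rw [polyDeg_apply, gradingHom_of_mem hp, coeff_C_mul_X_pow, if_pos rfl]

theorem polyDeg_ne {i j : ℕ} {p : SymDual 𝔤} (hp : p ∈ HomPoly 𝔤 i) (h : j ≠ i) :
    polyDeg j p = 0 := by
  rw [polyDeg_apply, gradingHom_of_mem hp, coeff_C_mul_X_pow, if_neg h]

theorem polyDeg_mem (j : ℕ) (p : SymDual 𝔤) : polyDeg j p ∈ HomPoly 𝔤 j := by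
  induction p using SymmetricAlgebra.induction generalizing j with
  | algebraMap r =>
    have h : algebraMap ℝ (SymDual 𝔤) r ∈ HomPoly 𝔤 0 := by
      rw [HomPoly, pow_zero]
      exact Submodule.mem_one.2 ⟨r, rfl⟩
    by_cases hj : j = 0
    · rw [hj, polyDeg_same h]
      exact h
    · rw [polyDeg_ne h hj]
      exact Submodule.zero_mem _
  | ι l =>
    have h : SymmetricAlgebra.ι ℝ _ l ∈ HomPoly 𝔤 1 := by
      rw [HomPoly, pow_one]
      exact ⟨l, rfl⟩
    by_cases hj : j = 1
    · rw [hj, polyDeg_same h]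
      exact h
    · rw [polyDeg_ne h hj]
      exact Submodule.zero_mem _
  | mul a b ha hb =>
    rw [polyDeg_apply, map_mul, coeff_mul]
    refine Submodule.sum_mem _ fun q hq => ?_
    rw [HomPoly, ← Finset.HasAntidiagonal.mem_antidiagonal.1 hq, pow_add]
    exact Submodule.mul_mem_mul (ha _) (hb _)
  | add a b ha hb =>
    rw [map_add]
    exact Submodule.add_mem _ (ha j) (hb j)

theorem exists_sum_polyDeg (p : SymDual 𝔤) :
    ∃ s : Finset ℕ, (∀ j ∉ s, polyDeg j p = 0) ∧ ∑ j ∈ s, polyDeg j p = p := by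
  refine ⟨Finset.range ((gradingHom 𝔤 p).natDegree + 1), fun j hj => ?_, ?_⟩
  · rw [Finset.mem_range, not_lt, Nat.succ_le_iff] at hj
    exact coeff_eq_zero_of_natDegree_lt hj
  · have h : ((aeval (1 : SymDual 𝔤)).restrictScalars ℝ).comp (gradingHom 𝔤) =
        AlgHom.id ℝ _ := by
      refine SymmetricAlgebra.algHom_ext (LinearMap.ext fun l => ?_)
      show aeval (1 : SymDual 𝔤) (gradingHom 𝔤 (SymmetricAlgebra.ι ℝ _ l)) =
        SymmetricAlgebra.ι ℝ _ l
      rw [gradingHom_ι, map_mul, aeval_X, mul_one, aeval_C]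
      rfl
    have h2 := DFunLike.congr_fun h p
    refine Eq.trans ?_ h2
    refine Eq.trans ?_ (aeval_eq_sum_range (1 : SymDual 𝔤)).symm
    simp only [one_pow, smul_eq_mul, mul_one]
    rfl

theorem polyDeg_ι_mul (j : ℕ) (l : 𝔤 →L[ℝ] ℝ) (p : SymDual 𝔤) :
    polyDeg (j + 1) (SymmetricAlgebra.ι ℝ _ l * p) = SymmetricAlgebra.ι ℝ _ l * polyDeg j p := by
  rw [polyDeg_apply, map_mul, gradingHom_ι, mul_assoc, coeff_C_mul, coeff_X_mul, polyDeg_apply]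

theorem polyDeg_zero_ι_mul (l : 𝔤 →L[ℝ] ℝ) (p : SymDual 𝔤) :
    polyDeg 0 (SymmetricAlgebra.ι ℝ _ l * p) = 0 := by
  rw [polyDeg_apply, map_mul, gradingHom_ι, mul_assoc, coeff_C_mul, coeff_X_mul_zero, mul_zero]

theorem polyDeg_coadPoly {G : Type*} [TopologicalSpace G] [ChartedSpace 𝔤 G] [Group G] (g : G)
    (j : ℕ) (p : SymDual 𝔤) : polyDeg j (coadPoly g p) = coadPoly g (polyDeg j p) := by
  have h : (gradingHom 𝔤).comp (coadPoly g) = (mapAlgHom (coadPoly g)).comp (gradingHom 𝔤) := by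
    refine SymmetricAlgebra.algHom_ext (LinearMap.ext fun l => ?_)
    show gradingHom 𝔤 (coadPoly g (SymmetricAlgebra.ι ℝ _ l)) =
      mapAlgHom (coadPoly g) (gradingHom 𝔤 (SymmetricAlgebra.ι ℝ _ l))
    have e : coadPoly g (SymmetricAlgebra.ι ℝ _ l) = SymmetricAlgebra.ι ℝ _ (l.comp (Ad g⁻¹)) :=
      SymmetricAlgebra.lift_ι_apply _ _
    rw [e, gradingHom_ι, gradingHom_ι]
    simp [e]
  have h2 := DFunLike.congr_fun h p
  rw [polyDeg_apply, polyDeg_apply]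
  refine (congrArg (fun q : (SymDual 𝔤)[X] => q.coeff j) h2).trans ?_
  simp

end PolyDegree

section Bigrading
variable {E : Type u} [NormedAddCommGroup E] [NormedSpace ℝ E] [FiniteDimensional ℝ E]
  {M : Type*} [TopologicalSpace M] [T2Space M] [ChartedSpace E M] [IsManifold 𝓘(ℝ, E) ∞ M]
  {𝔤 : Type*} [NormedAddCommGroup 𝔤] [NormedSpace ℝ 𝔤] [FiniteDimensional ℝ 𝔤]
  {G : Type*} [TopologicalSpace G] [ChartedSpace 𝔤 G] [Group G] [LieGroup 𝓘(ℝ, 𝔤) ∞ G]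
  [MulAction G M] [ContMDiffSMul 𝓘(ℝ, 𝔤) 𝓘(ℝ, E) ∞ G M]
  {H : ClosedThreeForm E M} {𝒥 : GCStructure E M H}

variable (𝔤) in
/-- The projection of `S𝔤^* ⊗ Ω(M)` onto `S^i𝔤^* ⊗ Γ(U^k)`. -/
def bproj (𝒥 : GCStructure E M H) (i : ℕ) (k : ℤ) : PolyForms E M 𝔤 →ₗ[ℝ] PolyForms E M 𝔤 :=
  TensorProduct.map (polyDeg i) ((proj 𝒥 k).restrictScalars ℝ)

theorem bproj_tmul (i : ℕ) (k : ℤ) (p : SymDual 𝔤) (α : Forms E M) :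
    bproj 𝔤 𝒥 i k (p ⊗ₜ[ℝ] α) = polyDeg i p ⊗ₜ[ℝ] proj 𝒥 k α := rfl

theorem proj_same {k : ℤ} {α : Forms E M} (h : α ∈ UDeg 𝒥.J k) : proj 𝒥 k α = α :=
  gproj_same (isInternal_UDeg 𝒥) h

theorem proj_ne {j k : ℤ} {α : Forms E M} (h : α ∈ UDeg 𝒥.J j) (hj : j ≠ k) : proj 𝒥 k α = 0 :=
  gproj_ne (isInternal_UDeg 𝒥) h hj

theorem bproj_bproj_same (i : ℕ) (k : ℤ) (t : PolyForms E M 𝔤) :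
    bproj 𝔤 𝒥 i k (bproj 𝔤 𝒥 i k t) = bproj 𝔤 𝒥 i k t := by
  induction t using TensorProduct.induction_on with
  | zero => simp only [map_zero]
  | add a b ha hb => rw [map_add, map_add, ha, hb]
  | tmul p α => rw [bproj_tmul, bproj_tmul, polyDeg_same (polyDeg_mem i p),
      proj_same (proj_mem 𝒥 k α)]

theorem bproj_bproj_ne {i i' : ℕ} {k k' : ℤ} (h : i ≠ i' ∨ k ≠ k') (t : PolyForms E M 𝔤) :
    bproj 𝔤 𝒥 i k (bproj 𝔤 𝒥 i' k' t) = 0 := by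
  induction t using TensorProduct.induction_on with
  | zero => simp only [map_zero]
  | add a b ha hb => rw [map_add, map_add, ha, hb, add_zero]
  | tmul p α =>
    rw [bproj_tmul, bproj_tmul]
    rcases h with h | h
    · rw [polyDeg_ne (polyDeg_mem i' p) h, TensorProduct.zero_tmul]
    · rw [proj_ne (proj_mem 𝒥 k' α) h.symm, TensorProduct.tmul_zero]

theorem exists_sum_proj (𝒥 : GCStructure E M H) (α : Forms E M) :
    ∃ s : Finset ℤ, (∀ k ∉ s, proj 𝒥 k α = 0) ∧ ∑ k ∈ s, proj 𝒥 k α = α := by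
  classical
  have h : α ∈ ⨆ k, UDeg 𝒥.J k := by rw [(isInternal_UDeg 𝒥).submodule_iSup_eq_top]; trivial
  induction h using Submodule.iSup_induction' with
  | mem j α hα =>
    exact ⟨{j}, fun k hk => proj_ne hα (by simpa [eq_comm] using hk), by
      rw [Finset.sum_singleton, proj_same hα]⟩
  | zero => exact ⟨∅, fun k _ => map_zero _, rfl⟩
  | add α β _ _ ha hb =>
    obtain ⟨s, h1, h2⟩ := ha
    obtain ⟨s', h1', h2'⟩ := hb
    refine ⟨s ∪ s', fun k hk => ?_, ?_⟩
    · rw [Finset.mem_union, not_or] at hk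
      rw [map_add, h1 k hk.1, h1' k hk.2, add_zero]
    · simp only [map_add, Finset.sum_add_distrib]
      rw [← Finset.sum_subset Finset.subset_union_left fun k _ hk => h1 k hk,
        ← Finset.sum_subset Finset.subset_union_right fun k _ hk => h1' k hk, h2, h2']

theorem exists_sum_bproj (𝒥 : GCStructure E M H) (t : PolyForms E M 𝔤) :
    ∃ s : Finset (ℕ × ℤ), (∀ q ∉ s, bproj 𝔤 𝒥 q.1 q.2 t = 0) ∧
      ∑ q ∈ s, bproj 𝔤 𝒥 q.1 q.2 t = t := by
  classical
  induction t using TensorProduct.induction_on with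
  | zero => exact ⟨∅, fun k _ => map_zero _, rfl⟩
  | add α β ha hb =>
    obtain ⟨s, h1, h2⟩ := ha
    obtain ⟨s', h1', h2'⟩ := hb
    refine ⟨s ∪ s', fun k hk => ?_, ?_⟩
    · rw [Finset.mem_union, not_or] at hk
      rw [map_add, h1 k hk.1, h1' k hk.2, add_zero]
    · simp only [map_add, Finset.sum_add_distrib]
      rw [← Finset.sum_subset Finset.subset_union_left fun k _ hk => h1 k hk,
        ← Finset.sum_subset Finset.subset_union_right fun k _ hk => h1' k hk, h2, h2']
  | tmul p α =>
    obtain ⟨s, h1, h2⟩ := exists_sum_polyDeg p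
    obtain ⟨s', h1', h2'⟩ := exists_sum_proj 𝒥 α
    refine ⟨s ×ˢ s', fun q hq => ?_, ?_⟩
    · rw [Finset.mem_product, not_and_or] at hq
      rw [bproj_tmul]
      rcases hq with hq | hq
      · rw [h1 _ hq, TensorProduct.zero_tmul]
      · rw [h1' _ hq, TensorProduct.tmul_zero]
    · simp only [bproj_tmul]
      rw [Finset.sum_product]
      simp only [← TensorProduct.tmul_sum, h2', ← TensorProduct.sum_tmul, h2]

theorem exists_bound_bproj (𝔤 : Type*) [NormedAddCommGroup 𝔤] [NormedSpace ℝ 𝔤]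
    [FiniteDimensional ℝ 𝔤] (𝒥 : GCStructure E M H) :
    ∃ N : ℤ, ∀ (i : ℕ) (k : ℤ), N < |k| → ∀ t : PolyForms E M 𝔤, bproj 𝔤 𝒥 i k t = 0 := by
  have h : ∃ N : ℤ, ∀ k : ℤ, N < |k| → ∀ α : Forms E M, proj 𝒥 k α = 0 := by
    rcases isEmpty_or_nonempty M with hM | ⟨⟨x₀⟩⟩
    · exact ⟨0, fun k _ α => Forms.ext fun x => hM.elim x⟩
    obtain ⟨m, hm⟩ := even_finrank (𝒥.skew x₀) (𝒥.sq x₀)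
    rw [← two_mul] at hm
    refine ⟨m, fun k hk α => ?_⟩
    rcases lt_abs.1 hk with hk | hk
    · exact UDeg_eq_zero 𝒥 (d := 1) (Or.inl rfl) hm (by rwa [one_mul]) (proj_mem 𝒥 k α)
    · exact UDeg_eq_zero 𝒥 (d := -1) (Or.inr rfl) hm (by rwa [neg_one_mul]) (proj_mem 𝒥 k α)
  obtain ⟨N, h⟩ := h
  refine ⟨N, fun i k hk t => ?_⟩
  induction t using TensorProduct.induction_on with
  | zero => simp only [map_zero]
  | add a b ha hb => rw [map_add, ha, hb, add_zero]
  | tmul p α => rw [bproj_tmul, h k hk, TensorProduct.tmul_zero]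

theorem bproj_extendOp {T : Forms E M →ₗ[ℂ] Forms E M} {d : ℤ}
    (hT : ∀ k, ∀ α ∈ UDeg 𝒥.J k, T α ∈ UDeg 𝒥.J (k + d)) (i : ℕ) (k : ℤ) (t : PolyForms E M 𝔤) :
    bproj 𝔤 𝒥 i (k + d) (extendOp T t) = extendOp T (bproj 𝔤 𝒥 i k t) := by
  induction t using TensorProduct.induction_on with
  | zero => simp only [map_zero]
  | add a b ha hb => rw [map_add, map_add, ha, hb, map_add, map_add]
  | tmul p α =>
    rw [extendOp_tmul, bproj_tmul, bproj_tmul, extendOp_tmul]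
    exact congrArg _ (gproj_homogeneous (isInternal_UDeg 𝒥) hT k α)

theorem bproj_del (i : ℕ) (k : ℤ) (t : PolyForms E M 𝔤) :
    bproj 𝔤 𝒥 i k (extendOp (del 𝒥) t) = extendOp (del 𝒥) (bproj 𝔤 𝒥 i (k + 1) t) := by
  have := bproj_extendOp (d := -1) (fun k α hα => del_mem 𝒥 hα) i (k + 1) t
  rwa [add_neg_cancel_right] at this

theorem bproj_delbar (i : ℕ) (k : ℤ) (t : PolyForms E M 𝔤) :
    bproj 𝔤 𝒥 i k (extendOp (delbar 𝒥) t) = extendOp (delbar 𝒥) (bproj 𝔤 𝒥 i (k - 1) t) := by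
  have := bproj_extendOp (d := 1) (fun k α hα => delbar_mem 𝒥 hα) i (k - 1) t
  rwa [sub_add_cancel] at this

theorem mulF_UDeg (A : HamiltonianAction 𝔤 G 𝒥) (ξ : 𝔤) {k : ℤ} {α : Forms E M}
    (hα : α ∈ UDeg 𝒥.J k) : A.mulF ξ α ∈ UDeg 𝒥.J k :=
  mulOp_UDeg 𝒥 _ hα

theorem cliffA_UDeg (A : HamiltonianAction 𝔤 G 𝒥) (ξ : 𝔤) (k : ℤ) (α : Forms E M)
    (hα : α ∈ UDeg 𝒥.J k) : A.cliffA ξ α ∈ UDeg 𝒥.J (k + -1) := by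
  rw [cliffA_eq]
  exact Submodule.smul_mem _ _ (Submodule.sub_mem _ (del_mem 𝒥 (mulF_UDeg A ξ hα))
    (mulF_UDeg A ξ (del_mem 𝒥 hα)))

theorem calA_tmul (A : HamiltonianAction 𝔤 G 𝒥) (p : SymDual 𝔤) (α : Forms E M) :
    A.calA (p ⊗ₜ[ℝ] α) = ∑ a, (SymmetricAlgebra.ι ℝ (𝔤 →L[ℝ] ℝ)
      (LinearMap.toContinuousLinearMap ((Module.finBasis ℝ 𝔤).coord a)) * p) ⊗ₜ[ℝ]
        A.cliffA (Module.finBasis ℝ 𝔤 a) α := by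
  rw [HamiltonianAction.calA, LinearMap.sum_apply]
  rfl

theorem bproj_succ_calA (A : HamiltonianAction 𝔤 G 𝒥) (i : ℕ) (k : ℤ) (t : PolyForms E M 𝔤) :
    bproj 𝔤 𝒥 (i + 1) k (A.calA t) = A.calA (bproj 𝔤 𝒥 i (k + 1) t) := by
  induction t using TensorProduct.induction_on with
  | zero => simp only [map_zero]
  | add a b ha hb => rw [map_add, map_add, ha, hb, map_add, map_add]
  | tmul p α =>
    rw [bproj_tmul, calA_tmul, calA_tmul, map_sum]
    refine Finset.sum_congr rfl fun a _ => ?_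
    have h := gproj_homogeneous (isInternal_UDeg 𝒥)
      (cliffA_UDeg A (Module.finBasis ℝ 𝔤 a)) (k + 1) α
    rw [add_neg_cancel_right] at h
    rw [bproj_tmul, polyDeg_ι_mul]
    exact congrArg _ h

theorem bproj_zero_calA (A : HamiltonianAction 𝔤 G 𝒥) (k : ℤ) (t : PolyForms E M 𝔤) :
    bproj 𝔤 𝒥 0 k (A.calA t) = 0 := by
  induction t using TensorProduct.induction_on with
  | zero => simp only [map_zero]
  | add a b ha hb => rw [map_add, map_add, ha, hb, add_zero]
  | tmul p α =>
    rw [calA_tmul, map_sum]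
    refine Finset.sum_eq_zero fun a _ => ?_
    rw [bproj_tmul, polyDeg_zero_ι_mul, TensorProduct.zero_tmul]

theorem bproj_mem (A : HamiltonianAction 𝔤 G 𝒥) (i : ℕ) (k : ℤ) {t : PolyForms E M 𝔤}
    (ht : t ∈ UG E M 𝔤 G) : bproj 𝔤 𝒥 i k t ∈ UG E M 𝔤 G := by
  have h : ∀ (g : G) (t : PolyForms E M 𝔤),
      act E M g (bproj 𝔤 𝒥 i k t) = bproj 𝔤 𝒥 i k (act E M g t) := by
    intro g t
    induction t using TensorProduct.induction_on with
    | zero => simp only [map_zero]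
    | add a b ha hb => rw [map_add, map_add, ha, hb, map_add, map_add]
    | tmul p α =>
      rw [bproj_tmul, act, TensorProduct.map_tmul, TensorProduct.map_tmul, bproj_tmul,
        AlgHom.toLinearMap_apply, AlgHom.toLinearMap_apply, polyDeg_coadPoly]
      exact congrArg _ (proj_translate A g k α).symm
  intro g
  rw [h, ht g]

theorem mem_homogeneous {i : ℕ} {j : ℤ} {t : PolyForms E M 𝔤} :
    t ∈ homogeneous 𝔤 𝒥 i j ↔ bproj 𝔤 𝒥 i (j - i) t = t := by
  constructor
  · rintro ⟨s, rfl⟩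
    induction s using TensorProduct.induction_on with
    | zero => simp only [map_zero]
    | add a b ha hb => rw [map_add, map_add, ha, hb]
    | tmul p α =>
      rw [TensorProduct.map_tmul, bproj_tmul]
      exact congrArg₂ _ (polyDeg_same p.2) (proj_same α.2)
  · intro h
    rw [← h]
    clear h
    induction t using TensorProduct.induction_on with
    | zero => rw [map_zero]; exact Submodule.zero_mem _
    | add a b ha hb => rw [map_add]; exact Submodule.add_mem _ ha hb
    | tmul p α =>
      exact ⟨(⟨polyDeg i p, polyDeg_mem i p⟩ : HomPoly 𝔤 i) ⊗ₜ[ℝ]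
        (⟨proj 𝒥 (j - i) α, proj_mem 𝒥 _ α⟩ : (UDeg 𝒥.J (j - i)).restrictScalars ℝ), rfl⟩

theorem slice_extendOp (T : Forms E M →ₗ[ℂ] Forms E M) (φ : SymDual 𝔤 →ₗ[ℝ] ℝ)
    (t : PolyForms E M 𝔤) : slice φ (extendOp T t) = T (slice φ t) :=
  slice_lTensor (T.restrictScalars ℝ) φ t

theorem exists_eq_delbar_del {t : PolyForms E M 𝔤}
    (h : ∀ φ, slice φ t ∈ LinearMap.range (delbar 𝒥 ∘ₗ del 𝒥)) :
    ∃ w, t = extendOp (delbar 𝒥) (extendOp (del 𝒥) w) := by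
  obtain ⟨w, hw⟩ := exists_lTensor_eq ((delbar 𝒥 ∘ₗ del 𝒥).restrictScalars ℝ) (t := t)
    fun φ => h φ
  exact ⟨w, hw.symm.trans (LinearMap.lTensor_comp_apply (SymDual 𝔤)
    ((delbar 𝒥).restrictScalars ℝ) ((del 𝒥).restrictScalars ℝ) w)⟩

variable [CompactSpace G] [T2Space G] [ConnectedSpace G]

/-- The `∂̄∂`-lemma on `U_G`, for the image of `∂`. -/
theorem delbarDel_of_del (A : HamiltonianAction 𝔤 G 𝒥) (hlemma : DelbarDelLemma 𝒥)
    {t : PolyForms E M 𝔤} (ht : t ∈ UG E M 𝔤 G)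
    (h : extendOp (delbar 𝒥) (extendOp (del 𝒥) t) = 0) :
    ∃ w ∈ UG E M 𝔤 G, extendOp (del 𝒥) t = extendOp (delbar 𝒥) (extendOp (del 𝒥) w) := by
  obtain ⟨Av, h1, h2, h3, h4, -⟩ := exists_projection_UG A
  obtain ⟨w, hw⟩ := exists_eq_delbar_del (𝒥 := 𝒥) (t := extendOp (del 𝒥) t) fun φ => by
    rw [← hlemma.2]
    refine ⟨⟨slice φ t, (slice_extendOp _ φ t).symm⟩, ?_⟩
    show delbar 𝒥 _ = 0
    rw [← slice_extendOp, h, map_zero]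
  refine ⟨Av w, h1 w, ?_⟩
  rw [h3, h4, ← hw, ← h3, h2 t ht]

/-- The `∂̄∂`-lemma on `U_G`, for the image of `∂̄`. -/
theorem delbarDel_of_delbar (A : HamiltonianAction 𝔤 G 𝒥) (hlemma : DelbarDelLemma 𝒥)
    {t : PolyForms E M 𝔤} (ht : t ∈ UG E M 𝔤 G)
    (h : extendOp (del 𝒥) (extendOp (delbar 𝒥) t) = 0) :
    ∃ w ∈ UG E M 𝔤 G, extendOp (delbar 𝒥) t = extendOp (delbar 𝒥) (extendOp (del 𝒥) w) := by
  obtain ⟨Av, h1, h2, h3, h4, -⟩ := exists_projection_UG A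
  obtain ⟨w, hw⟩ := exists_eq_delbar_del (𝒥 := 𝒥) (t := extendOp (delbar 𝒥) t) fun φ => by
    rw [← hlemma.2, ← hlemma.1]
    refine ⟨?_, ⟨slice φ t, (slice_extendOp _ φ t).symm⟩⟩
    show del 𝒥 _ = 0
    rw [← slice_extendOp, h, map_zero]
  refine ⟨Av w, h1 w, ?_⟩
  rw [h3, h4, ← hw, ← h4, h2 t ht]

end Bigrading
end GenEquivariant
end

open scoped Manifold ContDiff Topology TensorProduct
noncomputable section
namespace GenEquivariant
set_option linter.unusedSectionVars false

section Abstract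

/-- A bigraded space with operators `∂`, `∂̄`, `𝒜` and a subspace `K` on which they satisfy the
relations of the equivariant double complex and the `∂̄∂`-lemma. The total degree of `(i, k)` is
`k + 2i`. -/
structure DelbarDelComplex (V : Type*) [AddCommGroup V] [Module ℝ V] where
  pr : ℕ → ℤ → V →ₗ[ℝ] V
  del : V →ₗ[ℝ] V
  delbar : V →ₗ[ℝ] V
  hor : V →ₗ[ℝ] V
  mu : V →ₗ[ℝ] V
  K : Submodule ℝ V
  bound : ℤ
  pr_pr_same : ∀ i k x, pr i k (pr i k x) = pr i k x
  pr_pr_ne : ∀ {i i' k k'}, (i ≠ i' ∨ k ≠ k') → ∀ x, pr i k (pr i' k' x) = 0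
  exists_sum : ∀ x, ∃ s : Finset (ℕ × ℤ), (∀ q ∉ s, pr q.1 q.2 x = 0) ∧ ∑ q ∈ s, pr q.1 q.2 x = x
  pr_bound : ∀ i k, bound < |k| → ∀ x, pr i k x = 0
  pr_del : ∀ i k x, pr i k (del x) = del (pr i (k + 1) x)
  pr_delbar : ∀ i k x, pr i k (delbar x) = delbar (pr i (k - 1) x)
  pr_hor_zero : ∀ k x, pr 0 k (hor x) = 0
  pr_hor_succ : ∀ i k x, pr (i + 1) k (hor x) = hor (pr i (k + 1) x)
  pr_mem : ∀ i k, ∀ x ∈ K, pr i k x ∈ K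
  del_mem : ∀ x ∈ K, del x ∈ K
  delbar_mem : ∀ x ∈ K, delbar x ∈ K
  hor_mem : ∀ x ∈ K, hor x ∈ K
  mu_mem : ∀ x ∈ K, mu x ∈ K
  del_del : ∀ x, del (del x) = 0
  delbar_delbar : ∀ x, delbar (delbar x) = 0
  del_delbar : ∀ x, del (delbar x) = -delbar (del x)
  hor_eq : ∀ x, hor x = del (mu x) - mu (del x)
  hor_mu : ∀ x, hor (mu x) = mu (hor x)
  delbar_hor : ∀ x ∈ K, delbar (hor x) + hor (delbar x) = 0
  lemma_del : ∀ x ∈ K, delbar (del x) = 0 → ∃ w ∈ K, del x = delbar (del w)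
  lemma_delbar : ∀ x ∈ K, del (delbar x) = 0 → ∃ w ∈ K, delbar x = delbar (del w)

namespace DelbarDelComplex
variable {V : Type*} [AddCommGroup V] [Module ℝ V] (X : DelbarDelComplex V)

/-- The total differential. -/
def D : V →ₗ[ℝ] V := X.delbar + X.hor

theorem D_apply (x : V) : X.D x = X.delbar x + X.hor x := rfl

/-- The `∂`-closed part of `K`. -/
def Kdel : Submodule ℝ V := X.K ⊓ LinearMap.ker X.del

/-- The elements of `L` with components of horizontal degree at least `p` and total degree in `Q`. -/
def filt (L : Submodule ℝ V) (p : ℤ) (Q : ℤ → Prop) : Submodule ℝ V where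
  carrier := {x | x ∈ L ∧ ∀ (i : ℕ) (k : ℤ), ((i : ℤ) < p ∨ ¬Q (k + 2 * i)) → X.pr i k x = 0}
  add_mem' ha hb := ⟨L.add_mem ha.1 hb.1, fun i k h => by
    rw [map_add, ha.2 i k h, hb.2 i k h, add_zero]⟩
  zero_mem' := ⟨L.zero_mem, fun i k _ => map_zero _⟩
  smul_mem' c x hx := ⟨L.smul_mem c hx.1, fun i k h => by
    rw [map_smul, hx.2 i k h, smul_zero]⟩

variable {X}

theorem filt_mono {L : Submodule ℝ V} {p p' : ℤ} (h : p ≤ p') (Q : ℤ → Prop) :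
    X.filt L p' Q ≤ X.filt L p Q := fun _ hx =>
  ⟨hx.1, fun i k hi => hx.2 i k (hi.imp_left fun h' => h'.trans_le h)⟩

theorem eq_zero_of_pr {x : V} (h : ∀ i k, X.pr i k x = 0) : x = 0 := by
  obtain ⟨s, -, hs⟩ := X.exists_sum x
  rw [← hs]
  exact Finset.sum_eq_zero fun q _ => h _ _

theorem del_hor (x : V) : X.del (X.hor x) = -X.hor (X.del x) := by
  rw [X.hor_eq, X.hor_eq, map_sub, X.del_del, X.del_del, map_zero]
  abel

theorem hor_hor (x : V) : X.hor (X.hor x) = 0 := by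
  have h1 : X.hor (X.hor x) = -X.hor (X.hor x) := by
    conv_lhs => rw [X.hor_eq (X.hor x), ← X.hor_mu, del_hor, del_hor, map_neg, ← X.hor_mu]
    rw [X.hor_eq x, map_sub]
    abel
  have h2 : (2 : ℝ) • X.hor (X.hor x) = 0 := by
    rw [two_smul]
    nth_rewrite 1 [h1]
    exact neg_add_cancel _
  exact (smul_eq_zero.1 h2).resolve_left two_ne_zero

theorem D_D {x : V} (hx : x ∈ X.K) : X.D (X.D x) = 0 := by
  rw [D_apply, D_apply, map_add, map_add, X.delbar_delbar, hor_hor, zero_add, add_zero,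
    X.delbar_hor x hx]

theorem del_D (x : V) : X.del (X.D x) = -X.D (X.del x) := by
  rw [D_apply, D_apply, map_add, X.del_delbar, del_hor, neg_add]

theorem D_mem {x : V} (hx : x ∈ X.K) : X.D x ∈ X.K :=
  X.K.add_mem (X.delbar_mem x hx) (X.hor_mem x hx)

theorem pr_D_del (i : ℕ) (k : ℤ) (x : V) : X.pr i k (X.D (X.del x)) =
    X.delbar (X.del (X.pr i k x)) + X.pr i k (X.hor (X.del x)) := by
  rw [D_apply, map_add, X.pr_delbar, X.pr_del, sub_add_cancel]

/-- In a column where the lower columns vanish, the components of a cocycle are `∂̄`-closed. -/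
theorem delbar_pr {i : ℕ} {k : ℤ} {x : V} (h0 : X.pr i (k + 1) (X.D x) = 0)
    (h : ∀ j < i, ∀ k, X.pr j k x = 0) : X.delbar (X.pr i k x) = 0 := by
  have h1 : X.pr i (k + 1) (X.hor x) = 0 := by
    cases i with
    | zero => exact X.pr_hor_zero _ _
    | succ j => rw [X.pr_hor_succ, h j (Nat.lt_succ_self j), map_zero]
  rw [D_apply, map_add, h1, add_zero, X.pr_delbar, add_sub_cancel_right] at h0
  exact h0

theorem exists_D_del_aux {Q : ℤ → Prop} {n₀ : ℤ} (hQ : ∀ n, Q n → n ≤ n₀) (d : ℕ) :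
    ∀ p : ℤ, n₀ - 2 * p + X.bound < d → ∀ a ∈ X.filt X.K p Q, X.D a = 0 →
      (∃ b ∈ X.K, X.del b = a) → ∃ w ∈ X.filt X.K p Q, a = X.D (X.del w) := by
  classical
  induction d with
  | zero =>
    intro p hp a ha _ _
    refine ⟨0, Submodule.zero_mem _, ?_⟩
    rw [map_zero, map_zero]
    refine eq_zero_of_pr (X := X) fun i k => ?_
    by_cases h : (i : ℤ) < p ∨ ¬Q (k + 2 * i)
    · exact ha.2 i k h
    · rw [not_or, not_lt, not_not] at h
      have := hQ _ h.2
      refine X.pr_bound i k ?_ a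
      push_cast at hp
      exact lt_of_lt_of_le (by linarith [h.1]) (neg_le_abs k)
  | succ d ih =>
    intro p hp a ha hDa hba
    have hp' : n₀ - 2 * (p + 1) + X.bound < d := by push_cast at hp; linarith
    rcases lt_or_ge p 0 with hneg | hpos
    · have ha' : a ∈ X.filt X.K (p + 1) Q := ⟨ha.1, fun i k h => ha.2 i k (h.imp_left fun h' => by
        omega)⟩
      obtain ⟨w, hw, e⟩ := ih (p + 1) hp' a ha' hDa hba
      exact ⟨w, filt_mono (by omega) Q hw, e⟩
    lift p to ℕ using hpos
    obtain ⟨b, hb, hab⟩ := hba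
    have key : ∀ k, ∃ w ∈ X.K, X.pr p k w = w ∧ X.pr p k a = X.delbar (X.del w) := by
      intro k
      have h1 : X.delbar (X.pr p k a) = 0 := delbar_pr (by rw [hDa, map_zero])
        fun j hj k => ha.2 j k (Or.inl (by exact_mod_cast hj))
      have h2 : X.pr p k a = X.del (X.pr p (k + 1) b) := by rw [← hab, X.pr_del]
      rw [h2] at h1
      obtain ⟨w, hw, e⟩ := X.lemma_del _ (X.pr_mem p (k + 1) b hb) h1
      refine ⟨X.pr p k w, X.pr_mem p k w hw, X.pr_pr_same p k w, ?_⟩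
      have h3 := X.pr_delbar p k (X.del w)
      rw [X.pr_del, sub_add_cancel] at h3
      rw [← h3, ← e, ← h2, X.pr_pr_same]
    choose w hwK hwpr hw using key
    let s := (Finset.Icc (-X.bound) X.bound).filter fun k => Q (k + 2 * p)
    let W := ∑ k ∈ s, w k
    have hWK : W ∈ X.K := Submodule.sum_mem _ fun k _ => hwK k
    have hW0 : ∀ i k, (i ≠ p ∨ k ∉ s) → X.pr i k W = 0 := by
      intro i k h
      rw [map_sum]
      refine Finset.sum_eq_zero fun k' hk' => ?_
      rw [← hwpr k']
      refine X.pr_pr_ne (h.imp_right ?_) _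
      rintro h rfl
      exact h hk'
    have hW1 : ∀ k ∈ s, X.pr p k W = w k := by
      intro k hk
      rw [map_sum, Finset.sum_eq_single k (fun k' _ hk' => ?_) (fun h => absurd hk h), hwpr]
      rw [← hwpr k']
      exact X.pr_pr_ne (Or.inr hk'.symm) _
    have hWF : W ∈ X.filt X.K p Q := ⟨hWK, fun i k h => hW0 i k (by
      by_cases hi : i = p
      · subst hi
        refine Or.inr fun hk => ?_
        exact (h.resolve_left (lt_irrefl _)) (Finset.mem_filter.1 hk).2
      · exact Or.inl hi)⟩
    have ha' : a - X.D (X.del W) ∈ X.filt X.K (p + 1) Q := by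
      refine ⟨X.K.sub_mem ha.1 (D_mem (X.del_mem _ hWK)), fun i k h => ?_⟩
      have h1 : X.pr i k (X.hor (X.del W)) = 0 := by
        cases i with
        | zero => exact X.pr_hor_zero _ _
        | succ j =>
          rw [X.pr_hor_succ, X.pr_del, hW0 j (k + 1 + 1), map_zero, map_zero]
          by_cases hj : j = p
          · subst hj
            refine Or.inr fun hk => (h.resolve_left (by push_cast; omega)) ?_
            have := (Finset.mem_filter.1 hk).2
            convert this using 1
            push_cast
            ring
          · exact Or.inl hj
      rw [map_sub, pr_D_del, h1, add_zero]
      by_cases hi : i = p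
      · subst hi
        by_cases hk : k ∈ s
        · rw [hW1 k hk, hw, sub_self]
        · rw [hW0 i k (Or.inr hk), map_zero, map_zero, sub_zero]
          by_cases hb : X.bound < |k|
          · exact X.pr_bound i k hb a
          · refine ha.2 i k (Or.inr fun hq => hk ?_)
            exact Finset.mem_filter.2 ⟨Finset.mem_Icc.2 (abs_le.1 (not_lt.1 hb)), hq⟩
      · rw [hW0 i k (Or.inl hi), map_zero, map_zero, sub_zero]
        exact ha.2 i k (h.imp_left fun h' => by omega)
    obtain ⟨w', hw', e⟩ := ih (p + 1) hp' _ ha'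
      (by rw [map_sub, hDa, D_D (X.del_mem _ hWK), sub_zero])
      ⟨b + X.D W, X.K.add_mem hb (D_mem hWK), by rw [map_add, hab, del_D, sub_eq_add_neg]⟩
    refine ⟨W + w', Submodule.add_mem _ hWF (filt_mono (by omega) Q hw'), ?_⟩
    rw [map_add, map_add, ← e, add_sub_cancel]

/-- The `D∂`-lemma, with control of the filtration and of the total degree. -/
theorem exists_D_del {Q : ℤ → Prop} {n₀ : ℤ} (hQ : ∀ n, Q n → n ≤ n₀) {p : ℤ} {a : V}
    (ha : a ∈ X.filt X.K p Q) (hD : X.D a = 0) (hb : ∃ b ∈ X.K, X.del b = a) :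
    ∃ w ∈ X.filt X.K p Q, a = X.D (X.del w) :=
  exists_D_del_aux hQ (n₀ - 2 * p + X.bound + 1).toNat p (by
    have := Int.self_le_toNat (n₀ - 2 * p + X.bound + 1)
    omega) a ha hD hb

/-- The `D∂`-lemma. -/
theorem exists_D_del' {a : V} (ha : a ∈ X.K) (hD : X.D a = 0) (hb : ∃ b ∈ X.K, X.del b = a) :
    ∃ w ∈ X.K, a = X.D (X.del w) := by
  obtain ⟨s, hs, -⟩ := X.exists_sum a
  obtain ⟨n₀, hn⟩ := (s.image fun q => q.2 + 2 * (q.1 : ℤ)).exists_le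
  obtain ⟨w, hw, e⟩ := exists_D_del (Q := fun n => n ≤ n₀) (fun _ h => h) (p := 0)
    ⟨ha, fun i k h => by
      by_contra h0
      rcases h with h | h
      · omega
      · refine h (hn _ (Finset.mem_image.2 ⟨(i, k), ?_, rfl⟩))
        by_contra h1
        exact h0 (hs _ h1)⟩ hD hb
  exact ⟨w, hw.1, e⟩

theorem exists_del_of_delbar_D {v : V} (hv : v ∈ X.K) (h : X.del (X.D v) = 0) :
    ∃ w ∈ X.K, X.del (v + X.D w) = 0 := by
  obtain ⟨w, hw, e⟩ := exists_D_del' (X.del_mem v hv) (by rw [← neg_eq_zero, ← del_D, h])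
    ⟨v, hv, rfl⟩
  exact ⟨w, hw, by rw [map_add, del_D, e, add_neg_cancel]⟩

theorem incl_injective {v : V} (hv : v ∈ X.K) (h : X.del (X.D v) = 0) :
    ∃ v' ∈ X.Kdel, X.D v' = X.D v := by
  obtain ⟨w, hw, e⟩ := exists_del_of_delbar_D hv h
  exact ⟨v + X.D w, ⟨X.K.add_mem hv (D_mem hw), e⟩, by rw [map_add, D_D hw, add_zero]⟩

theorem incl_surjective {x : V} (hx : x ∈ X.K) (h : X.D x = 0) :
    ∃ w ∈ X.K, x + X.D w ∈ X.Kdel := by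
  obtain ⟨w, hw, e⟩ := exists_del_of_delbar_D hx (by rw [h, map_zero])
  exact ⟨w, hw, X.K.add_mem hx (D_mem hw), e⟩

theorem D_mem_range_del {b : V} (hb : b ∈ X.Kdel) : ∃ c ∈ X.K, X.del c = X.D b := by
  have h0 : X.del b = 0 := hb.2
  obtain ⟨w, hw, e⟩ := X.lemma_delbar b hb.1 (by rw [X.del_delbar, h0, map_zero, neg_zero])
  refine ⟨-X.delbar w + X.mu b, X.K.add_mem (X.K.neg_mem (X.delbar_mem w hw)) (X.mu_mem b hb.1), ?_⟩
  rw [D_apply, e, X.hor_eq, h0, map_zero, sub_zero, map_add, map_neg, X.del_delbar, neg_neg]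

theorem D_of_closed {z : V} (h1 : X.del z = 0) (h2 : X.delbar z = 0) : X.D z = X.del (X.mu z) := by
  rw [D_apply, h2, zero_add, X.hor_eq, h1, map_zero, sub_zero]

theorem pi_surjective {z : V} (hz : z ∈ X.Kdel) : ∃ w ∈ X.K, X.D (z - X.del w) = 0 := by
  have h0 : X.del z = 0 := hz.2
  obtain ⟨w, hw, e⟩ := X.lemma_delbar z hz.1 (by rw [X.del_delbar, h0, map_zero, neg_zero])
  have h1 : X.del (z - X.del w) = 0 := by rw [map_sub, h0, X.del_del, sub_zero]
  have h2 : X.delbar (z - X.del w) = 0 := by rw [map_sub, e, sub_self]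
  have hK := X.K.sub_mem hz.1 (X.del_mem w hw)
  obtain ⟨w', hw', e'⟩ := exists_D_del' (X := X) (D_mem hK) (D_D hK)
    ⟨X.mu (z - X.del w), X.mu_mem _ hK, (D_of_closed h1 h2).symm⟩
  refine ⟨w + w', X.K.add_mem hw hw', ?_⟩
  rw [map_add, ← sub_sub, map_sub, ← e', sub_self]

theorem pi_injective {x : V} (hx : x ∈ X.K) (h : X.D x = 0) (hb : ∃ b ∈ X.K, X.del b = x) :
    ∃ v ∈ X.Kdel, X.D v = x := by
  obtain ⟨w, hw, e⟩ := exists_D_del' hx h hb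
  exact ⟨X.del w, ⟨X.del_mem w hw, X.del_del w⟩, e.symm⟩

/-- A homogeneous element that is closed for `∂` and `∂̄` extends to a `D`-cocycle. -/
theorem exists_correction {i : ℕ} {k : ℤ} {z : V} (hz : z ∈ X.K) (hpr : X.pr i k z = z)
    (h1 : X.del z = 0) (h2 : X.delbar z = 0) :
    ∃ v ∈ X.filt X.Kdel (i + 1) (· = k + 2 * i), X.D v = X.D z := by
  have hF : X.D z ∈ X.filt X.K (i + 1) (· = k + 2 * i + 1) := by
    refine ⟨D_mem hz, fun j l h => ?_⟩
    rw [D_apply, h2, zero_add]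
    cases j with
    | zero => exact X.pr_hor_zero _ _
    | succ j =>
      rw [X.pr_hor_succ, ← hpr, X.pr_pr_ne, map_zero]
      by_contra h'
      rw [not_or, not_not, not_not] at h'
      obtain ⟨rfl, rfl⟩ := h'
      rcases h with h | h
      · push_cast at h
        omega
      · refine h ?_
        push_cast
        ring
  obtain ⟨w, hw, e⟩ := exists_D_del (fun n h => le_of_eq h) hF (D_D hz)
    ⟨X.mu z, X.mu_mem z hz, (D_of_closed h1 h2).symm⟩
  refine ⟨X.del w, ⟨⟨X.del_mem w hw.1, X.del_del w⟩, fun j l h => ?_⟩, e.symm⟩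
  rw [X.pr_del, hw.2 j (l + 1) (h.imp_right fun h' h'' => h' (by omega)), map_zero]

theorem exists_of_step_aux {L : Submodule ℝ V} (hLK : L ≤ X.K) (hL : X.Kdel ≤ L)
    (hLpr : ∀ i k, ∀ x ∈ L, X.pr i k x ∈ L)
    (hclose : ∀ (i : ℕ) (k : ℤ), ∀ x ∈ L, X.pr i k x = x → X.delbar x = 0 →
      ∃ w ∈ L, X.pr i (k - 1) w = w ∧ X.del (x + X.delbar w) = 0)
    (hLhor : ∀ x ∈ L, X.hor x ∈ L)
    {p n : ℤ} {x : V} (hx : x ∈ X.filt L p (· = n)) (hDx : X.D x ∈ X.filt L (p + 1) (· = n + 1)) :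
    ∃ y ∈ X.filt L (p + 1) (· = n), X.D y = X.D x := by
  rcases lt_or_ge p 0 with hneg | hpos
  · exact ⟨x, ⟨hx.1, fun i k h => hx.2 i k (h.imp_left fun h' => by omega)⟩, rfl⟩
  lift p to ℕ using hpos
  obtain ⟨k, rfl⟩ : ∃ k, n = k + 2 * p := ⟨n - 2 * p, by ring⟩
  have h1 : X.delbar (X.pr p k x) = 0 :=
    delbar_pr (hDx.2 p (k + 1) (Or.inl (by omega))) fun j hj k =>
      hx.2 j k (Or.inl (by exact_mod_cast hj))
  obtain ⟨w, hwL, hw, e⟩ := hclose p k _ (hLpr p k x hx.1) (X.pr_pr_same p k x) h1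
  have hw2 : X.pr p k (X.delbar w) = X.delbar w := by rw [X.pr_delbar, hw]
  obtain ⟨v, hv, ev⟩ := exists_correction (X := X) (i := p) (k := k)
    (z := X.pr p k x + X.delbar w)
    (X.K.add_mem (hLK (hLpr p k x hx.1)) (X.delbar_mem w (hLK hwL)))
    (by rw [map_add, X.pr_pr_same, hw2]) e (by rw [map_add, h1, X.delbar_delbar, add_zero])
  refine ⟨x - X.pr p k x + v + X.hor w, Submodule.add_mem _ (Submodule.add_mem _ ?_
    ⟨hL hv.1, hv.2⟩) ?_, ?_⟩
  · refine ⟨L.sub_mem hx.1 (hLpr p k x hx.1), fun i l h => ?_⟩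
    rw [map_sub]
    by_cases hi : i = p ∧ l = k
    · obtain ⟨rfl, rfl⟩ := hi
      rw [X.pr_pr_same, sub_self]
    · rw [X.pr_pr_ne (not_and_or.1 hi), sub_zero]
      by_cases hip : i = p
      · refine hx.2 i l (Or.inr fun h' => hi ⟨hip, ?_⟩)
        subst hip
        omega
      · exact hx.2 i l (h.imp_left fun h' => by omega)
  · refine ⟨hLhor w hwL, fun i l h => ?_⟩
    cases i with
    | zero => exact X.pr_hor_zero _ _
    | succ j =>
      rw [X.pr_hor_succ, ← hw, X.pr_pr_ne, map_zero]
      by_contra h'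
      rw [not_or, not_not, not_not] at h'
      obtain ⟨rfl, h2⟩ := h'
      rcases h with h | h
      · push_cast at h
        omega
      · refine h ?_
        push_cast
        omega
  · have h3 : X.D (X.hor w) = -X.D (X.delbar w) := by
      rw [eq_neg_iff_add_eq_zero, add_comm, ← map_add]
      exact D_D (hLK hwL)
    rw [map_add, map_add, map_sub, ev, h3, map_add]
    abel

theorem exists_of_step_K {p n : ℤ} {x : V} (hx : x ∈ X.filt X.K p (· = n))
    (hDx : X.D x ∈ X.filt X.K (p + 1) (· = n + 1)) :
    ∃ y ∈ X.filt X.K (p + 1) (· = n), X.D y = X.D x := by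
  refine exists_of_step_aux le_rfl inf_le_left X.pr_mem (fun i k x hx hpr h => ?_) X.hor_mem hx hDx
  obtain ⟨w, hw, e⟩ := X.lemma_del x hx (by rw [← neg_eq_zero, ← X.del_delbar, h, map_zero])
  refine ⟨X.pr i (k - 1) w, X.pr_mem _ _ w hw, X.pr_pr_same _ _ w, ?_⟩
  rw [← X.pr_delbar, ← hpr, ← map_add, ← sub_add_cancel k 1, ← X.pr_del, map_add, X.del_delbar, ← e,
    add_neg_cancel, map_zero]

theorem exists_of_step_Kdel {p n : ℤ} {x : V} (hx : x ∈ X.filt X.Kdel p (· = n))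
    (hDx : X.D x ∈ X.filt X.Kdel (p + 1) (· = n + 1)) :
    ∃ y ∈ X.filt X.Kdel (p + 1) (· = n), X.D y = X.D x := by
  refine exists_of_step_aux inf_le_left le_rfl (fun i k x hx => ⟨X.pr_mem i k x hx.1, ?_⟩)
    (fun i k x hx hpr h => ⟨0, Submodule.zero_mem _, map_zero _, ?_⟩)
    (fun x hx => ⟨X.hor_mem x hx.1, ?_⟩) hx hDx
  · show X.del (X.pr i k x) = 0
    have h0 : X.del x = 0 := hx.2
    rw [← sub_add_cancel k 1, ← X.pr_del, h0, map_zero]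
  · rw [map_zero, add_zero]
    exact hx.2
  · show X.del (X.hor x) = 0
    have h0 : X.del x = 0 := hx.2
    rw [del_hor, h0, map_zero, neg_zero]

theorem degenerates_of_step {L : Submodule ℝ V} (hLK : L ≤ X.K) {F : ℤ → ℤ → Submodule ℝ V}
    (hF : ∀ p n, F p n = X.filt L p (· = n))
    (h : ∀ p n x, x ∈ X.filt L p (· = n) → X.D x ∈ X.filt L (p + 1) (· = n + 1) →
      ∃ y ∈ X.filt L (p + 1) (· = n), X.D y = X.D x) : DegeneratesAtE1 F X.D := by
  have hD : ∀ p n, ∀ x ∈ F p n, X.D (X.D x) = 0 := fun p n x hx => by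
    rw [hF] at hx
    exact D_D (hLK hx.1)
  refine ⟨hD, fun r hr p n => Submodule.linearMap_qext _ (LinearMap.ext fun x => ?_)⟩
  obtain ⟨x, hx, hDx⟩ := x
  refine (Submodule.Quotient.mk_eq_zero _).2 ?_
  have hDx : X.D x ∈ F (p + r) (n + 1) := hDx
  have hx' := hx
  have hDx' := hDx
  rw [hF] at hx' hDx'
  obtain ⟨y, hy, e⟩ := h p n x hx' (filt_mono (by omega) _ hDx')
  refine Submodule.mem_sup_right ⟨y, ⟨?_, ?_⟩, e⟩
  · rw [hF]
    have h1 : p + r - r + 1 = p + 1 := by ring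
    have h2 : n + 1 - 1 = n := by ring
    rw [h1, h2]
    exact hy
  · show X.D y ∈ F (p + r - r + 1 + (r - 1)) (n + 1 - 1 + 1)
    have h1 : p + r - r + 1 + (r - 1) = p + r := by ring
    have h2 : n + 1 - 1 + 1 = n + 1 := by ring
    rw [h1, h2, e]
    exact hDx

end DelbarDelComplex
end Abstract
end GenEquivariant
end

open scoped Manifold ContDiff Topology TensorProduct
noncomputable section
namespace GenEquivariant
set_option linter.unusedSectionVars false

universe u

theorem exists_equiv_of_range_eq {R A B C : Type*} [CommRing R] [AddCommMonoid A] [Module R A]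
    [AddCommMonoid B] [Module R B] [AddCommMonoid C] [Module R C] (f : A →ₗ[R] C) (g : B →ₗ[R] C)
    (hf : Function.Injective f) (hg : Function.Injective g)
    (h : LinearMap.range f = LinearMap.range g) : ∃ e : A ≃ₗ[R] B, ∀ x, g (e x) = f x := by
  refine ⟨(LinearEquiv.ofInjective f hf).trans
    ((LinearEquiv.ofEq _ _ h).trans (LinearEquiv.ofInjective g hg).symm), fun x => ?_⟩
  have := (LinearEquiv.ofInjective g hg).apply_symm_apply
    (LinearEquiv.ofEq _ _ h (LinearEquiv.ofInjective f hf x))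
  exact congrArg Subtype.val this

theorem slice_comm {S W : Type*} [AddCommGroup S] [Module ℝ S] [AddCommGroup W] [Module ℝ W]
    (ψ : W →ₗ[ℝ] ℝ) (t : S ⊗[ℝ] W) :
    slice ψ (TensorProduct.comm ℝ S W t) = TensorProduct.rid ℝ S (LinearMap.lTensor S ψ t) := by
  induction t using TensorProduct.induction_on with
  | zero => simp only [map_zero]
  | add a b ha hb => simp only [map_add, ha, hb]
  | tmul p w =>
    rw [TensorProduct.comm_tmul, slice_tmul, LinearMap.lTensor_tmul, TensorProduct.rid_tmul]

theorem exists_rTensor_eq {P S W : Type*} [AddCommGroup P] [Module ℝ P] [AddCommGroup S]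
    [Module ℝ S] [AddCommGroup W] [Module ℝ W] (T : P →ₗ[ℝ] S) {t : S ⊗[ℝ] W}
    (h : ∀ ψ : W →ₗ[ℝ] ℝ, TensorProduct.rid ℝ S (LinearMap.lTensor S ψ t) ∈ LinearMap.range T) :
    ∃ v, LinearMap.rTensor W T v = t := by
  obtain ⟨v, hv⟩ := exists_lTensor_eq T (t := TensorProduct.comm ℝ S W t) fun ψ => by
    rw [slice_comm]
    exact h ψ
  refine ⟨TensorProduct.comm ℝ W P v, (TensorProduct.comm ℝ S W).injective ?_⟩
  rw [← hv, ← LinearMap.comm_comp_rTensor_comp_comm_eq]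
  simp

section Cohomology
variable {R V : Type*} [CommRing R] [AddCommGroup V] [Module R V]

theorem Coh.mk_eq_zero {K : Submodule R V} {D : V →ₗ[R] V} {x : ↥(K ⊓ LinearMap.ker D)} :
    Coh.mk K D x = 0 ↔ ∃ v ∈ K, D v = x.1 :=
  Submodule.Quotient.mk_eq_zero _

theorem Coh.mk_surjective (K : Submodule R V) (D : V →ₗ[R] V) :
    Function.Surjective (Coh.mk K D) :=
  Submodule.mkQ_surjective _

theorem Coh.mk_eq_mk {K : Submodule R V} {D : V →ₗ[R] V} {x y : ↥(K ⊓ LinearMap.ker D)} {v : V}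
    (hv : v ∈ K) (h : D v = x.1 - y.1) : Coh.mk K D x = Coh.mk K D y := by
  rw [← sub_eq_zero, ← map_sub]
  exact Coh.mk_eq_zero.2 ⟨v, hv, h⟩

theorem Coh.incl_bijective {K' K : Submodule R V} (h : K' ≤ K) {D : V →ₗ[R] V}
    (hD : ∀ w ∈ K, D (D w) = 0) (hinj : ∀ v ∈ K, D v ∈ K' → ∃ v' ∈ K', D v' = D v)
    (hsurj : ∀ x ∈ K, D x = 0 → ∃ w ∈ K, x + D w ∈ K') : Function.Bijective (Coh.incl h D) := by
  constructor
  · rw [injective_iff_map_eq_zero]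
    intro c hc
    obtain ⟨⟨x, hx⟩, rfl⟩ := Coh.mk_surjective _ _ c
    obtain ⟨v, hv, e⟩ := Coh.mk_eq_zero.1 (show Coh.mk K D ⟨x, h hx.1, hx.2⟩ = 0 from hc)
    obtain ⟨v', hv', e'⟩ := hinj v hv (by rw [e]; exact hx.1)
    exact Coh.mk_eq_zero.2 ⟨v', hv', e'.trans e⟩
  · intro c
    obtain ⟨⟨x, hx⟩, rfl⟩ := Coh.mk_surjective _ _ c
    have h0 : D x = 0 := hx.2
    obtain ⟨w, hw, e⟩ := hsurj x hx.1 h0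
    refine ⟨Coh.mk K' D ⟨x + D w, e, ?_⟩, ?_⟩
    · show D (x + D w) = 0
      rw [map_add, hD w hw, add_zero, h0]
    · exact Coh.mk_eq_mk (K := K) (v := w) hw (add_sub_cancel_left x (D w)).symm

theorem Coh.exists_equiv {C B : Type*} [AddCommMonoid C] [Module R C] [AddCommMonoid B]
    [Module R B]
    {K : Submodule R V} {D : V →ₗ[R] V} (Θ : V →ₗ[R] C) {ρ : B →ₗ[R] C}
    (hρ : Function.Injective ρ) (h0 : ∀ b ∈ K, Θ (D b) = 0)
    (h1 : ∀ x ∈ K, D x = 0 → Θ x = 0 → ∃ v ∈ K, D v = x)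
    (h2 : ∀ x ∈ K, D x = 0 → ∃ b, ρ b = Θ x) (h3 : ∀ b, ∃ x ∈ K, D x = 0 ∧ Θ x = ρ b) :
    ∃ Ψ : Coh K D ≃ₗ[R] B, ∀ x, ρ (Ψ (Coh.mk K D x)) = Θ x.1 := by
  let _ : AddCommGroup C := Module.addCommMonoidToAddCommGroup R
  let θ : Coh K D →ₗ[R] C := Submodule.liftQ _ (Θ ∘ₗ Submodule.subtype _) (by
    rintro ⟨x, hx⟩ ⟨b, hb, rfl⟩
    exact h0 b hb)
  have hθ : ∀ x, θ (Coh.mk K D x) = Θ x.1 := fun x => rfl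
  obtain ⟨Ψ, hΨ⟩ := exists_equiv_of_range_eq θ ρ (by
    rw [injective_iff_map_eq_zero]
    intro c hc
    obtain ⟨x, rfl⟩ := Coh.mk_surjective _ _ c
    exact Coh.mk_eq_zero.2 (h1 x.1 x.2.1 x.2.2 hc)) hρ (le_antisymm (by
      rintro _ ⟨c, rfl⟩
      obtain ⟨x, rfl⟩ := Coh.mk_surjective _ _ c
      exact h2 x.1 x.2.1 x.2.2) (by
      rintro _ ⟨b, rfl⟩
      obtain ⟨x, hx, hDx, e⟩ := h3 b
      exact ⟨Coh.mk K D ⟨x, hx, hDx⟩, e⟩))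
  exact ⟨Ψ, fun x => by rw [hΨ, hθ]⟩

theorem Coh.exists_equiv_of_closed {K : Submodule R V} {D δ : V →ₗ[R] V}
    (hδ : ∀ w ∈ K, δ w ∈ K ∧ δ (δ w) = 0)
    (h0 : ∀ b ∈ K ⊓ LinearMap.ker δ, ∃ c ∈ K, δ c = D b)
    (h1 : ∀ x ∈ K, D x = 0 → (∃ b ∈ K, δ b = x) → ∃ v ∈ K ⊓ LinearMap.ker δ, D v = x)
    (h2 : ∀ z ∈ K ⊓ LinearMap.ker δ, ∃ w ∈ K, D (z - δ w) = 0) :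
    ∃ π : Coh (K ⊓ LinearMap.ker δ) D ≃ₗ[R] Coh K δ,
      ∀ x : ↥((K ⊓ LinearMap.ker δ) ⊓ LinearMap.ker D),
        π (Coh.mk _ _ x) = Coh.mk _ _ ⟨x.1, x.2.1⟩ := by
  let ι : ↥((K ⊓ LinearMap.ker δ) ⊓ LinearMap.ker D) →ₗ[R] ↥(K ⊓ LinearMap.ker δ) :=
    Submodule.inclusion inf_le_left
  let f : Coh (K ⊓ LinearMap.ker δ) D →ₗ[R] Coh K δ := Submodule.mapQ _ _ ι (by
    rintro ⟨x, hx⟩ ⟨b, hb, rfl⟩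
    exact h0 b hb)
  have hf : ∀ x, f (Coh.mk _ _ x) = Coh.mk _ _ ⟨x.1, x.2.1⟩ := fun x => rfl
  refine ⟨LinearEquiv.ofBijective f ⟨?_, fun c => ?_⟩, hf⟩
  · rw [injective_iff_map_eq_zero]
    intro c hc
    obtain ⟨⟨x, hx⟩, rfl⟩ := Coh.mk_surjective _ _ c
    rw [hf] at hc
    exact Coh.mk_eq_zero.2 (h1 x hx.1.1 hx.2 (Coh.mk_eq_zero.1 hc))
  · obtain ⟨⟨z, hz⟩, rfl⟩ := Coh.mk_surjective _ _ c
    obtain ⟨w, hw, e⟩ := h2 z hz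
    have hz0 : δ z = 0 := hz.2
    have hz' : z - δ w ∈ K ⊓ LinearMap.ker δ := by
      refine ⟨Submodule.sub_mem _ hz.1 (hδ w hw).1, ?_⟩
      show δ (z - δ w) = 0
      rw [map_sub, (hδ w hw).2, hz0, sub_zero]
    refine ⟨Coh.mk _ _ ⟨z - δ w, hz', e⟩, ?_⟩
    rw [hf]
    exact Coh.mk_eq_mk (v := -w) (Submodule.neg_mem _ hw) ((map_neg δ w).trans (by simp))

end Cohomology

section Main
variable {E : Type u} [NormedAddCommGroup E] [NormedSpace ℝ E] [FiniteDimensional ℝ E]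
  {M : Type*} [TopologicalSpace M] [T2Space M] [ChartedSpace E M] [IsManifold 𝓘(ℝ, E) ∞ M]
  {𝔤 : Type*} [NormedAddCommGroup 𝔤] [NormedSpace ℝ 𝔤] [FiniteDimensional ℝ 𝔤]
  {G : Type*} [TopologicalSpace G] [ChartedSpace 𝔤 G] [Group G] [LieGroup 𝓘(ℝ, 𝔤) ∞ G]
  [MulAction G M] [ContMDiffSMul 𝓘(ℝ, 𝔤) 𝓘(ℝ, E) ∞ G M]
  {H : ClosedThreeForm E M} {𝒥 : GCStructure E M H}

theorem rowFiltration_eq (X : DelbarDelComplex (PolyForms E M 𝔤)) (hX : X.pr = bproj 𝔤 𝒥)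
    (K : Submodule (InvPoly 𝔤 G) (PolyForms E M 𝔤)) (hK : ∀ i k, ∀ t ∈ K, bproj 𝔤 𝒥 i k t ∈ K)
    (p n : ℤ) : rowFiltration 𝒥 K p n = X.filt (K.restrictScalars ℝ) p (· = n) := by
  refine le_antisymm (iSup₂_le fun i hi t ht => ⟨ht.1, fun j k h => ?_⟩) fun t ht => ?_
  · rw [hX, ← mem_homogeneous.1 ht.2]
    refine bproj_bproj_ne ?_ _
    by_contra h'
    rw [not_or, not_not, not_not] at h'
    omega
  · obtain ⟨s, -, hs⟩ := exists_sum_bproj 𝒥 t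
    rw [← hs]
    refine Submodule.sum_mem _ fun q _ => ?_
    by_cases h : (q.1 : ℤ) < p ∨ ¬(q.2 + 2 * q.1 = n)
    · rw [← hX, ht.2 _ _ h]
      exact Submodule.zero_mem _
    · rw [not_or, not_lt, not_not] at h
      refine Submodule.mem_iSup_of_mem q.1 (Submodule.mem_iSup_of_mem h.1
        ⟨hK _ _ t ht.1, mem_homogeneous.2 ?_⟩)
      have e : n - q.1 - q.1 = q.2 := by omega
      rw [e, bproj_bproj_same]

variable [CompactSpace G] [T2Space G] [ConnectedSpace G]

/-- The equivariant double complex. -/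
def equivariantComplex (A : HamiltonianAction 𝔤 G 𝒥) (hlemma : DelbarDelLemma 𝒥) :
    DelbarDelComplex (PolyForms E M 𝔤) where
  pr := bproj 𝔤 𝒥
  del := (extendOp (del 𝒥)).restrictScalars ℝ
  delbar := (extendOp (delbar 𝒥)).restrictScalars ℝ
  hor := A.calA.restrictScalars ℝ
  mu := A.polyF.restrictScalars ℝ
  K := (UG E M 𝔤 G).restrictScalars ℝ
  bound := (exists_bound_bproj 𝔤 𝒥).choose
  pr_pr_same := bproj_bproj_same
  pr_pr_ne := bproj_bproj_ne
  exists_sum := exists_sum_bproj 𝒥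
  pr_bound := (exists_bound_bproj 𝔤 𝒥).choose_spec
  pr_del := bproj_del
  pr_delbar := bproj_delbar
  pr_hor_zero := bproj_zero_calA A
  pr_hor_succ := bproj_succ_calA A
  pr_mem i k _ := bproj_mem A i k
  del_mem _ := extendOp_del_mem A
  delbar_mem _ := extendOp_delbar_mem A
  hor_mem _ := calA_mem A
  mu_mem _ := polyF_mem A
  del_del := extendOp_del_del 𝒥
  delbar_delbar := extendOp_delbar_delbar 𝒥
  del_delbar := extendOp_del_delbar 𝒥
  hor_eq := calA_eq A
  hor_mu := calA_polyF A
  delbar_hor _ := delbar_calA A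
  lemma_del _ := delbarDel_of_del A hlemma
  lemma_delbar _ := delbarDel_of_delbar A hlemma

theorem bproj_mem_UGdel (A : HamiltonianAction 𝔤 G 𝒥) (i : ℕ) (k : ℤ) (t : PolyForms E M 𝔤)
    (ht : t ∈ UGdel 𝔤 G 𝒥) : bproj 𝔤 𝒥 i k t ∈ UGdel 𝔤 G 𝒥 := by
  refine ⟨bproj_mem A i k ht.1, ?_⟩
  have h0 : extendOp (del 𝒥) t = 0 := ht.2
  show extendOp (del 𝒥) (bproj 𝔤 𝒥 i k t) = 0
  have := bproj_del (𝒥 := 𝒥) i (k - 1) t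
  rwa [h0, map_zero, sub_add_cancel, eq_comm] at this

theorem degenerates_UG (A : HamiltonianAction 𝔤 G 𝒥) (hlemma : DelbarDelLemma 𝒥) :
    DegeneratesAtE1 (rowFiltration 𝒥 (UG E M 𝔤 G)) (A.delbarG.restrictScalars ℝ) :=
  DelbarDelComplex.degenerates_of_step (X := equivariantComplex A hlemma) le_rfl
    (rowFiltration_eq (equivariantComplex A hlemma) rfl _ fun i k _ => bproj_mem A i k)
    fun _ _ _ => DelbarDelComplex.exists_of_step_K

theorem degenerates_UGdel (A : HamiltonianAction 𝔤 G 𝒥) (hlemma : DelbarDelLemma 𝒥) :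
    DegeneratesAtE1 (rowFiltration 𝒥 (UGdel 𝔤 G 𝒥)) (A.delbarG.restrictScalars ℝ) :=
  DelbarDelComplex.degenerates_of_step (X := equivariantComplex A hlemma) inf_le_left
    (rowFiltration_eq (equivariantComplex A hlemma) rfl _ (bproj_mem_UGdel A))
    fun _ _ _ => DelbarDelComplex.exists_of_step_Kdel

end Main
end GenEquivariant
end

open scoped Manifold ContDiff Topology TensorProduct
noncomputable section
namespace GenEquivariant
set_option linter.unusedSectionVars false

universe u

section Main
variable {E : Type u} [NormedAddCommGroup E] [NormedSpace ℝ E] [FiniteDimensional ℝ E]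
  {M : Type*} [TopologicalSpace M] [T2Space M] [ChartedSpace E M] [IsManifold 𝓘(ℝ, E) ∞ M]
  {𝔤 : Type*} [NormedAddCommGroup 𝔤] [NormedSpace ℝ 𝔤] [FiniteDimensional ℝ 𝔤]
  {G : Type*} [TopologicalSpace G] [ChartedSpace 𝔤 G] [Group G] [LieGroup 𝓘(ℝ, 𝔤) ∞ G]
  [MulAction G M] [ContMDiffSMul 𝓘(ℝ, 𝔤) 𝓘(ℝ, E) ∞ G M]
  {H : ClosedThreeForm E M} {𝒥 : GCStructure E M H}

variable [CompactSpace G] [T2Space G] [ConnectedSpace G]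

theorem incl_bijective (A : HamiltonianAction 𝔤 G 𝒥) (hlemma : DelbarDelLemma 𝒥) :
    Function.Bijective (Coh.incl (inf_le_left : UGdel 𝔤 G 𝒥 ≤ UG E M 𝔤 G) A.delbarG) :=
  Coh.incl_bijective _
    (fun _ hw => DelbarDelComplex.D_D (X := equivariantComplex A hlemma) hw)
    (fun _ hv h => DelbarDelComplex.incl_injective (X := equivariantComplex A hlemma) hv h.2)
    (fun _ hx h => DelbarDelComplex.incl_surjective (X := equivariantComplex A hlemma) hx h)

theorem exists_equiv_coh_del (A : HamiltonianAction 𝔤 G 𝒥) (hlemma : DelbarDelLemma 𝒥) :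
    ∃ π : Coh (UGdel 𝔤 G 𝒥) A.delbarG ≃ₗ[InvPoly 𝔤 G] Coh (UG E M 𝔤 G) (delInv G 𝒥),
      ∀ x : ↥(UGdel 𝔤 G 𝒥 ⊓ LinearMap.ker A.delbarG),
        π (Coh.mk _ _ x) = Coh.mk _ _ ⟨x.1, x.2.1⟩ :=
  Coh.exists_equiv_of_closed (K := UG E M 𝔤 G) (D := A.delbarG) (δ := delInv G 𝒥)
    (fun w hw => ⟨extendOp_del_mem A hw, extendOp_del_del 𝒥 w⟩)
    (fun _ hb => DelbarDelComplex.D_mem_range_del (X := equivariantComplex A hlemma) hb)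
    (fun _ hx h hb => DelbarDelComplex.pi_injective (X := equivariantComplex A hlemma) hx h hb)
    (fun _ hz => DelbarDelComplex.pi_surjective (X := equivariantComplex A hlemma) hz)

/-- A linear extension to all forms of the map from `∂`-closed forms to `∂`-homology. -/
theorem exists_class_extension (𝒥 : GCStructure E M H) :
    ∃ c : Forms E M →ₗ[ℝ] HDel 𝒥,
      (∀ w, ∃ α, del 𝒥 α = 0 ∧ c α = w) ∧ (∀ β, c (del 𝒥 β) = 0) ∧
      (∀ α, del 𝒥 α = 0 → c α = 0 → ∃ β, del 𝒥 β = α) ∧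
      c ∘ₗ Submodule.subtype _ = Coh.mk ⊤ ((del 𝒥).restrictScalars ℝ) := by
  obtain ⟨c, hc⟩ := LinearMap.exists_extend (Coh.mk ⊤ ((del 𝒥).restrictScalars ℝ))
  have hc1 : ∀ α (h : del 𝒥 α = 0), c α = Coh.mk ⊤ ((del 𝒥).restrictScalars ℝ) ⟨α, trivial, h⟩ :=
    fun α h => DFunLike.congr_fun hc ⟨α, trivial, h⟩
  refine ⟨c, fun w => ?_, fun β => ?_, fun α h h0 => ?_, hc⟩
  · obtain ⟨⟨α, hα⟩, rfl⟩ := Coh.mk_surjective _ _ w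
    exact ⟨α, hα.2, hc1 α hα.2⟩
  · rw [hc1 _ (del_del 𝒥 β)]
    exact Coh.mk_eq_zero.2 ⟨β, trivial, rfl⟩
  · rw [hc1 α h] at h0
    obtain ⟨β, -, e⟩ := Coh.mk_eq_zero.1 h0
    exact ⟨β, e⟩

theorem lTensor_extendOp_del {W : Type*} [AddCommGroup W] [Module ℝ W] {c : Forms E M →ₗ[ℝ] W}
    (hc : ∀ β, c (del 𝒥 β) = 0) (b : PolyForms E M 𝔤) :
    LinearMap.lTensor (SymDual 𝔤) c (extendOp (del 𝒥) b) = 0 :=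
  evTensor_ext fun ζ => by rw [evTensor_lTensor, evTensor_extendOp, hc, map_zero]

theorem exists_extendOp_del_eq {W : Type*} [AddCommGroup W] [Module ℝ W] {c : Forms E M →ₗ[ℝ] W}
    (hc : ∀ α, del 𝒥 α = 0 → c α = 0 → ∃ β, del 𝒥 β = α) {t : PolyForms E M 𝔤}
    (h0 : extendOp (del 𝒥) t = 0) (ht : LinearMap.lTensor (SymDual 𝔤) c t = 0) :
    ∃ w, extendOp (del 𝒥) w = t := by
  obtain ⟨w, hw⟩ := exists_lTensor_eq ((del 𝒥).restrictScalars ℝ) (t := t) fun φ => by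
    obtain ⟨β, hβ⟩ := hc (slice φ t) (by rw [← slice_extendOp, h0, map_zero])
      (by rw [← slice_lTensor, ht, map_zero])
    exact ⟨β, hβ⟩
  exact ⟨w, hw⟩

theorem evTensor_Ad_lTensor (A : HamiltonianAction 𝔤 G 𝒥) {W : Type*} [AddCommGroup W]
    [Module ℝ W] {c : Forms E M →ₗ[ℝ] W} (hc : ∀ β, c (del 𝒥 β) = 0) {t : PolyForms E M 𝔤}
    (ht : t ∈ UG E M 𝔤 G) (h0 : extendOp (del 𝒥) t = 0) (g : G) (ζ : 𝔤) :
    evTensor (Ad g⁻¹ ζ) (LinearMap.lTensor (SymDual 𝔤) c t) =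
      evTensor ζ (LinearMap.lTensor (SymDual 𝔤) c t) := by
  have h1 : del 𝒥 (evTensor (Ad g⁻¹ ζ) t) = 0 := by
    rw [← evTensor_extendOp, h0, map_zero]
  borelize G
  obtain ⟨β, hβ⟩ := translate_sub_mem A g h1
  rw [evTensor_lTensor, evTensor_lTensor, ← mem_UG.1 ht g ζ,
    ← sub_add_cancel (translate E M 𝔤 g _) (evTensor (Ad g⁻¹ ζ) t), ← hβ, map_add, hc, zero_add]

theorem evPoly_rid_lTensor {W : Type*} [AddCommGroup W] [Module ℝ W] (ψ : W →ₗ[ℝ] ℝ) (ζ : 𝔤)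
    (s : SymDual 𝔤 ⊗[ℝ] W) : evPoly ζ (TensorProduct.rid ℝ _
      (LinearMap.lTensor (SymDual 𝔤) ψ s)) = ψ (evTensor ζ s) := by
  induction s using TensorProduct.induction_on with
  | zero => simp only [map_zero]
  | add a b ha hb => rw [map_add, map_add, map_add, ha, hb, map_add, map_add]
  | tmul p w =>
    rw [LinearMap.lTensor_tmul, TensorProduct.rid_tmul, evTensor_tmul, map_smul, map_smul,
      smul_eq_mul, smul_eq_mul, mul_comm]

variable (G) in
/-- An `Ad`-invariant element of `S𝔤^* ⊗ W` comes from `(S𝔤^*)^G ⊗ W`. -/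
theorem exists_rTensor_val_eq {W : Type*} [AddCommGroup W] [Module ℝ W] {s : SymDual 𝔤 ⊗[ℝ] W}
    (h : ∀ (g : G) (ζ : 𝔤), evTensor (Ad g⁻¹ ζ) s = evTensor ζ s) :
    ∃ v, LinearMap.rTensor W (InvPoly 𝔤 G).val.toLinearMap v = s := by
  refine exists_rTensor_eq _ fun ψ => ⟨⟨TensorProduct.rid ℝ _
    (LinearMap.lTensor (SymDual 𝔤) ψ s), fun g => ?_⟩, rfl⟩
  rw [← sub_eq_zero]
  refine eq_zero_of_evPoly fun ζ => ?_
  rw [map_sub, evPoly_coadPoly, evPoly_rid_lTensor, evPoly_rid_lTensor, h, sub_self]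

theorem exists_lTensor_eq_rTensor (A : HamiltonianAction 𝔤 G 𝒥) {W : Type*} [AddCommGroup W]
    [Module ℝ W] {c : Forms E M →ₗ[ℝ] W} (hc1 : ∀ w, ∃ α, del 𝒥 α = 0 ∧ c α = w)
    (hc2 : ∀ β, c (del 𝒥 β) = 0) (v : InvPoly 𝔤 G ⊗[ℝ] W) :
    ∃ x ∈ UG E M 𝔤 G, extendOp (del 𝒥) x = 0 ∧ LinearMap.lTensor (SymDual 𝔤) c x =
      LinearMap.rTensor W (InvPoly 𝔤 G).val.toLinearMap v := by
  obtain ⟨Av, hAv1, -, hAv3, -, hAv5⟩ := exists_projection_UG A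
  induction v using TensorProduct.induction_on with
  | zero => exact ⟨0, Submodule.zero_mem _, map_zero _, by rw [map_zero, map_zero]⟩
  | add a b ha hb =>
    obtain ⟨x, hx, hx0, hxe⟩ := ha
    obtain ⟨y, hy, hy0, hye⟩ := hb
    exact ⟨x + y, Submodule.add_mem _ hx hy, by rw [map_add, hx0, hy0, add_zero],
      by rw [map_add, map_add, hxe, hye]⟩
  | tmul p w =>
    obtain ⟨α, hα, rfl⟩ := hc1 w
    obtain ⟨β, hβ⟩ := hAv5 p.1 p.2 α hα
    refine ⟨Av (p.1 ⊗ₜ[ℝ] α), hAv1 _, ?_, ?_⟩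
    · rw [hAv3, extendOp_tmul, hα, TensorProduct.tmul_zero, map_zero]
    · rw [hβ, LinearMap.lTensor_tmul, map_add, hc2, add_zero]
      rfl

variable (𝔤 G) in
/-- The inclusion of `(S𝔤^*)^G ⊗ W` into `S𝔤^* ⊗ W`, as a map of `(S𝔤^*)^G`-modules. -/
def invPolyIncl (W : Type*) [AddCommGroup W] [Module ℝ W] :
    InvPoly 𝔤 G ⊗[ℝ] W →ₗ[InvPoly 𝔤 G] SymDual 𝔤 ⊗[ℝ] W :=
  TensorProduct.AlgebraTensorModule.rTensor ℝ W
    ((IsScalarTower.toAlgHom (InvPoly 𝔤 G) (InvPoly 𝔤 G) (SymDual 𝔤)).toLinearMap)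

variable (𝔤 G) in
theorem invPolyIncl_injective (W : Type*) [AddCommGroup W] [Module ℝ W] :
    Function.Injective (invPolyIncl 𝔤 G W) :=
  Module.Flat.rTensor_preserves_injective_linearMap (M := W) (InvPoly 𝔤 G).val.toLinearMap
    Subtype.val_injective

theorem exists_equiv_of_class (A : HamiltonianAction 𝔤 G 𝒥) {W : Type*} [AddCommGroup W]
    [Module ℝ W] {c : Forms E M →ₗ[ℝ] W} (hc1 : ∀ w, ∃ α, del 𝒥 α = 0 ∧ c α = w)
    (hc2 : ∀ β, c (del 𝒥 β) = 0) (hc3 : ∀ α, del 𝒥 α = 0 → c α = 0 → ∃ β, del 𝒥 β = α) :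
    ∃ Ψ : Coh (UG E M 𝔤 G) (delInv G 𝒥) ≃ₗ[InvPoly 𝔤 G] InvPoly 𝔤 G ⊗[ℝ] W,
      ∀ x, invPolyIncl 𝔤 G W (Ψ (Coh.mk _ _ x)) = LinearMap.lTensor (SymDual 𝔤) c x.1 := by
  obtain ⟨Av, hAv1, hAv2, hAv3, -, -⟩ := exists_projection_UG A
  refine Coh.exists_equiv (K := UG E M 𝔤 G) (D := delInv G 𝒥)
    ((c.baseChange (SymDual 𝔤)).restrictScalars (InvPoly 𝔤 G))
    (invPolyIncl_injective 𝔤 G W) (fun b _ => lTensor_extendOp_del hc2 b) (fun x hx h0 h => ?_)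
    (fun x hx h0 => ?_) (fun b => ?_)
  · obtain ⟨w, hw⟩ := exists_extendOp_del_eq hc3 h0 h
    exact ⟨Av w, hAv1 w, (hAv3 w).trans (by rw [hw, hAv2 x hx])⟩
  · exact exists_rTensor_val_eq G (evTensor_Ad_lTensor A hc2 hx h0)
  · exact exists_lTensor_eq_rTensor A hc1 hc2 b

theorem exists_equiv_homology_del (A : HamiltonianAction 𝔤 G 𝒥) :
    ∃ Ψ : Coh (UG E M 𝔤 G) (delInv G 𝒥) ≃ₗ[InvPoly 𝔤 G] InvPoly 𝔤 G ⊗[ℝ] HDel 𝒥,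
      ∀ (t : SymDual 𝔤 ⊗[ℝ] ↥((⊤ : Submodule ℝ (Forms E M)) ⊓
          LinearMap.ker ((del 𝒥).restrictScalars ℝ)))
        (ht : LinearMap.lTensor (SymDual 𝔤) (Submodule.subtype _) t ∈ UGdel 𝔤 G 𝒥),
        LinearMap.rTensor (HDel 𝒥) (InvPoly 𝔤 G).val.toLinearMap (Ψ (Coh.mk _ _ ⟨_, ht⟩)) =
          LinearMap.lTensor (SymDual 𝔤) (Coh.mk ⊤ ((del 𝒥).restrictScalars ℝ)) t := by
  obtain ⟨c, hc1, hc2, hc3, hc⟩ := exists_class_extension 𝒥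
  obtain ⟨Ψ, hΨ⟩ := exists_equiv_of_class A hc1 hc2 hc3
  refine ⟨Ψ, fun t ht => (hΨ ⟨_, ht⟩).trans ?_⟩
  rw [← LinearMap.lTensor_comp_apply, hc]

end Main
end GenEquivariant
end

set_option maxHeartbeats 1000000 in
theorem mainTheorem2
    {E : Type*} [NormedAddCommGroup E] [NormedSpace ℝ E] [FiniteDimensional ℝ E]
    {M : Type*} [TopologicalSpace M] [T2Space M] [SecondCountableTopology M]
    [ChartedSpace E M] [IsManifold 𝓘(ℝ, E) ∞ M]
    {𝔤 : Type*} [NormedAddCommGroup 𝔤] [NormedSpace ℝ 𝔤] [FiniteDimensional ℝ 𝔤]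
    {G : Type*} [TopologicalSpace G] [ChartedSpace 𝔤 G] [Group G] [LieGroup 𝓘(ℝ, 𝔤) ∞ G]
    [T2Space G] [CompactSpace G] [ConnectedSpace G]
    [MulAction G M] [ContMDiffSMul 𝓘(ℝ, 𝔤) 𝓘(ℝ, E) ∞ G M]
    {H : ClosedThreeForm E M} {𝒥 : GCStructure E M H} (A : HamiltonianAction 𝔤 G 𝒥)
    (hlemma : DelbarDelLemma 𝒥) :
    DegeneratesAtE1 (rowFiltration 𝒥 (UG E M 𝔤 G)) (A.delbarG.restrictScalars ℝ) ∧
    DegeneratesAtE1 (rowFiltration 𝒥 (UGdel 𝔤 G 𝒥)) (A.delbarG.restrictScalars ℝ) ∧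
    Function.Bijective
      (Coh.incl (inf_le_left : UGdel 𝔤 G 𝒥 ≤ UG E M 𝔤 G) A.delbarG) ∧
    ∃ (π : Coh (UGdel 𝔤 G 𝒥) A.delbarG ≃ₗ[InvPoly 𝔤 G] Coh (UG E M 𝔤 G) (delInv G 𝒥))
      (Ψ : Coh (UG E M 𝔤 G) (delInv G 𝒥) ≃ₗ[InvPoly 𝔤 G] InvPoly 𝔤 G ⊗[ℝ] HDel 𝒥),
      (∀ x : ↥(UGdel 𝔤 G 𝒥 ⊓ LinearMap.ker A.delbarG),
        π (Coh.mk _ _ x) = Coh.mk _ _ ⟨x.1, x.2.1⟩) ∧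
      ∀ (t : SymDual 𝔤 ⊗[ℝ] ↥((⊤ : Submodule ℝ (Forms E M)) ⊓
          LinearMap.ker ((del 𝒥).restrictScalars ℝ)))
        (ht : LinearMap.lTensor (SymDual 𝔤) (Submodule.subtype _) t ∈ UGdel 𝔤 G 𝒥),
        LinearMap.rTensor (HDel 𝒥) (InvPoly 𝔤 G).val.toLinearMap (Ψ (Coh.mk _ _ ⟨_, ht⟩)) =
          LinearMap.lTensor (SymDual 𝔤) (Coh.mk ⊤ ((del 𝒥).restrictScalars ℝ)) t := by
  refine ⟨degenerates_UG A hlemma, degenerates_UGdel A hlemma, incl_bijective A hlemma, ?_⟩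
  obtain ⟨π, hπ⟩ := exists_equiv_coh_del A hlemma
  obtain ⟨Ψ, hΨ⟩ := exists_equiv_homology_del A
  refine ⟨π, Ψ, hπ, ?_⟩
  exact hΨ
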